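/- Let $k$ be a field of characteristic zero; algebras are unital associative over $k$, $\otimes=\otimes_k$, and Hopf algebras have invertible antipode $\gamma$. Sweedler notation: $\Delta(x)=x^{(1)}\otimes x^{(2)}$. **Data.** Let $\mathcal U$ be a quasitriangular Hopf algebra with universal R-matrix $\mathcal R$ and $\mathcal H\subset\mathcal U$ a Hopf subalgebra. Let $\mathcal L$ be an $\mathcal H$-base algebra: a left $\mathcal H$-module algebra (action $\triangleright$) and left $\mathcal H$-comodule algebra (coaction $\lambda\mapsto\lambda^{(1)}\otimes\lambda^{[\infty]}\in\mathcal H\otimes\mathcal L$) that is a Yetter--Drinfeld module with $\lambda\mu=(\lambda^{(1)}\triangleright\mu)\lambda^{[\infty]}$ for all $\lambda,\mu\in\mathcal L$. Subscripts to the right of a bar denote the tensor factor produced by the coaction on the $\mathcal L$-factor, e.g. $u_{1|2}=u_1\otimes u_{\mathcal L}^{(1)}\otimes u_{\mathcal L}^{[\infty]}$ for $u=u_1\otimes u_{\mathcal L}\in\mathcal U\otimes\mathcal L$; parentheses denote coproducts, e.g. $\mathcal F_{(12)3}=(\Delta\otimes\mathrm{id})(\mathcal F)$. Let $\mathcal F=\mathcal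 F_1\otimes\mathcal F_2\otimes\mathcal F_{\mathcal L}\in\mathcal U\otimes\mathcal U\otimes\mathcal L$ be a dynamical $(\mathcal U,\mathcal H,\mathcal L)$-twist, i.e. an invertible element with $$\Delta(h^{(1)})(\mathcal F_1\otimes \mathcal F_2)\otimes h^{(2)}\triangleright \mathcal F_{\mathcal L}=(\mathcal F_1\otimes \mathcal F_2)\Delta(h)\otimes \mathcal F_{\mathcal L}\quad(h\in\mathcal H),$$ $$\mathcal F_{(12)3}\mathcal F_{12|3}=\mathcal F_{1(23)}\mathcal F_{23},\qquad \varepsilon_1(\mathcal F)=1=\varepsilon_2(\mathcal F).$$ Write $\bar{\mathcal F}=\mathcal F^{-1}$, $\tilde{\mathcal R}=\bar{\mathcal F}_{21}\mathcal R\mathcal F$ and $\zeta=\bar{\mathcal F}_2\gamma^{-1}(\bar{\mathcal F}_1)\otimes\bar{\mathcal F}_{\mathcal L}\in\mathcal U\otimes\mathcal L$. Let $\rho:\mathcal U\to\mathrm{End}(V)$ be a finite-dimensional representation with a chosen basis, $R,\tilde R$ the images of $\mathcal R,\tilde{\mathcal R}$, $P$ the permutation of $V\otimes V$, $S=PR$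 and $\tilde S=P\tilde R\in\mathrm{End}(V\otimes V)\otimes\mathcal L$. For a matrix $K$ put $K_2=1\otimes K$. **Twisted tensor square.** Let $\mathcal U\overset{\mathcal R}{\otimes}\mathcal U$ be the algebra $\mathcal U\otimes\mathcal U$ with coproduct $x\mapsto\mathcal R_{23}^{-1}\Delta_{\mathcal U\otimes\mathcal U}(x)\mathcal R_{23}$ and counit $\varepsilon\otimes\varepsilon$; it contains $\mathcal H$ via $\Delta$. **RE algebra.** Let $\mathcal K$ be the algebra generated by the entries $K^i_j$ of a matrix $K$ with relations $SK_2SK_2=K_2SK_2S$. It is a module algebra over $\mathcal U\overset{\mathcal R}{\otimes}\mathcal U$ by $(x\otimes y)\blacktriangleright K=\rho(\gamma(x))K\rho(y)$. **Composite twist.** For an invertible $\xi\in(\mathcal U\overset{\mathcal R}{\otimes}\mathcal U)\otimes\mathcal L$, composing a dynamical $(\mathcal U\overset{\mathcal R}{\otimes}\mathcal U,\mathcal H,\mathcal L)$-twist $\Phi$ with the coboundary twist generated by $\xi$ means passing to $\Delta(\xi)^{-1}\,\Phi\,\xi_{1|2}\,\xi_2$, where $\Delta$ is the coproduct of $\mathcal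 U\overset{\mathcal R}{\otimes}\mathcal U$ and the indices count factors $\mathcal U\overset{\mathcal R}{\otimes}\mathcal U$. Let $\Upsilon$ be obtained from $\mathcal F_{(12)(34)}=(\Delta\otimes\Delta\otimes\mathrm{id})(\mathcal F)$ by composing first with the coboundary twist generated by $\mathcal F$ and then with the one generated by $\zeta_{1|2}$. **Twisted algebra.** Let $\tilde{\mathcal K}''$ be the vector space $\mathcal K\otimes\mathcal L$ with the product twisted by $\Upsilon=\Upsilon_1\otimes\Upsilon_2\otimes\Upsilon_{\mathcal L}$: $$(a\otimes\lambda)*(b\otimes\mu)=(\Upsilon_1\blacktriangleright a)\bigl(\Upsilon_2\Delta(\lambda^{(1)})\blacktriangleright b\bigr)\otimes\Upsilon_{\mathcal L}\lambda^{[\infty]}\mu .$$ **dRE algebra.** Let $\tilde{\mathcal K}$ be the quotient of the smash product $k\langle K^i_j\rangle\rtimes\mathcal L$, in which $\lambda K=\rho(\gamma(\lambda^{(1)}))K\rho(\lambda^{(2)})\lambda^{[\infty]}$ (with $\lambda^{(1)}\otimes\lambda^{(2)}\otimes\lambda^{[\infty]}$ the iterated coaction), by the relations $\tilde SK_2\tilde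 SK_2=K_2\tilde SK_2\tilde S$. **Theorem.** The element $\zeta$ is invertible, there is exactly one module algebra structure on $\mathcal K$ as above, and $\tilde{\mathcal K}''$ is isomorphic to $\tilde{\mathcal K}$ as an algebra, by an isomorphism $\tilde{\mathcal K}\to\tilde{\mathcal K}''$ with $\lambda\mapsto1\otimes\lambda$ for $\lambda\in\mathcal L$ and $K^i_j\mapsto K^i_j\otimes1$. -/

import Mathlib

open scoped TensorProduct Kronecker

noncomputable section

namespace DynRE

/-! ## Module algebras, base algebras, universal R-matrices -/

section Basic

variable {k : Type*} [Field k]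

/-- The action of `B ⊗ B` on `A ⊗ A` : `(x ⊗ y) (a ⊗ b) = (x ▸ a) ⊗ (y ▸ b)`. -/
def tensorAct {B A : Type*} [Ring B] [Algebra k B] [Ring A] [Algebra k A]
    (act : B →ₐ[k] Module.End k A) : B ⊗[k] B →ₗ[k] A ⊗[k] A →ₗ[k] A ⊗[k] A :=
  TensorProduct.homTensorHomMap (RingHom.id k) A A A A ∘ₗ
    TensorProduct.map act.toLinearMap act.toLinearMap

/-- `act : B → End A` makes the algebra `A` a module algebra with respect to the coproduct `Δ` and
the counit `ε` : `b ▸ 1 = ε(b) 1` and `b ▸ (x y) = (b⁽¹⁾ ▸ x) (b⁽²⁾ ▸ y)`. -/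
structure IsModuleAlgebra {B A : Type*} [Ring B] [Algebra k B] [Ring A] [Algebra k A]
    (Δ : B →ₐ[k] B ⊗[k] B) (ε : B →ₐ[k] k) (act : B →ₐ[k] Module.End k A) : Prop where
  act_one : ∀ b : B, act b 1 = ε b • (1 : A)
  act_mul : ∀ (b : B) (x y : A), act b (x * y) =
    LinearMap.mul' k A (tensorAct act (Δ b) (x ⊗ₜ[k] y))

/-- An `H`-base algebra: a left `H`-module algebra and left `H`-comodule algebra `L` which is a
Yetter-Drinfeld module and satisfies `λ μ = (λ⁽¹⁾ ▹ μ) λ⁽∞⁾`. -/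
structure BaseAlgebra (k H L : Type*) [Field k] [Ring H] [Bialgebra k H]
    [Ring L] [Algebra k L] where
  /-- the action `h ▹ λ` -/
  act : H →ₐ[k] Module.End k L
  /-- the coaction `δ(λ) = λ⁽¹⁾ ⊗ λ⁽∞⁾` -/
  coact : L →ₐ[k] H ⊗[k] L
  isModuleAlgebra :
    IsModuleAlgebra (Bialgebra.comulAlgHom k H) (Bialgebra.counitAlgHom k H) act
  coassoc : ∀ l : L,
    TensorProduct.assoc k H H L ((Coalgebra.comul (R := k) (A := H)).rTensor L (coact l)) =
      coact.toLinearMap.lTensor H (coact l)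
  counit_coact : ∀ l : L,
    TensorProduct.lid k L ((Coalgebra.counit (R := k) (A := H)).rTensor L (coact l)) = l
  /-- `h⁽¹⁾ λ⁽¹⁾ ⊗ (h⁽²⁾ ▹ λ⁽∞⁾) = (h⁽¹⁾ ▹ λ)⁽¹⁾ h⁽²⁾ ⊗ (h⁽¹⁾ ▹ λ)⁽∞⁾` -/
  yetterDrinfeld : ∀ (h : H) (l : L),
    TensorProduct.homTensorHomMap (RingHom.id k) H L H L
        (TensorProduct.map (LinearMap.mul k H) act.toLinearMap (Coalgebra.comul (R := k) h))
        (coact l) =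
      TensorProduct.lift
        ((LinearMap.mul k (H ⊗[k] L)).compl₁₂
          (coact.toLinearMap ∘ₗ act.toLinearMap.flip l)
          (Algebra.TensorProduct.includeLeft : H →ₐ[k] H ⊗[k] L).toLinearMap)
        (Coalgebra.comul (R := k) h)
  /-- `λ μ = (λ⁽¹⁾ ▹ μ) λ⁽∞⁾` -/
  quasiCommutative : ∀ l m : L,
    l * m = TensorProduct.lift
      ((LinearMap.mul k L).compl₁₂ (act.toLinearMap.flip m) LinearMap.id) (coact l)

variable {U : Type*} [Ring U]

section Legs

variable [Algebra k U]

/-- `x ⊗ y ↦ x ⊗ y ⊗ 1`. -/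
def leg12 : U ⊗[k] U →ₐ[k] (U ⊗[k] U) ⊗[k] U := Algebra.TensorProduct.includeLeft

/-- `x ⊗ y ↦ x ⊗ 1 ⊗ y`. -/
def leg13 : U ⊗[k] U →ₐ[k] (U ⊗[k] U) ⊗[k] U :=
  Algebra.TensorProduct.map Algebra.TensorProduct.includeLeft (AlgHom.id k U)

/-- `x ⊗ y ↦ 1 ⊗ x ⊗ y`. -/
def leg23 : U ⊗[k] U →ₐ[k] (U ⊗[k] U) ⊗[k] U :=
  Algebra.TensorProduct.map Algebra.TensorProduct.includeRight (AlgHom.id k U)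

end Legs

variable [Bialgebra k U]

/-- `u ↦ u_{(12)3} = (Δ ⊗ id)(u)`. -/
def comulFst : U ⊗[k] U →ₐ[k] (U ⊗[k] U) ⊗[k] U :=
  Algebra.TensorProduct.map (Bialgebra.comulAlgHom k U) (AlgHom.id k U)

/-- `u ↦ u_{1(23)} = (id ⊗ Δ)(u)`. -/
def comulSnd : U ⊗[k] U →ₐ[k] (U ⊗[k] U) ⊗[k] U :=
  (Algebra.TensorProduct.assoc k k k U U U).symm.toAlgHom.comp
    (Algebra.TensorProduct.map (AlgHom.id k U) (Bialgebra.comulAlgHom k U))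

/-- `R` is a universal R-matrix (quasitriangular structure) of `U`. -/
structure IsUniversalRMatrix (R : (U ⊗[k] U)ˣ) : Prop where
  intertwine : ∀ x : U, (R : U ⊗[k] U) * Coalgebra.comul (R := k) x =
    Algebra.TensorProduct.comm k U U (Coalgebra.comul (R := k) x) * R
  comul_fst : comulFst (R : U ⊗[k] U) = leg13 (R : U ⊗[k] U) * leg23 (R : U ⊗[k] U)
  comul_snd : comulSnd (R : U ⊗[k] U) = leg13 (R : U ⊗[k] U) * leg12 (R : U ⊗[k] U)

end Basic

/-! ## Dynamical tensors and dynamical twists -/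

section Dynamical

variable {k H L : Type*} [Field k] [Ring H] [Bialgebra k H] [Ring L] [Algebra k L]

/-- For algebras `A`, `B` and a homomorphism `j : H → B`, the map
`A ⊗ L → A ⊗ B ⊗ L`, `a ⊗ λ ↦ a ⊗ j(λ⁽¹⁾) ⊗ λ⁽∞⁾`. With `A = B = U` this is `u ↦ u_{1|2}`, with
`A = U ⊗ U` and `B = U` it is `u ↦ u_{12|3}`. -/
def BaseAlgebra.attach (𝔏 : BaseAlgebra k H L) {A B : Type*} [Ring A] [Algebra k A] [Ring B]
    [Algebra k B] (j : H →ₐ[k] B) : A ⊗[k] L →ₐ[k] (A ⊗[k] B) ⊗[k] L :=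
  (Algebra.TensorProduct.assoc k k k A B L).symm.toAlgHom.comp
    (Algebra.TensorProduct.map (AlgHom.id k A)
      ((Algebra.TensorProduct.map j (AlgHom.id k L)).comp 𝔏.coact))

/-- For `D : H → A`, the invariance condition
`D(h⁽¹⁾) u₁ ⊗ (h⁽²⁾ ▹ u_L) = u₁ D(h) ⊗ u_L` on `u = u₁ ⊗ u_L ∈ A ⊗ L`. -/
def BaseAlgebra.IsInvariant (𝔏 : BaseAlgebra k H L) {A : Type*} [Ring A] [Algebra k A]
    (D : H →ₐ[k] A) (u : A ⊗[k] L) : Prop :=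
  ∀ h : H,
    TensorProduct.homTensorHomMap (RingHom.id k) A L A L
        (TensorProduct.map (LinearMap.mul k A ∘ₗ D.toLinearMap) 𝔏.act.toLinearMap
          (Coalgebra.comul (R := k) h)) u =
      u * (D h ⊗ₜ[k] (1 : L))

variable {U : Type*} [Ring U] [Bialgebra k U]

/-- `F ∈ U ⊗ U ⊗ L` is a dynamical `(U, H, L)`-twist: an invertible invariant element with
`F_{(12)3} F_{12|3} = F_{1(23)} F_{23}` and `ε₁(F) = 1 = ε₂(F)`. -/
structure IsDynamicalTwist (j : H →ₐ[k] U) (𝔏 : BaseAlgebra k H L)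
    (F : ((U ⊗[k] U) ⊗[k] L)ˣ) : Prop where
  invariant : 𝔏.IsInvariant ((Bialgebra.comulAlgHom k U).comp j) (F : (U ⊗[k] U) ⊗[k] L)
  cocycle :
    Algebra.TensorProduct.map comulFst (AlgHom.id k L) (F : (U ⊗[k] U) ⊗[k] L) *
        𝔏.attach j (F : (U ⊗[k] U) ⊗[k] L) =
      Algebra.TensorProduct.map comulSnd (AlgHom.id k L) (F : (U ⊗[k] U) ⊗[k] L) *
        Algebra.TensorProduct.map leg23 (AlgHom.id k L) (F : (U ⊗[k] U) ⊗[k] L)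
  counit_fst :
    Algebra.TensorProduct.map
      ((Algebra.TensorProduct.lid k U).toAlgHom.comp
        (Algebra.TensorProduct.map (Bialgebra.counitAlgHom k U) (AlgHom.id k U)))
      (AlgHom.id k L) (F : (U ⊗[k] U) ⊗[k] L) = 1
  counit_snd :
    Algebra.TensorProduct.map
      ((Algebra.TensorProduct.rid k k U).toAlgHom.comp
        (Algebra.TensorProduct.map (AlgHom.id k U) (Bialgebra.counitAlgHom k U)))
      (AlgHom.id k L) (F : (U ⊗[k] U) ⊗[k] L) = 1

/-- The dynamical R-matrix `R̃ = F₂₁⁻¹ R F ∈ U ⊗ U ⊗ L`. -/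
def dynR (R : (U ⊗[k] U)ˣ) (F : ((U ⊗[k] U) ⊗[k] L)ˣ) : (U ⊗[k] U) ⊗[k] L :=
  Algebra.TensorProduct.map (Algebra.TensorProduct.comm k U U).toAlgHom (AlgHom.id k L)
      ((F⁻¹ : ((U ⊗[k] U) ⊗[k] L)ˣ) : (U ⊗[k] U) ⊗[k] L) *
    ((R : U ⊗[k] U) ⊗ₜ[k] (1 : L)) * F

/-- `Φ ↦ Δ(ξ)⁻¹ Φ ξ_{1|2} ξ₂`: the composition of a dynamical twist `Φ ∈ B ⊗ B ⊗ L` with the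
coboundary twist generated by an invertible `ξ ∈ B ⊗ L`. Here `Δ` is the coproduct of `B` and
`j : H → B` is the inclusion. -/
def gaugeTwist (𝔏 : BaseAlgebra k H L) {B : Type*} [Ring B] [Algebra k B]
    (Δ : B →ₐ[k] B ⊗[k] B) (j : H →ₐ[k] B) (ξ : (B ⊗[k] L)ˣ) (Φ : (B ⊗[k] B) ⊗[k] L) :
    (B ⊗[k] B) ⊗[k] L :=
  Algebra.TensorProduct.map Δ (AlgHom.id k L) ((ξ⁻¹ : (B ⊗[k] L)ˣ) : B ⊗[k] L) * Φ *
    𝔏.attach j (ξ : B ⊗[k] L) *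
    Algebra.TensorProduct.map Algebra.TensorProduct.includeRight (AlgHom.id k L) (ξ : B ⊗[k] L)

/-- `x ⊗ y ↦ (1 ⊗ x) ⊗ (y ⊗ 1)`, so that `R ↦ R₂₃`. -/
def midLeg : U ⊗[k] U →ₐ[k] (U ⊗[k] U) ⊗[k] (U ⊗[k] U) :=
  Algebra.TensorProduct.map Algebra.TensorProduct.includeRight Algebra.TensorProduct.includeLeft

/-- The coproduct `x ↦ R₂₃⁻¹ Δ_{U ⊗ U}(x) R₂₃` of the twisted tensor square of `U` by `R`, which as
an algebra (and as regards its counit) is `U ⊗ U`. -/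
def twistedComul (R : (U ⊗[k] U)ˣ) :
    U ⊗[k] U →ₐ[k] (U ⊗[k] U) ⊗[k] (U ⊗[k] U) :=
  have h₁ : midLeg ((R⁻¹ : (U ⊗[k] U)ˣ) : U ⊗[k] U) * midLeg (R : U ⊗[k] U) = 1 := by
    rw [← map_mul, Units.inv_mul, map_one]
  have h₂ : midLeg (R : U ⊗[k] U) * midLeg ((R⁻¹ : (U ⊗[k] U)ˣ) : U ⊗[k] U) = 1 := by
    rw [← map_mul, Units.mul_inv, map_one]
  { toFun := fun x =>
      midLeg ((R⁻¹ : (U ⊗[k] U)ˣ) : U ⊗[k] U) * Bialgebra.comulAlgHom k (U ⊗[k] U) x *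
        midLeg (R : U ⊗[k] U)
    map_one' := by rw [map_one, mul_one, h₁]
    map_zero' := by rw [map_zero, mul_zero, zero_mul]
    map_add' := fun x y => by rw [map_add, mul_add, add_mul]
    map_mul' := fun x y => by
      simp only [map_mul, mul_assoc]
      rw [← mul_assoc (midLeg (R : U ⊗[k] U)), h₂, one_mul]
    commutes' := fun c => by
      rw [AlgHom.commutes, ← Algebra.commutes, mul_assoc, h₁, mul_one] }

end Dynamical

/-! ## The composite twist -/

section Composite

variable {k H L U : Type*} [Field k] [Ring H] [Bialgebra k H] [Ring L] [Algebra k L]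
  [Ring U] [HopfAlgebra k U]

/-- `ζ = F̄₂ γ⁻¹(F̄₁) ⊗ F̄_L ∈ U ⊗ L`, where `F̄ = F⁻¹`. -/
def zeta (hγ : Function.Bijective (HopfAlgebra.antipode k (A := U)))
    (F : ((U ⊗[k] U) ⊗[k] L)ˣ) : U ⊗[k] L :=
  LinearMap.rTensor L
    (TensorProduct.lift
      ((LinearMap.mul k U).flip ∘ₗ
        (LinearEquiv.ofBijective (HopfAlgebra.antipode k (A := U)) hγ).symm.toLinearMap))
    ((F⁻¹ : ((U ⊗[k] U) ⊗[k] L)ˣ) : (U ⊗[k] U) ⊗[k] L)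

/-- The inclusion of `H` into the twisted tensor square of `U`, via the coproduct. -/
def diagIncl (j : H →ₐ[k] U) : H →ₐ[k] U ⊗[k] U := (Bialgebra.comulAlgHom k U).comp j

/-- The composite dynamical twist `Υ`, in `(U ⊗ U) ⊗ (U ⊗ U) ⊗ L` : the twist `F_{(12)(34)}`,
composed with the coboundary twist generated by `F` and then with the one generated by
`ζ_{1|2}` (here `z` is `ζ`). -/
def compositeTwist (j : H →ₐ[k] U) (𝔏 : BaseAlgebra k H L) (R : (U ⊗[k] U)ˣ)
    (F : ((U ⊗[k] U) ⊗[k] L)ˣ) (z : (U ⊗[k] L)ˣ) :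
    ((U ⊗[k] U) ⊗[k] (U ⊗[k] U)) ⊗[k] L :=
  gaugeTwist 𝔏 (twistedComul R) (diagIncl j)
    (Units.map (𝔏.attach (A := U) j).toMonoidHom z)
    (gaugeTwist 𝔏 (twistedComul R) (diagIncl j) F
      (Algebra.TensorProduct.map
        (Algebra.TensorProduct.map (Bialgebra.comulAlgHom k U) (Bialgebra.comulAlgHom k U))
        (AlgHom.id k L) (F : (U ⊗[k] U) ⊗[k] L)))

end Composite

/-! ## The twisted multiplication on `A ⊗ L` -/

section TwistedMul

variable {k H L B A : Type*} [Field k] [Ring H] [Bialgebra k H] [Ring L] [Algebra k L]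
  [Ring B] [Algebra k B] [Ring A] [Algebra k A]

/-- For `t = a ⊗ b ∈ A ⊗ A`, the map `(x ⊗ y) ⊗ ν ↦ (x ▸ a) (y ▸ b) ⊗ ν`. -/
def evalTwist (L : Type*) [Ring L] [Algebra k L] (act : B →ₐ[k] Module.End k A) :
    A ⊗[k] A →ₗ[k] (B ⊗[k] B) ⊗[k] L →ₗ[k] A ⊗[k] L :=
  LinearMap.rTensorHom L ∘ₗ
    (tensorAct act).flip.compr₂ (LinearMap.mul' k A)

/-- The bilinear multiplication on `A ⊗ L` obtained from the `B`-module algebra `A` and the base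
algebra `L` by the dynamical twist `Φ ∈ B ⊗ B ⊗ L`:
`(a ⊗ λ) * (b ⊗ μ) = (Φ₁ ▸ a) (Φ₂ j(λ⁽¹⁾) ▸ b) ⊗ Φ_L λ⁽∞⁾ μ`. -/
def twistedMul (𝔏 : BaseAlgebra k H L) (j : H →ₐ[k] B) (act : B →ₐ[k] Module.End k A)
    (Φ : (B ⊗[k] B) ⊗[k] L) :
    A ⊗[k] L →ₗ[k] A ⊗[k] L →ₗ[k] A ⊗[k] L :=
  TensorProduct.curry
    (TensorProduct.lift
        ((evalTwist L act).compl₂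
          (TensorProduct.lift
            ((LinearMap.mul k ((B ⊗[k] B) ⊗[k] L)).compl₁₂
              (LinearMap.mulLeft k Φ ∘ₗ (𝔏.attach j).toLinearMap ∘ₗ
                (Algebra.TensorProduct.includeRight : L →ₐ[k] B ⊗[k] L).toLinearMap)
              (Algebra.TensorProduct.includeRight :
                L →ₐ[k] (B ⊗[k] B) ⊗[k] L).toLinearMap))) ∘ₗ
      (TensorProduct.tensorTensorTensorComm k A L A L).toLinearMap)

theorem evalTwist_tmul (act : B →ₐ[k] Module.End k A) (a b : A) (x y : B) (l : L) :
    evalTwist L act (a ⊗ₜ[k] b) ((x ⊗ₜ[k] y) ⊗ₜ[k] l) = (act x a * act y b) ⊗ₜ[k] l := by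
  simp [evalTwist, tensorAct]

theorem twistedMul_tmul (𝔏 : BaseAlgebra k H L) (j : H →ₐ[k] B)
    (act : B →ₐ[k] Module.End k A) (Φ : (B ⊗[k] B) ⊗[k] L) (a b : A) (l m : L) :
    twistedMul 𝔏 j act Φ (a ⊗ₜ[k] l) (b ⊗ₜ[k] m) =
      evalTwist L act (a ⊗ₜ[k] b)
        (Φ * 𝔏.attach j ((1 : B) ⊗ₜ[k] l) * (1 ⊗ₜ[k] m)) := by
  simp [twistedMul]

end TwistedMul

/-! ## The reflection equation algebra -/

section RE

variable {k ι : Type*} [Field k] [Fintype ι] [DecidableEq ι]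

/-- `X₂ = 1 ⊗ X` for a square matrix `X`. -/
def sndCopy {A : Type*} [Ring A] (X : Matrix ι ι A) : Matrix (ι × ι) (ι × ι) A :=
  (1 : Matrix ι ι A) ⊗ₖ X

/-- `P X`, where `P (v ⊗ w) = w ⊗ v`. -/
def flipMul {A : Type*} (X : Matrix (ι × ι) (ι × ι) A) : Matrix (ι × ι) (ι × ι) A :=
  X.submatrix Prod.swap id

/-- The two sides of the entries of `S K₂ S K₂ = K₂ S K₂ S`. -/
def ReflectionRel {A : Type*} [Ring A] (S : Matrix (ι × ι) (ι × ι) A) (K : Matrix ι ι A) :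
    A → A → Prop :=
  fun x y => ∃ p q : ι × ι,
    x = (S * sndCopy K * S * sndCopy K) p q ∧ y = (sndCopy K * S * sndCopy K * S) p q

/-- The RE algebra of a matrix `S ∈ End(V ⊗ V)` : generators `K i j`, relations
`S K₂ S K₂ = K₂ S K₂ S`. -/
abbrev REAlgebra (S : Matrix (ι × ι) (ι × ι) k) : Type _ :=
  RingQuot (ReflectionRel (S.map (algebraMap k (FreeAlgebra k (ι × ι))))
    (Matrix.of fun i j => FreeAlgebra.ι k (i, j)))

/-- The matrix of generators of the RE algebra. -/
def REAlgebra.gen (S : Matrix (ι × ι) (ι × ι) k) : Matrix ι ι (REAlgebra S) :=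
  Matrix.of fun i j => RingQuot.mkAlgHom k _ (FreeAlgebra.ι k (i, j))

variable {U : Type*} [Ring U] [HopfAlgebra k U]

/-- The matrix entry `ρ(·) i j` as a linear form. -/
def entry {U : Type*} [Ring U] [Algebra k U] (ρ : U →ₐ[k] Matrix ι ι k) (i j : ι) : U →ₗ[k] k :=
  Matrix.entryLinearMap k k i j ∘ₗ ρ.toLinearMap

/-- `u₁ ⊗ u₂ ⊗ u_L ↦ ρ(u₁) ⊗ ρ(u₂) ⊗ u_L`, as a matrix over `V ⊗ V` with entries in `L`. -/
def repMatrix {U L : Type*} [Ring U] [Algebra k U] [Ring L] [Algebra k L]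
    (ρ : U →ₐ[k] Matrix ι ι k) (u : (U ⊗[k] U) ⊗[k] L) : Matrix (ι × ι) (ι × ι) L :=
  Matrix.of fun p q =>
    TensorProduct.lid k L
      (LinearMap.rTensor L
        (LinearMap.mul' k k ∘ₗ TensorProduct.map (entry ρ p.1 q.1) (entry ρ p.2 q.2)) u)

/-- The matrix `S = P R`, with `R` evaluated in the representation `ρ`. -/
def matS (ρ : U →ₐ[k] Matrix ι ι k) (R : (U ⊗[k] U)ˣ) : Matrix (ι × ι) (ι × ι) k :=
  flipMul (repMatrix ρ ((R : U ⊗[k] U) ⊗ₜ[k] (1 : k)))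

/-- `act` is an action on the RE algebra of `S = P R` that makes it a module algebra over the
twisted tensor square of `U` by `R` and is given on generators by
`(x ⊗ y) ▸ K = ρ(γ(x)) K ρ(y)`. -/
structure IsREAction (ρ : U →ₐ[k] Matrix ι ι k) (R : (U ⊗[k] U)ˣ)
    (act : U ⊗[k] U →ₐ[k] Module.End k (REAlgebra (matS ρ R))) : Prop where
  isModuleAlgebra : IsModuleAlgebra (twistedComul R) (Bialgebra.counitAlgHom k (U ⊗[k] U)) act
  act_gen : ∀ (x y : U) (i j : ι),
    act (x ⊗ₜ[k] y) (REAlgebra.gen (matS ρ R) i j) =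
      ∑ a : ι, ∑ b : ι, (ρ (HopfAlgebra.antipode k x) i a * ρ y b j) •
        REAlgebra.gen (matS ρ R) a b

end RE

/-! ## The dynamical reflection equation algebra -/

section DRE

variable {k ι H L : Type*} [Field k] [Fintype ι] [DecidableEq ι] [Ring H] [HopfAlgebra k H]
  [Ring L] [Algebra k L]

/-- `λ ↦ ρ(γ(λ⁽¹⁾⁽¹⁾)) i a · ρ(λ⁽¹⁾⁽²⁾) b j · λ⁽∞⁾`, the coefficients of `K a b` in the `(i, j)`
entry of `ρ(γ(λ⁽¹⁾)) K ρ(λ⁽²⁾) λ⁽∞⁾`. -/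
def crossCoeff (𝔏 : BaseAlgebra k H L) (ρ : H →ₐ[k] Matrix ι ι k) (i j a b : ι) : L →ₗ[k] L :=
  (TensorProduct.lid k L).toLinearMap ∘ₗ
    LinearMap.rTensor L
      (LinearMap.mul' k k ∘ₗ
        TensorProduct.map (entry ρ i a ∘ₗ HopfAlgebra.antipode k) (entry ρ b j) ∘ₗ
        Coalgebra.comul) ∘ₗ
    𝔏.coact.toLinearMap

/-- Defining relations of the smash product `k⟨K i j⟩ ⋊ L` on generators `K i j` and `L` : the
relations of the algebra `L`, and `λ K = ρ(γ(λ⁽¹⁾)) K ρ(λ⁽²⁾) λ⁽∞⁾`. -/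
inductive SmashRel (𝔏 : BaseAlgebra k H L) (ρ : H →ₐ[k] Matrix ι ι k) :
    FreeAlgebra k ((ι × ι) ⊕ L) → FreeAlgebra k ((ι × ι) ⊕ L) → Prop
  | add (l m : L) : SmashRel 𝔏 ρ (FreeAlgebra.ι k (Sum.inr (l + m)))
      (FreeAlgebra.ι k (Sum.inr l) + FreeAlgebra.ι k (Sum.inr m))
  | mul (l m : L) : SmashRel 𝔏 ρ (FreeAlgebra.ι k (Sum.inr (l * m)))
      (FreeAlgebra.ι k (Sum.inr l) * FreeAlgebra.ι k (Sum.inr m))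
  | algebraMap (c : k) : SmashRel 𝔏 ρ (FreeAlgebra.ι k (Sum.inr (algebraMap k L c)))
      (algebraMap k _ c)
  | cross (l : L) (i j : ι) : SmashRel 𝔏 ρ
      (FreeAlgebra.ι k (Sum.inr l) * FreeAlgebra.ι k (Sum.inl (i, j)))
      (∑ a : ι, ∑ b : ι, FreeAlgebra.ι k (Sum.inl (a, b)) *
        FreeAlgebra.ι k (Sum.inr (crossCoeff 𝔏 ρ i j a b l)))

/-- The smash product `k⟨K i j⟩ ⋊ L`, by generators and relations. -/
abbrev SmashAlgebra (𝔏 : BaseAlgebra k H L) (ρ : H →ₐ[k] Matrix ι ι k) : Type _ :=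
  RingQuot (SmashRel 𝔏 ρ)

/-- The matrix of generators `K i j` of the smash product. -/
def SmashAlgebra.gen (𝔏 : BaseAlgebra k H L) (ρ : H →ₐ[k] Matrix ι ι k) :
    Matrix ι ι (SmashAlgebra 𝔏 ρ) :=
  Matrix.of fun i j => RingQuot.mkAlgHom k _ (FreeAlgebra.ι k (Sum.inl (i, j)))

/-- The canonical homomorphism from `L` to the smash product. -/
def SmashAlgebra.incl (𝔏 : BaseAlgebra k H L) (ρ : H →ₐ[k] Matrix ι ι k) :
    L →ₐ[k] SmashAlgebra 𝔏 ρ where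
  toFun l := RingQuot.mkAlgHom k _ (FreeAlgebra.ι k (Sum.inr l))
  map_one' := by
    have h := RingQuot.mkAlgHom_rel k (SmashRel.algebraMap (𝔏 := 𝔏) (ρ := ρ) 1)
    simpa using h
  map_zero' := by
    have h := RingQuot.mkAlgHom_rel k (SmashRel.algebraMap (𝔏 := 𝔏) (ρ := ρ) 0)
    simpa using h
  map_add' l m := by
    simpa using RingQuot.mkAlgHom_rel k (SmashRel.add (𝔏 := 𝔏) (ρ := ρ) l m)
  map_mul' l m := by
    simpa using RingQuot.mkAlgHom_rel k (SmashRel.mul (𝔏 := 𝔏) (ρ := ρ) l m)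
  commutes' c := by
    simpa using RingQuot.mkAlgHom_rel k (SmashRel.algebraMap (𝔏 := 𝔏) (ρ := ρ) c)

/-- The dRE algebra of `S̃ ∈ End(V ⊗ V) ⊗ L` : the quotient of `k⟨K i j⟩ ⋊ L` by the relations
`S̃ K₂ S̃ K₂ = K₂ S̃ K₂ S̃`. -/
abbrev DREAlgebra (𝔏 : BaseAlgebra k H L) (ρ : H →ₐ[k] Matrix ι ι k)
    (S : Matrix (ι × ι) (ι × ι) L) : Type _ :=
  RingQuot (ReflectionRel (S.map (SmashAlgebra.incl 𝔏 ρ)) (SmashAlgebra.gen 𝔏 ρ))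

/-- The matrix of generators `K i j` of the dRE algebra. -/
def DREAlgebra.gen (𝔏 : BaseAlgebra k H L) (ρ : H →ₐ[k] Matrix ι ι k)
    (S : Matrix (ι × ι) (ι × ι) L) : Matrix ι ι (DREAlgebra 𝔏 ρ S) :=
  (SmashAlgebra.gen 𝔏 ρ).map (RingQuot.mkAlgHom k _)

/-- The canonical homomorphism from `L` to the dRE algebra. -/
def DREAlgebra.incl (𝔏 : BaseAlgebra k H L) (ρ : H →ₐ[k] Matrix ι ι k)
    (S : Matrix (ι × ι) (ι × ι) L) : L →ₐ[k] DREAlgebra 𝔏 ρ S :=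
  (RingQuot.mkAlgHom k _).comp (SmashAlgebra.incl 𝔏 ρ)

end DRE

end DynRE

end

open DynRE

noncomputable section

namespace DynRE

/-! ## Points of algebras and their convolution -/

section Points

variable {k E : Type*} [Field k] [Ring E] [Algebra k E]

/-! Method. An identity in an iterated tensor product of algebras is equivalent to the family of its
values in arbitrary algebras `E` at commuting "points", that is, multiplicative unital linear maps
with pairwise commuting ranges. A coproduct becomes the convolution `conv`. The bar subscript, where
the coaction produces an extra leg, becomes the replacement of a point `l` of `L` by the shifted
point `dyn D a l`. The antipode enters through operators: right multiplication by `a (γ⁻¹ x)` is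
again a point of `U`, with values in `Module.End k E`, and the antipode axioms say that certain
convolutions of points act as the counit, often only on the vector `1`. Invariance of a twist is
used only in the form "commutes with all `D ν⁽¹⁾ ⊗ ν⁽∞⁾`", which follows from the
quasi-commutativity of `L`; with it, twists are stable under gauge transformations.

The element `ζ`. At points, `ζ` is `F⁻¹` applied to `1` in the operator picture. Two rearrangements
of the cocycle equation, with antipode axioms killing one side, give a right and a left inverse
(`isUnit_zeta`). A third rearrangement, used twice, gives a coproduct formula for `ζ` (`zeta_conv`).
Consequently the twist `J` obtained from `F` by gauging with `ζ` is `F⁻¹` read through `γ⁻¹` in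
reversed order (`tri_gauge_zeta`), so that `R̃`, acting through `γ⁻¹`, turns `J` into `R` times the
flipped `J` (`dynR_gauge_zeta`).

The key formula. Write `a, b, c, d` for points at the four `U`-legs of `Υ`. The cocycle equation and
the hexagon for `R̃` reduce `Υ`, multiplied by an explicit factor `X` built from `R̃`, to `R_{bc}⁻¹
J_{ac} F_{bd}` (`tri_compositeUnit_mul`). The two sides of the dynamical reflection equation are
operators of the shape `R̃ · X` and `X τ R̃`, with `τ` a flip, and `Υ` carries them to the two sides
of the ordinary reflection equation times one and the same invertible element
(`compositeUnit_mul_left`, `compositeUnit_mul_right`). Thus `Υ` exchanges the two sets of quadratic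
relations.

The module algebra. A module algebra structure on the RE algebra is an algebra map into the
convolution algebra of linear maps from `U ⊗ U`; it exists because the operators of the relations
intertwine actions of the twisted tensor square, and it is unique because it is fixed on generators.

The isomorphism. In one direction, left multiplications by `K ⊗ 1` and by `1 ⊗ λ` in the twisted
algebra satisfy the dRE relations, so the dRE algebra acts on `𝒦 ⊗ L`; the map sends `x` to `x · (1
⊗ 1)`. In the other direction the RE algebra is made to act on equivariant maps `B ⊗ L → T`, where
`B = U ⊗ U` and `T` is the dRE algebra, by operators containing `Υ⁻¹` (`pair_genEnd_eq_zero`).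
Acting on `ε ⊗ ι`, with `ι : L → T`, and evaluating gives a linear map `𝒦 ⊗ L → T` compatible with
generators (`exists_linear_of_genEnd`), hence a left inverse. Surjectivity is an induction on words
in the generators (`regular_surjective`). No basis of either algebra is needed. -/

/-- A linear map between algebras which is unital and multiplicative. -/
class IsPoint {A : Type*} [Ring A] [Algebra k A] (f : A →ₗ[k] E) : Prop where
  map_one : f 1 = 1
  map_mul : ∀ x y : A, f (x * y) = f x * f y

/-- Two linear maps with commuting ranges. -/
class Commuting {V W : Type*} [AddCommGroup V] [Module k V] [AddCommGroup W] [Module k W]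
    (f : V →ₗ[k] E) (g : W →ₗ[k] E) : Prop where
  comm : ∀ x y, f x * g y = g y * f x

section Pair

variable {V W X Y : Type*} [AddCommGroup V] [Module k V] [AddCommGroup W] [Module k W]
  [AddCommGroup X] [Module k X] [AddCommGroup Y] [Module k Y]

/-- The map `x ⊗ y ↦ f x * g y`. -/
def pair (f : V →ₗ[k] E) (g : W →ₗ[k] E) : V ⊗[k] W →ₗ[k] E :=
  LinearMap.mul' k E ∘ₗ TensorProduct.map f g

@[simp] theorem pair_tmul (f : V →ₗ[k] E) (g : W →ₗ[k] E) (x : V) (y : W) :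
    pair f g (x ⊗ₜ y) = f x * g y := by simp [pair]

instance Commuting.symm (f : V →ₗ[k] E) (g : W →ₗ[k] E) [h : Commuting f g] : Commuting g f :=
  ⟨fun x y => (h.comm y x).symm⟩

instance Commuting.pair (f : V →ₗ[k] E) (g : W →ₗ[k] E) (h : X →ₗ[k] E)
    [Commuting f h] [Commuting g h] : Commuting (DynRE.pair f g) h :=
  ⟨fun t y => by
    induction t with
    | zero => simp
    | add s t hs ht => rw [map_add, add_mul, mul_add, hs, ht]
    | tmul x z =>
      rw [pair_tmul, mul_assoc, Commuting.comm (f := g) z y, ← mul_assoc,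
        Commuting.comm (f := f) x y, mul_assoc]⟩

instance Commuting.comp (f : V →ₗ[k] E) (g : W →ₗ[k] V) (h : X →ₗ[k] E) [Commuting f h] :
    Commuting (f ∘ₗ g) h := ⟨fun x y => Commuting.comm (g x) y⟩

theorem pair_comp (f : V →ₗ[k] E) (g : W →ₗ[k] E) (f' : X →ₗ[k] V) (g' : Y →ₗ[k] W) :
    pair (f ∘ₗ f') (g ∘ₗ g') = pair f g ∘ₗ TensorProduct.map f' g' := by
  ext; simp

theorem pair_assoc (f : V →ₗ[k] E) (g : W →ₗ[k] E) (h : X →ₗ[k] E) :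
    pair (pair f g) h = pair f (pair g h) ∘ₗ (TensorProduct.assoc k V W X).toLinearMap := by
  ext; simp [mul_assoc]

theorem pair_comm (f : V →ₗ[k] E) (g : W →ₗ[k] E) [Commuting f g] :
    pair f g = pair g f ∘ₗ (TensorProduct.comm k V W).toLinearMap := by
  ext; simp [Commuting.comm (f := f) (g := g)]

end Pair

variable {A A' A'' : Type*} [Ring A] [Algebra k A] [Ring A'] [Algebra k A']
  [Ring A''] [Algebra k A'']

/-- Commuting ranges are what multiplicativity on a tensor product requires. With the instances for
`Commuting`, typeclass search then verifies all side conditions of evaluations at iterated points.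
-/
instance IsPoint.pair (f : A →ₗ[k] E) (g : A' →ₗ[k] E) [IsPoint f] [IsPoint g]
    [Commuting f g] : IsPoint (DynRE.pair f g) where
  map_one := by
    rw [Algebra.TensorProduct.one_def, pair_tmul, IsPoint.map_one, IsPoint.map_one, one_mul]
  map_mul s t := by
    induction s with
    | zero => simp
    | add s s' hs hs' => rw [add_mul, map_add, map_add, add_mul, hs, hs']
    | tmul x y =>
      induction t with
      | zero => simp
      | add t t' ht ht' => rw [mul_add, map_add, map_add, mul_add, ht, ht']
      | tmul z w =>
        rw [Algebra.TensorProduct.tmul_mul_tmul, pair_tmul, pair_tmul, pair_tmul,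
          IsPoint.map_mul, IsPoint.map_mul, mul_assoc, mul_assoc, ← mul_assoc (f z),
          Commuting.comm (f := f) z y, mul_assoc]

theorem pair_mul (f : A →ₗ[k] E) (g : A' →ₗ[k] E) [IsPoint f] [IsPoint g] [Commuting f g]
    (s t : A ⊗[k] A') : pair f g (s * t) = pair f g s * pair f g t := IsPoint.map_mul s t

theorem pair_one (f : A →ₗ[k] E) (g : A' →ₗ[k] E) [IsPoint f] [IsPoint g] [Commuting f g] :
    pair f g 1 = 1 := IsPoint.map_one

instance IsPoint.algHom (f : A →ₐ[k] E) : IsPoint f.toLinearMap := ⟨f.map_one, f.map_mul⟩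

instance IsPoint.comp (f : A →ₗ[k] E) (g : A' →ₐ[k] A) [IsPoint f] :
    IsPoint (f ∘ₗ g.toLinearMap) where
  map_one := by simp [IsPoint.map_one (f := f)]
  map_mul x y := by simp [IsPoint.map_mul (f := f)]

/-- A point, as an algebra homomorphism. -/
def IsPoint.toAlgHom (f : A →ₗ[k] E) [IsPoint f] : A →ₐ[k] E :=
  AlgHom.ofLinearMap f IsPoint.map_one IsPoint.map_mul

theorem IsPoint.map_inv_mul (f : A →ₗ[k] E) [IsPoint f] (u : Aˣ) :
    f ((u⁻¹ : Aˣ) : A) * f u = 1 := by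
  rw [← IsPoint.map_mul, Units.inv_mul, IsPoint.map_one]

theorem IsPoint.map_mul_inv (f : A →ₗ[k] E) [IsPoint f] (u : Aˣ) :
    f u * f ((u⁻¹ : Aˣ) : A) = 1 := by
  rw [← IsPoint.map_mul, Units.mul_inv, IsPoint.map_one]

theorem IsPoint.inv_mul_cancel (f : A →ₗ[k] E) [IsPoint f] (u : Aˣ) (e : E) :
    f ((u⁻¹ : Aˣ) : A) * (f u * e) = e := by
  rw [← mul_assoc, IsPoint.map_inv_mul, one_mul]

theorem IsPoint.mul_inv_cancel (f : A →ₗ[k] E) [IsPoint f] (u : Aˣ) (e : E) :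
    f u * (f ((u⁻¹ : Aˣ) : A) * e) = e := by
  rw [← mul_assoc, IsPoint.map_mul_inv, one_mul]

/-- If `f u` commutes with `e`, then so does `f u⁻¹`. -/
theorem IsPoint.commute_inv (f : A →ₗ[k] E) [IsPoint f] (u : Aˣ) (e : E) (h : Commute (f u) e) :
    Commute (f ((u⁻¹ : Aˣ) : A)) e := by
  have := IsPoint.mul_inv_cancel f u
  calc f ((u⁻¹ : Aˣ) : A) * e = f ((u⁻¹ : Aˣ) : A) * e * (f u * f ((u⁻¹ : Aˣ) : A)) := by
        rw [IsPoint.map_mul_inv, mul_one]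
    _ = f ((u⁻¹ : Aˣ) : A) * (e * f u) * f ((u⁻¹ : Aˣ) : A) := by noncomm_ring
    _ = f ((u⁻¹ : Aˣ) : A) * (f u * e) * f ((u⁻¹ : Aˣ) : A) := by rw [h.eq]
    _ = _ := by rw [IsPoint.inv_mul_cancel]

/-- `x ⊗ y ⊗ z ↦ a x * b y * l z`. -/
abbrev tri {V W X : Type*} [AddCommGroup V] [Module k V] [AddCommGroup W] [Module k W]
    [AddCommGroup X] [Module k X] (a : V →ₗ[k] E) (b : W →ₗ[k] E) (l : X →ₗ[k] E) :
    (V ⊗[k] W) ⊗[k] X →ₗ[k] E := pair (pair a b) l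

/-- The convolution of two linear maps with respect to a coproduct. -/
def conv (Δ : A →ₐ[k] A ⊗[k] A) (a b : A →ₗ[k] E) : A →ₗ[k] E := pair a b ∘ₗ Δ.toLinearMap

theorem conv_apply (Δ : A →ₐ[k] A ⊗[k] A) (a b : A →ₗ[k] E) (x : A) :
    conv Δ a b x = pair a b (Δ x) := rfl

instance (Δ : A →ₐ[k] A ⊗[k] A) (a b : A →ₗ[k] E) [IsPoint a] [IsPoint b] [Commuting a b] :
    IsPoint (conv Δ a b) := inferInstanceAs (IsPoint (pair a b ∘ₗ Δ.toLinearMap))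

instance {X : Type*} [AddCommGroup X] [Module k X] (Δ : A →ₐ[k] A ⊗[k] A) (a b : A →ₗ[k] E)
    (h : X →ₗ[k] E) [Commuting a h] [Commuting b h] :
    Commuting (conv Δ a b) h := inferInstanceAs (Commuting (pair a b ∘ₗ Δ.toLinearMap) h)

/-- Coassociativity of a coproduct. -/
def IsCoassoc (Δ : A →ₐ[k] A ⊗[k] A) : Prop :=
  ∀ x, TensorProduct.assoc k A A A (Δ.toLinearMap.rTensor A (Δ x)) =
    Δ.toLinearMap.lTensor A (Δ x)

theorem pair_conv_left {X : Type*} [AddCommGroup X] [Module k X] (Δ : A →ₐ[k] A ⊗[k] A)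
    (a b : A →ₗ[k] E) (l : X →ₗ[k] E) :
    pair (conv Δ a b) l = pair (pair a b) l ∘ₗ Δ.toLinearMap.rTensor X := by
  ext; simp [conv]

theorem pair_conv_right {X : Type*} [AddCommGroup X] [Module k X] (Δ : A →ₐ[k] A ⊗[k] A)
    (a b : A →ₗ[k] E) (l : X →ₗ[k] E) :
    pair l (conv Δ a b) = pair l (pair a b) ∘ₗ Δ.toLinearMap.lTensor X := by
  ext; simp [conv]

theorem conv_assoc {Δ : A →ₐ[k] A ⊗[k] A} (hΔ : IsCoassoc Δ) (a b c : A →ₗ[k] E) :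
    conv Δ (conv Δ a b) c = conv Δ a (conv Δ b c) := by
  ext x
  rw [conv_apply, conv_apply, pair_conv_left, pair_conv_right, pair_assoc]
  simp only [LinearMap.comp_apply, LinearEquiv.coe_coe]
  rw [hΔ]

/-- The constant point `x ↦ ε x • 1`. -/
def epsPoint (E : Type*) [Ring E] [Algebra k E] (ε : A →ₐ[k] k) : A →ₗ[k] E :=
  ((Algebra.ofId k E).comp ε).toLinearMap

@[simp] theorem epsPoint_apply (ε : A →ₐ[k] k) (x : A) :
    epsPoint E ε x = algebraMap k E (ε x) := rfl

instance (ε : A →ₐ[k] k) : IsPoint (epsPoint E ε) :=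
  inferInstanceAs (IsPoint ((Algebra.ofId k E).comp ε).toLinearMap)

instance {X : Type*} [AddCommGroup X] [Module k X] (ε : A →ₐ[k] k) (h : X →ₗ[k] E) :
    Commuting (epsPoint E ε) h := ⟨fun x y => Algebra.commutes (ε x) (h y)⟩

/-- Counitality of a coproduct, on the left. -/
def IsCounitLeft (Δ : A →ₐ[k] A ⊗[k] A) (ε : A →ₐ[k] k) : Prop :=
  ∀ x, TensorProduct.lid k A (ε.toLinearMap.rTensor A (Δ x)) = x

/-- Counitality of a coproduct, on the right. -/
def IsCounitRight (Δ : A →ₐ[k] A ⊗[k] A) (ε : A →ₐ[k] k) : Prop :=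
  ∀ x, TensorProduct.rid k A (ε.toLinearMap.lTensor A (Δ x)) = x

theorem conv_eps_left {Δ : A →ₐ[k] A ⊗[k] A} {ε : A →ₐ[k] k} (h : IsCounitLeft Δ ε)
    (a : A →ₗ[k] E) : conv Δ (epsPoint E ε) a = a := by
  have h' : pair (epsPoint E ε) a = a ∘ₗ (TensorProduct.lid k A).toLinearMap ∘ₗ
      ε.toLinearMap.rTensor A := by
    ext; simp [Algebra.algebraMap_eq_smul_one]
  ext x
  rw [conv_apply, h']
  exact congrArg a (h x)

theorem conv_eps_right {Δ : A →ₐ[k] A ⊗[k] A} {ε : A →ₐ[k] k} (h : IsCounitRight Δ ε)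
    (a : A →ₗ[k] E) : conv Δ a (epsPoint E ε) = a := by
  have h' : pair a (epsPoint E ε) = a ∘ₗ (TensorProduct.rid k A).toLinearMap ∘ₗ
      ε.toLinearMap.lTensor A := by
    ext; simp [Algebra.algebraMap_eq_smul_one]
  ext x
  rw [conv_apply, h']
  exact congrArg a (h x)

end Points

/-! ### Points of a base algebra -/

section Dyn

variable {k H L E : Type*} [Field k] [Ring H] [Bialgebra k H] [Ring L] [Algebra k L]
  [Ring E] [Algebra k E] {A A' : Type*} [Ring A] [Algebra k A] [Ring A'] [Algebra k A']

/-- `ν ↦ a (D ν⁽¹⁾) * l ν⁽∞⁾`. -/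
def BaseAlgebra.dyn (𝔏 : BaseAlgebra k H L) (D : H →ₐ[k] A) (a : A →ₗ[k] E) (l : L →ₗ[k] E) :
    L →ₗ[k] E :=
  pair (a ∘ₗ D.toLinearMap) l ∘ₗ 𝔏.coact.toLinearMap

variable (𝔏 : BaseAlgebra k H L)

instance (D : H →ₐ[k] A) (a : A →ₗ[k] E) (l : L →ₗ[k] E) [IsPoint a] [IsPoint l]
    [Commuting a l] : IsPoint (𝔏.dyn D a l) :=
  inferInstanceAs (IsPoint (pair (a ∘ₗ D.toLinearMap) l ∘ₗ 𝔏.coact.toLinearMap))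

instance {X : Type*} [AddCommGroup X] [Module k X] (D : H →ₐ[k] A) (a : A →ₗ[k] E)
    (l : L →ₗ[k] E) (h : X →ₗ[k] E) [Commuting a h] [Commuting l h] :
    Commuting (𝔏.dyn D a l) h :=
  inferInstanceAs (Commuting (pair (a ∘ₗ D.toLinearMap) l ∘ₗ 𝔏.coact.toLinearMap) h)

/-- Compatibility of a homomorphism from a bialgebra with a coproduct. -/
def IsComulHom (Δ : A →ₐ[k] A ⊗[k] A) (D : H →ₐ[k] A) : Prop :=
  ∀ h, Δ (D h) = TensorProduct.map D.toLinearMap D.toLinearMap (Coalgebra.comul (R := k) h)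

/-- Coassociativity of the coaction. Nested shifts of a point of `L` can thus be traded for a single
shift by a convolution, which is the normal form used in all later computations. -/
theorem BaseAlgebra.dyn_assoc {Δ : A →ₐ[k] A ⊗[k] A} {D : H →ₐ[k] A} (hD : IsComulHom Δ D)
    (a b : A →ₗ[k] E) (l : L →ₗ[k] E) :
    𝔏.dyn D a (𝔏.dyn D b l) = 𝔏.dyn D (conv Δ a b) l := by
  have h1 : conv Δ a b ∘ₗ D.toLinearMap =
      pair (a ∘ₗ D.toLinearMap) (b ∘ₗ D.toLinearMap) ∘ₗ Coalgebra.comul (R := k) (A := H) := by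
    ext h
    rw [pair_comp]
    exact congrArg (pair a b) (hD h)
  have h2 : pair (conv Δ a b ∘ₗ D.toLinearMap) l =
      pair (a ∘ₗ D.toLinearMap) (pair (b ∘ₗ D.toLinearMap) l) ∘ₗ
        (TensorProduct.assoc k H H L).toLinearMap ∘ₗ
        (Coalgebra.comul (R := k) (A := H)).rTensor L := by
    rw [h1, ← LinearMap.comp_assoc, ← pair_assoc]
    ext; simp
  have h3 : pair (a ∘ₗ D.toLinearMap) (𝔏.dyn D b l) =
      pair (a ∘ₗ D.toLinearMap) (pair (b ∘ₗ D.toLinearMap) l) ∘ₗ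
        𝔏.coact.toLinearMap.lTensor H := by
    ext; simp [BaseAlgebra.dyn]
  ext ν
  have := congrArg (pair (a ∘ₗ D.toLinearMap) (pair (b ∘ₗ D.toLinearMap) l)) (𝔏.coassoc ν)
  simp only [BaseAlgebra.dyn] at h3 ⊢
  rw [LinearMap.comp_apply, LinearMap.comp_apply, h2, h3]
  exact this.symm

/-- Compatibility of a homomorphism from a bialgebra with a counit. -/
def IsCounitHom (ε : A →ₐ[k] k) (D : H →ₐ[k] A) : Prop :=
  ∀ h, ε (D h) = Coalgebra.counit (R := k) h

theorem BaseAlgebra.dyn_eps {ε : A →ₐ[k] k} {D : H →ₐ[k] A} (hD : IsCounitHom ε D)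
    (l : L →ₗ[k] E) : 𝔏.dyn D (epsPoint E ε) l = l := by
  have h : pair (epsPoint E ε ∘ₗ D.toLinearMap) l = l ∘ₗ (TensorProduct.lid k L).toLinearMap ∘ₗ
      (Coalgebra.counit (R := k) (A := H)).rTensor L := by
    ext; simp [hD _, Algebra.algebraMap_eq_smul_one]
  ext ν
  rw [BaseAlgebra.dyn, LinearMap.comp_apply, h]
  exact congrArg l (𝔏.counit_coact ν)

/-- The two descriptions of points of an algebra with compatible coproduct. -/
theorem BaseAlgebra.dyn_comp (D : H →ₐ[k] A) (f : A →ₐ[k] A') (a : A' →ₗ[k] E) (l : L →ₗ[k] E) :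
    𝔏.dyn (f.comp D) a l = 𝔏.dyn D (a ∘ₗ f.toLinearMap) l := rfl

/-- The dictionary entry for bar subscripts: a leg created by the coaction does not change the
tensor, only the point at which its `L`-factor is evaluated. -/
theorem BaseAlgebra.pair_attach (D : H →ₐ[k] A') (f : A →ₗ[k] E) (a : A' →ₗ[k] E)
    (l : L →ₗ[k] E) (u : A ⊗[k] L) :
    tri f a l (𝔏.attach D u) = pair f (𝔏.dyn D a l) u := by
  have h : tri f a l ∘ₗ (𝔏.attach (A := A) D).toLinearMap = pair f (𝔏.dyn D a l) := by
    ext x ν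
    simp only [BaseAlgebra.attach, BaseAlgebra.dyn, TensorProduct.AlgebraTensorModule.curry_apply,
      LinearMap.restrictScalars_self, TensorProduct.curry_apply, LinearMap.comp_apply,
      AlgHom.toLinearMap_apply, AlgHom.comp_apply, Algebra.TensorProduct.map_tmul, pair_tmul,
      AlgHom.id_apply]
    induction 𝔏.coact ν with
    | zero => simp
    | add s t hs ht => 
      simp only [map_add, TensorProduct.tmul_add, mul_add, hs, ht]
    | tmul h m => simp [mul_assoc]
  exact LinearMap.congr_fun h u

end Dyn

/-! ## Weakly invariant elements and gauge transformations of twists -/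

section Const

variable {k E : Type*} [Field k] [Ring E] [Algebra k E] {V W X : Type*}
  [AddCommGroup V] [Module k V] [AddCommGroup W] [Module k W] [AddCommGroup X] [Module k X]

/-- The linear map `c ↦ c • e`. -/
def cst (k : Type*) {E : Type*} [Field k] [Ring E] [Algebra k E] (e : E) : k →ₗ[k] E :=
  LinearMap.toSpanSingleton k E e

theorem commuting_cst {e : E} {f : V →ₗ[k] E} (h : ∀ x, Commute e (f x)) :
    Commuting (cst k e) f :=
  ⟨fun c x => by simp [cst, (h x).eq]⟩

/-- A single element is treated as a linear map out of `k`, so that the commutation of one value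
with a whole family is also found by instance search; `commute_cst` extracts the resulting
statement. -/
instance (f : V →ₗ[k] E) (g : W →ₗ[k] E) (x : V) [Commuting f g] :
    Commuting (cst k (f x)) g := commuting_cst fun y => Commuting.comm x y

instance (e e' : E) (g : W →ₗ[k] E) [Commuting (cst k e) g] [Commuting (cst k e') g] :
    Commuting (cst k (e * e')) g := ⟨fun c y => by
  have h := Commuting.comm (f := cst k e) (g := g) 1 y
  have h' := Commuting.comm (f := cst k e') (g := g) 1 y
  simp only [cst, LinearMap.toSpanSingleton_apply, one_smul] at h h' ⊢
  rw [smul_mul_assoc, mul_assoc, h', ← mul_assoc, h, mul_assoc, mul_smul_comm]⟩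

theorem commute_cst (e : E) (f : V →ₗ[k] E) [Commuting (cst k e) f] (x : V) :
    Commute e (f x) := by
  have h := Commuting.comm (f := cst k e) (g := f) 1 x
  simp only [cst, LinearMap.toSpanSingleton_apply, one_smul] at h
  exact h

theorem algHom_pair {E' : Type*} [Ring E'] [Algebra k E'] (φ : E →ₐ[k] E') (f : V →ₗ[k] E)
    (g : W →ₗ[k] E) (t : V ⊗[k] W) :
    φ (pair f g t) = pair (φ.toLinearMap ∘ₗ f) (φ.toLinearMap ∘ₗ g) t := by
  have : φ.toLinearMap ∘ₗ pair f g = pair (φ.toLinearMap ∘ₗ f) (φ.toLinearMap ∘ₗ g) := by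
    ext; simp
  exact LinearMap.congr_fun this t

theorem algHom_comp_pair {E' : Type*} [Ring E'] [Algebra k E'] (φ : E →ₐ[k] E') (f : V →ₗ[k] E)
    (g : W →ₗ[k] E) :
    φ.toLinearMap ∘ₗ pair f g = pair (φ.toLinearMap ∘ₗ f) (φ.toLinearMap ∘ₗ g) :=
  LinearMap.ext (algHom_pair φ f g)

theorem algHom_comp_conv {E' A : Type*} [Ring E'] [Algebra k E'] [Ring A] [Algebra k A]
    (φ : E →ₐ[k] E') (Δ : A →ₐ[k] A ⊗[k] A) (f g : A →ₗ[k] E) :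
    φ.toLinearMap ∘ₗ conv Δ f g = conv Δ (φ.toLinearMap ∘ₗ f) (φ.toLinearMap ∘ₗ g) := by
  rw [conv, ← LinearMap.comp_assoc, algHom_comp_pair, conv]

end Const

section Weak

variable {k H L E : Type*} [Field k] [Ring H] [Bialgebra k H] [Ring L] [Algebra k L]
  [Ring E] [Algebra k E] {A : Type*} [Ring A] [Algebra k A] (𝔏 : BaseAlgebra k H L)

theorem algHom_comp_dyn {E' : Type*} [Ring E'] [Algebra k E'] (φ : E →ₐ[k] E')
    (D : H →ₐ[k] A) (a : A →ₗ[k] E) (l : L →ₗ[k] E) :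
    φ.toLinearMap ∘ₗ 𝔏.dyn D a l = 𝔏.dyn D (φ.toLinearMap ∘ₗ a) (φ.toLinearMap ∘ₗ l) := by
  rw [BaseAlgebra.dyn, ← LinearMap.comp_assoc, algHom_comp_pair]
  rfl

/-- The inclusion of the left factor of a tensor product, as a point. -/
def ptL (k A B : Type*) [Field k] [Ring A] [Algebra k A] [Ring B] [Algebra k B] :
    A →ₗ[k] A ⊗[k] B :=
  (Algebra.TensorProduct.includeLeft : A →ₐ[k] A ⊗[k] B).toLinearMap

/-- The inclusion of the right factor of a tensor product, as a point. -/
def ptR (k A B : Type*) [Field k] [Ring A] [Algebra k A] [Ring B] [Algebra k B] :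
    B →ₗ[k] A ⊗[k] B :=
  (Algebra.TensorProduct.includeRight : B →ₐ[k] A ⊗[k] B).toLinearMap

section
variable (B : Type*) [Ring B] [Algebra k B]

@[simp] theorem ptL_apply (x : A) : ptL k A B x = x ⊗ₜ 1 := rfl
@[simp] theorem ptR_apply (x : B) : ptR k A B x = 1 ⊗ₜ x := rfl

instance : IsPoint (ptL k A B) := inferInstanceAs (IsPoint (AlgHom.toLinearMap _))
instance : IsPoint (ptR k A B) := inferInstanceAs (IsPoint (AlgHom.toLinearMap _))
instance : Commuting (ptL k A B) (ptR k A B) := ⟨fun x y => by simp⟩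

theorem pair_ptL_ptR : pair (ptL k A B) (ptR k A B) = LinearMap.id := by ext; simp

instance {V W : Type*} [AddCommGroup V] [Module k V] [AddCommGroup W] [Module k W]
    (f : V →ₗ[k] A) (g : W →ₗ[k] A) [Commuting f g] :
    Commuting (ptL k A B ∘ₗ f) (ptL k A B ∘ₗ g) :=
  ⟨fun x y => by simp [Commuting.comm (f := f) (g := g)]⟩

end

instance IsPoint.comp' {A' A'' : Type*} [Ring A'] [Algebra k A'] [Ring A''] [Algebra k A'']
    (f : A' →ₗ[k] E) (g : A'' →ₗ[k] A') [IsPoint f] [IsPoint g] : IsPoint (f ∘ₗ g) where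
  map_one := by simp [IsPoint.map_one (f := f), IsPoint.map_one (f := g)]
  map_mul x y := by simp [IsPoint.map_mul (f := f), IsPoint.map_mul (f := g)]

/-- `u ∈ A ⊗ L` commutes with all `D ν⁽¹⁾ ⊗ ν⁽∞⁾`. -/
def BaseAlgebra.IsWeakInvariant (D : H →ₐ[k] A) (u : A ⊗[k] L) : Prop :=
  ∀ ν : L, Commute u (𝔏.dyn D (ptL k A L) (ptR k A L) ν)

variable {𝔏}

theorem toAlgHom_comp_ptL (a : A →ₗ[k] E) (l : L →ₗ[k] E) [IsPoint a] [IsPoint l]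
    [Commuting a l] : (IsPoint.toAlgHom (pair a l)).toLinearMap ∘ₗ ptL k A L = a := by
  ext x; simp [IsPoint.toAlgHom, IsPoint.map_one (f := l)]

theorem toAlgHom_comp_ptR (a : A →ₗ[k] E) (l : L →ₗ[k] E) [IsPoint a] [IsPoint l]
    [Commuting a l] : (IsPoint.toAlgHom (pair a l)).toLinearMap ∘ₗ ptR k A L = l := by
  ext x; simp [IsPoint.toAlgHom, IsPoint.map_one (f := a)]

theorem algHom_comp_epsPoint {E' : Type*} [Ring E'] [Algebra k E'] (φ : E →ₐ[k] E')
    (ε : A →ₐ[k] k) : φ.toLinearMap ∘ₗ epsPoint E ε = epsPoint E' ε :=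
  LinearMap.ext fun x => φ.commutes (ε x)

/-- A pair of commuting points is an algebra homomorphism from `A ⊗ L`, and it carries the
commutation in `A ⊗ L` to any target algebra. -/
theorem BaseAlgebra.IsWeakInvariant.commuting {D : H →ₐ[k] A} {u : A ⊗[k] L}
    (h : 𝔏.IsWeakInvariant D u) (a : A →ₗ[k] E) (l : L →ₗ[k] E) [IsPoint a] [IsPoint l]
    [Commuting a l] : Commuting (cst k (pair a l u)) (𝔏.dyn D a l) := by
  refine commuting_cst fun ν => ?_
  have h1 := (h ν).map (IsPoint.toAlgHom (pair a l))
  have h2 := LinearMap.congr_fun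
    (algHom_comp_dyn 𝔏 (IsPoint.toAlgHom (pair a l)) D (ptL k A L) (ptR k A L)) ν
  rw [toAlgHom_comp_ptL, toAlgHom_comp_ptR] at h2
  rw [← h2]
  exact h1

theorem BaseAlgebra.IsWeakInvariant.commuting_inv {D : H →ₐ[k] A} {u : (A ⊗[k] L)ˣ}
    (h : 𝔏.IsWeakInvariant D u) (a : A →ₗ[k] E) (l : L →ₗ[k] E) [IsPoint a] [IsPoint l]
    [Commuting a l] :
    Commuting (cst k (pair a l ((u⁻¹ : (A ⊗[k] L)ˣ) : A ⊗[k] L))) (𝔏.dyn D a l) :=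
  haveI := h.commuting a l
  commuting_cst fun ν => IsPoint.commute_inv _ _ _ (commute_cst _ _ ν)

/-- By quasi-commutativity, left multiplication by `λ` on `L` is the action of `λ⁽¹⁾` followed by
right multiplication by `λ⁽∞⁾`. Hence left multiplication by `D ν⁽¹⁾ ⊗ ν⁽∞⁾` applies the invariance
operator of `ν⁽¹⁾` and then multiplies by `ν⁽∞⁾` on the right; invariance turns the former into
right multiplication by `D ν⁽¹⁾`. -/
theorem BaseAlgebra.IsInvariant.isWeakInvariant {D : H →ₐ[k] A} {u : A ⊗[k] L}
    (h : 𝔏.IsInvariant D u) : 𝔏.IsWeakInvariant D u := by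
  intro ν
  -- In the opposite algebra the left factor of a product acts first, which matches the order "act
  -- by the `H`-leg, then multiply on the right by the `L`-leg".
  set o : Module.End k (A ⊗[k] L) →ₗ[k] (Module.End k (A ⊗[k] L))ᵐᵒᵖ :=
    (MulOpposite.opLinearEquiv k).toLinearMap with ho
  set α : A →ₗ[k] (Module.End k (A ⊗[k] L))ᵐᵒᵖ :=
    o ∘ₗ LinearMap.mul k (A ⊗[k] L) ∘ₗ ptL k A L with hα
  set θ : H →ₗ[k] (Module.End k (A ⊗[k] L))ᵐᵒᵖ :=
    o ∘ₗ (LinearMap.lTensorHom A : Module.End k L →ₗ[k] _) ∘ₗ 𝔏.act.toLinearMap with hθ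
  set r : L →ₗ[k] (Module.End k (A ⊗[k] L))ᵐᵒᵖ :=
    o ∘ₗ (LinearMap.mul k (A ⊗[k] L)).flip ∘ₗ ptR k A L with hr
  set l : L →ₗ[k] (Module.End k (A ⊗[k] L))ᵐᵒᵖ :=
    o ∘ₗ LinearMap.mul k (A ⊗[k] L) ∘ₗ ptR k A L with hl
  have hl' : l = 𝔏.dyn (AlgHom.id k H) θ r := by
    ext m : 1
    refine MulOpposite.unop_injective ?_
    ext a n
    have hq : ∀ t : H ⊗[k] L, (pair (θ ∘ₗ (AlgHom.id k H).toLinearMap) r t).unop (a ⊗ₜ n) =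
        a ⊗ₜ TensorProduct.lift
          ((LinearMap.mul k L).compl₁₂ (𝔏.act.toLinearMap.flip n) LinearMap.id) t := by
      intro t
      induction t with
      | zero => simp
      | add s t hs ht => 
        rw [map_add, map_add, TensorProduct.tmul_add, ← hs, ← ht]; rfl
      | tmul h m => simp [hθ, hr, ho]
    have := hq (𝔏.coact m)
    rw [← 𝔏.quasiCommutative] at this
    refine Eq.trans ?_ this.symm
    simp [hl, ho]
  have hI : ∀ h, (conv (Bialgebra.comulAlgHom k H) (α ∘ₗ D.toLinearMap) θ h).unop u =
      u * (D h ⊗ₜ[k] (1 : L)) := by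
    intro x
    rw [← h x, conv_apply]
    change _ = TensorProduct.homTensorHomMap (RingHom.id k) A L A L
        (TensorProduct.map (LinearMap.mul k A ∘ₗ D.toLinearMap) 𝔏.act.toLinearMap
          (Bialgebra.comulAlgHom k H x)) u
    generalize Bialgebra.comulAlgHom k H x = t
    induction t with
    | zero => simp
    | add s t hs ht => simp only [map_add, MulOpposite.unop_add, LinearMap.add_apply, hs, ht]
    | tmul y z =>
      clear h
      induction u with
      | zero => simp
      | add u v hu hv => simp only [map_add, hu, hv]
      | tmul a m => simp [hα, hθ, ho]
  have h1 : ∀ n : L, (𝔏.dyn D α l n).unop u = 𝔏.dyn D (ptL k A L) (ptR k A L) n * u := by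
    intro n
    rw [BaseAlgebra.dyn, BaseAlgebra.dyn, LinearMap.comp_apply, LinearMap.comp_apply]
    generalize 𝔏.coact.toLinearMap n = t
    induction t with
    | zero => simp
    | add s t hs ht => simp only [map_add, MulOpposite.unop_add, LinearMap.add_apply, hs, ht, add_mul]
    | tmul y z =>
      simp [hα, hl, ho, ← mul_assoc]
  -- Coassociativity groups the two `H`-legs, one acting through `D` and one on `L`, into the
  -- invariance operator of a single leg.
  have h2 : 𝔏.dyn D α l = 𝔏.dyn (AlgHom.id k H)
      (conv (Bialgebra.comulAlgHom k H) (α ∘ₗ D.toLinearMap) θ) r := by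
    rw [hl', ← 𝔏.dyn_assoc (D := AlgHom.id k H) (fun h => by simp)]
    rfl
  rw [Commute, SemiconjBy, ← h1, h2, BaseAlgebra.dyn, BaseAlgebra.dyn, LinearMap.comp_apply,
    LinearMap.comp_apply]
  generalize 𝔏.coact.toLinearMap ν = t
  induction t with
  | zero => simp
  | add s t hs ht => simp only [map_add, MulOpposite.unop_add, LinearMap.add_apply, hs, ht, mul_add]
  | tmul y z =>
    have h3 := hI y
    simp only [pair_tmul, MulOpposite.unop_mul, Module.End.mul_apply, LinearMap.comp_apply,
      AlgHom.toLinearMap_apply, AlgHom.id_apply] at h3 ⊢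
    rw [h3]
    simp [hr, ho, mul_assoc]


section Twist

variable (𝔏) (Δ : A →ₐ[k] A ⊗[k] A) (ε : A →ₐ[k] k) (D : H →ₐ[k] A)

/-- A coassociative counital coproduct with a compatible homomorphism from a bialgebra. -/
structure IsCompatible (Δ : A →ₐ[k] A ⊗[k] A) (ε : A →ₐ[k] k) (D : H →ₐ[k] A) : Prop where
  coassoc : IsCoassoc Δ
  counitLeft : IsCounitLeft Δ ε
  counitRight : IsCounitRight Δ ε
  comulHom : IsComulHom Δ D
  counitHom : IsCounitHom ε D

/-- A dynamical twist for a coproduct `Δ`, with invariance replaced by weak invariance. -/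
structure IsWeakTwist (Φ : ((A ⊗[k] A) ⊗[k] L)ˣ) : Prop where
  invariant : 𝔏.IsWeakInvariant (Δ.comp D) (Φ : (A ⊗[k] A) ⊗[k] L)
  cocycle :
    Algebra.TensorProduct.map (Algebra.TensorProduct.map Δ (AlgHom.id k A)) (AlgHom.id k L)
        (Φ : (A ⊗[k] A) ⊗[k] L) * 𝔏.attach D (Φ : (A ⊗[k] A) ⊗[k] L) =
      Algebra.TensorProduct.map ((Algebra.TensorProduct.assoc k k k A A A).symm.toAlgHom.comp
        (Algebra.TensorProduct.map (AlgHom.id k A) Δ)) (AlgHom.id k L)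
        (Φ : (A ⊗[k] A) ⊗[k] L) *
        Algebra.TensorProduct.map (leg23 : A ⊗[k] A →ₐ[k] _) (AlgHom.id k L) (Φ : (A ⊗[k] A) ⊗[k] L)
  counit_fst : tri (epsPoint _ ε) (ptL k A L) (ptR k A L) (Φ : (A ⊗[k] A) ⊗[k] L) = 1
  counit_snd : tri (ptL k A L) (epsPoint _ ε) (ptR k A L) (Φ : (A ⊗[k] A) ⊗[k] L) = 1

variable {𝔏 Δ ε D}

section
variable (a b c : A →ₗ[k] E) (l : L →ₗ[k] E)

theorem tri_map_left (u : (A ⊗[k] A) ⊗[k] L) :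
    pair (pair (pair a b) c) l (Algebra.TensorProduct.map
      (Algebra.TensorProduct.map Δ (AlgHom.id k A)) (AlgHom.id k L) u) =
    tri (conv Δ a b) c l u := by
  have : pair (pair (pair a b) c) l ∘ₗ (Algebra.TensorProduct.map
      (Algebra.TensorProduct.map Δ (AlgHom.id k A)) (AlgHom.id k L)).toLinearMap =
    tri (conv Δ a b) c l := by
    ext; simp [conv]
  exact LinearMap.congr_fun this u

theorem tri_map_right (u : (A ⊗[k] A) ⊗[k] L) :
    pair (pair (pair a b) c) l (Algebra.TensorProduct.map
      ((Algebra.TensorProduct.assoc k k k A A A).symm.toAlgHom.comp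
        (Algebra.TensorProduct.map (AlgHom.id k A) Δ)) (AlgHom.id k L) u) =
    tri a (conv Δ b c) l u := by
  have : pair (pair (pair a b) c) l ∘ₗ (Algebra.TensorProduct.map
      ((Algebra.TensorProduct.assoc k k k A A A).symm.toAlgHom.comp
        (Algebra.TensorProduct.map (AlgHom.id k A) Δ)) (AlgHom.id k L)).toLinearMap =
    tri a (conv Δ b c) l := by
    ext x y z
    have : pair (pair a b) c ∘ₗ
      (TensorProduct.assoc k A A A).symm.toLinearMap = pair a (pair b c) := by
      ext; simp [mul_assoc]
    have := LinearMap.congr_fun this (x ⊗ₜ Δ y)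
    simp [conv] at this ⊢
    rw [← this]
    rfl
  exact LinearMap.congr_fun this u

theorem tri_leg23 [IsPoint a] (u : (A ⊗[k] A) ⊗[k] L) :
    pair (pair (pair a b) c) l (Algebra.TensorProduct.map (leg23 : A ⊗[k] A →ₐ[k] _) (AlgHom.id k L) u) =
    tri b c l u := by
  have : pair (pair (pair a b) c) l ∘ₗ
      (Algebra.TensorProduct.map (leg23 : A ⊗[k] A →ₐ[k] _) (AlgHom.id k L)).toLinearMap = tri b c l := by
    ext; simp [leg23, IsPoint.map_one (f := a)]
  exact LinearMap.congr_fun this u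

variable {Φ : ((A ⊗[k] A) ⊗[k] L)ˣ}

variable [IsPoint a] [IsPoint b] [IsPoint l] [Commuting a b] [Commuting a l] [Commuting b l]

theorem IsWeakTwist.cocycle_points [IsPoint c] [Commuting a c] [Commuting b c] [Commuting c l]
    (h : IsWeakTwist 𝔏 Δ ε D Φ) :
    tri (conv Δ a b) c l (Φ : (A ⊗[k] A) ⊗[k] L) *
        tri a b (𝔏.dyn D c l) (Φ : (A ⊗[k] A) ⊗[k] L) =
      tri a (conv Δ b c) l (Φ : (A ⊗[k] A) ⊗[k] L) * tri b c l (Φ : (A ⊗[k] A) ⊗[k] L) := by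
  have := congrArg (pair (pair (pair a b) c) l) h.cocycle
  rwa [pair_mul, pair_mul, tri_map_left, tri_map_right, tri_leg23,
    𝔏.pair_attach] at this

theorem IsWeakTwist.commuting (h : IsWeakTwist 𝔏 Δ ε D Φ) :
    Commuting (cst k (tri a b l (Φ : (A ⊗[k] A) ⊗[k] L))) (𝔏.dyn D (conv Δ a b) l) :=
  h.invariant.commuting (pair a b) l

theorem IsWeakTwist.commuting_inv (h : IsWeakTwist 𝔏 Δ ε D Φ) :
    Commuting (cst k (tri a b l ((Φ⁻¹ : ((A ⊗[k] A) ⊗[k] L)ˣ) : (A ⊗[k] A) ⊗[k] L)))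
      (𝔏.dyn D (conv Δ a b) l) :=
  h.invariant.commuting_inv (pair a b) l

omit [IsPoint b] [Commuting a b] [Commuting b l]

theorem IsWeakTwist.eps_left (h : IsWeakTwist 𝔏 Δ ε D Φ) :
    tri (epsPoint E ε) a l (Φ : (A ⊗[k] A) ⊗[k] L) = 1 := by
  have h1 := congrArg (IsPoint.toAlgHom (pair a l)) h.counit_fst
  rwa [tri, algHom_pair, algHom_comp_pair, map_one, toAlgHom_comp_ptL, toAlgHom_comp_ptR,
    algHom_comp_epsPoint] at h1

theorem IsWeakTwist.eps_right (h : IsWeakTwist 𝔏 Δ ε D Φ) :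
    tri a (epsPoint E ε) l (Φ : (A ⊗[k] A) ⊗[k] L) = 1 := by
  have h1 := congrArg (IsPoint.toAlgHom (pair a l)) h.counit_snd
  rwa [tri, algHom_pair, algHom_comp_pair, map_one, toAlgHom_comp_ptL, toAlgHom_comp_ptR,
    algHom_comp_epsPoint] at h1

end

end Twist

end Weak

section Gauge

variable {k H L E : Type*} [Field k] [Ring H] [Bialgebra k H] [Ring L] [Algebra k L]
  [Ring E] [Algebra k E] {A : Type*} [Ring A] [Algebra k A] (𝔏 : BaseAlgebra k H L)
  (Δ : A →ₐ[k] A ⊗[k] A) (ε : A →ₐ[k] k) (D : H →ₐ[k] A)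

/-- The composition of an invertible `Φ` with the coboundary twist generated by `ξ`, as a unit. -/
def gaugeUnit (ξ : (A ⊗[k] L)ˣ) (Φ : ((A ⊗[k] A) ⊗[k] L)ˣ) : ((A ⊗[k] A) ⊗[k] L)ˣ :=
  Units.map (Algebra.TensorProduct.map Δ (AlgHom.id k L)).toMonoidHom ξ⁻¹ * Φ *
    Units.map (𝔏.attach (A := A) D).toMonoidHom ξ *
    Units.map (Algebra.TensorProduct.map
      (Algebra.TensorProduct.includeRight : A →ₐ[k] A ⊗[k] A) (AlgHom.id k L)).toMonoidHom ξ

theorem coe_gaugeUnit (ξ : (A ⊗[k] L)ˣ) (Φ : ((A ⊗[k] A) ⊗[k] L)ˣ) :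
    (gaugeUnit 𝔏 Δ D ξ Φ : (A ⊗[k] A) ⊗[k] L) =
      gaugeTwist 𝔏 Δ D ξ (Φ : (A ⊗[k] A) ⊗[k] L) := rfl

variable {𝔏 Δ ε D}

theorem pair_map_comul (a b : A →ₗ[k] E) (l : L →ₗ[k] E) (u : A ⊗[k] L) :
    tri a b l (Algebra.TensorProduct.map Δ (AlgHom.id k L) u) = pair (conv Δ a b) l u := by
  have : tri a b l ∘ₗ (Algebra.TensorProduct.map Δ (AlgHom.id k L)).toLinearMap =
      pair (conv Δ a b) l := by ext; simp [conv]
  exact LinearMap.congr_fun this u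

theorem pair_map_includeRight {A' : Type*} [Ring A'] [Algebra k A'] (a : A' →ₗ[k] E)
    (b : A →ₗ[k] E) (l : L →ₗ[k] E) [IsPoint a] (u : A ⊗[k] L) :
    tri a b l (Algebra.TensorProduct.map
      (Algebra.TensorProduct.includeRight : A →ₐ[k] A' ⊗[k] A) (AlgHom.id k L) u) =
    pair b l u := by
  have : tri a b l ∘ₗ (Algebra.TensorProduct.map
      (Algebra.TensorProduct.includeRight : A →ₐ[k] A' ⊗[k] A) (AlgHom.id k L)).toLinearMap =
      pair b l := by ext; simp [IsPoint.map_one (f := a)]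
  exact LinearMap.congr_fun this u

theorem tri_gaugeTwist (a b : A →ₗ[k] E) (l : L →ₗ[k] E) [IsPoint a] [IsPoint b] [IsPoint l]
    [Commuting a b] [Commuting a l] [Commuting b l] (ξ : (A ⊗[k] L)ˣ) (Φ : (A ⊗[k] A) ⊗[k] L) :
    tri a b l (gaugeTwist 𝔏 Δ D ξ Φ) =
      pair (conv Δ a b) l ((ξ⁻¹ : (A ⊗[k] L)ˣ) : A ⊗[k] L) * tri a b l Φ *
        pair a (𝔏.dyn D b l) (ξ : A ⊗[k] L) * pair b l (ξ : A ⊗[k] L) := by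
  rw [gaugeTwist, pair_mul, pair_mul, pair_mul, pair_map_comul, pair_map_includeRight,
    𝔏.pair_attach]

/-- The points of the iterated tensor product `A ⊗ A ⊗ A ⊗ L`. -/
theorem eq_of_quad {u v : ((A ⊗[k] A) ⊗[k] A) ⊗[k] L}
    (h : pair (pair (pair (ptL k ((A ⊗[k] A) ⊗[k] A) L ∘ₗ ptL k (A ⊗[k] A) A ∘ₗ ptL k A A)
        (ptL k ((A ⊗[k] A) ⊗[k] A) L ∘ₗ ptL k (A ⊗[k] A) A ∘ₗ ptR k A A))
        (ptL k ((A ⊗[k] A) ⊗[k] A) L ∘ₗ ptR k (A ⊗[k] A) A)) (ptR k ((A ⊗[k] A) ⊗[k] A) L) u =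
      pair (pair (pair (ptL k ((A ⊗[k] A) ⊗[k] A) L ∘ₗ ptL k (A ⊗[k] A) A ∘ₗ ptL k A A)
        (ptL k ((A ⊗[k] A) ⊗[k] A) L ∘ₗ ptL k (A ⊗[k] A) A ∘ₗ ptR k A A))
        (ptL k ((A ⊗[k] A) ⊗[k] A) L ∘ₗ ptR k (A ⊗[k] A) A)) (ptR k ((A ⊗[k] A) ⊗[k] A) L) v) :
    u = v := by
  have : pair (pair (pair (ptL k ((A ⊗[k] A) ⊗[k] A) L ∘ₗ ptL k (A ⊗[k] A) A ∘ₗ ptL k A A)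
        (ptL k ((A ⊗[k] A) ⊗[k] A) L ∘ₗ ptL k (A ⊗[k] A) A ∘ₗ ptR k A A))
        (ptL k ((A ⊗[k] A) ⊗[k] A) L ∘ₗ ptR k (A ⊗[k] A) A)) (ptR k ((A ⊗[k] A) ⊗[k] A) L) =
      LinearMap.id := by ext; simp
  rwa [this] at h

/-- Weak invariance lets `ξ(c, l)` pass every factor whose dependence on `c` and `l` is only through
`dyn D c l`. After this move the inner `ξ` and `ξ⁻¹` cancel, the cocycle equation of `Φ` applies,
and a pair `ξ ξ⁻¹` at `conv Δ b c` is inserted to reach the other side. -/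
theorem pair_cocycle_gauge {ξ : (A ⊗[k] L)ˣ} {Φ : ((A ⊗[k] A) ⊗[k] L)ˣ}
    (hc : IsCompatible Δ ε D) (hΦ : IsWeakTwist 𝔏 Δ ε D Φ)
    (hξ : 𝔏.IsWeakInvariant D (ξ : A ⊗[k] L)) (a b c : A →ₗ[k] E) (l : L →ₗ[k] E)
    [IsPoint a] [IsPoint b] [IsPoint c] [IsPoint l] [Commuting a b] [Commuting a c]
    [Commuting b c] [Commuting a l] [Commuting b l] [Commuting c l] :
    tri (conv Δ a b) c l (gaugeTwist 𝔏 Δ D ξ (Φ : (A ⊗[k] A) ⊗[k] L)) *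
        tri a b (𝔏.dyn D c l) (gaugeTwist 𝔏 Δ D ξ (Φ : (A ⊗[k] A) ⊗[k] L)) =
      tri a (conv Δ b c) l (gaugeTwist 𝔏 Δ D ξ (Φ : (A ⊗[k] A) ⊗[k] L)) *
        tri b c l (gaugeTwist 𝔏 Δ D ξ (Φ : (A ⊗[k] A) ⊗[k] L)) := by
  have hco := hΦ.cocycle_points a b c l
  have hc1 := hξ.commuting c l
  have hc2 := hΦ.commuting b c l
  simp only [tri_gaugeTwist, conv_assoc hc.coassoc, 𝔏.dyn_assoc hc.comulHom] at hco hc1 hc2 ⊢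
  have e1 : Commute (pair c l (ξ : A ⊗[k] L)) (pair (conv Δ a b) (𝔏.dyn D c l)
      ((ξ⁻¹ : (A ⊗[k] L)ˣ) : A ⊗[k] L)) := commute_cst _ _ _
  have e2 : Commute (pair c l (ξ : A ⊗[k] L)) (tri a b (𝔏.dyn D c l) (Φ : (A ⊗[k] A) ⊗[k] L)) :=
    commute_cst _ _ _
  have e3 : Commute (pair c l (ξ : A ⊗[k] L)) (pair a (𝔏.dyn D (conv Δ b c) l)
      (ξ : A ⊗[k] L)) := by
    rw [← 𝔏.dyn_assoc hc.comulHom]; exact commute_cst _ _ _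
  have e4 : Commute (pair c l (ξ : A ⊗[k] L)) (pair b (𝔏.dyn D c l) (ξ : A ⊗[k] L)) :=
    commute_cst _ _ _
  have e5 : Commute (tri b c l (Φ : (A ⊗[k] A) ⊗[k] L)) (pair a (𝔏.dyn D (conv Δ b c) l)
      (ξ : A ⊗[k] L)) := commute_cst _ _ _
  have n1 := IsPoint.map_mul_inv (pair (conv Δ a b) (𝔏.dyn D c l)) ξ
  have n2 := IsPoint.map_mul_inv (pair (conv Δ b c) l) ξ
  generalize tri (conv Δ a b) c l (Φ : (A ⊗[k] A) ⊗[k] L) = p1 at *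
  generalize tri a b (𝔏.dyn D c l) (Φ : (A ⊗[k] A) ⊗[k] L) = p2 at *
  generalize tri a (conv Δ b c) l (Φ : (A ⊗[k] A) ⊗[k] L) = q1 at *
  generalize tri b c l (Φ : (A ⊗[k] A) ⊗[k] L) = q2 at *
  generalize pair (conv Δ a b) (𝔏.dyn D c l) (ξ : A ⊗[k] L) = y at *
  generalize pair (conv Δ a b) (𝔏.dyn D c l) ((ξ⁻¹ : (A ⊗[k] L)ˣ) : A ⊗[k] L) = y' at *
  generalize pair (conv Δ b c) l (ξ : A ⊗[k] L) = z at *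
  generalize pair (conv Δ b c) l ((ξ⁻¹ : (A ⊗[k] L)ˣ) : A ⊗[k] L) = z' at *
  generalize pair c l (ξ : A ⊗[k] L) = s at *
  generalize pair b (𝔏.dyn D c l) (ξ : A ⊗[k] L) = t at *
  generalize pair a (𝔏.dyn D (conv Δ b c) l) (ξ : A ⊗[k] L) = w at *
  generalize pair (conv Δ a (conv Δ b c)) l ((ξ⁻¹ : (A ⊗[k] L)ˣ) : A ⊗[k] L) = x at *
  calc x * p1 * y * s * (y' * p2 * w * t) = x * p1 * y * (s * y') * p2 * w * t := by
        simp only [mul_assoc]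
    _ = x * p1 * (y * y') * (s * p2) * w * t := by rw [e1.eq]; simp only [mul_assoc]
    _ = x * (p1 * p2) * (s * w) * t := by rw [n1, e2.eq, mul_one]; simp only [mul_assoc]
    _ = x * q1 * (q2 * w) * (s * t) := by rw [hco, e3.eq]; simp only [mul_assoc]
    _ = x * q1 * w * (z * z') * q2 * t * s := by
        rw [e5.eq, e4.eq, n2, mul_one]; simp only [mul_assoc]
    _ = _ := by simp only [mul_assoc]

theorem pair_comp_ptL_ptR {A A' : Type*} [Ring A] [Algebra k A] [Ring A'] [Algebra k A']
    (f : A ⊗[k] A' →ₗ[k] E) [IsPoint f] : pair (f ∘ₗ ptL k A A') (f ∘ₗ ptR k A A') = f := by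
  ext x y
  have h := IsPoint.map_mul (f := f) (x ⊗ₜ 1) (1 ⊗ₜ y)
  simpa using h.symm

theorem pair_eps_eq_one {ξ : A ⊗[k] L} (hε : pair (epsPoint L ε) LinearMap.id ξ = 1)
    (l : L →ₗ[k] E) [IsPoint l] : pair (epsPoint E ε) l ξ = 1 := by
  have := congrArg (IsPoint.toAlgHom l) hε
  rwa [algHom_pair, algHom_comp_epsPoint, map_one] at this

/-- The axioms are evaluated at universal points. Each of the four factors of the gauged element
commutes with the shifted point for its own reason: weak invariance of `ξ` or `ξ⁻¹` at different
points, and of `Φ`. -/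
theorem IsWeakTwist.gauge {ξ : (A ⊗[k] L)ˣ} {Φ : ((A ⊗[k] A) ⊗[k] L)ˣ}
    (hc : IsCompatible Δ ε D) (hΦ : IsWeakTwist 𝔏 Δ ε D Φ)
    (hξ : 𝔏.IsWeakInvariant D (ξ : A ⊗[k] L))
    (hε : pair (epsPoint L ε) LinearMap.id (ξ : A ⊗[k] L) = 1) :
    IsWeakTwist 𝔏 Δ ε D (gaugeUnit 𝔏 Δ D ξ Φ) := by
  refine ⟨fun ν => ?_, ?_, ?_, ?_⟩
  · have e0 : ∀ u : (A ⊗[k] A) ⊗[k] L, tri (ptL k (A ⊗[k] A) L ∘ₗ ptL k A A)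
      (ptL k (A ⊗[k] A) L ∘ₗ ptR k A A) (ptR k (A ⊗[k] A) L) u = u := by
        have : tri (ptL k (A ⊗[k] A) L ∘ₗ ptL k A A)
          (ptL k (A ⊗[k] A) L ∘ₗ ptR k A A) (ptR k (A ⊗[k] A) L) = LinearMap.id := by ext; simp
        intro u; rw [this]; rfl
    have e1 : 𝔏.dyn (Δ.comp D) (ptL k (A ⊗[k] A) L) (ptR k (A ⊗[k] A) L) =
        𝔏.dyn D (conv Δ (ptL k (A ⊗[k] A) L ∘ₗ ptL k A A) (ptL k (A ⊗[k] A) L ∘ₗ ptR k A A))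
          (ptR k (A ⊗[k] A) L) := by
      rw [𝔏.dyn_comp, conv, pair_comp_ptL_ptR]
    rw [e1, coe_gaugeUnit, ← e0 (gaugeTwist _ _ _ _ _), tri_gaugeTwist]
    have i1 := hξ.commuting_inv (conv Δ (ptL k (A ⊗[k] A) L ∘ₗ ptL k A A)
      (ptL k (A ⊗[k] A) L ∘ₗ ptR k A A)) (ptR k (A ⊗[k] A) L)
    have i2 := hΦ.commuting (ptL k (A ⊗[k] A) L ∘ₗ ptL k A A)
      (ptL k (A ⊗[k] A) L ∘ₗ ptR k A A) (ptR k (A ⊗[k] A) L)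
    have i3 := hξ.commuting (ptL k (A ⊗[k] A) L ∘ₗ ptL k A A)
      (𝔏.dyn D (ptL k (A ⊗[k] A) L ∘ₗ ptR k A A) (ptR k (A ⊗[k] A) L))
    have i4 := hξ.commuting (ptL k (A ⊗[k] A) L ∘ₗ ptR k A A) (ptR k (A ⊗[k] A) L)
    have i5 : Commuting (cst k (pair (ptL k (A ⊗[k] A) L ∘ₗ ptR k A A) (ptR k (A ⊗[k] A) L)
        (ξ : A ⊗[k] L))) (𝔏.dyn D (ptL k (A ⊗[k] A) L ∘ₗ ptL k A A)
      (𝔏.dyn D (ptL k (A ⊗[k] A) L ∘ₗ ptR k A A) (ptR k (A ⊗[k] A) L))) := inferInstance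
    rw [𝔏.dyn_assoc hc.comulHom] at i3 i5
    exact commute_cst _ _ _
  · apply eq_of_quad
    rw [pair_mul, pair_mul, tri_map_left, tri_map_right, tri_leg23, 𝔏.pair_attach]
    exact pair_cocycle_gauge hc hΦ hξ _ _ _ _
  · rw [coe_gaugeUnit, tri_gaugeTwist, hΦ.eps_left (ptL k A L) (ptR k A L),
      conv_eps_left hc.counitLeft, mul_one, pair_eps_eq_one hε, mul_one, IsPoint.map_inv_mul]
  · rw [coe_gaugeUnit, tri_gaugeTwist, hΦ.eps_right (ptL k A L) (ptR k A L),
      conv_eps_right hc.counitRight, mul_one, 𝔏.dyn_eps hc.counitHom, pair_eps_eq_one hε, mul_one,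
      IsPoint.map_inv_mul]

end Gauge

/-! ## Left and right multiplications as points -/

section Mult

variable {k E : Type*} [Field k] [Ring E] [Algebra k E] {V W X : Type*}
  [AddCommGroup V] [Module k V] [AddCommGroup W] [Module k W] [AddCommGroup X] [Module k X]
  {N N' : Type*} [AddCommGroup N] [Module k N] [AddCommGroup N'] [Module k N']

/-- Left multiplication by `a x`. -/
def lp (a : V →ₗ[k] E) : V →ₗ[k] Module.End k E := (Algebra.lmul k E).toLinearMap ∘ₗ a

/-- Right multiplication by `a x`. -/
def rmul (a : V →ₗ[k] E) : V →ₗ[k] Module.End k E := (LinearMap.mul k E).flip ∘ₗ a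

@[simp] theorem lp_apply (a : V →ₗ[k] E) (x : V) (e : E) : lp a x e = a x * e := rfl
@[simp] theorem rmul_apply (a : V →ₗ[k] E) (x : V) (e : E) : rmul a x e = e * a x := rfl

instance {A : Type*} [Ring A] [Algebra k A] (a : A →ₗ[k] E) [IsPoint a] : IsPoint (lp a) :=
  inferInstanceAs (IsPoint ((Algebra.lmul k E).toLinearMap ∘ₗ a))

instance (a : V →ₗ[k] E) (b : W →ₗ[k] E) [Commuting a b] : Commuting (lp a) (lp b) :=
  ⟨fun x y => by ext e; simp [← mul_assoc, Commuting.comm (f := a) (g := b)]⟩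

instance (a : V →ₗ[k] E) (b : W →ₗ[k] E) [Commuting a b] : Commuting (rmul a) (rmul b) :=
  ⟨fun x y => by ext e; simp [mul_assoc, Commuting.comm (f := a) (g := b)]⟩

instance (a : V →ₗ[k] E) (b : W →ₗ[k] E) : Commuting (lp a) (rmul b) :=
  ⟨fun x y => by ext e; simp [mul_assoc]⟩

theorem pair_lp (a : V →ₗ[k] E) (b : W →ₗ[k] E) : pair (lp a) (lp b) = lp (pair a b) :=
  (algHom_comp_pair (Algebra.lmul k E) a b).symm

theorem conv_lp {A : Type*} [Ring A] [Algebra k A] (Δ : A →ₐ[k] A ⊗[k] A) (a b : A →ₗ[k] E) :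
    conv Δ (lp a) (lp b) = lp (conv Δ a b) :=
  (algHom_comp_conv (Algebra.lmul k E) Δ a b).symm

theorem dyn_lp {H L A : Type*} [Ring H] [Bialgebra k H] [Ring L] [Algebra k L] [Ring A]
    [Algebra k A] (𝔏 : BaseAlgebra k H L) (D : H →ₐ[k] A) (a : A →ₗ[k] E) (l : L →ₗ[k] E) :
    𝔏.dyn D (lp a) (lp l) = lp (𝔏.dyn D a l) :=
  (algHom_comp_dyn 𝔏 (Algebra.lmul k E) D a l).symm

/-! ### Changing an operator without changing its value at a vector -/

/-- The right factor acts first, so only its values on `v` matter. This and the following variants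
allow the use of antipode identities that hold on one vector but not as identities of operators;
commutation brings any leg into the position that acts first. -/
theorem pair_congr_right {f : V →ₗ[k] Module.End k N} {g g' : W →ₗ[k] Module.End k N} {v : N}
    (h : ∀ y, g y v = g' y v) (t : V ⊗[k] W) : pair f g t v = pair f g' t v := by
  induction t with
  | zero => simp
  | add s t hs ht => simp only [map_add, LinearMap.add_apply, hs, ht]
  | tmul x y => simp [h]

theorem pair_congr_left {f f' : V →ₗ[k] Module.End k N} {g : W →ₗ[k] Module.End k N} {v : N}
    [Commuting f g] [Commuting f' g] (h : ∀ x, f x v = f' x v) (t : V ⊗[k] W) :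
    pair f g t v = pair f' g t v := by
  rw [pair_comm, pair_comm f' g]
  exact pair_congr_right h _

theorem tri_congr_left {a a' : V →ₗ[k] Module.End k N} {b : W →ₗ[k] Module.End k N}
    {l : X →ₗ[k] Module.End k N} {v : N} [Commuting a b] [Commuting a' b] [Commuting a l]
    [Commuting a' l] [Commuting b l] (h : ∀ x, a x v = a' x v) (t : (V ⊗[k] W) ⊗[k] X) :
    tri a b l t v = tri a' b l t v :=
  pair_congr_left (pair_congr_left h) t

theorem tri_congr_mid {a : V →ₗ[k] Module.End k N} {b b' : W →ₗ[k] Module.End k N}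
    {l : X →ₗ[k] Module.End k N} {v : N} [Commuting a l] [Commuting b l] [Commuting b' l]
    (h : ∀ x, b x v = b' x v) (t : (V ⊗[k] W) ⊗[k] X) :
    tri a b l t v = tri a b' l t v :=
  pair_congr_left (pair_congr_right h) t

section

variable {H L A : Type*} [Ring H] [Bialgebra k H] [Ring L] [Algebra k L] [Ring A]
  [Algebra k A] (𝔏 : BaseAlgebra k H L) (D : H →ₐ[k] A)

theorem dyn_congr_right {a : A →ₗ[k] Module.End k N} {l l' : L →ₗ[k] Module.End k N} {v : N}
    (h : ∀ y, l y v = l' y v) (ν : L) : 𝔏.dyn D a l ν v = 𝔏.dyn D a l' ν v := by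
  rw [BaseAlgebra.dyn, BaseAlgebra.dyn, LinearMap.comp_apply, LinearMap.comp_apply]
  exact pair_congr_right h _

theorem dyn_congr_left {a a' : A →ₗ[k] Module.End k N} {l : L →ₗ[k] Module.End k N} {v : N}
    [Commuting a l] [Commuting a' l] (h : ∀ x, a x v = a' x v) (ν : L) :
    𝔏.dyn D a l ν v = 𝔏.dyn D a' l ν v := by
  rw [BaseAlgebra.dyn, BaseAlgebra.dyn, LinearMap.comp_apply, LinearMap.comp_apply]
  exact pair_congr_left (f := a ∘ₗ D.toLinearMap) (f' := a' ∘ₗ D.toLinearMap) (fun x => h _) _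

end

/-- The dual principle: the left factor acts last, so it may be changed as long as its composite
with `μ` is unchanged. It serves antipode identities that hold only after multiplying two tensor
factors together. -/
theorem pair_comp_congr_left {μ : N →ₗ[k] N'} {f f' : V →ₗ[k] Module.End k N}
    {g : W →ₗ[k] Module.End k N} (h : ∀ x n, μ (f x n) = μ (f' x n)) (t : V ⊗[k] W) (n : N) :
    μ (pair f g t n) = μ (pair f' g t n) := by
  induction t with
  | zero => simp
  | add s t hs ht => simp only [map_add, LinearMap.add_apply, hs, ht]
  | tmul x y => simp [h]

theorem pair_comp_congr_right {μ : N →ₗ[k] N'} {f : V →ₗ[k] Module.End k N}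
    {g g' : W →ₗ[k] Module.End k N} [Commuting f g] [Commuting f g']
    (h : ∀ x n, μ (g x n) = μ (g' x n)) (t : V ⊗[k] W) (n : N) :
    μ (pair f g t n) = μ (pair f g' t n) := by
  rw [pair_comm, pair_comm f g']
  exact pair_comp_congr_left h _ _

/-! ### Operators on a tensor product of two spaces -/

/-- Operators on the first factor. -/
def on1 (N' : Type*) [AddCommGroup N'] [Module k N'] (f : V →ₗ[k] Module.End k N) :
    V →ₗ[k] Module.End k (N ⊗[k] N') := (Module.End.rTensorAlgHom k N N').toLinearMap ∘ₗ f

/-- Operators on the second factor. -/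
def on2 (N : Type*) [AddCommGroup N] [Module k N] (f : V →ₗ[k] Module.End k N') :
    V →ₗ[k] Module.End k (N ⊗[k] N') := (Module.End.lTensorAlgHom k N' N).toLinearMap ∘ₗ f

@[simp] theorem on1_apply (f : V →ₗ[k] Module.End k N) (x : V) (n : N) (n' : N') :
    on1 N' f x (n ⊗ₜ n') = f x n ⊗ₜ n' := rfl

@[simp] theorem on2_apply (f : V →ₗ[k] Module.End k N') (x : V) (n : N) (n' : N') :
    on2 N f x (n ⊗ₜ n') = n ⊗ₜ f x n' := rfl

instance {A : Type*} [Ring A] [Algebra k A] (f : A →ₗ[k] Module.End k N) [IsPoint f] :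
    IsPoint (on1 N' f) :=
  inferInstanceAs (IsPoint ((Module.End.rTensorAlgHom k N N').toLinearMap ∘ₗ f))

instance {A : Type*} [Ring A] [Algebra k A] (f : A →ₗ[k] Module.End k N') [IsPoint f] :
    IsPoint (on2 N f) :=
  inferInstanceAs (IsPoint ((Module.End.lTensorAlgHom k N' N).toLinearMap ∘ₗ f))

instance (f : V →ₗ[k] Module.End k N) (g : W →ₗ[k] Module.End k N') :
    Commuting (on1 N' f) (on2 N g) := ⟨fun x y => by ext; simp⟩

instance (f : V →ₗ[k] Module.End k N) (g : W →ₗ[k] Module.End k N) [Commuting f g] :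
    Commuting (on1 N' f) (on1 N' g) :=
  ⟨fun x y => by
    have := Commuting.comm (f := f) (g := g) x y
    exact ((map_mul (Module.End.rTensorAlgHom k N N') _ _).symm.trans
      (congrArg (Module.End.rTensorAlgHom k N N') this)).trans
      (map_mul (Module.End.rTensorAlgHom k N N') _ _)⟩

instance (f : V →ₗ[k] Module.End k N') (g : W →ₗ[k] Module.End k N') [Commuting f g] :
    Commuting (on2 N f) (on2 N g) :=
  ⟨fun x y => by
    have := Commuting.comm (f := f) (g := g) x y
    exact ((map_mul (Module.End.lTensorAlgHom k N' N) _ _).symm.trans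
      (congrArg (Module.End.lTensorAlgHom k N' N) this)).trans
      (map_mul (Module.End.lTensorAlgHom k N' N) _ _)⟩

theorem conv_on1 {A : Type*} [Ring A] [Algebra k A] (Δ : A →ₐ[k] A ⊗[k] A)
    (a b : A →ₗ[k] Module.End k N) : conv Δ (on1 N' a) (on1 N' b) = on1 N' (conv Δ a b) :=
  (algHom_comp_conv (Module.End.rTensorAlgHom k N N') Δ a b).symm

theorem conv_on2 {A : Type*} [Ring A] [Algebra k A] (Δ : A →ₐ[k] A ⊗[k] A)
    (a b : A →ₗ[k] Module.End k N') : conv Δ (on2 N a) (on2 N b) = on2 N (conv Δ a b) :=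
  (algHom_comp_conv (Module.End.lTensorAlgHom k N' N) Δ a b).symm

end Mult

/-! ## The inverse of the antipode -/

section Antipode

variable {k U : Type*} [Field k] [Ring U] [HopfAlgebra k U]
  (hγ : Function.Bijective (HopfAlgebra.antipode k (A := U)))

/-- The inverse of the antipode. -/
def antiInv : U →ₗ[k] U :=
  (LinearEquiv.ofBijective (HopfAlgebra.antipode k (A := U)) hγ).symm.toLinearMap

@[simp] theorem antipode_antiInv (x : U) : HopfAlgebra.antipode k (antiInv hγ x) = x :=
  (LinearEquiv.ofBijective (HopfAlgebra.antipode k (A := U)) hγ).apply_symm_apply x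

theorem antiInv_mul (x y : U) : antiInv hγ (x * y) = antiInv hγ y * antiInv hγ x :=
  hγ.1 (by simp [HopfAlgebra.antipode_mul_antidistrib])

@[simp] theorem antiInv_one : antiInv hγ (1 : U) = 1 :=
  hγ.1 (by simp [HopfAlgebra.antipode_one])

/-- `x⁽²⁾ γ⁻¹(x⁽¹⁾) = ε(x)`. -/
theorem snd_mul_antiInv_fst (x : U) :
    TensorProduct.lift ((LinearMap.mul k U).flip ∘ₗ antiInv hγ) (Coalgebra.comul (R := k) x) =
      algebraMap k U (Coalgebra.counit (R := k) x) := by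
  apply hγ.1
  have h : ∀ t : U ⊗[k] U, HopfAlgebra.antipode k
      (TensorProduct.lift ((LinearMap.mul k U).flip ∘ₗ antiInv hγ) t) =
      LinearMap.mul' k U ((HopfAlgebra.antipode k).lTensor U t) := by
    intro t
    induction t with
    | zero => simp
    | add s t hs ht => simp only [map_add, hs, ht]
    | tmul x y => simp [HopfAlgebra.antipode_mul_antidistrib]
  rw [h, HopfAlgebra.mul_antipode_lTensor_comul_apply, Algebra.algebraMap_eq_smul_one, map_smul,
    HopfAlgebra.antipode_one]

/-- `γ⁻¹(x⁽²⁾) x⁽¹⁾ = ε(x)`. -/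
theorem antiInv_snd_mul_fst (x : U) :
    TensorProduct.lift ((LinearMap.mul k U).flip.compl₂ (antiInv hγ))
      (Coalgebra.comul (R := k) x) = algebraMap k U (Coalgebra.counit (R := k) x) := by
  apply hγ.1
  have h : ∀ t : U ⊗[k] U, HopfAlgebra.antipode k
      (TensorProduct.lift ((LinearMap.mul k U).flip.compl₂ (antiInv hγ)) t) =
      LinearMap.mul' k U ((HopfAlgebra.antipode k).rTensor U t) := by
    intro t
    induction t with
    | zero => simp
    | add s t hs ht => simp only [map_add, hs, ht]
    | tmul x y => simp [HopfAlgebra.antipode_mul_antidistrib]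
  rw [h, HopfAlgebra.mul_antipode_rTensor_comul_apply, Algebra.algebraMap_eq_smul_one, map_smul,
    HopfAlgebra.antipode_one]

variable {E : Type*} [Ring E] [Algebra k E]

/-- Right multiplication by `a (γ⁻¹ x)`. -/
abbrev rp (a : U →ₗ[k] E) : U →ₗ[k] Module.End k E := rmul (a ∘ₗ antiInv hγ)

/-- Both `γ⁻¹` and right multiplication reverse products, so together they preserve them. This is
why `γ⁻¹` can be handled by the calculus of points. -/
instance (a : U →ₗ[k] E) [IsPoint a] : IsPoint (rp hγ a) where
  map_one := by ext e; simp [IsPoint.map_one (f := a)]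
  map_mul x y := by ext e; simp [antiInv_mul, IsPoint.map_mul (f := a), mul_assoc]

variable (k U) in
/-- The coproduct and the counit of a bialgebra. -/
abbrev cop : U →ₐ[k] U ⊗[k] U := Bialgebra.comulAlgHom k U

variable (k U) in
/-- The coproduct and the counit of a bialgebra. -/
abbrev cou : U →ₐ[k] k := Bialgebra.counitAlgHom k U

/-- On the vector `1` the two multiplications produce `x⁽²⁾ γ⁻¹(x⁽¹⁾)`. On a general vector that
vector would stand in between, and the antipode axiom would not apply. -/
theorem conv_rp_lp (a : U →ₗ[k] E) [IsPoint a] (x : U) :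
    conv (cop k U) (rp hγ a) (lp a) x 1 = epsPoint (Module.End k E) (cou k U) x 1 := by
  have h : ∀ t : U ⊗[k] U, pair (rp hγ a) (lp a) t 1 =
      a (TensorProduct.lift ((LinearMap.mul k U).flip ∘ₗ antiInv hγ) t) := by
    intro t
    induction t with
    | zero => simp
    | add s t hs ht => simp only [map_add, LinearMap.add_apply, hs, ht]
    | tmul x y => simp [IsPoint.map_mul (f := a)]
  rw [conv_apply, h]
  refine (congrArg a (snd_mul_antiInv_fst hγ x)).trans ?_
  simp [Algebra.algebraMap_eq_smul_one, IsPoint.map_one (f := a)]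

/-- Here both factors multiply on the right and meet as `γ⁻¹(x⁽²⁾) x⁽¹⁾`, so the identity holds for
operators. The map `rmul a` itself reverses products and is not claimed to be a point. -/
theorem conv_rmul_rp (a : U →ₗ[k] E) [IsPoint a] :
    conv (cop k U) (rmul a) (rp hγ a) = epsPoint (Module.End k E) (cou k U) := by
  have h : ∀ (t : U ⊗[k] U) (e : E), pair (rmul a) (rp hγ a) t e =
      e * a (TensorProduct.lift ((LinearMap.mul k U).flip.compl₂ (antiInv hγ)) t) := by
    intro t e
    induction t with
    | zero => simp
    | add s t hs ht => simp only [map_add, LinearMap.add_apply, hs, ht, mul_add]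
    | tmul x y => simp [IsPoint.map_mul (f := a), mul_assoc]
  ext x e
  rw [conv_apply, h]
  refine (congrArg (fun z => e * a z) (antiInv_snd_mul_fst hγ x)).trans ?_
  simp [Algebra.algebraMap_eq_smul_one, IsPoint.map_one (f := a)]

end Antipode

/-! ## The element `ζ` -/

section Zeta

variable {k H L U : Type*} [Field k] [Ring H] [Bialgebra k H] [Ring L] [Algebra k L]
  [Ring U] [HopfAlgebra k U] {𝔏 : BaseAlgebra k H L}

theorem isCompatible_cop (j : H →ₐc[k] U) : IsCompatible (cop k U) (cou k U) (j : H →ₐ[k] U) where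
  coassoc x := Coalgebra.coassoc_apply x
  counitLeft x := by
    have := Coalgebra.rTensor_counit_comul (R := k) x
    change TensorProduct.lid k U ((Coalgebra.counit (R := k) (A := U)).rTensor U
      (Coalgebra.comul (R := k) x)) = x
    rw [this]; simp
  counitRight x := by
    have := Coalgebra.lTensor_counit_comul (R := k) x
    change TensorProduct.rid k U ((Coalgebra.counit (R := k) (A := U)).lTensor U
      (Coalgebra.comul (R := k) x)) = x
    rw [this]; simp
  comulHom h := (CoalgHomClass.map_comp_comul_apply j h).symm
  counitHom h := CoalgHomClass.counit_comp_apply j h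

theorem IsDynamicalTwist.isWeakTwist {j : H →ₐ[k] U} {F : ((U ⊗[k] U) ⊗[k] L)ˣ}
    (hF : IsDynamicalTwist j 𝔏 F) : IsWeakTwist 𝔏 (cop k U) (cou k U) j F where
  invariant := hF.invariant.isWeakInvariant
  cocycle := hF.cocycle
  counit_fst := by
    have h : tri (epsPoint _ (cou k U)) (ptL k U L) (ptR k U L) = (Algebra.TensorProduct.map
      ((Algebra.TensorProduct.lid k U).toAlgHom.comp
        (Algebra.TensorProduct.map (Bialgebra.counitAlgHom k U) (AlgHom.id k U)))
      (AlgHom.id k L)).toLinearMap := by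
      ext; simp [Algebra.algebraMap_eq_smul_one, TensorProduct.smul_tmul']
    rw [h]; exact hF.counit_fst
  counit_snd := by
    have h : tri (ptL k U L) (epsPoint _ (cou k U)) (ptR k U L) = (Algebra.TensorProduct.map
      ((Algebra.TensorProduct.rid k k U).toAlgHom.comp
        (Algebra.TensorProduct.map (AlgHom.id k U) (Bialgebra.counitAlgHom k U)))
      (AlgHom.id k L)).toLinearMap := by
      ext; simp [Algebra.algebraMap_eq_smul_one, TensorProduct.smul_tmul']
    rw [h]; exact hF.counit_snd

section Inv

variable {A E : Type*} [Ring A] [Algebra k A] [Ring E] [Algebra k E] {Δ : A →ₐ[k] A ⊗[k] A}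
  {ε : A →ₐ[k] k} {D : H →ₐ[k] A} {Φ : ((A ⊗[k] A) ⊗[k] L)ˣ} (hΦ : IsWeakTwist 𝔏 Δ ε D Φ)
  (a b c : A →ₗ[k] E) (l : L →ₗ[k] E) [IsPoint a] [IsPoint l] [Commuting a l]

include hΦ

theorem IsWeakTwist.eps_left_inv :
    tri (epsPoint E ε) a l ((Φ⁻¹ : ((A ⊗[k] A) ⊗[k] L)ˣ) : (A ⊗[k] A) ⊗[k] L) = 1 := by
  have := IsPoint.map_mul_inv (tri (epsPoint E ε) a l) Φ
  rwa [hΦ.eps_left a l, one_mul] at this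

theorem IsWeakTwist.eps_right_inv :
    tri a (epsPoint E ε) l ((Φ⁻¹ : ((A ⊗[k] A) ⊗[k] L)ˣ) : (A ⊗[k] A) ⊗[k] L) = 1 := by
  have := IsPoint.map_mul_inv (tri a (epsPoint E ε) l) Φ
  rwa [hΦ.eps_right a l, one_mul] at this

variable [IsPoint b] [IsPoint c] [Commuting a b] [Commuting b l] [Commuting a c]
  [Commuting b c] [Commuting c l]

/-- `Φ_{(12)3}⁻¹ Φ_{1(23)} = Φ_{12|3} Φ_{23}⁻¹`. -/
theorem IsWeakTwist.cocycle_inv_left :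
    tri (conv Δ a b) c l ((Φ⁻¹ : ((A ⊗[k] A) ⊗[k] L)ˣ) : (A ⊗[k] A) ⊗[k] L) *
        tri a (conv Δ b c) l (Φ : (A ⊗[k] A) ⊗[k] L) =
      tri a b (𝔏.dyn D c l) (Φ : (A ⊗[k] A) ⊗[k] L) *
        tri b c l ((Φ⁻¹ : ((A ⊗[k] A) ⊗[k] L)ˣ) : (A ⊗[k] A) ⊗[k] L) := by
  have h := congrArg (fun e => tri (conv Δ a b) c l
    ((Φ⁻¹ : ((A ⊗[k] A) ⊗[k] L)ˣ) : (A ⊗[k] A) ⊗[k] L) * e * tri b c l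
    ((Φ⁻¹ : ((A ⊗[k] A) ⊗[k] L)ˣ) : (A ⊗[k] A) ⊗[k] L)) (hΦ.cocycle_points a b c l)
  simp only [mul_assoc] at h
  rw [IsPoint.inv_mul_cancel, IsPoint.map_mul_inv, mul_one] at h
  exact h.symm

/-- `Φ_{1(23)}⁻¹ Φ_{(12)3} = Φ_{23} Φ_{12|3}⁻¹`. -/
theorem IsWeakTwist.cocycle_inv_right :
    tri a (conv Δ b c) l ((Φ⁻¹ : ((A ⊗[k] A) ⊗[k] L)ˣ) : (A ⊗[k] A) ⊗[k] L) *
        tri (conv Δ a b) c l (Φ : (A ⊗[k] A) ⊗[k] L) =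
      tri b c l (Φ : (A ⊗[k] A) ⊗[k] L) * tri a b (𝔏.dyn D c l)
        ((Φ⁻¹ : ((A ⊗[k] A) ⊗[k] L)ˣ) : (A ⊗[k] A) ⊗[k] L) := by
  have h := congrArg (fun e => tri a (conv Δ b c) l
    ((Φ⁻¹ : ((A ⊗[k] A) ⊗[k] L)ˣ) : (A ⊗[k] A) ⊗[k] L) * e * tri a b (𝔏.dyn D c l)
    ((Φ⁻¹ : ((A ⊗[k] A) ⊗[k] L)ˣ) : (A ⊗[k] A) ⊗[k] L)) (hΦ.cocycle_points a b c l)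
  simp only [mul_assoc] at h
  rw [IsPoint.inv_mul_cancel, IsPoint.map_mul_inv, mul_one] at h
  exact h

/-- `Φ_{12|3}⁻¹ Φ_{(12)3}⁻¹ = Φ_{23}⁻¹ Φ_{1(23)}⁻¹`. -/
theorem IsWeakTwist.cocycle_inv :
    tri a b (𝔏.dyn D c l) ((Φ⁻¹ : ((A ⊗[k] A) ⊗[k] L)ˣ) : (A ⊗[k] A) ⊗[k] L) *
        tri (conv Δ a b) c l ((Φ⁻¹ : ((A ⊗[k] A) ⊗[k] L)ˣ) : (A ⊗[k] A) ⊗[k] L) =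
      tri b c l ((Φ⁻¹ : ((A ⊗[k] A) ⊗[k] L)ˣ) : (A ⊗[k] A) ⊗[k] L) *
        tri a (conv Δ b c) l ((Φ⁻¹ : ((A ⊗[k] A) ⊗[k] L)ˣ) : (A ⊗[k] A) ⊗[k] L) := by
  have h := congrArg (fun e => tri b c l
    ((Φ⁻¹ : ((A ⊗[k] A) ⊗[k] L)ˣ) : (A ⊗[k] A) ⊗[k] L) * e *
    tri (conv Δ a b) c l ((Φ⁻¹ : ((A ⊗[k] A) ⊗[k] L)ˣ) : (A ⊗[k] A) ⊗[k] L))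
    (hΦ.cocycle_inv_right a b c l)
  simp only [mul_assoc] at h
  rw [IsPoint.inv_mul_cancel, IsPoint.map_mul_inv, mul_one] at h
  exact h.symm

end Inv

variable {F : ((U ⊗[k] U) ⊗[k] L)ˣ} (hγ : Function.Bijective (HopfAlgebra.antipode k (A := U)))

/-- The value of `ζ` at a point, at a vector where the point `r` acts as `a ∘ γ⁻¹`. -/
theorem pair_zeta_apply {N : Type*} [AddCommGroup N] [Module k N] (r a : U →ₗ[k] Module.End k N)
    (l : L →ₗ[k] Module.End k N) [IsPoint a] [Commuting r a] [Commuting r l] [Commuting a l]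
    (v : N) (hr : ∀ x, r x v = a (antiInv hγ x) v) :
    pair a l (zeta hγ F) v =
      tri r a l ((F⁻¹ : ((U ⊗[k] U) ⊗[k] L)ˣ) : (U ⊗[k] U) ⊗[k] L) v := by
  rw [zeta]
  generalize ((F⁻¹ : ((U ⊗[k] U) ⊗[k] L)ˣ) : (U ⊗[k] U) ⊗[k] L) = t
  induction t with
  | zero => simp
  | add s t hs ht => simp only [map_add, LinearMap.add_apply, hs, ht]
  | tmul p z =>
    induction p with
    | zero => simp
    | add p q hp hq =>
      simp only [TensorProduct.add_tmul, map_add, LinearMap.add_apply, hp, hq]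
    | tmul x y =>
      have h1 : r x * a y * l z = a y * l z * r x := by
        rw [Commuting.comm (f := r) (g := a), mul_assoc, Commuting.comm (f := r) (g := l),
          mul_assoc]
      have h2 : a (antiInv hγ x) * l z = l z * a (antiInv hγ x) := Commuting.comm _ _
      rw [tri, pair_tmul, pair_tmul, h1, Module.End.mul_apply, hr]
      simp only [LinearMap.rTensor_tmul, TensorProduct.lift.tmul, LinearMap.comp_apply,
        LinearMap.flip_apply, LinearMap.mul_apply', pair_tmul]
      change (a (y * antiInv hγ x) * l z) v = _
      rw [IsPoint.map_mul, mul_assoc, h2, ← mul_assoc]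
      rfl

section

variable {E : Type*} [Ring E] [Algebra k E] (a : U →ₗ[k] E) (l : L →ₗ[k] E) [IsPoint a]
  [IsPoint l] [Commuting a l]

-- The formula for `ζ` multiplies `γ⁻¹` of the first leg onto the right of the second. As right and
-- left multiplications commute, `ζ` thereby becomes a value of `F⁻¹` at commuting points, to which
-- the twist axioms apply.
omit [IsPoint l] in
theorem pair_zeta : pair a l (zeta hγ F) = tri (rp hγ a) (lp a) (lp l)
    ((F⁻¹ : ((U ⊗[k] U) ⊗[k] L)ˣ) : (U ⊗[k] U) ⊗[k] L) 1 := by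
  rw [← pair_zeta_apply hγ (rp hγ a) (lp a) (lp l) 1 (fun x => by simp), pair_lp, lp_apply,
    mul_one]

omit [IsPoint l] in
theorem dyn_rp_lp {j : H →ₐc[k] U} (m : L) :
    𝔏.dyn (j : H →ₐ[k] U) (rp hγ a) (𝔏.dyn (j : H →ₐ[k] U) (lp a) (lp l)) m 1 = l m := by
  have hc := isCompatible_cop j
  rw [𝔏.dyn_assoc hc.comulHom]
  have h : 𝔏.dyn (j : H →ₐ[k] U) (conv (cop k U) (rp hγ a) (lp a)) (lp l) m 1 =
      𝔏.dyn (j : H →ₐ[k] U) (epsPoint _ (cou k U)) (lp l) m 1 :=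
    dyn_congr_left 𝔏 _ (fun x => conv_rp_lp hγ a _) _
  rw [h, 𝔏.dyn_eps hc.counitHom, lp_apply, mul_one]

variable {j : H →ₐc[k] U} (hF : IsDynamicalTwist (j : H →ₐ[k] U) 𝔏 F)
include hF

/-- Weak invariance of `F⁻¹` at the points `rp a`, `lp a`, `lp l` moves `l m` from the right of `ζ`
to the left, at the price of an additional right factor carrying `γ⁻¹`. The right factor `a ν⁽¹⁾`
that is still present cancels it by `conv_rmul_rp`. -/
theorem commute_pair_zeta (ν : L) :
    Commute (pair a l (zeta hγ F)) (𝔏.dyn (j : H →ₐ[k] U) a l ν) := by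
  have hc := isCompatible_cop j
  have hw := hF.isWeakTwist
  set r := rp hγ a
  set T := tri r (lp a) (lp l) ((F⁻¹ : ((U ⊗[k] U) ⊗[k] L)ˣ) : (U ⊗[k] U) ⊗[k] L) with hT
  have hz : pair a l (zeta hγ F) = T 1 := pair_zeta hγ a l
  have hm : ∀ m : L, T 1 * l m =
      𝔏.dyn (j : H →ₐ[k] U) r (𝔏.dyn (j : H →ₐ[k] U) (lp a) (lp l)) m (T 1) := by
    intro m
    have h1 : Commute T (rmul l m) := by
      have : Commuting (cst k T) (rmul l) := inferInstance
      exact commute_cst _ _ _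
    have h2 : Commute T (𝔏.dyn (j : H →ₐ[k] U) r (𝔏.dyn (j : H →ₐ[k] U) (lp a) (lp l)) m) := by
      have := hw.commuting_inv r (lp a) (lp l)
      rw [𝔏.dyn_assoc hc.comulHom]
      exact commute_cst _ _ _
    have h3 : T 1 * l m = T (l m) := by
      have := LinearMap.congr_fun h1.eq 1
      simpa using this.symm
    -- On `1`, the element `l m` equals the value of the doubly shifted operator with which `T`
    -- commutes.
    rw [h3, ← dyn_rp_lp hγ a l (𝔏 := 𝔏) (j := j) m]
    exact LinearMap.congr_fun h2.eq 1
  have h1 : T 1 * 𝔏.dyn (j : H →ₐ[k] U) a l ν =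
      𝔏.dyn (j : H →ₐ[k] U) (rmul a) (rmul l) ν (T 1) := by
    rw [BaseAlgebra.dyn, BaseAlgebra.dyn, LinearMap.comp_apply, LinearMap.comp_apply]
    generalize 𝔏.coact.toLinearMap ν = t
    induction t with
    | zero => simp
    | add s t hs ht => simp only [map_add, LinearMap.add_apply, mul_add, hs, ht]
    | tmul x m =>
      simp only [pair_tmul, Module.End.mul_apply, rmul_apply, LinearMap.comp_apply, mul_assoc]
      rw [Commuting.comm (f := a) (g := l)]
  have h2 : 𝔏.dyn (j : H →ₐ[k] U) (rmul a) (rmul l) ν (T 1) =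
      𝔏.dyn (j : H →ₐ[k] U) (rmul a)
        (𝔏.dyn (j : H →ₐ[k] U) r (𝔏.dyn (j : H →ₐ[k] U) (lp a) (lp l))) ν (T 1) :=
    dyn_congr_right 𝔏 _ (fun m => by rw [rmul_apply, hm]) _
  rw [hz, Commute, SemiconjBy, h1, h2, 𝔏.dyn_assoc hc.comulHom, conv_rmul_rp,
    𝔏.dyn_eps hc.counitHom, dyn_lp, lp_apply]

theorem isWeakInvariant_zeta : 𝔏.IsWeakInvariant (j : H →ₐ[k] U) (zeta hγ F) := by
  intro ν
  have := commute_pair_zeta hγ (ptL k U L) (ptR k U L) hF ν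
  rwa [pair_ptL_ptR] at this

end

end Zeta

/-! ### Invertibility of `ζ` -/

section ZetaInv

variable {k H L U : Type*} [Field k] [Ring H] [Bialgebra k H] [Ring L] [Algebra k L]
  [Ring U] [HopfAlgebra k U] {𝔏 : BaseAlgebra k H L}
  {F : ((U ⊗[k] U) ⊗[k] L)ˣ} (hγ : Function.Bijective (HopfAlgebra.antipode k (A := U)))
  {E : Type*} [Ring E] [Algebra k E] (a : U →ₗ[k] E) (l : L →ₗ[k] E) [IsPoint a]
  [IsPoint l] [Commuting a l]

/-- `e ⊗ u ↦ e * a u`. -/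
def mulPt : E ⊗[k] U →ₗ[k] E := pair LinearMap.id a

omit [IsPoint a] in
@[simp] theorem mulPt_tmul (e : E) (u : U) : mulPt a (e ⊗ₜ[k] u) = e * a u := by simp [mulPt]

/-- The vector space `E ⊗ U` keeps the `U`-leg to the right of everything produced in `E`. Once the
two factors are multiplied, the legs meet as `γ⁻¹(x⁽²⁾) x⁽¹⁾` and become a counit. -/
theorem mulPt_conv_rp_lp (x : U) (n : E ⊗[k] U) :
    mulPt a (conv (cop k U) (on2 E (lp LinearMap.id)) (on1 U (rp hγ a)) x n) =
      mulPt a (epsPoint (Module.End k (E ⊗[k] U)) (cou k U) x n) := by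
  have h : ∀ (t : U ⊗[k] U) (e : E) (u : U),
      mulPt a (pair (on2 E (lp LinearMap.id)) (on1 U (rp hγ a)) t (e ⊗ₜ u)) =
      e * a (TensorProduct.lift ((LinearMap.mul k U).flip.compl₂ (antiInv hγ)) t) * a u := by
    intro t e u
    induction t with
    | zero => simp
    | add s t hs ht => simp only [map_add, LinearMap.add_apply, hs, ht, mul_add, add_mul]
    | tmul x y => simp [IsPoint.map_mul (f := a), mul_assoc]
  induction n with
  | zero => simp
  | add n m hn hm => simp only [map_add, hn, hm]
  | tmul e u =>
    rw [conv_apply, h]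
    refine (congrArg (fun z => e * a z * a u) (antiInv_snd_mul_fst hγ x)).trans ?_
    simp [Algebra.algebraMap_eq_smul_one, IsPoint.map_one (f := a)]

theorem conv_on1_rp_lp (x : U) :
    conv (cop k U) (on1 U (rp hγ a)) (on1 U (lp a)) x (1 ⊗ₜ[k] (1 : U)) =
      epsPoint (Module.End k (E ⊗[k] U)) (cou k U) x (1 ⊗ₜ 1) := by
  rw [conv_on1, on1_apply, conv_rp_lp]
  simp [Algebra.algebraMap_eq_smul_one, TensorProduct.smul_tmul']

instance {A : Type*} [Ring A] [Algebra k A] : IsPoint (LinearMap.id : A →ₗ[k] A) :=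
  inferInstanceAs (IsPoint (AlgHom.id k A).toLinearMap)

theorem conv_on2_rp_lp (x : U) :
    conv (cop k U) (on2 E (rp hγ LinearMap.id)) (on2 E (lp LinearMap.id)) x (1 ⊗ₜ[k] (1 : U)) =
      epsPoint (Module.End k (E ⊗[k] U)) (cou k U) x (1 ⊗ₜ 1) := by
  rw [conv_on2, on2_apply, conv_rp_lp]
  simp [Algebra.algebraMap_eq_smul_one]

variable {j : H →ₐc[k] U} (hF : IsDynamicalTwist (j : H →ₐ[k] U) 𝔏 F)

variable (𝔏 F j) in
/-- `F_L⁽¹⁾ γ⁻¹(F₂) F₁ ⊗ F_L⁽∞⁾` at a point. -/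
def zetaInv : E :=
  mulPt a (tri (on2 E (lp LinearMap.id)) (on1 U (rp hγ a))
    (𝔏.dyn (j : H →ₐ[k] U) (on1 U (lp a)) (on1 U (lp l))) (F : (U ⊗[k] U) ⊗[k] L) (1 ⊗ₜ 1))

include hF

/-- The identity `F_{(12)3}⁻¹ F_{1(23)} = F_{12|3} F_{23}⁻¹` is evaluated on `1 ⊗ 1` and multiplied
out by `mulPt`. On its left side the second factor becomes trivial on `1 ⊗ 1` and the first one
after `mulPt`, both through a counit leg. On its right side `F_{23}⁻¹` produces `ζ`, which by weak
invariance moves out to the left of `F_{12|3}`. -/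
theorem pair_zeta_mul_zetaInv : pair a l (zeta hγ F) * zetaInv 𝔏 F hγ a l j = 1 := by
  have hw := hF.isWeakTwist
  have h := hw.cocycle_inv_left (on2 E (lp LinearMap.id)) (on1 U (rp hγ a)) (on1 U (lp a))
    (on1 U (lp l))
  have h1 := congrArg (mulPt a) (LinearMap.congr_fun h (1 ⊗ₜ 1))
  have hz := (isWeakInvariant_zeta hγ hF).commuting (on1 U (lp a)) (on1 U (lp l))
  have e1 : tri (on2 E (lp LinearMap.id)) (conv (cop k U) (on1 U (rp hγ a)) (on1 U (lp a)))
      (on1 U (lp l)) (F : (U ⊗[k] U) ⊗[k] L) (1 ⊗ₜ 1) = 1 ⊗ₜ 1 := by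
    rw [tri_congr_mid (b' := epsPoint (Module.End k (E ⊗[k] U)) (cou k U))
      (fun x => conv_on1_rp_lp hγ a x), hw.eps_right (on2 E (lp LinearMap.id)) (on1 U (lp l)),
      Module.End.one_apply]
  have e2 : ∀ n, mulPt a (tri (conv (cop k U) (on2 E (lp LinearMap.id)) (on1 U (rp hγ a)))
      (on1 U (lp a)) (on1 U (lp l))
      ((F⁻¹ : ((U ⊗[k] U) ⊗[k] L)ˣ) : (U ⊗[k] U) ⊗[k] L) n) = mulPt a n := by
    intro n
    rw [tri, pair_comp_congr_left (f' := pair (epsPoint (Module.End k (E ⊗[k] U)) (cou k U))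
      (on1 U (lp a))) (fun t m => pair_comp_congr_left (fun x m => mulPt_conv_rp_lp hγ a x m) t m),
      hw.eps_left_inv (on1 U (lp a)) (on1 U (lp l)), Module.End.one_apply]
  have e3 : tri (on1 U (rp hγ a)) (on1 U (lp a)) (on1 U (lp l))
      ((F⁻¹ : ((U ⊗[k] U) ⊗[k] L)ˣ) : (U ⊗[k] U) ⊗[k] L) (1 ⊗ₜ 1) =
      pair (on1 U (lp a)) (on1 U (lp l)) (zeta hγ F) (1 ⊗ₜ 1) :=
    (pair_zeta_apply hγ _ _ _ _ (fun x => by simp)).symm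
  have e4 : Commute (pair (on1 U (lp a)) (on1 U (lp l)) (zeta hγ F))
    (tri (on2 E (lp LinearMap.id)) (on1 U (rp hγ a))
    (𝔏.dyn (j : H →ₐ[k] U) (on1 U (lp a)) (on1 U (lp l))) (F : (U ⊗[k] U) ⊗[k] L)) :=
    commute_cst _ _ _
  have e5 : ∀ n, mulPt a (pair (on1 U (lp a)) (on1 U (lp l)) (zeta hγ F) n) =
      pair a l (zeta hγ F) * mulPt a n := by
    intro n
    have : pair (on1 U (lp a)) (on1 U (lp l)) = on1 U (lp (pair a l)) := by
      rw [← pair_lp]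
      exact (algHom_comp_pair (Module.End.rTensorAlgHom k E U) _ _).symm
    rw [this]
    induction n with
    | zero => simp
    | add n m hn hm => simp only [map_add, hn, hm, mul_add]
    | tmul e u => simp [mul_assoc]
  rw [Module.End.mul_apply, Module.End.mul_apply, e1, e2, e3, ← Module.End.mul_apply, ← e4.eq,
    Module.End.mul_apply, e5] at h1
  rw [zetaInv, ← h1]
  simp [IsPoint.map_one (f := a)]

/-- The mirror image of the previous argument, from `F_{1(23)}⁻¹ F_{(12)3} = F_{23} F_{12|3}⁻¹`,
with the first two legs on `U` and the third, through `γ⁻¹`, on `E`. -/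
theorem zetaInv_mul_pair_zeta : zetaInv 𝔏 F hγ a l j * pair a l (zeta hγ F) = 1 := by
  have hw := hF.isWeakTwist
  have hc := isCompatible_cop j
  set l' := 𝔏.dyn (j : H →ₐ[k] U) (on1 U (lp a)) (on1 U (lp l)) with hl'
  have h := hw.cocycle_inv_right (on2 E (rp hγ LinearMap.id)) (on2 E (lp LinearMap.id))
    (on1 U (rp hγ a)) l'
  have h1 := congrArg (mulPt a) (LinearMap.congr_fun h (1 ⊗ₜ 1))
  have e1 : tri (conv (cop k U) (on2 E (rp hγ LinearMap.id)) (on2 E (lp LinearMap.id)))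
      (on1 U (rp hγ a)) l' (F : (U ⊗[k] U) ⊗[k] L) (1 ⊗ₜ 1) = 1 ⊗ₜ 1 := by
    rw [tri_congr_left (a' := epsPoint (Module.End k (E ⊗[k] U)) (cou k U))
      (fun x => conv_on2_rp_lp hγ x), hw.eps_left (on1 U (rp hγ a)) l',
      Module.End.one_apply]
  have e2 : ∀ n, mulPt a (tri (on2 E (rp hγ LinearMap.id))
      (conv (cop k U) (on2 E (lp LinearMap.id)) (on1 U (rp hγ a))) l'
      ((F⁻¹ : ((U ⊗[k] U) ⊗[k] L)ˣ) : (U ⊗[k] U) ⊗[k] L) n) = mulPt a n := by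
    intro n
    rw [tri, pair_comp_congr_left (f' := pair (on2 E (rp hγ LinearMap.id))
      (epsPoint (Module.End k (E ⊗[k] U)) (cou k U)))
      (fun t m => pair_comp_congr_right (fun x m => mulPt_conv_rp_lp hγ a x m) t m),
      hw.eps_right_inv (on2 E (rp hγ LinearMap.id)) l', Module.End.one_apply]
  have e3 : tri (on2 E (rp hγ LinearMap.id)) (on2 E (lp LinearMap.id))
      (𝔏.dyn (j : H →ₐ[k] U) (on1 U (rp hγ a)) l')
      ((F⁻¹ : ((U ⊗[k] U) ⊗[k] L)ˣ) : (U ⊗[k] U) ⊗[k] L) (1 ⊗ₜ 1) =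
      pair (on2 E (lp LinearMap.id)) (on1 U (lp l)) (zeta hγ F) (1 ⊗ₜ[k] (1 : U)) := by
    rw [pair_zeta_apply hγ (on2 E (rp hγ LinearMap.id)) _ _ _ (fun x => by simp)]
    refine pair_congr_right (fun m => ?_) _
    rw [hl', 𝔏.dyn_assoc hc.comulHom, dyn_congr_left 𝔏 _ (fun x => conv_on1_rp_lp hγ a x),
      𝔏.dyn_eps hc.counitHom]
  -- The vector made by `ζ` is rewritten as right multiplications applied to `1 ⊗ 1`. These commute
  -- with the operator of `F` and so end up as a right factor of `zetaInv`.
  have e4 : ∀ t : U ⊗[k] L, mulPt a (tri (on2 E (lp LinearMap.id)) (on1 U (rp hγ a)) l'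
      (F : (U ⊗[k] U) ⊗[k] L) (pair (on2 E (lp LinearMap.id)) (on1 U (lp l)) t (1 ⊗ₜ 1))) =
      zetaInv 𝔏 F hγ a l j * pair a l t := by
    intro t
    induction t with
    | zero => simp
    | add s t hs ht => simp only [map_add, LinearMap.add_apply, mul_add, hs, ht]
    | tmul x z =>
      have c1 : Commute (tri (on2 E (lp LinearMap.id)) (on1 U (rp hγ a)) l'
        (F : (U ⊗[k] U) ⊗[k] L)) (on1 U (rmul l) z) := commute_cst _ _ _
      have c2 : Commute (tri (on2 E (lp LinearMap.id)) (on1 U (rp hγ a)) l'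
        (F : (U ⊗[k] U) ⊗[k] L)) (on2 E (rmul LinearMap.id) x) := commute_cst _ _ _
      have c3 : pair (on2 E (lp LinearMap.id)) (on1 U (lp l)) (x ⊗ₜ[k] z) (1 ⊗ₜ[k] (1 : U)) =
        (on1 U (rmul l) z * on2 E (rmul (LinearMap.id : U →ₗ[k] U)) x : Module.End k (E ⊗[k] U)) (1 ⊗ₜ[k] (1 : U)) := by simp
      have c4 : ∀ n, mulPt a ((on1 U (rmul l) z * on2 E (rmul (LinearMap.id : U →ₗ[k] U)) x : Module.End k (E ⊗[k] U)) n) =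
          mulPt a n * (a x * l z) := by
        intro n
        induction n with
        | zero => simp
        | add n m hn hm => simp only [map_add, hn, hm, add_mul]
        | tmul e u =>
          simp only [Module.End.mul_apply, on1_apply, on2_apply, rmul_apply, mulPt_tmul,
            LinearMap.id_apply, IsPoint.map_mul (f := a), mul_assoc]
          rw [Commuting.comm (f := a) (g := l) x z, ← mul_assoc (a u) (l z),
            Commuting.comm (f := a) (g := l) u z, mul_assoc]
      rw [c3, ← Module.End.mul_apply, (c1.mul_right c2).eq, Module.End.mul_apply, c4, pair_tmul]
      rfl
  rw [Module.End.mul_apply, Module.End.mul_apply, e1, e2, e3, e4] at h1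
  rw [← h1]
  simp [IsPoint.map_one (f := a)]

theorem isUnit_zeta : IsUnit (zeta hγ F) := by
  refine ⟨⟨zeta hγ F, zetaInv 𝔏 F hγ (ptL k U L) (ptR k U L) j, ?_, ?_⟩, rfl⟩
  · simpa [pair_ptL_ptR] using pair_zeta_mul_zetaInv hγ (ptL k U L) (ptR k U L) hF
  · simpa [pair_ptL_ptR] using zetaInv_mul_pair_zeta hγ (ptL k U L) (ptR k U L) hF

end ZetaInv

/-! ## Universal R-matrices at points -/

section RMatrix

variable {k U E : Type*} [Field k] [Ring U] [HopfAlgebra k U] [Ring E] [Algebra k E]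

/-- An element that carries points to other points carries all their convolutions and shifts. It is
applied with `e` a value of `R`, which reverses a convolution, with `e` a flip of tensor factors,
and with `e` a multiplication operator. -/
theorem pair_semiconj {V W : Type*} [AddCommGroup V] [Module k V] [AddCommGroup W] [Module k W]
    {f f' : V →ₗ[k] E} {g g' : W →ₗ[k] E} {e : E} (hf : ∀ x, e * f x = f' x * e)
    (hg : ∀ y, e * g y = g' y * e) (t : V ⊗[k] W) : e * pair f g t = pair f' g' t * e := by
  induction t with
  | zero => simp
  | add s t hs ht => rw [map_add, map_add, mul_add, add_mul, hs, ht]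
  | tmul x y => rw [pair_tmul, pair_tmul, ← mul_assoc, hf, mul_assoc, hg, mul_assoc]

theorem conv_semiconj {A : Type*} [Ring A] [Algebra k A] {Δ : A →ₐ[k] A ⊗[k] A}
    {f f' g g' : A →ₗ[k] E} {e : E} (hf : ∀ x, e * f x = f' x * e)
    (hg : ∀ y, e * g y = g' y * e) (x : A) : e * conv Δ f g x = conv Δ f' g' x * e :=
  pair_semiconj hf hg _

theorem dyn_semiconj {H L A : Type*} [Ring H] [Bialgebra k H] [Ring L] [Algebra k L] [Ring A]
    [Algebra k A] {𝔏 : BaseAlgebra k H L} {D : H →ₐ[k] A} {f f' : A →ₗ[k] E} {g g' : L →ₗ[k] E}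
    {e : E} (hf : ∀ x, e * f x = f' x * e)
    (hg : ∀ y, e * g y = g' y * e) (ν : L) : e * 𝔏.dyn D f g ν = 𝔏.dyn D f' g' ν * e := by
  exact pair_semiconj (f := f ∘ₗ D.toLinearMap) (f' := f' ∘ₗ D.toLinearMap) (fun x => hf _) hg _

variable {R : (U ⊗[k] U)ˣ} (hR : IsUniversalRMatrix R) (a b c : U →ₗ[k] E)
  [IsPoint a] [IsPoint b] [Commuting a b]

include hR

theorem IsUniversalRMatrix.conv_swap (x : U) :
    pair a b (R : U ⊗[k] U) * conv (cop k U) a b x =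
      conv (cop k U) b a x * pair a b (R : U ⊗[k] U) := by
  have h := congrArg (pair a b) (hR.intertwine x)
  rw [pair_mul, pair_mul] at h
  rw [conv_apply, conv_apply, pair_comm b a]
  exact h

theorem IsUniversalRMatrix.conv_left [IsPoint c] [Commuting a c] [Commuting b c] :
    pair (conv (cop k U) a b) c (R : U ⊗[k] U) =
      pair a c (R : U ⊗[k] U) * pair b c (R : U ⊗[k] U) := by
  have h := congrArg (pair (pair a b) c) hR.comul_fst
  have h1 : pair (pair a b) c ∘ₗ (comulFst (k := k) (U := U)).toLinearMap =
      pair (conv (cop k U) a b) c := by ext; simp [comulFst, conv]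
  have h2 : pair (pair a b) c ∘ₗ (leg13 (k := k) (U := U)).toLinearMap = pair a c := by
    ext; simp [leg13, IsPoint.map_one (f := b)]
  have h3 : pair (pair a b) c ∘ₗ (leg23 (k := k) (U := U)).toLinearMap = pair b c := by
    ext; simp [leg23, IsPoint.map_one (f := a)]
  rw [pair_mul] at h
  rw [← h1, ← h2, ← h3]
  exact h

theorem IsUniversalRMatrix.conv_right [IsPoint c] [Commuting a c] [Commuting b c] :
    pair a (conv (cop k U) b c) (R : U ⊗[k] U) =
      pair a c (R : U ⊗[k] U) * pair a b (R : U ⊗[k] U) := by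
  have h := congrArg (pair (pair a b) c) hR.comul_snd
  have h1 : pair (pair a b) c ∘ₗ (comulSnd (k := k) (U := U)).toLinearMap =
      pair a (conv (cop k U) b c) := by
    ext x y
    have : pair (pair a b) c ∘ₗ
      (TensorProduct.assoc k U U U).symm.toLinearMap = pair a (pair b c) := by
      ext; simp [mul_assoc]
    have := LinearMap.congr_fun this (x ⊗ₜ Coalgebra.comul (R := k) y)
    simp [conv] at this ⊢
    rw [← this]
    simp [comulSnd]
    rfl
  have h2 : pair (pair a b) c ∘ₗ (leg13 (k := k) (U := U)).toLinearMap = pair a c := by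
    ext; simp [leg13, IsPoint.map_one (f := b)]
  have h3 : pair (pair a b) c ∘ₗ (leg12 (k := k) (U := U)).toLinearMap = pair a b := by
    ext; simp [leg12, IsPoint.map_one (f := c)]
  rw [pair_mul] at h
  exact (LinearMap.congr_fun h1 _).symm.trans
    (h.trans (congrArg₂ (· * ·) (LinearMap.congr_fun h2 _) (LinearMap.congr_fun h3 _)))

-- Since the counit is idempotent under convolution, the hexagon makes this value idempotent. Being
-- invertible as well, it is `1`.
omit [IsPoint b] [Commuting a b] in
theorem IsUniversalRMatrix.eps_left : pair (epsPoint E (cou k U)) a (R : U ⊗[k] U) = 1 := by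
  have hc : IsCounitLeft (cop k U) (cou k U) :=
    (isCompatible_cop (BialgHom.id k U)).counitLeft
  have h := hR.conv_left (epsPoint E (cou k U)) (epsPoint E (cou k U)) a
  rw [conv_eps_left hc] at h
  have h1 := congrArg (fun e => pair (epsPoint E (cou k U)) a ((R⁻¹ : (U ⊗[k] U)ˣ) : U ⊗[k] U) * e) h
  simp only [IsPoint.inv_mul_cancel, IsPoint.map_inv_mul] at h1
  exact h1.symm

omit [IsPoint b] [Commuting a b] in
theorem IsUniversalRMatrix.eps_right : pair a (epsPoint E (cou k U)) (R : U ⊗[k] U) = 1 := by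
  have hc : IsCounitLeft (cop k U) (cou k U) :=
    (isCompatible_cop (BialgHom.id k U)).counitLeft
  have h := hR.conv_right a (epsPoint E (cou k U)) (epsPoint E (cou k U))
  rw [conv_eps_left hc] at h
  have h1 := congrArg (fun e => pair a (epsPoint E (cou k U)) ((R⁻¹ : (U ⊗[k] U)ˣ) : U ⊗[k] U) * e) h
  simp only [IsPoint.inv_mul_cancel, IsPoint.map_inv_mul] at h1
  exact h1.symm

variable (hγ : Function.Bijective (HopfAlgebra.antipode k (A := U)))

/-- `(id ⊗ γ⁻¹)(R) = R⁻¹`. -/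
theorem IsUniversalRMatrix.antiInv_right :
    pair a (b ∘ₗ antiInv hγ) (R : U ⊗[k] U) = pair a b ((R⁻¹ : (U ⊗[k] U)ˣ) : U ⊗[k] U) := by
  have h := LinearMap.congr_fun (hR.conv_right (lp a) (rp hγ b) (lp b)) 1
  rw [pair_congr_right (fun x => conv_rp_lp hγ b x), hR.eps_right (lp a), pair_lp,
    Module.End.mul_apply, lp_apply, Module.End.one_apply] at h
  have h1 : ∀ t, pair (lp a) (rp hγ b) t 1 = pair a (b ∘ₗ antiInv hγ) t := by
    intro t
    induction t with
    | zero => simp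
    | add s t hs ht => simp only [map_add, LinearMap.add_apply, hs, ht]
    | tmul x y => simp
  rw [h1] at h
  have h2 := congrArg (fun e => pair a b ((R⁻¹ : (U ⊗[k] U)ˣ) : U ⊗[k] U) * e) h
  simp only [IsPoint.inv_mul_cancel, mul_one] at h2
  exact h2.symm

/-- `(γ⁻¹ ⊗ γ⁻¹)(R) = R`. -/
theorem IsUniversalRMatrix.antiInv_antiInv :
    pair (a ∘ₗ antiInv hγ) (b ∘ₗ antiInv hγ) (R : U ⊗[k] U) = pair a b (R : U ⊗[k] U) := by
  have h := LinearMap.congr_fun (hR.conv_left (rp hγ (ptL k U U)) (lp (ptL k U U))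
    (lp (ptR k U U))) 1
  rw [pair_congr_left (fun x => conv_rp_lp hγ (ptL k U U) x), hR.eps_left (lp (ptR k U U)),
    Module.End.mul_apply, pair_lp, lp_apply, mul_one, pair_ptL_ptR, Module.End.one_apply,
    LinearMap.id_apply] at h
  have h1 : ∀ s t : U ⊗[k] U, pair a (b ∘ₗ antiInv hγ)
      (pair (rp hγ (ptL k U U)) (lp (ptR k U U)) s t) =
      pair a (b ∘ₗ antiInv hγ) t * pair (a ∘ₗ antiInv hγ) (b ∘ₗ antiInv hγ) s := by
    intro s t
    induction s with
    | zero => simp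
    | add s s' hs hs' => simp only [map_add, LinearMap.add_apply, mul_add, hs, hs']
    | tmul x y =>
      induction t with
      | zero => simp
      | add t t' ht ht' => simp only [map_add, add_mul, ht, ht']
      | tmul p q =>
        simp only [pair_tmul, Module.End.mul_apply, rmul_apply, lp_apply, LinearMap.comp_apply,
          ptL_apply, ptR_apply, Algebra.TensorProduct.tmul_mul_tmul, one_mul, mul_one,
          antiInv_mul, IsPoint.map_mul (f := a), IsPoint.map_mul (f := b)]
        rw [mul_assoc, mul_assoc, ← mul_assoc (b _) (a _), Commuting.comm (f := b) (g := a)]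
        simp only [mul_assoc]
  -- With `R'` a second copy of `R`, the relation `h` reads `R'₁ γ⁻¹(R₁) ⊗ R₂ R'₂ = 1`. Applying
  -- `γ⁻¹` to the second leg reverses it and gives `R⁻¹ · (γ⁻¹ ⊗ γ⁻¹)(R) = 1` at the points.
  have h2 := congrArg (pair a (b ∘ₗ antiInv hγ)) h
  rw [h1, hR.antiInv_right a b hγ] at h2
  have h3 := congrArg (fun e => pair a b (R : U ⊗[k] U) * e) h2
  simp only [IsPoint.mul_inv_cancel] at h3
  rw [← h3, Algebra.TensorProduct.one_def, pair_tmul]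
  simp [IsPoint.map_one (f := a), IsPoint.map_one (f := b)]

theorem IsUniversalRMatrix.pair_rp :
    pair (rp hγ a) (rp hγ b) (R : U ⊗[k] U) 1 = pair a b (R : U ⊗[k] U) := by
  rw [← hR.antiInv_antiInv a b hγ]
  generalize (R : U ⊗[k] U) = t
  induction t with
  | zero => simp
  | add s t hs ht => simp only [map_add, LinearMap.add_apply, hs, ht]
  | tmul x y => simp [Commuting.comm (f := a) (g := b)]

omit hR

/-- `γ⁻¹` is an anti-homomorphism of coalgebras. -/
theorem conv_rp_rp (u : U) :
    conv (cop k U) (rp hγ b) (rp hγ a) u 1 = conv (cop k U) a b (antiInv hγ u) := by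
  have hc := isCompatible_cop (BialgHom.id k U)
  set T : U →ₗ[k] E :=
    (LinearMap.applyₗ (1 : E) : (E →ₗ[k] E) →ₗ[k] E) ∘ₗ conv (cop k U) (rp hγ b) (rp hγ a) with hT
  have h1 : conv (cop k U) (rmul T) (rmul (conv (cop k U) a b)) =
      epsPoint (Module.End k E) (cou k U) := by
    have h2 : ∀ t : U ⊗[k] U, ∀ e : E, pair (rmul T) (rmul (conv (cop k U) a b)) t e =
        e * pair (conv (cop k U) (rp hγ b) (rp hγ a)) (lp (conv (cop k U) a b)) t 1 := by
      intro t e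
      induction t with
      | zero => simp
      | add s t hs ht => simp only [map_add, LinearMap.add_apply, mul_add, hs, ht]
      | tmul x y =>
        have := LinearMap.congr_fun (Commuting.comm (f := conv (cop k U) (rp hγ b) (rp hγ a))
          (g := lp (conv (cop k U) a b)) x y) 1
        rw [pair_tmul, pair_tmul, this]
        simp [hT, mul_assoc]
    ext x e
    rw [conv_apply, h2, ← conv_apply, ← conv_lp, conv_assoc hc.coassoc, ← conv_assoc hc.coassoc
      (rp hγ a)]
    have h3 : ∀ y, conv (cop k U) (conv (cop k U) (rp hγ a) (lp a)) (lp b) y 1 = lp b y 1 := by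
      intro y
      rw [← conv_eps_left hc.counitLeft (lp b), conv_apply, conv_apply]
      rw [conv_eps_left hc.counitLeft (lp b)]
      exact pair_congr_left (fun x => conv_rp_lp hγ a x) _
    have h4 : conv (cop k U) (rp hγ b) (conv (cop k U) (conv (cop k U) (rp hγ a) (lp a)) (lp b)) x 1
        = conv (cop k U) (rp hγ b) (lp b) x 1 := pair_congr_right h3 _
    rw [h4, conv_rp_lp]
    simp [Algebra.algebraMap_eq_smul_one]
  -- `rmul T` is a left and `rp (conv a b)` a right convolution inverse of `rmul (conv a b)`, so
  -- they agree; evaluation at `1` compares `T` with `conv a b ∘ γ⁻¹`.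
  have h2 := conv_rmul_rp hγ (conv (cop k U) a b)
  have h3 := conv_assoc hc.coassoc (rmul T) (rmul (conv (cop k U) a b)) (rp hγ (conv (cop k U) a b))
  rw [h1, h2, conv_eps_left hc.counitLeft, conv_eps_right hc.counitRight] at h3
  have h4 := LinearMap.congr_fun (LinearMap.congr_fun h3 u) 1
  simpa [hT] using h4.symm

end RMatrix

/-! ## The coboundary of `ζ` and the dynamical R-matrix at points -/

section DynR

variable {k H L U E : Type*} [Field k] [Ring H] [Bialgebra k H] [Ring L] [Algebra k L]
  [Ring U] [HopfAlgebra k U] [Ring E] [Algebra k E] {𝔏 : BaseAlgebra k H L}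

theorem tri_semiconj {V W X : Type*} [AddCommGroup V] [Module k V] [AddCommGroup W] [Module k W]
    [AddCommGroup X] [Module k X] {f f' : V →ₗ[k] E} {g g' : W →ₗ[k] E} {h h' : X →ₗ[k] E} {e : E}
    (hf : ∀ x, e * f x = f' x * e) (hg : ∀ y, e * g y = g' y * e) (hh : ∀ y, e * h y = h' y * e)
    (t : (V ⊗[k] W) ⊗[k] X) : e * tri f g h t = tri f' g' h' t * e :=
  pair_semiconj (pair_semiconj hf hg) hh t

variable {R : (U ⊗[k] U)ˣ} {F : ((U ⊗[k] U) ⊗[k] L)ˣ}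

section

variable (a b : U →ₗ[k] E) (l : L →ₗ[k] E) [IsPoint a] [IsPoint b] [IsPoint l]
  [Commuting a b] [Commuting a l] [Commuting b l]

theorem tri_dynR : tri a b l (dynR R F) =
    tri b a l (↑F⁻¹) * pair a b (R : U ⊗[k] U) * tri a b l (F : (U ⊗[k] U) ⊗[k] L) := by
  have h1 : tri a b l ∘ₗ (Algebra.TensorProduct.map (Algebra.TensorProduct.comm k U U).toAlgHom
      (AlgHom.id k L)).toLinearMap = tri b a l := by
    ext; simp [Commuting.comm (f := a) (g := b)]
  rw [dynR, pair_mul, pair_mul, pair_tmul, IsPoint.map_one (f := l), mul_one, ← h1]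
  rfl

end

section

variable (hR : IsUniversalRMatrix R) {j : H →ₐc[k] U}
  (hF : IsDynamicalTwist (j : H →ₐ[k] U) 𝔏 F)
  (a b c : U →ₗ[k] E) (l : L →ₗ[k] E) [IsPoint a] [IsPoint b] [IsPoint l]
  [Commuting a b] [Commuting a l] [Commuting b l]

include hR hF

/-- The two factors `F` and `F₂₁⁻¹` are weakly invariant and commute with the shifted points of
their own order; the middle factor `R` reverses the order of the convolution. -/
theorem dynR_swap (ν : L) :
    tri a b l (dynR R F) * 𝔏.dyn (j : H →ₐ[k] U) (conv (cop k U) a b) l ν =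
      𝔏.dyn (j : H →ₐ[k] U) (conv (cop k U) b a) l ν * tri a b l (dynR R F) := by
  have hw := hF.isWeakTwist
  have h1 := hw.commuting a b l
  have h2 := hw.commuting_inv b a l
  have c1 : Commute (tri a b l (F : (U ⊗[k] U) ⊗[k] L))
    (𝔏.dyn (j : H →ₐ[k] U) (conv (cop k U) a b) l ν) := commute_cst _ _ ν
  have c2 : Commute (tri b a l (↑F⁻¹)) (𝔏.dyn (j : H →ₐ[k] U) (conv (cop k U) b a) l ν) :=
    commute_cst _ _ ν
  have c3 := dyn_semiconj (𝔏 := 𝔏) (D := (j : H →ₐ[k] U)) (e := pair a b (R : U ⊗[k] U))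
    (hR.conv_swap a b) (fun y => commute_cst _ l y) ν
  rw [tri_dynR, mul_assoc, c1.eq, mul_assoc (tri b a l _), ← mul_assoc (pair a b _), c3,
    ← mul_assoc, ← mul_assoc, c2.eq]
  simp only [mul_assoc]

/-- The dynamical hexagon, conjugated by `F` because the coproduct of `U` is not twisted here. Three
forms of the cocycle equation merge the factors `F`, the values of `R` pass the merged ones while
reversing convolutions, and the hexagon of `R` remains. -/
theorem dynR_conv_right [IsPoint c] [Commuting a c] [Commuting b c] [Commuting c l] :
    tri a (conv (cop k U) b c) l (dynR R F) =
      tri b c (𝔏.dyn (j : H →ₐ[k] U) a l) (F : (U ⊗[k] U) ⊗[k] L) * tri a c l (dynR R F) *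
        tri a b (𝔏.dyn (j : H →ₐ[k] U) c l) (dynR R F) * tri b c l (↑F⁻¹) := by
  have hw := hF.isWeakTwist
  simp only [tri_dynR]
  have e1 := hw.cocycle_inv_right b a c l
  have e2 : pair a c (R : U ⊗[k] U) * tri b (conv (cop k U) a c) l (↑F⁻¹) =
      tri b (conv (cop k U) c a) l (↑F⁻¹) * pair a c (R : U ⊗[k] U) :=
    tri_semiconj (fun y => commute_cst _ b y) (hR.conv_swap a c) (fun y => commute_cst _ l y) _
  have e3 : pair a b (R : U ⊗[k] U) * tri (conv (cop k U) a b) c l (F : (U ⊗[k] U) ⊗[k] L) =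
      tri (conv (cop k U) b a) c l (F : (U ⊗[k] U) ⊗[k] L) * pair a b (R : U ⊗[k] U) :=
    tri_semiconj (hR.conv_swap a b) (fun y => commute_cst _ c y) (fun y => commute_cst _ l y) _
  have e4 := hw.cocycle_inv_left b c a l
  have e5 := hw.cocycle_points a b c l
  have e6 := hR.conv_right a b c
  have n1 := IsPoint.map_mul_inv (tri b (conv (cop k U) c a) l) F
  have n2 := IsPoint.map_mul_inv (tri b c l) F
  rw [e6]
  generalize tri b c l (F : (U ⊗[k] U) ⊗[k] L) = f1 at *
  generalize tri b c l (↑F⁻¹) = f1' at *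
  generalize tri a c l (F : (U ⊗[k] U) ⊗[k] L) = f2 at *
  generalize tri c a l (↑F⁻¹) = f3 at *
  generalize tri b a (𝔏.dyn (j : H →ₐ[k] U) c l) (↑F⁻¹) = f4 at *
  generalize tri a b (𝔏.dyn (j : H →ₐ[k] U) c l) (F : (U ⊗[k] U) ⊗[k] L) = f5 at *
  generalize tri b c (𝔏.dyn (j : H →ₐ[k] U) a l) (F : (U ⊗[k] U) ⊗[k] L) = f6 at *
  generalize tri b (conv (cop k U) a c) l (↑F⁻¹) = g1 at *
  generalize tri b (conv (cop k U) c a) l (↑F⁻¹) = g2 at *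
  generalize tri b (conv (cop k U) c a) l (F : (U ⊗[k] U) ⊗[k] L) = g2' at *
  generalize tri (conv (cop k U) a b) c l (F : (U ⊗[k] U) ⊗[k] L) = g3 at *
  generalize tri (conv (cop k U) b a) c l (F : (U ⊗[k] U) ⊗[k] L) = g4 at *
  generalize tri (conv (cop k U) b c) a l (↑F⁻¹) = g5 at *
  generalize tri a (conv (cop k U) b c) l (F : (U ⊗[k] U) ⊗[k] L) = g6 at *
  generalize pair a c (R : U ⊗[k] U) = r1 at *
  generalize pair a b (R : U ⊗[k] U) = r2 at *
  symm
  calc f6 * (f3 * r1 * f2) * (f4 * r2 * f5) * f1' = (f6 * f3) * r1 * (f2 * f4) * r2 * f5 * f1' := by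
        simp only [mul_assoc]
    _ = g5 * g2' * (r1 * g1) * (g4 * r2) * f5 * f1' := by rw [← e4, ← e1]; simp only [mul_assoc]
    _ = g5 * (g2' * g2) * r1 * r2 * (g3 * f5) * f1' := by rw [e2, ← e3]; simp only [mul_assoc]
    _ = g5 * (r1 * r2) * g6 * (f1 * f1') := by rw [n1, e5]; simp only [mul_assoc, one_mul]
    _ = _ := by rw [n2, mul_one]

omit [IsPoint b] [Commuting a b] [Commuting b l] in
theorem dynR_eps_right : tri a (epsPoint E (cou k U)) l (dynR R F) = 1 := by
  have hw := hF.isWeakTwist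
  rw [tri_dynR, hw.eps_left_inv a l, hR.eps_right a, hw.eps_right a l, one_mul, one_mul]

end

section

variable (hγ : Function.Bijective (HopfAlgebra.antipode k (A := U))) {j : H →ₐc[k] U}
  (hF : IsDynamicalTwist (j : H →ₐ[k] U) 𝔏 F)
  (a b c : U →ₗ[k] E) (l : L →ₗ[k] E) [IsPoint a] [IsPoint b] [IsPoint c] [IsPoint l]
  [Commuting a b] [Commuting a c] [Commuting b c] [Commuting a l] [Commuting b l] [Commuting c l]

include hF

/-- `R̃(b, c, l) ζ(c, l) X = ζ(c, b · l)`, where `X` is `R̃` with the value of its second leg under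
`γ⁻¹` on the right of the other legs. -/
theorem dynR_zeta (hR : IsUniversalRMatrix R) :
    tri b c l (dynR R F) * pair c l (zeta hγ F) *
        tri (lp b) (rp hγ c) (lp (𝔏.dyn (j : H →ₐ[k] U) c l)) (dynR R F) 1 =
      pair c (𝔏.dyn (j : H →ₐ[k] U) b l) (zeta hγ F) := by
  -- The hexagon with `γ⁻¹` in the middle leg: the merged leg acts on `1` as the counit, so the left
  -- side is `1`, and the trailing `F⁻¹` becomes `ζ(c, l)`.
  have h := LinearMap.congr_fun (dynR_conv_right hR hF (lp b) (rp hγ c) (lp c) (lp l)) 1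
  have hw := hF.isWeakTwist
  rw [tri_congr_mid (b' := epsPoint (Module.End k E) (cou k U)) (fun x => conv_rp_lp hγ c x),
    dynR_eps_right hR hF (lp b) (lp l)] at h
  simp only [Module.End.mul_apply, Module.End.one_apply] at h
  rw [← pair_zeta hγ c l] at h
  have hz := (isWeakInvariant_zeta hγ hF).commuting c l
  have h1 : lp (cst k (pair c l (zeta hγ F))) 1 *
      tri (lp b) (rp hγ c) (𝔏.dyn (j : H →ₐ[k] U) (lp c) (lp l)) (dynR R F) = 
      tri (lp b) (rp hγ c) (𝔏.dyn (j : H →ₐ[k] U) (lp c) (lp l)) (dynR R F) *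
       lp (cst k (pair c l (zeta hγ F))) 1 := by
    rw [dyn_lp]
    exact tri_semiconj (fun x => Commuting.comm _ _) (fun x => Commuting.comm _ _)
      (fun x => Commuting.comm _ _) _
  have h2 := LinearMap.congr_fun h1 1
  simp only [Module.End.mul_apply, lp_apply, cst, LinearMap.toSpanSingleton_apply, one_smul,
    mul_one] at h2
  rw [← h2] at h
  -- The leading `F` is inverted. Its inverse, applied to `1`, is `ζ` at the shifted point.
  have h3 := congrArg (fun e => tri (rp hγ c) (lp c) (𝔏.dyn (j : H →ₐ[k] U) (lp b) (lp l))
    (↑F⁻¹) e) h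
  have n1 := fun e => LinearMap.congr_fun (IsPoint.map_inv_mul (tri (rp hγ c) (lp c) (𝔏.dyn (j : H →ₐ[k] U) (lp b) (lp l))) F) e
  simp only [Module.End.mul_apply, Module.End.one_apply] at n1
  rw [n1, dyn_lp, ← pair_zeta, tri, pair_lp, pair_lp, dyn_lp, lp_apply, ← mul_assoc] at h3
  exact h3.symm

/-- As `γ⁻¹` reverses coproducts, `ζ` at a convolution is `F⁻¹` with first leg the convolution of
`rp c` and `rp a`. The inverted cocycle equation splits this leg, and a second use of it splits the
remaining convolution of `a` and `c`; after each use an antipode cancels. -/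
theorem zeta_conv :
    tri a c l (↑F⁻¹) * pair (conv (cop k U) a c) l (zeta hγ F) =
      tri (rp hγ c) (rp hγ a) (lp (𝔏.dyn (j : H →ₐ[k] U) (conv (cop k U) a c) l))
        (F : (U ⊗[k] U) ⊗[k] L)
        (pair a (𝔏.dyn (j : H →ₐ[k] U) c l) (zeta hγ F) * pair c l (zeta hγ F)) := by
  have hc := isCompatible_cop j
  have hw := hF.isWeakTwist
  have h1 := pair_zeta_apply (F := F) hγ (conv (cop k U) (rp hγ c) (rp hγ a))
    (lp (conv (cop k U) a c)) (lp l) 1 (fun x => by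
      rw [conv_rp_rp, lp_apply, mul_one])
  rw [pair_lp, lp_apply, mul_one] at h1
  have h2 := LinearMap.congr_fun (hw.cocycle_inv (rp hγ c) (rp hγ a) (lp (conv (cop k U) a c))
    (lp l)) 1
  have h3 : tri (rp hγ c) (conv (cop k U) (rp hγ a) (lp (conv (cop k U) a c))) (lp l) (↑F⁻¹) 1 =
      pair c l (zeta hγ F) := by
    rw [pair_zeta]
    refine tri_congr_mid (fun x => ?_) _
    rw [← conv_lp, ← conv_assoc hc.coassoc]
    conv_rhs => rw [← conv_eps_left hc.counitLeft (lp c)]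
    exact pair_congr_left (fun x => conv_rp_lp hγ a x) _
  rw [Module.End.mul_apply, Module.End.mul_apply, h3, ← h1, dyn_lp] at h2
  have h4 := LinearMap.congr_fun (hw.cocycle_inv (rp hγ a) (lp a) (lp c) (lp l))
    (pair c l (zeta hγ F))
  have hcm : ∀ x, rp hγ a x (pair c l (zeta hγ F)) = lp a (antiInv hγ x) (pair c l (zeta hγ F)) := by
    intro x
    exact Commuting.comm (f := pair c l) (g := a) _ _
  -- The vector is now `ζ(c, l)` and not `1`. It commutes with values of `a`, so right
  -- multiplication by it can be pulled out and the antipode identity used on `1`.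
  have h5 : tri (conv (cop k U) (rp hγ a) (lp a)) (lp c) (lp l) (↑F⁻¹) (pair c l (zeta hγ F)) =
      pair c l (zeta hγ F) := by
    rw [tri_congr_left (a' := epsPoint (Module.End k E) (cou k U)), hw.eps_left_inv (lp c) (lp l),
      Module.End.one_apply]
    intro x
    have h6 : Commute (conv (cop k U) (rp hγ a) (lp a) x) (rmul (pair c l) (zeta hγ F)) := by
      have : Commute (rmul (pair c l) (zeta hγ F)) (conv (cop k U) (rp hγ a) (lp a) x) :=
        conv_semiconj (fun x => Commuting.comm _ _) (fun x => Commuting.comm _ _) _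
      exact this.symm
    have h7 := LinearMap.congr_fun h6.eq 1
    simp only [Module.End.mul_apply, rmul_apply, one_mul] at h7
    rw [h7, conv_rp_lp]
    simp [Algebra.algebraMap_eq_smul_one]
  rw [Module.End.mul_apply, Module.End.mul_apply, h5, dyn_lp,
    ← pair_zeta_apply hγ (rp hγ a) (lp a) _ _ hcm, conv_lp, pair_lp, lp_apply, tri, pair_lp, pair_lp,
    lp_apply] at h4
  have h8 := congrArg (fun e => tri (rp hγ c) (rp hγ a)
    (lp (𝔏.dyn (j : H →ₐ[k] U) (conv (cop k U) a c) l)) (F : (U ⊗[k] U) ⊗[k] L) e) h2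
  have n1 := fun e => LinearMap.congr_fun (IsPoint.map_mul_inv (tri (rp hγ c) (rp hγ a)
    (lp (𝔏.dyn (j : H →ₐ[k] U) (conv (cop k U) a c) l))) F) e
  simp only [Module.End.mul_apply, Module.End.one_apply] at n1 h8
  rw [n1] at h8
  have hi := hw.commuting_inv a c l
  have h9 : Commute (lp (cst k (tri a c l (↑F⁻¹))) 1) (tri (rp hγ c) (rp hγ a)
      (lp (𝔏.dyn (j : H →ₐ[k] U) (conv (cop k U) a c) l)) (F : (U ⊗[k] U) ⊗[k] L)) :=
    tri_semiconj (fun x => Commuting.comm _ _) (fun x => Commuting.comm _ _)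
      (fun x => Commuting.comm _ _) _
  have h10 := LinearMap.congr_fun h9.eq (tri (rp hγ a) (lp (conv (cop k U) a c)) (lp l) (↑F⁻¹)
    (pair c l (zeta hγ F)))
  simp only [Module.End.mul_apply, lp_apply, cst, LinearMap.toSpanSingleton_apply, one_smul] at h10
  rw [h8, h4, h10]

/-- The twist `F`, composed with the coboundary twist generated by `ζ`, in terms of `F⁻¹` evaluated
through `γ⁻¹`. -/
theorem tri_gauge_zeta {z : (U ⊗[k] L)ˣ} (hz : (z : U ⊗[k] L) = zeta hγ F) :
    tri a c l (gaugeTwist 𝔏 (cop k U) (j : H →ₐ[k] U) z (F : (U ⊗[k] U) ⊗[k] L)) =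
      tri (rp hγ c) (rp hγ a) (lp (𝔏.dyn (j : H →ₐ[k] U) (conv (cop k U) a c) l)) (↑F⁻¹) 1 := by
  have hc := isCompatible_cop j
  have hw := hF.isWeakTwist
  have hzi := isWeakInvariant_zeta hγ hF
  have h := zeta_conv hγ hF a c l
  rw [tri_gaugeTwist, hz]
  rw [← hz] at hzi h ⊢
  have c1 := hzi.commuting_inv (conv (cop k U) a c) l
  have c2 := hw.commuting a c l
  have c3 := hzi.commuting a (𝔏.dyn (j : H →ₐ[k] U) c l)
  have c4 : Commuting (cst k (pair c l (z : U ⊗[k] L))) (𝔏.dyn (j : H →ₐ[k] U) a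
    (𝔏.dyn (j : H →ₐ[k] U) c l)) := by
      have := hzi.commuting c l
      infer_instance
  rw [𝔏.dyn_assoc hc.comulHom] at c3 c4
  have n1 := IsPoint.map_inv_mul (pair (conv (cop k U) a c) l) z
  have n2 := IsPoint.map_mul_inv (tri a c l) F
  have hd : 𝔏.dyn (j : H →ₐ[k] U) a (𝔏.dyn (j : H →ₐ[k] U) c l) =
    𝔏.dyn (j : H →ₐ[k] U) (conv (cop k U) a c) l := 𝔏.dyn_assoc hc.comulHom _ _ _
  generalize pair c l (z : U ⊗[k] L) = z1 at *
  generalize pair a (𝔏.dyn (j : H →ₐ[k] U) c l) (z : U ⊗[k] L) = z2 at *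
  generalize pair (conv (cop k U) a c) l (↑z⁻¹) = y' at *
  generalize pair (conv (cop k U) a c) l (z : U ⊗[k] L) = y at *
  generalize tri a c l (F : (U ⊗[k] U) ⊗[k] L) = f at *
  generalize tri a c l (↑F⁻¹) = f' at *
  -- The prefix `ζ⁻¹ F` at the combined points commutes with the shifted point of `L`, hence with
  -- this operator. Applied to `zeta_conv`, it shows that the operator of `F` sends the gauged twist
  -- to `1`.
  have h9 : Commute (lp (cst k (y' * f)) 1) (tri (rp hγ c) (rp hγ a)
      (lp (𝔏.dyn (j : H →ₐ[k] U) (conv (cop k U) a c) l)) (F : (U ⊗[k] U) ⊗[k] L)) :=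
    tri_semiconj (fun x => Commuting.comm _ _) (fun x => Commuting.comm _ _)
      (fun x => Commuting.comm _ _) _
  have h10 := LinearMap.congr_fun h9.eq (z2 * z1)
  simp only [Module.End.mul_apply, lp_apply, cst, LinearMap.toSpanSingleton_apply, one_smul] at h10
  have h11 : y' * f * (f' * y) = 1 := by
    rw [mul_assoc, ← mul_assoc f, n2, one_mul, n1]
  rw [← h, h11] at h10
  have n3 := LinearMap.congr_fun (IsPoint.map_inv_mul (tri (rp hγ c) (rp hγ a)
    (lp (𝔏.dyn (j : H →ₐ[k] U) (conv (cop k U) a c) l))) F) (y' * f * (z2 * z1))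
  simp only [Module.End.mul_apply, Module.End.one_apply] at n3
  rw [← h10] at n3
  rw [n3, mul_assoc (y' * f)]

/-- By `tri_gauge_zeta` the vector acted upon is `F⁻¹` at exactly the points where `R̃ = F₂₁⁻¹ R F`
is evaluated, so `F` cancels. What is left is `R` with `γ⁻¹` in both legs, which is `R` itself, and
`F₂₁⁻¹`, which is the gauged twist in the other order. -/
theorem dynR_gauge_zeta (hR : IsUniversalRMatrix R) {z : (U ⊗[k] L)ˣ}
    (hz : (z : U ⊗[k] L) = zeta hγ F) :
    tri (rp hγ c) (rp hγ a) (lp (𝔏.dyn (j : H →ₐ[k] U) (conv (cop k U) a c) l)) (dynR R F)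
        (tri a c l (gaugeTwist 𝔏 (cop k U) (j : H →ₐ[k] U) z (F : (U ⊗[k] U) ⊗[k] L))) =
      pair c a (R : U ⊗[k] U) *
        tri c a l (gaugeTwist 𝔏 (cop k U) (j : H →ₐ[k] U) z (F : (U ⊗[k] U) ⊗[k] L)) := by
  rw [tri_gauge_zeta hγ hF a c l hz, tri_gauge_zeta hγ hF c a l hz, tri_dynR]
  have n1 := LinearMap.congr_fun (IsPoint.map_mul_inv (tri (rp hγ c) (rp hγ a)
    (lp (𝔏.dyn (j : H →ₐ[k] U) (conv (cop k U) a c) l))) F) 1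
  simp only [Module.End.mul_apply, Module.End.one_apply] at n1 ⊢
  rw [n1, hR.pair_rp]
  have hs : ∀ ν, pair c a (R : U ⊗[k] U) * 𝔏.dyn (j : H →ₐ[k] U) (conv (cop k U) c a) l ν =
      𝔏.dyn (j : H →ₐ[k] U) (conv (cop k U) a c) l ν * pair c a (R : U ⊗[k] U) :=
    dyn_semiconj (hR.conv_swap c a) (fun y => commute_cst _ l y)
  have h9 : lp (cst k (pair c a (R : U ⊗[k] U))) 1 * tri (rp hγ a) (rp hγ c)
      (lp (𝔏.dyn (j : H →ₐ[k] U) (conv (cop k U) c a) l)) (↑F⁻¹) =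
      tri (rp hγ a) (rp hγ c)
      (lp (𝔏.dyn (j : H →ₐ[k] U) (conv (cop k U) a c) l)) (↑F⁻¹) *
      lp (cst k (pair c a (R : U ⊗[k] U))) 1 :=
    tri_semiconj (fun x => Commuting.comm _ _) (fun x => Commuting.comm _ _)
      (fun x => by ext e; simp [cst, ← mul_assoc, hs]) _
  have h10 := LinearMap.congr_fun h9 1
  simp only [Module.End.mul_apply, lp_apply, cst, LinearMap.toSpanSingleton_apply, one_smul,
    mul_one] at h10
  exact h10.symm

end

end DynR

/-! ## The twisted tensor square and the composite twist -/

section MapTwist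

variable {k H L A B E : Type*} [Field k] [Ring H] [Bialgebra k H] [Ring L] [Algebra k L]
  [Ring A] [Algebra k A] [Ring B] [Algebra k B] [Ring E] [Algebra k E] {𝔏 : BaseAlgebra k H L}
  {Δ : A →ₐ[k] A ⊗[k] A} {ε : A →ₐ[k] k} {D : H →ₐ[k] A}
  {Δ' : B →ₐ[k] B ⊗[k] B} {ε' : B →ₐ[k] k} {f : A →ₐ[k] B}

theorem conv_comp_algHom (hf : ∀ x, Δ' (f x) = Algebra.TensorProduct.map f f (Δ x))
    (a b : B →ₗ[k] E) : conv Δ' a b ∘ₗ f.toLinearMap =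
      conv Δ (a ∘ₗ f.toLinearMap) (b ∘ₗ f.toLinearMap) := by
  ext x
  rw [conv, conv, pair_comp]
  exact congrArg (pair a b) (hf x)

theorem tri_map_map (a b : B →ₗ[k] E) (l : L →ₗ[k] E) (u : (A ⊗[k] A) ⊗[k] L) :
    tri a b l (Algebra.TensorProduct.map (Algebra.TensorProduct.map f f) (AlgHom.id k L) u) =
      tri (a ∘ₗ f.toLinearMap) (b ∘ₗ f.toLinearMap) l u := by
  have : tri a b l ∘ₗ (Algebra.TensorProduct.map (Algebra.TensorProduct.map f f)
      (AlgHom.id k L)).toLinearMap =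
      tri (a ∘ₗ f.toLinearMap) (b ∘ₗ f.toLinearMap) l := by ext; simp
  exact LinearMap.congr_fun this u

theorem tri_pt (u : (A ⊗[k] A) ⊗[k] L) : tri (ptL k (A ⊗[k] A) L ∘ₗ ptL k A A)
    (ptL k (A ⊗[k] A) L ∘ₗ ptR k A A) (ptR k (A ⊗[k] A) L) u = u := by
  have : tri (ptL k (A ⊗[k] A) L ∘ₗ ptL k A A)
    (ptL k (A ⊗[k] A) L ∘ₗ ptR k A A) (ptR k (A ⊗[k] A) L) = LinearMap.id := by ext; simp
  rw [this]; rfl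

/-- The image of a dynamical twist under a homomorphism of bialgebras. -/
theorem IsWeakTwist.map {Φ : ((A ⊗[k] A) ⊗[k] L)ˣ} (hΦ : IsWeakTwist 𝔏 Δ ε D Φ)
    (hf : ∀ x, Δ' (f x) = Algebra.TensorProduct.map f f (Δ x)) (hε : ∀ x, ε' (f x) = ε x) :
    IsWeakTwist 𝔏 Δ' ε' (f.comp D) (Units.map (Algebra.TensorProduct.map
      (Algebra.TensorProduct.map f f) (AlgHom.id k L)).toMonoidHom Φ) := by
  have hcoe : (Units.map (Algebra.TensorProduct.map
      (Algebra.TensorProduct.map f f) (AlgHom.id k L)).toMonoidHom Φ : (B ⊗[k] B) ⊗[k] L) =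
      Algebra.TensorProduct.map (Algebra.TensorProduct.map f f) (AlgHom.id k L) Φ := rfl
  have he : epsPoint (B ⊗[k] L) ε' ∘ₗ f.toLinearMap = epsPoint _ ε := by
    ext x; simp [hε]
  refine ⟨fun ν => ?_, ?_, ?_, ?_⟩
  · rw [hcoe, ← tri_pt (k := k) (A := B) (L := L)
      (Algebra.TensorProduct.map (Algebra.TensorProduct.map f f) (AlgHom.id k L) _), tri_map_map]
    have e1 : 𝔏.dyn (Δ'.comp (f.comp D)) (ptL k (B ⊗[k] B) L) (ptR k (B ⊗[k] B) L) =
        𝔏.dyn D (conv Δ ((ptL k (B ⊗[k] B) L ∘ₗ ptL k B B) ∘ₗ f.toLinearMap)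
          ((ptL k (B ⊗[k] B) L ∘ₗ ptR k B B) ∘ₗ f.toLinearMap)) (ptR k (B ⊗[k] B) L) := by
      rw [← conv_comp_algHom hf, conv, pair_comp_ptL_ptR]
      rfl
    rw [e1]
    have := hΦ.commuting ((ptL k (B ⊗[k] B) L ∘ₗ ptL k B B) ∘ₗ f.toLinearMap)
      ((ptL k (B ⊗[k] B) L ∘ₗ ptR k B B) ∘ₗ f.toLinearMap) (ptR k (B ⊗[k] B) L)
    exact commute_cst _ _ _
  · apply eq_of_quad
    rw [hcoe, pair_mul, pair_mul, tri_map_left, tri_map_right, tri_leg23, 𝔏.pair_attach]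
    simp only [tri_map_map, conv_comp_algHom hf]
    exact hΦ.cocycle_points _ _ _ _
  · rw [hcoe, tri_map_map, he]
    exact hΦ.eps_left _ _
  · rw [hcoe, tri_map_map, he]
    exact hΦ.eps_right _ _

end MapTwist

theorem isCoassoc_of_points {k B : Type*} [Field k] [Ring B] [Algebra k B] {Δ : B →ₐ[k] B ⊗[k] B}
    (h : ∀ x, conv Δ (conv Δ (ptL k B (B ⊗[k] B)) (ptR k B (B ⊗[k] B) ∘ₗ ptL k B B))
        (ptR k B (B ⊗[k] B) ∘ₗ ptR k B B) x =
      conv Δ (ptL k B (B ⊗[k] B)) (conv Δ (ptR k B (B ⊗[k] B) ∘ₗ ptL k B B)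
        (ptR k B (B ⊗[k] B) ∘ₗ ptR k B B)) x) : IsCoassoc Δ := by
  intro x
  have h0 : ∀ t, pair (ptL k B (B ⊗[k] B)) (pair (ptR k B (B ⊗[k] B) ∘ₗ ptL k B B)
        (ptR k B (B ⊗[k] B) ∘ₗ ptR k B B)) t = t := by
    have : pair (ptL k B (B ⊗[k] B)) (pair (ptR k B (B ⊗[k] B) ∘ₗ ptL k B B)
        (ptR k B (B ⊗[k] B) ∘ₗ ptR k B B)) = LinearMap.id := by ext; simp
    intro t; rw [this]; rfl
  have h1 := h x
  rw [conv_apply, conv_apply, pair_conv_left, pair_conv_right, pair_assoc] at h1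
  simp only [LinearMap.comp_apply, h0] at h1
  exact h1

/-! ### The coproduct of the twisted tensor square at points -/

section Twisted

variable {k H L U E : Type*} [Field k] [Ring H] [Bialgebra k H] [Ring L] [Algebra k L]
  [Ring U] [HopfAlgebra k U] [Ring E] [Algebra k E] {𝔏 : BaseAlgebra k H L}

theorem conv_pair_pair (a b c d : U →ₗ[k] E) [Commuting b c] :
    conv (cop k (U ⊗[k] U)) (pair a b) (pair c d) =
      pair (conv (cop k U) a c) (conv (cop k U) b d) := by
  have h : ∀ s t : U ⊗[k] U, pair (pair a b) (pair c d)
      (TensorProduct.tensorTensorTensorComm k U U U U (s ⊗ₜ t)) = pair a c s * pair b d t := by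
    intro s t
    induction s with
    | zero => simp
    | add s s' hs hs' => simp only [map_add, TensorProduct.add_tmul, hs, hs', add_mul]
    | tmul x y =>
      induction t with
      | zero => simp
      | add t t' hs hs' => simp only [map_add, TensorProduct.tmul_add, hs, hs', mul_add]
      | tmul z w =>
        simp only [TensorProduct.tensorTensorTensorComm_tmul, pair_tmul]
        rw [mul_assoc, ← mul_assoc (b z), Commuting.comm (f := b) (g := c)]
        simp only [mul_assoc]
  ext x y
  refine Eq.trans ?_ (h _ _)
  simp [conv, TensorProduct.comul_tmul]
  rfl

variable {R : (U ⊗[k] U)ˣ} (hR : IsUniversalRMatrix R)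

section

variable (a b c d : U →ₗ[k] E) [IsPoint a] [IsPoint b] [IsPoint c] [IsPoint d]
  [Commuting a b] [Commuting a c] [Commuting a d] [Commuting b c] [Commuting b d] [Commuting c d]

/-- The definition of the twisted coproduct with `R₂₃⁻¹` moved to the other side. In this
semiconjugation form it can be combined with `pair_semiconj`. -/
theorem conv_twistedComul (x : U ⊗[k] U) :
    pair b c (R : U ⊗[k] U) * conv (twistedComul R) (pair a b) (pair c d) x =
      pair (conv (cop k U) a c) (conv (cop k U) b d) x * pair b c (R : U ⊗[k] U) := by
  have h1 : ∀ t, pair (pair a b) (pair c d) (midLeg t) = pair b c t := by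
    have : pair (pair a b) (pair c d) ∘ₗ (midLeg (k := k) (U := U)).toLinearMap = pair b c := by
      ext; simp [midLeg, IsPoint.map_one (f := a), IsPoint.map_one (f := d)]
    exact fun t => LinearMap.congr_fun this t
  rw [← conv_pair_pair]
  have : twistedComul R x = midLeg (↑R⁻¹) * Bialgebra.comulAlgHom k (U ⊗[k] U) x *
    midLeg (R : U ⊗[k] U) := rfl
  rw [conv_apply, this, pair_mul, pair_mul, h1, h1, mul_assoc, IsPoint.mul_inv_cancel]
  rfl

end

instance {V W A' A'' : Type*} [AddCommGroup V] [Module k V] [AddCommGroup W] [Module k W]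
    [Ring A'] [Algebra k A'] [Ring A''] [Algebra k A'']
    (f : V →ₗ[k] A') (g : W →ₗ[k] A'') :
    Commuting (ptL k A' A'' ∘ₗ f) (ptR k A' A'' ∘ₗ g) := ⟨fun x y => by simp⟩

instance {V W A' A'' : Type*} [AddCommGroup V] [Module k V] [AddCommGroup W] [Module k W]
    [Ring A'] [Algebra k A'] [Ring A''] [Algebra k A'']
    (f : V →ₗ[k] A'') (g : W →ₗ[k] A'') [Commuting f g] :
    Commuting (ptR k A' A'' ∘ₗ f) (ptR k A' A'' ∘ₗ g) :=
  ⟨fun x y => by simp [Commuting.comm (f := f) (g := g)]⟩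

instance {A' A'' : Type*} [Ring A'] [Algebra k A'] [Ring A''] [Algebra k A'']
    (p : A' ⊗[k] A'' →ₗ[k] E) [IsPoint p] : Commuting (p ∘ₗ ptL k A' A'') (p ∘ₗ ptR k A' A'') :=
  ⟨fun x y => by
    rw [LinearMap.comp_apply, LinearMap.comp_apply, ← IsPoint.map_mul, ← IsPoint.map_mul,
      Commuting.comm (f := ptL k A' A'') (g := ptR k A' A'')]⟩

include hR

/-- Left multiplication by `R_{be} R_{bc} R_{de}` turns both bracketings into the iterated
componentwise convolution, one through each hexagon; `R_{bc}` and `R_{de}` commute because they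
involve disjoint points. -/
theorem twistedComul_conv_assoc (a b c d e f : U →ₗ[k] E) [IsPoint a] [IsPoint b] [IsPoint c]
    [IsPoint d] [IsPoint e] [IsPoint f] [Commuting a b] [Commuting a c] [Commuting a d]
    [Commuting b c] [Commuting b d] [Commuting c d] [Commuting a e] [Commuting b e] [Commuting c e]
    [Commuting d e] [Commuting a f] [Commuting b f] [Commuting c f] [Commuting d f]
    [Commuting e f] (x : U ⊗[k] U) :
    conv (twistedComul R) (conv (twistedComul R) (pair a b) (pair c d)) (pair e f) x =
      conv (twistedComul R) (pair a b) (conv (twistedComul R) (pair c d) (pair e f)) x := by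
  have hc : IsCoassoc (cop k U) := (isCompatible_cop (BialgHom.id k U)).coassoc
  have h1 := conv_semiconj (Δ := twistedComul R) (conv_twistedComul (R := R) a b c d)
    (fun y => commute_cst (pair b c (R : U ⊗[k] U)) (pair e f) y) x
  have h2 := conv_semiconj (Δ := twistedComul R)
    (fun y => commute_cst (pair d e (R : U ⊗[k] U)) (pair a b) y)
    (conv_twistedComul (R := R) c d e f) x
  have h3 := conv_twistedComul (R := R) (conv (cop k U) a c) (conv (cop k U) b d) e f x
  have h4 := conv_twistedComul (R := R) a b (conv (cop k U) c e) (conv (cop k U) d f) x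
  rw [hR.conv_left, conv_assoc hc, conv_assoc hc] at h3
  rw [hR.conv_right] at h4
  have hcm : Commute (pair d e (R : U ⊗[k] U)) (pair b c (R : U ⊗[k] U)) := commute_cst _ _ _
  have n1 := IsPoint.inv_mul_cancel (pair b c) R
  have n2 := IsPoint.inv_mul_cancel (pair d e) R
  have n3 := IsPoint.inv_mul_cancel (pair b e) R
  have key : pair b e (R : U ⊗[k] U) * (pair b c (R : U ⊗[k] U) * (pair d e (R : U ⊗[k] U) *
      conv (twistedComul R) (conv (twistedComul R) (pair a b) (pair c d)) (pair e f) x)) =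
      pair b e (R : U ⊗[k] U) * (pair b c (R : U ⊗[k] U) * (pair d e (R : U ⊗[k] U) *
      conv (twistedComul R) (pair a b) (conv (twistedComul R) (pair c d) (pair e f)) x)) := by
    rw [h2, ← mul_assoc (pair b c _) (pair d e _), ← hcm.eq, mul_assoc (pair d e _), h1]
    simp only [← mul_assoc]
    rw [h3, h4]
    simp only [mul_assoc]
    rw [hcm.eq]
  have := congrArg (fun y => pair d e (↑R⁻¹) * (pair b c (↑R⁻¹) * (pair b e (↑R⁻¹) * y))) key
  simpa only [n1, n2, n3] using this

/-- On the image of `Δ`, the conjugation by `R₂₃` only undoes the interchange of the two middle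
legs. So `Δ` is a bialgebra map from `U` to the twisted tensor square; for the untwisted square it
need not be one. -/
theorem conv_twistedComul_comul (a b c d : U →ₗ[k] E) [IsPoint a] [IsPoint b] [IsPoint c]
    [IsPoint d] [Commuting a b] [Commuting a c] [Commuting a d]
    [Commuting b c] [Commuting b d] [Commuting c d] (x : U) :
    conv (twistedComul R) (pair a b) (pair c d) (cop k U x) =
      conv (cop k U) (conv (cop k U) a b) (conv (cop k U) c d) x := by
  have hc : IsCoassoc (cop k U) := (isCompatible_cop (BialgHom.id k U)).coassoc
  have h1 := conv_twistedComul (R := R) a b c d (cop k U x)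
  rw [← conv_apply] at h1
  have h2 := conv_semiconj (Δ := cop k U) (fun y => commute_cst (pair b c (R : U ⊗[k] U)) a y)
    (conv_semiconj (Δ := cop k U) (hR.conv_swap b c)
      (fun y => commute_cst (pair b c (R : U ⊗[k] U)) d y)) x
  simp only [conv_assoc hc] at h1 h2 ⊢
  rw [← h2] at h1
  have := congrArg (fun e => pair b c (↑R⁻¹) * e) h1
  simpa only [IsPoint.inv_mul_cancel] using this

theorem isCompatible_twistedComul (j : H →ₐc[k] U) :
    IsCompatible (twistedComul R) (cou k (U ⊗[k] U)) (diagIncl (j : H →ₐ[k] U)) where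
  coassoc := by
    apply isCoassoc_of_points
    intro x
    have h1 := twistedComul_conv_assoc hR
      (ptL k (U ⊗[k] U) ((U ⊗[k] U) ⊗[k] (U ⊗[k] U)) ∘ₗ ptL k U U)
      (ptL k (U ⊗[k] U) ((U ⊗[k] U) ⊗[k] (U ⊗[k] U)) ∘ₗ ptR k U U)
      ((ptR k (U ⊗[k] U) ((U ⊗[k] U) ⊗[k] (U ⊗[k] U)) ∘ₗ ptL k (U ⊗[k] U) (U ⊗[k] U)) ∘ₗ ptL k U U)
      ((ptR k (U ⊗[k] U) ((U ⊗[k] U) ⊗[k] (U ⊗[k] U)) ∘ₗ ptL k (U ⊗[k] U) (U ⊗[k] U)) ∘ₗ ptR k U U)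
      ((ptR k (U ⊗[k] U) ((U ⊗[k] U) ⊗[k] (U ⊗[k] U)) ∘ₗ ptR k (U ⊗[k] U) (U ⊗[k] U)) ∘ₗ ptL k U U)
      ((ptR k (U ⊗[k] U) ((U ⊗[k] U) ⊗[k] (U ⊗[k] U)) ∘ₗ ptR k (U ⊗[k] U) (U ⊗[k] U)) ∘ₗ ptR k U U) x
    rw [pair_comp_ptL_ptR, pair_comp_ptL_ptR, pair_comp_ptL_ptR] at h1
    exact h1
  counitLeft x := by
    have h1 : pair (epsPoint (U ⊗[k] U) (cou k (U ⊗[k] U))) LinearMap.id =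
        (TensorProduct.lid k (U ⊗[k] U)).toLinearMap ∘ₗ
          (cou k (U ⊗[k] U)).toLinearMap.rTensor _ := by
      ext; simp [Algebra.algebraMap_eq_smul_one]
    have h2 : epsPoint (U ⊗[k] U) (cou k (U ⊗[k] U)) =
        pair (epsPoint (U ⊗[k] U) (cou k U)) (epsPoint (U ⊗[k] U) (cou k U)) := by
      ext; simp [Algebra.algebraMap_eq_smul_one, mul_comm, smul_smul]
    have h3 := conv_twistedComul (R := R) (epsPoint (U ⊗[k] U) (cou k U))
      (epsPoint (U ⊗[k] U) (cou k U)) (LinearMap.id ∘ₗ ptL k U U) (LinearMap.id ∘ₗ ptR k U U) x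
    have hc : IsCounitLeft (cop k U) (cou k U) :=
      (isCompatible_cop (BialgHom.id k U)).counitLeft
    rw [hR.eps_left, one_mul, mul_one, pair_comp_ptL_ptR, conv_eps_left hc, conv_eps_left hc,
      pair_comp_ptL_ptR, ← h2, conv_apply, h1] at h3
    exact h3
  counitRight x := by
    have h1 : pair LinearMap.id (epsPoint (U ⊗[k] U) (cou k (U ⊗[k] U))) =
        (TensorProduct.rid k (U ⊗[k] U)).toLinearMap ∘ₗ
          (cou k (U ⊗[k] U)).toLinearMap.lTensor _ := by
      ext; simp [Algebra.algebraMap_eq_smul_one]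
    have h2 : epsPoint (U ⊗[k] U) (cou k (U ⊗[k] U)) =
        pair (epsPoint (U ⊗[k] U) (cou k U)) (epsPoint (U ⊗[k] U) (cou k U)) := by
      ext; simp [Algebra.algebraMap_eq_smul_one, mul_comm, smul_smul]
    have h3 := conv_twistedComul (R := R) (LinearMap.id ∘ₗ ptL k U U) (LinearMap.id ∘ₗ ptR k U U)
      (epsPoint (U ⊗[k] U) (cou k U)) (epsPoint (U ⊗[k] U) (cou k U)) x
    have hc : IsCounitRight (cop k U) (cou k U) :=
      (isCompatible_cop (BialgHom.id k U)).counitRight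
    rw [hR.eps_right, one_mul, mul_one, pair_comp_ptL_ptR, conv_eps_right hc, conv_eps_right hc,
      pair_comp_ptL_ptR, ← h2, conv_apply, h1] at h3
    exact h3
  comulHom h := by
    have hc := isCompatible_cop j
    have h1 := conv_twistedComul_comul hR (ptL k (U ⊗[k] U) (U ⊗[k] U) ∘ₗ ptL k U U)
      (ptL k (U ⊗[k] U) (U ⊗[k] U) ∘ₗ ptR k U U) (ptR k (U ⊗[k] U) (U ⊗[k] U) ∘ₗ ptL k U U)
      (ptR k (U ⊗[k] U) (U ⊗[k] U) ∘ₗ ptR k U U) (j h)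
    have h2 : conv (twistedComul R) (ptL k (U ⊗[k] U) (U ⊗[k] U)) (ptR k _ _) =
        (twistedComul R).toLinearMap := by rw [conv, pair_ptL_ptR]; rfl
    have h3 : ∀ a b : U →ₗ[k] (U ⊗[k] U) ⊗[k] (U ⊗[k] U), conv (cop k U) a b (j h) =
        pair (a ∘ₗ (j : H →ₐ[k] U).toLinearMap) (b ∘ₗ (j : H →ₐ[k] U).toLinearMap)
          (Coalgebra.comul (R := k) h) := by
      intro a b
      rw [pair_comp]
      exact congrArg (pair a b) (hc.comulHom h)
    rw [pair_comp_ptL_ptR, pair_comp_ptL_ptR, h2, h3, conv, conv, pair_comp_ptL_ptR,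
      pair_comp_ptL_ptR] at h1
    refine h1.trans ?_
    have h4 : pair ((ptL k (U ⊗[k] U) (U ⊗[k] U) ∘ₗ (cop k U).toLinearMap) ∘ₗ
        (j : H →ₐ[k] U).toLinearMap) ((ptR k (U ⊗[k] U) (U ⊗[k] U) ∘ₗ (cop k U).toLinearMap) ∘ₗ
        (j : H →ₐ[k] U).toLinearMap) = TensorProduct.map (diagIncl (j : H →ₐ[k] U)).toLinearMap
        (diagIncl (j : H →ₐ[k] U)).toLinearMap := by
      ext; simp [diagIncl]
    rw [h4]
  counitHom h := by
    have hc := isCompatible_cop j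
    rw [← hc.counitHom h]
    have h1 : conv (cop k U) (epsPoint k (cou k U)) (epsPoint k (cou k U)) =
        (cou k (U ⊗[k] U)).toLinearMap ∘ₗ (cop k U).toLinearMap := by
      rw [conv]
      congr 1
      ext; simp [mul_comm]
    rw [conv_eps_left hc.counitLeft] at h1
    exact (LinearMap.congr_fun h1 (j h)).symm

end Twisted

/-! ### The composite twist is a dynamical twist -/

section CompositeTwist

variable {k H L U E : Type*} [Field k] [Ring H] [Bialgebra k H] [Ring L] [Algebra k L]
  [Ring U] [HopfAlgebra k U] [Ring E] [Algebra k E] (𝔏 : BaseAlgebra k H L)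
  (j : H →ₐc[k] U) (R : (U ⊗[k] U)ˣ) (F : ((U ⊗[k] U) ⊗[k] L)ˣ) (z : (U ⊗[k] L)ˣ)

/-- `F_{(12)(34)}` composed with the coboundary twist generated by `F`. -/
def innerTwist : (((U ⊗[k] U) ⊗[k] (U ⊗[k] U)) ⊗[k] L)ˣ :=
  gaugeUnit 𝔏 (twistedComul R) (diagIncl (j : H →ₐ[k] U)) F
    (Units.map (Algebra.TensorProduct.map (Algebra.TensorProduct.map (cop k U) (cop k U))
      (AlgHom.id k L)).toMonoidHom F)

/-- The composite twist, as a unit. -/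
def compositeUnit : (((U ⊗[k] U) ⊗[k] (U ⊗[k] U)) ⊗[k] L)ˣ :=
  gaugeUnit 𝔏 (twistedComul R) (diagIncl (j : H →ₐ[k] U))
    (Units.map (𝔏.attach (A := U) (j : H →ₐ[k] U)).toMonoidHom z) (innerTwist 𝔏 j R F)

variable {𝔏 j R F z} (hR : IsUniversalRMatrix R) (hF : IsDynamicalTwist (j : H →ₐ[k] U) 𝔏 F)
include hR hF

/-- `F_{(12)(34)}` is the image of the twist `F` under the bialgebra map `Δ`, and the gauge element
`F` is weakly invariant with counit `1`. -/
theorem isWeakTwist_innerTwist : IsWeakTwist 𝔏 (twistedComul R) (cou k (U ⊗[k] U))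
    (diagIncl (j : H →ₐ[k] U)) (innerTwist 𝔏 j R F) := by
  have hc := isCompatible_cop j
  have hw := hF.isWeakTwist
  have hB := isCompatible_twistedComul hR (BialgHom.id k U)
  refine IsWeakTwist.gauge (isCompatible_twistedComul hR j) ?_ hw.invariant ?_
  · exact hw.map (f := cop k U) (fun x => hB.comulHom x) (fun x => hB.counitHom x)
  · have h1 : epsPoint L (cou k (U ⊗[k] U)) =
        pair (epsPoint L (cou k U)) (epsPoint L (cou k U)) := by
      ext; simp [Algebra.algebraMap_eq_smul_one, mul_comm, smul_smul]
    rw [h1]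
    exact hw.eps_left (epsPoint L (cou k U)) LinearMap.id

theorem isWeakTwist_compositeUnit (hγ : Function.Bijective (HopfAlgebra.antipode k (A := U)))
    (hz : (z : U ⊗[k] L) = zeta hγ F) : IsWeakTwist 𝔏 (twistedComul R) (cou k (U ⊗[k] U))
    (diagIncl (j : H →ₐ[k] U)) (compositeUnit 𝔏 j R F z) := by
  have hc := isCompatible_cop j
  have hw := hF.isWeakTwist
  have hzi := isWeakInvariant_zeta hγ hF
  rw [← hz] at hzi
  refine IsWeakTwist.gauge (isCompatible_twistedComul hR j) (isWeakTwist_innerTwist hR hF)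
    (fun ν => ?_) ?_
  · have e1 : 𝔏.dyn (diagIncl (j : H →ₐ[k] U)) (ptL k (U ⊗[k] U) L) (ptR k (U ⊗[k] U) L) =
        𝔏.dyn (j : H →ₐ[k] U) (conv (cop k U) (ptL k (U ⊗[k] U) L ∘ₗ ptL k U U)
          (ptL k (U ⊗[k] U) L ∘ₗ ptR k U U)) (ptR k (U ⊗[k] U) L) := by
      rw [diagIncl, 𝔏.dyn_comp, conv, pair_comp_ptL_ptR]
    rw [e1, ← 𝔏.dyn_assoc hc.comulHom]
    have e2 : ((Units.map (𝔏.attach (A := U) (j : H →ₐ[k] U)).toMonoidHom z :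
        ((U ⊗[k] U) ⊗[k] L)ˣ) : (U ⊗[k] U) ⊗[k] L) =
        pair (ptL k (U ⊗[k] U) L ∘ₗ ptL k U U) (𝔏.dyn (j : H →ₐ[k] U)
          (ptL k (U ⊗[k] U) L ∘ₗ ptR k U U) (ptR k (U ⊗[k] U) L)) (z : U ⊗[k] L) := by
      rw [← 𝔏.pair_attach, tri_pt]
      rfl
    rw [e2]
    have := hzi.commuting (ptL k (U ⊗[k] U) L ∘ₗ ptL k U U) (𝔏.dyn (j : H →ₐ[k] U)
          (ptL k (U ⊗[k] U) L ∘ₗ ptR k U U) (ptR k (U ⊗[k] U) L))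
    exact commute_cst _ _ _
  · have h1 : epsPoint L (cou k (U ⊗[k] U)) =
        pair (epsPoint L (cou k U)) (epsPoint L (cou k U)) := by
      ext; simp [Algebra.algebraMap_eq_smul_one, mul_comm, smul_smul]
    rw [h1]
    refine (𝔏.pair_attach (j : H →ₐ[k] U) _ _ _ _).trans ?_
    rw [𝔏.dyn_eps hc.counitHom, hz]
    -- The counit is invariant under `γ⁻¹`, so the counit of `ζ` is that of `F⁻¹`.
    have h2 := pair_zeta_apply (F := F) hγ (epsPoint (Module.End k L) (cou k U))
      (epsPoint (Module.End k L) (cou k U)) (lp LinearMap.id) 1 (fun x => by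
        have := HopfAlgebra.counit_antipode (R := k) (antiInv hγ x)
        rw [antipode_antiInv] at this
        simp [this])
    rw [hw.eps_left_inv (epsPoint (Module.End k L) (cou k U)) (lp LinearMap.id)] at h2
    have h3 : epsPoint (Module.End k L) (cou k U) = lp (epsPoint L (cou k U)) := by
      ext; simp [Algebra.algebraMap_eq_smul_one]
    rw [h3, pair_lp, lp_apply, mul_one] at h2
    exact h2

end CompositeTwist

/-! ## The composite twist at points -/

section CompositePoints

variable {k H L U E : Type*} [Field k] [Ring H] [Bialgebra k H] [Ring L] [Algebra k L]
  [Ring U] [HopfAlgebra k U] [Ring E] [Algebra k E] {𝔏 : BaseAlgebra k H L}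
  {j : H →ₐc[k] U} {R : (U ⊗[k] U)ˣ} {F : ((U ⊗[k] U) ⊗[k] L)ˣ} {z : (U ⊗[k] L)ˣ}
  (hR : IsUniversalRMatrix R) (hF : IsDynamicalTwist (j : H →ₐ[k] U) 𝔏 F)
  (a b c d : U →ₗ[k] E) (l : L →ₗ[k] E) [IsPoint a] [IsPoint b] [IsPoint c] [IsPoint d] [IsPoint l]
  [Commuting a b] [Commuting a c] [Commuting a d] [Commuting b c] [Commuting b d] [Commuting c d]
  [Commuting a l] [Commuting b l] [Commuting c l] [Commuting d l]

omit [IsPoint l] [Commuting a l] [Commuting d l] in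
theorem pair_conv_twistedComul (t : (U ⊗[k] U) ⊗[k] L) :
    pair (conv (twistedComul R) (pair a b) (pair c d)) l t =
      pair b c (↑R⁻¹) * tri (conv (cop k U) a c) (conv (cop k U) b d) l t *
        pair b c (R : U ⊗[k] U) := by
  have h := pair_semiconj (e := pair b c (R : U ⊗[k] U)) (conv_twistedComul (R := R) a b c d)
    (fun y => commute_cst _ l y) t
  have := congrArg (fun e => pair b c (↑R⁻¹) * e) h
  rw [IsPoint.inv_mul_cancel] at this
  rw [this, mul_assoc]

theorem dyn_diagIncl_pair (f : H →ₐ[k] U) (a b : U →ₗ[k] E) (l : L →ₗ[k] E) :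
    𝔏.dyn (diagIncl f) (pair a b) l = 𝔏.dyn f (conv (cop k U) a b) l := rfl

theorem tri_gaugeTwist_twistedComul (ξ : ((U ⊗[k] U) ⊗[k] L)ˣ)
    (Φ : ((U ⊗[k] U) ⊗[k] (U ⊗[k] U)) ⊗[k] L) :
    tri (pair a b) (pair c d) l (gaugeTwist 𝔏 (twistedComul R) (diagIncl (j : H →ₐ[k] U)) ξ Φ) =
      pair b c (↑R⁻¹) * (tri (conv (cop k U) a c) (conv (cop k U) b d) l (↑ξ⁻¹) *
        (pair b c (R : U ⊗[k] U) * (tri (pair a b) (pair c d) l Φ *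
          (tri a b (𝔏.dyn (j : H →ₐ[k] U) (conv (cop k U) c d) l) (ξ : (U ⊗[k] U) ⊗[k] L) *
            tri c d l (ξ : (U ⊗[k] U) ⊗[k] L))))) := by
  rw [tri_gaugeTwist, pair_conv_twistedComul, dyn_diagIncl_pair]
  simp only [mul_assoc]

include hR hF

/-- Gauging by `F` removes all coproducts and leaves `R_{bc}⁻¹ F_{ac|bd} F_{bd} R̃_{bc|d}`. The
cocycle equation merges the factors at `a, b | c, d`, the value `R_{bc}` interchanges `b` and `c`,
and the cocycle equation splits the result at `a, c | b, d`; the mismatch between the orders `bc`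
and `cb` is `R̃`. -/
theorem tri_innerTwist : tri (pair a b) (pair c d) l
      (innerTwist 𝔏 j R F : ((U ⊗[k] U) ⊗[k] (U ⊗[k] U)) ⊗[k] L) =
    pair b c (↑R⁻¹) * (tri a c (𝔏.dyn (j : H →ₐ[k] U) (conv (cop k U) b d) l)
        (F : (U ⊗[k] U) ⊗[k] L) * (tri b d l (F : (U ⊗[k] U) ⊗[k] L) *
          tri b c (𝔏.dyn (j : H →ₐ[k] U) d l) (dynR R F))) := by
  have hw := hF.isWeakTwist
  have hc := isCompatible_cop j
  have hA := fun a b c : U →ₗ[k] E => conv_assoc hc.coassoc a b c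
  have e0 : tri (pair a b) (pair c d) l (Algebra.TensorProduct.map
      (Algebra.TensorProduct.map (cop k U) (cop k U)) (AlgHom.id k L)
        (F : (U ⊗[k] U) ⊗[k] L)) = tri (conv (cop k U) a b) (conv (cop k U) c d) l
        (F : (U ⊗[k] U) ⊗[k] L) := tri_map_map _ _ _ _
  rw [innerTwist, coe_gaugeUnit, tri_gaugeTwist_twistedComul]
  refine congrArg (fun e => pair b c (↑R⁻¹) * e) ?_
  refine (congrArg (fun e => _ * (_ * (e * _))) e0).trans ?_
  have e1 := hw.cocycle_points a b (conv (cop k U) c d) l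
  have e2 := hw.cocycle_points b c d l
  have e3 := hw.cocycle_inv_left a c (conv (cop k U) b d) l
  have e4 := hw.cocycle_points c b d l
  have e5 : pair b c (R : U ⊗[k] U) * tri a (conv (cop k U) b (conv (cop k U) c d)) l
      (F : (U ⊗[k] U) ⊗[k] L) = tri a (conv (cop k U) c (conv (cop k U) b d)) l
      (F : (U ⊗[k] U) ⊗[k] L) * pair b c (R : U ⊗[k] U) := by
    rw [← hA, ← hA]
    exact tri_semiconj (fun y => commute_cst _ a y)
      (conv_semiconj (hR.conv_swap b c) (fun y => commute_cst _ d y))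
      (fun y => commute_cst _ l y) _
  have e6 : pair b c (R : U ⊗[k] U) * tri (conv (cop k U) b c) d l
      (F : (U ⊗[k] U) ⊗[k] L) = tri (conv (cop k U) c b) d l
      (F : (U ⊗[k] U) ⊗[k] L) * pair b c (R : U ⊗[k] U) :=
    tri_semiconj (hR.conv_swap b c) (fun y => commute_cst _ d y)
      (fun y => commute_cst _ l y) _
  have n1 := IsPoint.map_inv_mul (tri c (conv (cop k U) b d) l) F
  have n2 := IsPoint.map_mul_inv (tri c b (𝔏.dyn (j : H →ₐ[k] U) d l)) F
  rw [tri_dynR]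
  generalize tri (conv (cop k U) a c) (conv (cop k U) b d) l (↑F⁻¹) = f1 at *
  generalize tri (conv (cop k U) a b) (conv (cop k U) c d) l (F : (U ⊗[k] U) ⊗[k] L) = f2 at *
  generalize tri a b (𝔏.dyn (j : H →ₐ[k] U) (conv (cop k U) c d) l) (F : (U ⊗[k] U) ⊗[k] L) = f3 at *
  generalize tri c d l (F : (U ⊗[k] U) ⊗[k] L) = f4 at *
  generalize tri a c (𝔏.dyn (j : H →ₐ[k] U) (conv (cop k U) b d) l) (F : (U ⊗[k] U) ⊗[k] L) = f5 at *
  generalize tri b d l (F : (U ⊗[k] U) ⊗[k] L) = f6 at *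
  generalize tri c b (𝔏.dyn (j : H →ₐ[k] U) d l) (↑F⁻¹) = f7' at *
  generalize tri c b (𝔏.dyn (j : H →ₐ[k] U) d l) (F : (U ⊗[k] U) ⊗[k] L) = f7 at *
  generalize tri b c (𝔏.dyn (j : H →ₐ[k] U) d l) (F : (U ⊗[k] U) ⊗[k] L) = f8 at *
  generalize tri a (conv (cop k U) b (conv (cop k U) c d)) l (F : (U ⊗[k] U) ⊗[k] L) = g1 at *
  generalize tri a (conv (cop k U) c (conv (cop k U) b d)) l (F : (U ⊗[k] U) ⊗[k] L) = g2 at *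
  generalize tri b (conv (cop k U) c d) l (F : (U ⊗[k] U) ⊗[k] L) = g3 at *
  generalize tri c (conv (cop k U) b d) l (F : (U ⊗[k] U) ⊗[k] L) = g4 at *
  generalize tri c (conv (cop k U) b d) l (↑F⁻¹) = g4' at *
  generalize tri (conv (cop k U) b c) d l (F : (U ⊗[k] U) ⊗[k] L) = g5 at *
  generalize tri (conv (cop k U) c b) d l (F : (U ⊗[k] U) ⊗[k] L) = g6 at *
  generalize pair b c (R : U ⊗[k] U) = r at *
  calc f1 * (r * (f2 * (f3 * f4))) = f1 * (r * (g1 * (g3 * f4))) := by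
        rw [← mul_assoc f2, e1, mul_assoc]
    _ = f1 * ((r * g1) * (g5 * f8)) := by rw [← e2, mul_assoc]
    _ = (f1 * g2) * ((r * g5) * f8) := by rw [e5]; simp only [mul_assoc]
    _ = f5 * (g4' * (g6 * (r * f8))) := by rw [e3, e6]; simp only [mul_assoc]
    _ = f5 * (g4' * (g6 * (f7 * f7' * (r * f8)))) := by rw [n2, one_mul]
    _ = f5 * (g4' * ((g6 * f7) * (f7' * (r * f8)))) := by simp only [mul_assoc]
    _ = f5 * ((g4' * g4) * (f6 * (f7' * (r * f8)))) := by rw [e4]; simp only [mul_assoc]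
    _ = _ := by rw [n1, one_mul]; simp only [mul_assoc]

theorem tri_compositeUnit : tri (pair a b) (pair c d) l
      (compositeUnit 𝔏 j R F z : ((U ⊗[k] U) ⊗[k] (U ⊗[k] U)) ⊗[k] L) =
    pair b c (↑R⁻¹) * (pair (conv (cop k U) a c) (𝔏.dyn (j : H →ₐ[k] U) (conv (cop k U) b d) l)
        (↑z⁻¹) * (tri a c (𝔏.dyn (j : H →ₐ[k] U) (conv (cop k U) b d) l)
        (F : (U ⊗[k] U) ⊗[k] L) * (tri b d l (F : (U ⊗[k] U) ⊗[k] L) *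
          (tri b c (𝔏.dyn (j : H →ₐ[k] U) d l) (dynR R F) *
          (pair a (𝔏.dyn (j : H →ₐ[k] U) b (𝔏.dyn (j : H →ₐ[k] U) (conv (cop k U) c d) l))
            (z : U ⊗[k] L) * pair c (𝔏.dyn (j : H →ₐ[k] U) d l) (z : U ⊗[k] L)))))) := by
  have hat : ∀ (a b : U →ₗ[k] E) (l : L →ₗ[k] E) (z : (U ⊗[k] L)ˣ), tri a b l
      ((Units.map (𝔏.attach (A := U) (j : H →ₐ[k] U)).toMonoidHom z :
        ((U ⊗[k] U) ⊗[k] L)ˣ) : (U ⊗[k] U) ⊗[k] L) =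
      pair a (𝔏.dyn (j : H →ₐ[k] U) b l) (z : U ⊗[k] L) :=
    fun a b l z => 𝔏.pair_attach (j : H →ₐ[k] U) a b l (z : U ⊗[k] L)
  rw [compositeUnit, coe_gaugeUnit, tri_gaugeTwist_twistedComul, ← map_inv, hat, hat, hat,
    tri_innerTwist hR hF]
  simp only [mul_assoc, IsPoint.mul_inv_cancel]

/-- The key formula. The factor on the right is the one for which `dynR_zeta` collapses the trailing
`R̃_{bc|d}` and `ζ` of `Υ` into a single value of `ζ`. Moved in front of `F_{bd}`, the two remaining
values of `ζ` complete the gauge transformation of `F` at `a, c`, with the `L`-point shifted by `b`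
and `d`. -/
theorem tri_compositeUnit_mul (hγ : Function.Bijective (HopfAlgebra.antipode k (A := U)))
    (hz : (z : U ⊗[k] L) = zeta hγ F) : tri (pair a b) (pair c d) l
      (compositeUnit 𝔏 j R F z : ((U ⊗[k] U) ⊗[k] (U ⊗[k] U)) ⊗[k] L) *
      tri (lp b) (rp hγ c) (lp (𝔏.dyn (j : H →ₐ[k] U) (conv (cop k U) c d) l)) (dynR R F) 1 =
    pair b c (↑R⁻¹) * (tri a c (𝔏.dyn (j : H →ₐ[k] U) (conv (cop k U) b d) l)
        (gaugeTwist 𝔏 (cop k U) (j : H →ₐ[k] U) z (F : (U ⊗[k] U) ⊗[k] L)) *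
      tri b d l (F : (U ⊗[k] U) ⊗[k] L)) := by
  have hw := hF.isWeakTwist
  have hc := isCompatible_cop j
  have hda : ∀ (a b : U →ₗ[k] E) (l : L →ₗ[k] E), 𝔏.dyn (j : H →ₐ[k] U) (conv (cop k U) a b) l =
    𝔏.dyn (j : H →ₐ[k] U) a (𝔏.dyn (j : H →ₐ[k] U) b l) :=
    fun a b l => (𝔏.dyn_assoc hc.comulHom a b l).symm
  -- Moving `R̃_{bc}` past `ζ(a, ·)` exchanges `b` and `c` in the shifted point, by `dynR_swap`.
  have e1 : tri b c (𝔏.dyn (j : H →ₐ[k] U) d l) (dynR R F) *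
      pair a (𝔏.dyn (j : H →ₐ[k] U) b (𝔏.dyn (j : H →ₐ[k] U) (conv (cop k U) c d) l))
            (z : U ⊗[k] L) =
      pair a (𝔏.dyn (j : H →ₐ[k] U) c (𝔏.dyn (j : H →ₐ[k] U) (conv (cop k U) b d) l))
            (z : U ⊗[k] L) * tri b c (𝔏.dyn (j : H →ₐ[k] U) d l) (dynR R F) := by
    refine pair_semiconj (fun x => commute_cst _ a x) (fun ν => ?_) _
    have := dynR_swap hR hF b c (𝔏.dyn (j : H →ₐ[k] U) d l) ν
    simpa only [hda] using this
  have e2 := dynR_zeta hγ hF b c (𝔏.dyn (j : H →ₐ[k] U) d l) hR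
  have i1 := hw.commuting b d l
  have e3 : Commute (tri b d l (F : (U ⊗[k] U) ⊗[k] L))
    (pair a (𝔏.dyn (j : H →ₐ[k] U) c (𝔏.dyn (j : H →ₐ[k] U) (conv (cop k U) b d) l))
            (z : U ⊗[k] L)) := commute_cst _ _ _
  have e4 : Commute (tri b d l (F : (U ⊗[k] U) ⊗[k] L))
    (pair c (𝔏.dyn (j : H →ₐ[k] U) (conv (cop k U) b d) l) (z : U ⊗[k] L)) := commute_cst _ _ _
  rw [← hz] at e2
  rw [tri_compositeUnit hR hF, tri_gaugeTwist]
  rw [← hda, ← hda] at e2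
  simp only [mul_assoc] at e2 ⊢
  refine congrArg (fun e => _ * e) ?_
  refine congrArg (fun e => _ * e) ?_
  refine congrArg (fun e => _ * e) ?_
  rw [← mul_assoc (tri b c _ _) (pair a _ _), e1, mul_assoc, e2, ← mul_assoc, e3.eq, mul_assoc,
    e4.eq]

end CompositePoints

/-! ### The two sides of the dynamical reflection equation -/

section Sides

variable {k H L U E : Type*} [Field k] [Ring H] [Bialgebra k H] [Ring L] [Algebra k L]
  [Ring U] [HopfAlgebra k U] [Ring E] [Algebra k E] {𝔏 : BaseAlgebra k H L}
  {j : H →ₐc[k] U} {R : (U ⊗[k] U)ˣ} {F : ((U ⊗[k] U) ⊗[k] L)ˣ} {z : (U ⊗[k] L)ˣ}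
  (hR : IsUniversalRMatrix R) (hF : IsDynamicalTwist (j : H →ₐ[k] U) 𝔏 F)
  (hγ : Function.Bijective (HopfAlgebra.antipode k (A := U))) (hz : (z : U ⊗[k] L) = zeta hγ F)
  (a b c d : U →ₗ[k] E) (l : L →ₗ[k] E) [IsPoint a] [IsPoint b] [IsPoint c] [IsPoint d] [IsPoint l]
  [Commuting a b] [Commuting a c] [Commuting a d] [Commuting b c] [Commuting b d] [Commuting c d]
  [Commuting a l] [Commuting b l] [Commuting c l] [Commuting d l]

/-- `R̃` at the point `(b, c ∘ γ⁻¹, ·)`, where the second leg is on the right. -/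
def dynSideX (𝔏 : BaseAlgebra k H L) (j : H →ₐc[k] U) (R : (U ⊗[k] U)ˣ)
    (F : ((U ⊗[k] U) ⊗[k] L)ˣ)
    (hγ : Function.Bijective (HopfAlgebra.antipode k (A := U))) (b c d : U →ₗ[k] E)
    (l : L →ₗ[k] E) : E :=
  tri (lp b) (rp hγ c) (lp (𝔏.dyn (j : H →ₐ[k] U) (conv (cop k U) c d) l)) (dynR R F) 1

include hR hF hz

/-- Weak invariance of `Υ` lets it pass the outer `R̃` and meet `X`, where the key formula applies.
The factor `R_{bc}⁻¹` then leaves on the left, reordering the shift of `l`, and `F_{bd}` leaves as a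
right multiplication. The outer `R̃` now acts on the gauged twist alone and `dynR_gauge_zeta`
exchanges `a` and `c`. -/
theorem compositeUnit_mul_left : tri (pair a b) (pair c d) l
      (compositeUnit 𝔏 j R F z : ((U ⊗[k] U) ⊗[k] (U ⊗[k] U)) ⊗[k] L) *
      tri (rp hγ c) (rp hγ a) (lp (𝔏.dyn (j : H →ₐ[k] U) (conv (cop k U) (conv (cop k U) a b)
        (conv (cop k U) c d)) l)) (dynR R F) (dynSideX 𝔏 j R F hγ b c d l) =
    pair b c (↑R⁻¹) * pair c a (R : U ⊗[k] U) *
      (tri c a (𝔏.dyn (j : H →ₐ[k] U) (conv (cop k U) b d) l)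
        (gaugeTwist 𝔏 (cop k U) (j : H →ₐ[k] U) z (F : (U ⊗[k] U) ⊗[k] L)) *
      tri b d l (F : (U ⊗[k] U) ⊗[k] L)) := by
  have hw := hF.isWeakTwist
  have hc := isCompatible_cop j
  have hA := fun a b c : U →ₗ[k] E => conv_assoc hc.coassoc a b c
  have hda : ∀ (a b : U →ₗ[k] E) (l : L →ₗ[k] E), 𝔏.dyn (j : H →ₐ[k] U) (conv (cop k U) a b) l =
    𝔏.dyn (j : H →ₐ[k] U) a (𝔏.dyn (j : H →ₐ[k] U) b l) :=
    fun a b l => (𝔏.dyn_assoc hc.comulHom a b l).symm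
  have hΥ := (isWeakTwist_compositeUnit hR hF hγ hz).commuting (pair a b) (pair c d) l
  have key := tri_compositeUnit_mul hR hF a b c d l hγ hz
  rw [← 𝔏.dyn_assoc (isCompatible_twistedComul hR j).comulHom, dyn_diagIncl_pair,
    dyn_diagIncl_pair, ← hda] at hΥ
  generalize tri (pair a b) (pair c d) l
      (compositeUnit 𝔏 j R F z : ((U ⊗[k] U) ⊗[k] (U ⊗[k] U)) ⊗[k] L) = Y at *
  have h1 : Commute (lp (cst k Y) 1) (tri (rp hγ c) (rp hγ a) (lp (𝔏.dyn (j : H →ₐ[k] U)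
      (conv (cop k U) (conv (cop k U) a b) (conv (cop k U) c d)) l)) (dynR R F)) :=
    tri_semiconj (fun x => Commuting.comm _ _) (fun x => Commuting.comm _ _)
      (fun x => Commuting.comm _ _) _
  have h2 := LinearMap.congr_fun h1.eq (dynSideX 𝔏 j R F hγ b c d l)
  simp only [Module.End.mul_apply, lp_apply, cst, LinearMap.toSpanSingleton_apply, one_smul] at h2
  rw [h2, dynSideX, key]
  clear h2 h1 hΥ key
  have h3 : lp (cst k (pair b c (↑R⁻¹))) 1 * tri (rp hγ c) (rp hγ a) (lp (𝔏.dyn (j : H →ₐ[k] U)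
      (conv (cop k U) (conv (cop k U) a c) (conv (cop k U) b d)) l)) (dynR R F) =
      tri (rp hγ c) (rp hγ a) (lp (𝔏.dyn (j : H →ₐ[k] U)
      (conv (cop k U) (conv (cop k U) a b) (conv (cop k U) c d)) l)) (dynR R F) *
      lp (cst k (pair b c (↑R⁻¹))) 1 := by
    refine tri_semiconj (fun x => Commuting.comm _ _) (fun x => Commuting.comm _ _)
      (fun x => ?_) _
    have h4 := dyn_semiconj (𝔏 := 𝔏) (D := (j : H →ₐ[k] U)) (conv_semiconj (Δ := cop k U)
      (fun y => commute_cst (pair b c (R : U ⊗[k] U)) a y)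
      (conv_semiconj (Δ := cop k U) (hR.conv_swap b c)
      (fun y => commute_cst (pair b c (R : U ⊗[k] U)) d y)))
      (fun y => commute_cst (pair b c (R : U ⊗[k] U)) l y) x
    have h5 := congrArg (fun e => pair b c (↑R⁻¹) * e * pair b c (↑R⁻¹)) h4
    simp only [mul_assoc, IsPoint.inv_mul_cancel, IsPoint.map_mul_inv, mul_one] at h5
    ext e
    simp only [hA] at h5 ⊢
    simp only [Module.End.mul_apply, lp_apply, cst, LinearMap.toSpanSingleton_apply, one_smul]
    rw [← mul_assoc, ← h5, mul_assoc]
  have h6 := LinearMap.congr_fun h3 ((tri a c (𝔏.dyn (j : H →ₐ[k] U) (conv (cop k U) b d) l)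
        (gaugeTwist 𝔏 (cop k U) (j : H →ₐ[k] U) z (F : (U ⊗[k] U) ⊗[k] L)) *
      tri b d l (F : (U ⊗[k] U) ⊗[k] L)))
  simp only [Module.End.mul_apply, lp_apply, cst, LinearMap.toSpanSingleton_apply, one_smul] at h6
  rw [← h6, mul_assoc]
  refine congrArg (fun e => _ * e) ?_
  have h7 : Commute (rmul (cst k (tri b d l (F : (U ⊗[k] U) ⊗[k] L))) 1) (tri (rp hγ c) (rp hγ a) (lp (𝔏.dyn (j : H →ₐ[k] U)
      (conv (cop k U) (conv (cop k U) a c) (conv (cop k U) b d)) l)) (dynR R F)) :=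
    tri_semiconj (fun x => Commuting.comm _ _) (fun x => Commuting.comm _ _)
      (fun x => Commuting.comm _ _) _
  have h8 := LinearMap.congr_fun h7.eq (tri a c (𝔏.dyn (j : H →ₐ[k] U) (conv (cop k U) b d) l)
        (gaugeTwist 𝔏 (cop k U) (j : H →ₐ[k] U) z (F : (U ⊗[k] U) ⊗[k] L)))
  simp only [Module.End.mul_apply, rmul_apply, cst, LinearMap.toSpanSingleton_apply,
    one_smul] at h8
  rw [← h8, hda, dynR_gauge_zeta hγ hF a c _ hR hz, mul_assoc]

/-- After the key formula, `F_{bd} τ = τ F_{db}` cancels the factor `F_{db}⁻¹` of `R̃_{bd}`. The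
flip `τ` and then `R_{bd}` move to the left of the gauged twist, which puts its legs into the order
`c, a` and restores the shift by `b, d`. The trailing factor is therefore the same as on the left
hand side. -/
theorem compositeUnit_mul_right (τ : E) (ha : ∀ x, τ * c x = a x * τ) (hc' : ∀ x, τ * a x = c x * τ)
    (hb : ∀ x, τ * b x = d x * τ) (hd : ∀ x, τ * d x = b x * τ) (hl : ∀ x, τ * l x = l x * τ) :
    tri (pair a b) (pair c d) l
      (compositeUnit 𝔏 j R F z : ((U ⊗[k] U) ⊗[k] (U ⊗[k] U)) ⊗[k] L) *
      (dynSideX 𝔏 j R F hγ b c d l * τ * tri b d l (dynR R F)) =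
    pair b c (↑R⁻¹) * τ * pair b d (R : U ⊗[k] U) *
      (tri c a (𝔏.dyn (j : H →ₐ[k] U) (conv (cop k U) b d) l)
        (gaugeTwist 𝔏 (cop k U) (j : H →ₐ[k] U) z (F : (U ⊗[k] U) ⊗[k] L)) *
      tri b d l (F : (U ⊗[k] U) ⊗[k] L)) := by
  have hw := hF.isWeakTwist
  have hc := isCompatible_cop j
  have key := tri_compositeUnit_mul hR hF a b c d l hγ hz
  rw [← dynSideX] at key
  rw [← mul_assoc, ← mul_assoc, key, tri_dynR]
  have e1 : τ * tri c a (𝔏.dyn (j : H →ₐ[k] U) (conv (cop k U) d b) l)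
        (gaugeTwist 𝔏 (cop k U) (j : H →ₐ[k] U) z (F : (U ⊗[k] U) ⊗[k] L)) =
      tri a c (𝔏.dyn (j : H →ₐ[k] U) (conv (cop k U) b d) l)
        (gaugeTwist 𝔏 (cop k U) (j : H →ₐ[k] U) z (F : (U ⊗[k] U) ⊗[k] L)) * τ :=
    tri_semiconj ha hc' (dyn_semiconj (conv_semiconj hd hb) hl) _
  have e2 : τ * tri d b l (F : (U ⊗[k] U) ⊗[k] L) = tri b d l (F : (U ⊗[k] U) ⊗[k] L) * τ :=
    tri_semiconj hd hb hl _
  have e3 : pair b d (R : U ⊗[k] U) * tri c a (𝔏.dyn (j : H →ₐ[k] U) (conv (cop k U) b d) l)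
        (gaugeTwist 𝔏 (cop k U) (j : H →ₐ[k] U) z (F : (U ⊗[k] U) ⊗[k] L)) =
      tri c a (𝔏.dyn (j : H →ₐ[k] U) (conv (cop k U) d b) l)
        (gaugeTwist 𝔏 (cop k U) (j : H →ₐ[k] U) z (F : (U ⊗[k] U) ⊗[k] L)) *
        pair b d (R : U ⊗[k] U) :=
    tri_semiconj (fun y => commute_cst _ c y) (fun y => commute_cst _ a y)
      (dyn_semiconj (hR.conv_swap b d) (fun y => commute_cst _ l y)) _
  have n1 := IsPoint.mul_inv_cancel (tri d b l) F
  simp only [mul_assoc]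
  refine congrArg (fun e => _ * e) ?_
  rw [← mul_assoc (tri b d l _) τ, ← e2]
  simp only [mul_assoc]
  rw [n1, ← mul_assoc _ τ, ← e1, mul_assoc, ← mul_assoc (tri c a _ _), ← e3, mul_assoc]

end Sides

/-! ## Twisted products -/

section Intertwine

variable {k : Type*} [Field k] {N N' V W X : Type*} [AddCommGroup N] [Module k N]
  [AddCommGroup N'] [Module k N'] [AddCommGroup V] [Module k V] [AddCommGroup W] [Module k W]
  [AddCommGroup X] [Module k X] {μ : N →ₗ[k] N'}

/-- A linear map intertwining points intertwines all tensors evaluated at them. It transports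
formulas along multiplication maps, shifts and evaluations that are not algebra homomorphisms. -/
theorem pair_intertwine {f : V →ₗ[k] Module.End k N} {f' : V →ₗ[k] Module.End k N'}
    {g : W →ₗ[k] Module.End k N} {g' : W →ₗ[k] Module.End k N'}
    (hf : ∀ x n, μ (f x n) = f' x (μ n)) (hg : ∀ x n, μ (g x n) = g' x (μ n)) (t : V ⊗[k] W)
    (n : N) : μ (pair f g t n) = pair f' g' t (μ n) := by
  induction t with
  | zero => simp
  | add s t hs ht => simp only [map_add, LinearMap.add_apply, hs, ht]
  | tmul x y => simp [hf, hg]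

theorem intertwine_of_comp {p : Module.End k N} {q : Module.End k N'} (h : μ ∘ₗ p = q ∘ₗ μ) (n : N) :
    μ (p n) = q (μ n) := LinearMap.congr_fun h n

theorem tri_intertwine {f : V →ₗ[k] Module.End k N} {f' : V →ₗ[k] Module.End k N'}
    {g : W →ₗ[k] Module.End k N} {g' : W →ₗ[k] Module.End k N'}
    {h : X →ₗ[k] Module.End k N} {h' : X →ₗ[k] Module.End k N'}
    (hf : ∀ x n, μ (f x n) = f' x (μ n)) (hg : ∀ x n, μ (g x n) = g' x (μ n))
    (hh : ∀ x n, μ (h x n) = h' x (μ n)) (t : (V ⊗[k] W) ⊗[k] X)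
    (n : N) : μ (tri f g h t n) = tri f' g' h' t (μ n) :=
  pair_intertwine (pair_intertwine hf hg) hh t n

theorem dyn_intertwine {H L B : Type*} [Ring H] [Bialgebra k H] [Ring L] [Algebra k L] [Ring B]
    [Algebra k B] {𝔏 : BaseAlgebra k H L} {D : H →ₐ[k] B}
    {f : B →ₗ[k] Module.End k N} {f' : B →ₗ[k] Module.End k N'}
    {g : L →ₗ[k] Module.End k N} {g' : L →ₗ[k] Module.End k N'}
    (hf : ∀ x n, μ (f x n) = f' x (μ n)) (hg : ∀ x n, μ (g x n) = g' x (μ n)) (ν : L)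
    (n : N) : μ (𝔏.dyn D f g ν n) = 𝔏.dyn D f' g' ν (μ n) :=
  pair_intertwine (f := f ∘ₗ D.toLinearMap) (f' := f' ∘ₗ D.toLinearMap) (fun _ => hf _) hg _ n

theorem conv_intertwine {A : Type*} [Ring A] [Algebra k A] {Δ : A →ₐ[k] A ⊗[k] A}
    {f : A →ₗ[k] Module.End k N} {f' : A →ₗ[k] Module.End k N'}
    {g : A →ₗ[k] Module.End k N} {g' : A →ₗ[k] Module.End k N'}
    (hf : ∀ x n, μ (f x n) = f' x (μ n)) (hg : ∀ x n, μ (g x n) = g' x (μ n)) (x : A)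
    (n : N) : μ (conv Δ f g x n) = conv Δ f' g' x (μ n) := pair_intertwine hf hg _ n

theorem pair_on2 (f : V →ₗ[k] Module.End k N') (g : W →ₗ[k] Module.End k N') :
    pair (on2 N f) (on2 N g) = on2 N (pair f g) :=
  (algHom_comp_pair (Module.End.lTensorAlgHom k N' N) f g).symm

theorem tri_on2 (f : V →ₗ[k] Module.End k N') (g : W →ₗ[k] Module.End k N')
    (h : X →ₗ[k] Module.End k N') :
    tri (on2 N f) (on2 N g) (on2 N h) = on2 N (tri f g h) := by
  rw [tri, pair_on2, pair_on2]

theorem on1_map_one {A : Type*} [Ring A] [Algebra k A] (f : A →ₗ[k] Module.End k N) [IsPoint f] :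
    on1 N' f 1 = 1 := IsPoint.map_one

theorem on2_map_one {A : Type*} [Ring A] [Algebra k A] (f : A →ₗ[k] Module.End k N') [IsPoint f] :
    on2 N f 1 = 1 := IsPoint.map_one

theorem dyn_on2 {H L B : Type*} [Ring H] [Bialgebra k H] [Ring L] [Algebra k L] [Ring B]
    [Algebra k B] (𝔏 : BaseAlgebra k H L) (D : H →ₐ[k] B) (f : B →ₗ[k] Module.End k N')
    (g : L →ₗ[k] Module.End k N') : 𝔏.dyn D (on2 N f) (on2 N g) = on2 N (𝔏.dyn D f g) :=
  (algHom_comp_dyn 𝔏 (Module.End.lTensorAlgHom k N' N) D f g).symm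

end Intertwine

/-! ### Left multiplications in the twisted algebra -/

section TwistedProduct

variable {k H L B A : Type*} [Field k] [Ring H] [Bialgebra k H] [Ring L] [Algebra k L]
  [Ring B] [Algebra k B] [Ring A] [Algebra k A] (𝔏 : BaseAlgebra k H L)

/-- `a ⊗ b ⊗ n ↦ a b ⊗ n`. -/
def mulFst (k A N : Type*) [Field k] [Ring A] [Algebra k A] [AddCommGroup N] [Module k N] :
    A ⊗[k] (A ⊗[k] N) →ₗ[k] A ⊗[k] N :=
  (LinearMap.mul' k A).rTensor N ∘ₗ (TensorProduct.assoc k A A N).symm.toLinearMap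

@[simp] theorem mulFst_tmul {N : Type*} [AddCommGroup N] [Module k N] (a b : A) (n : N) :
    mulFst k A N (a ⊗ₜ (b ⊗ₜ n)) = (a * b) ⊗ₜ n := by simp [mulFst]

/-- Left multiplication in `L`, as a point. -/
abbrev ptMul (k L : Type*) [Field k] [Ring L] [Algebra k L] : L →ₗ[k] Module.End k L :=
  lp LinearMap.id

/-- The operators of left multiplication by `λ ∈ L` on `V ⊗ L` for a representation `V` of `B` :
`λ · (v ⊗ μ) = j(λ⁽¹⁾) v ⊗ λ⁽∞⁾ μ`. -/
def lact {V : Type*} [AddCommGroup V] [Module k V] (D : H →ₐ[k] B)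
    (act : B →ₐ[k] Module.End k V) : L →ₗ[k] Module.End k (V ⊗[k] L) :=
  𝔏.dyn D (on1 L act.toLinearMap) (on2 V (ptMul k L))

instance {V : Type*} [AddCommGroup V] [Module k V] (D : H →ₐ[k] B)
    (act : B →ₐ[k] Module.End k V) : IsPoint (lact 𝔏 D act) :=
  inferInstanceAs (IsPoint (𝔏.dyn D (on1 L act.toLinearMap) (on2 V (ptMul k L))))

/-- The operator by which `Φ ∈ B ⊗ B ⊗ L` acts on `V ⊗ (W ⊗ L)`. -/
def twistOp {V W : Type*} [AddCommGroup V] [Module k V] [AddCommGroup W] [Module k W]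
    (act : B →ₐ[k] Module.End k V) (act' : B →ₐ[k] Module.End k W) :
    (B ⊗[k] B) ⊗[k] L →ₗ[k] Module.End k (V ⊗[k] (W ⊗[k] L)) :=
  tri (on1 (W ⊗[k] L) act.toLinearMap) (on2 V (on1 L act'.toLinearMap))
    (on2 V (on2 W (ptMul k L)))

/-- The operators of left multiplication by `a ⊗ 1` in the twisted product. -/
def leftMul (act : B →ₐ[k] Module.End k A) (Φ : (B ⊗[k] B) ⊗[k] L) :
    A →ₗ[k] Module.End k (A ⊗[k] L) :=
  (TensorProduct.mk k A (A ⊗[k] L)).compr₂ (mulFst k A L ∘ₗ twistOp act act Φ)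

variable (D : H →ₐ[k] B) (act : B →ₐ[k] Module.End k A) (Φ : (B ⊗[k] B) ⊗[k] L)

theorem leftMul_apply (a : A) (t : A ⊗[k] L) :
    leftMul act Φ a t = mulFst k A L (twistOp act act Φ (a ⊗ₜ t)) := rfl

/-- Left multiplication by `a ⊗ l` factors into left multiplications by `a ⊗ 1` and `1 ⊗ l`, since
the extra coaction leg in the definition only moves the point of `L`. Associativity is then examined
for each of the two families separately. -/
theorem twistedMul_tmul_apply (a : A) (l : L) (t : A ⊗[k] L) :
    twistedMul 𝔏 D act Φ (a ⊗ₜ l) t = leftMul act Φ a (lact 𝔏 D act l t) := by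
  have h1 : ∀ (a b : A) (u : (B ⊗[k] B) ⊗[k] L), evalTwist L act (a ⊗ₜ b) u =
      mulFst k A L (twistOp act act u (a ⊗ₜ (b ⊗ₜ 1))) := by
    intro a b u
    induction u with
    | zero => simp
    | add s t hs ht => simp only [map_add, LinearMap.add_apply, hs, ht]
    | tmul p l =>
      induction p with
      | zero => simp
      | add s t hs ht => simp only [TensorProduct.add_tmul, map_add, LinearMap.add_apply, hs, ht]
      | tmul x y => simp [evalTwist_tmul, twistOp]
  induction t with
  | zero => simp
  | add s t hs ht => simp only [map_add, hs, ht]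
  | tmul b m =>
    rw [twistedMul_tmul, h1, leftMul_apply, twistOp, pair_mul, pair_mul, 𝔏.pair_attach, dyn_on2]
    rw [Algebra.TensorProduct.one_def (A := B) (B := B), pair_tmul, pair_tmul, pair_tmul]
    simp only [on1_map_one, on2_map_one, one_mul, Module.End.mul_apply]
    simp [lact]

/-- `a ⊗ l ↦ a ⊗ l · t`. -/
def shift (t : A ⊗[k] L) : A ⊗[k] L →ₗ[k] A ⊗[k] (A ⊗[k] L) :=
  ((lact 𝔏 D act).flip t).lTensor A

@[simp] theorem shift_tmul (t : A ⊗[k] L) (a : A) (l : L) :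
    shift 𝔏 D act t (a ⊗ₜ l) = a ⊗ₜ lact 𝔏 D act l t := rfl

theorem twistedMul_apply (s t : A ⊗[k] L) : twistedMul 𝔏 D act Φ s t =
    mulFst k A L (twistOp act act Φ (shift 𝔏 D act t s)) := by
  induction s with
  | zero => simp
  | add s s' hs hs' => simp only [map_add, LinearMap.add_apply, hs, hs']
  | tmul a l => rw [twistedMul_tmul_apply, shift_tmul, leftMul_apply]

section

variable {N : Type*} [AddCommGroup N] [Module k N] {Δ : B →ₐ[k] B ⊗[k] B} {ε : B →ₐ[k] k}
  {act} (hA : IsModuleAlgebra Δ ε act)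

include hA

/-- The module algebra axiom, in the form needed by `pair_intertwine`: multiplication intertwines
the convolution of the two actions with the action on the product. -/
theorem mulFst_conv (x : B) (n : A ⊗[k] (A ⊗[k] N)) :
    mulFst k A N (conv (E := Module.End k (A ⊗[k] (A ⊗[k] N))) Δ (on1 (A ⊗[k] N) act.toLinearMap) (on2 A (on1 N act.toLinearMap)) x n) =
      on1 N act.toLinearMap x (mulFst k A N n) := by
  induction n with
  | zero => simp
  | add s s' hs hs' => simp only [map_add, hs, hs']
  | tmul a n =>
    induction n with
    | zero => simp
    | add s s' hs hs' => simp only [TensorProduct.tmul_add, map_add, hs, hs']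
    | tmul b n =>
      simp only [mulFst_tmul, on1_apply, conv_apply]
      change _ = act x (a * b) ⊗ₜ n
      rw [hA.act_mul]
      generalize Δ x = t
      induction t with
      | zero => simp
      | add s s' hs hs' => 
        simp only [map_add, LinearMap.add_apply, TensorProduct.add_tmul, hs, hs']
      | tmul x y => simp [tensorAct]

end

theorem mulFst_mulFst {N : Type*} [AddCommGroup N] [Module k N] (n : A ⊗[k] (A ⊗[k] (A ⊗[k] N))) :
    mulFst k A N (mulFst k A (A ⊗[k] N) n) = mulFst k A N ((mulFst k A N).lTensor A n) := by
  have : mulFst k A N ∘ₗ mulFst k A (A ⊗[k] N) = mulFst k A N ∘ₗ (mulFst k A N).lTensor A := by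
    ext; simp [mul_assoc]
  exact LinearMap.congr_fun this n

section

variable {𝔏 D act} {Δ : B →ₐ[k] B ⊗[k] B} {ε : B →ₐ[k] k}
  {Φ : ((B ⊗[k] B) ⊗[k] L)ˣ} (hc : IsCompatible Δ ε D) (hΦ : IsWeakTwist 𝔏 Δ ε D Φ)
  (hA : IsModuleAlgebra Δ ε act)

include hc hΦ hA

/-- Weak invariance of `Φ` moves the iterated coaction of `ν` to its left, and the module algebra
axiom contracts the two `B`-legs. -/
theorem mulFst_twistOp_lact (ν : L) (n : A ⊗[k] (A ⊗[k] L)) :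
    mulFst k A L (twistOp act act (Φ : (B ⊗[k] B) ⊗[k] L)
      (𝔏.dyn (E := Module.End k (A ⊗[k] (A ⊗[k] L))) D (on1 (A ⊗[k] L) act.toLinearMap)
        (on2 A (lact 𝔏 D act)) ν n)) =
    lact 𝔏 D act ν (mulFst k A L (twistOp act act (Φ : (B ⊗[k] B) ⊗[k] L) n)) := by
  have h1 := hΦ.commuting (E := Module.End k (A ⊗[k] (A ⊗[k] L))) (on1 (A ⊗[k] L) act.toLinearMap) (on2 A (on1 L act.toLinearMap))
    (on2 A (on2 A (ptMul k L)))
  have h3 : 𝔏.dyn (E := Module.End k (A ⊗[k] (A ⊗[k] L))) D (on1 (A ⊗[k] L) act.toLinearMap)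
      (on2 A (lact 𝔏 D act)) = 𝔏.dyn D (conv Δ (on1 (A ⊗[k] L) act.toLinearMap)
        (on2 A (on1 L act.toLinearMap))) (on2 A (on2 A (ptMul k L))) := by
    rw [← 𝔏.dyn_assoc hc.comulHom, dyn_on2]
    rfl
  have h2 := (commute_cst (E := Module.End k (A ⊗[k] (A ⊗[k] L)))
    (tri (on1 (A ⊗[k] L) act.toLinearMap) (on2 A (on1 L act.toLinearMap))
      (on2 A (on2 A (ptMul k L))) (Φ : (B ⊗[k] B) ⊗[k] L)) (𝔏.dyn D (conv Δ
        (on1 (A ⊗[k] L) act.toLinearMap) (on2 A (on1 L act.toLinearMap)))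
        (on2 A (on2 A (ptMul k L)))) ν).eq
  rw [h3]
  refine (congrArg (mulFst k A L) (LinearMap.congr_fun h2 n)).trans ?_
  refine dyn_intertwine (mulFst_conv hA) (fun x => intertwine_of_comp ?_) ν _
  ext; simp

theorem lact_mul_leftMul (ν : L) (a : A) :
    lact 𝔏 D act ν * leftMul act (Φ : (B ⊗[k] B) ⊗[k] L) a =
      pair (leftMul act (Φ : (B ⊗[k] B) ⊗[k] L) ∘ₗ (act.comp D).toLinearMap.flip a)
        (lact 𝔏 D act) (𝔏.coact ν) := by
  refine LinearMap.ext fun t => ?_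
  rw [Module.End.mul_apply, leftMul_apply, ← mulFst_twistOp_lact hc hΦ hA, BaseAlgebra.dyn,
    LinearMap.comp_apply, AlgHom.toLinearMap_apply]
  generalize 𝔏.coact ν = u
  induction u with
  | zero => simp
  | add s s' hs hs' => simp only [map_add, LinearMap.add_apply, hs, hs']
  | tmul h l => simp [leftMul_apply]

theorem twistedMul_lact (ν : L) (s t : A ⊗[k] L) :
    twistedMul 𝔏 D act Φ (lact 𝔏 D act ν s) t = lact 𝔏 D act ν (twistedMul 𝔏 D act Φ s t) := by
  rw [twistedMul_apply, twistedMul_apply, ← mulFst_twistOp_lact hc hΦ hA, lact]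
  refine congrArg (fun n => mulFst k A L (twistOp act act (Φ : (B ⊗[k] B) ⊗[k] L) n)) ?_
  refine dyn_intertwine (μ := shift 𝔏 D act t) (fun x n => ?_) (fun x n => ?_) ν s
  · have : shift 𝔏 D act t ∘ₗ on1 L act.toLinearMap x =
        on1 (A ⊗[k] L) act.toLinearMap x ∘ₗ shift 𝔏 D act t := by ext; simp
    exact LinearMap.congr_fun this n
  · have : shift 𝔏 D act t ∘ₗ on2 A (ptMul k L) x =
        on2 A (lact 𝔏 D act) x ∘ₗ shift 𝔏 D act t := by
      ext; simp [IsPoint.map_mul (f := lact 𝔏 D act)]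
    exact LinearMap.congr_fun this n

-- Both sides expand to operators on `A ⊗ (A ⊗ (A ⊗ L))` followed by the threefold multiplication:
-- one is `Φ_{(12)3} Φ_{12|3}`, the other `Φ_{1(23)} Φ_{23}`. The cocycle equation identifies them.
omit hc in
theorem twistedMul_leftMul (a : A) (s t : A ⊗[k] L) :
    twistedMul 𝔏 D act Φ (leftMul act (Φ : (B ⊗[k] B) ⊗[k] L) a s) t =
      leftMul act (Φ : (B ⊗[k] B) ⊗[k] L) a (twistedMul 𝔏 D act Φ s t) := by
  rw [twistedMul_apply, twistedMul_apply, leftMul_apply, leftMul_apply]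
  set a1 := on1 (A ⊗[k] (A ⊗[k] L)) act.toLinearMap
  set a2 := on2 A (on1 (A ⊗[k] L) act.toLinearMap)
  set a3 := on2 A (on2 A (on1 L act.toLinearMap))
  set l := on2 A (on2 A (on2 A (ptMul k L)))
  have e1 : ∀ n, shift 𝔏 D act t (mulFst k A L n) =
      mulFst k A (A ⊗[k] L) ((shift 𝔏 D act t).lTensor A n) := by
    have : shift 𝔏 D act t ∘ₗ mulFst k A L =
      mulFst k A (A ⊗[k] L) ∘ₗ (shift 𝔏 D act t).lTensor A := by ext; simp
    exact LinearMap.congr_fun this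
  have e2 : ∀ n, (shift 𝔏 D act t).lTensor A (twistOp act act (Φ : (B ⊗[k] B) ⊗[k] L) n) =
      tri (E := Module.End k (A ⊗[k] (A ⊗[k] (A ⊗[k] L)))) a1 a2 (𝔏.dyn D a3 l) (Φ : (B ⊗[k] B) ⊗[k] L) ((shift 𝔏 D act t).lTensor A n) := by
    refine tri_intertwine (fun x => intertwine_of_comp ?_) (fun x => intertwine_of_comp ?_)
      (fun x => intertwine_of_comp ?_) _
    · ext; simp [a1]
    · ext; simp [a2]
    · simp only [a3, l, dyn_on2]
      ext
      simp [IsPoint.map_mul (f := lact 𝔏 D act)]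
      rfl
  have e3 : ∀ n, twistOp act act (Φ : (B ⊗[k] B) ⊗[k] L) (mulFst k A (A ⊗[k] L) n) =
      mulFst k A (A ⊗[k] L) (tri (E := Module.End k (A ⊗[k] (A ⊗[k] (A ⊗[k] L)))) (conv Δ a1 a2) a3 l (Φ : (B ⊗[k] B) ⊗[k] L) n) := by
    intro n
    refine (tri_intertwine (mulFst_conv hA)
      (fun x => intertwine_of_comp ?_) (fun x => intertwine_of_comp ?_) _ n).symm
    · ext; simp [a3]
    · ext; simp [l]
  have e4 : ∀ n, twistOp act act (Φ : (B ⊗[k] B) ⊗[k] L) ((mulFst k A L).lTensor A n) =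
      (mulFst k A L).lTensor A (tri (E := Module.End k (A ⊗[k] (A ⊗[k] (A ⊗[k] L)))) a1 (conv Δ a2 a3) l (Φ : (B ⊗[k] B) ⊗[k] L) n) := by
    intro n
    refine (tri_intertwine (fun x => intertwine_of_comp ?_)
      (fun x => intertwine_of_comp ?_) (fun x => intertwine_of_comp ?_) _ n).symm
    · ext; simp [a1]
    · simp only [a2, a3, conv_on2]
      refine TensorProduct.ext' fun a n => ?_
      simp [mulFst_conv hA]
    · ext; simp [l]
  have e5 : ∀ n, a ⊗ₜ twistOp act act (Φ : (B ⊗[k] B) ⊗[k] L) n =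
      tri (E := Module.End k (A ⊗[k] (A ⊗[k] (A ⊗[k] L)))) a2 a3 l (Φ : (B ⊗[k] B) ⊗[k] L) (a ⊗ₜ n) := by
    intro n
    simp only [a2, a3, l, tri_on2]
    rfl
  have h := LinearMap.congr_fun (hΦ.cocycle_points (E := Module.End k (A ⊗[k] (A ⊗[k] (A ⊗[k] L)))) a1 a2 a3 l) (a ⊗ₜ shift 𝔏 D act t s)
  rw [Module.End.mul_apply, Module.End.mul_apply] at h
  rw [e1, e2, LinearMap.lTensor_tmul, e3, h, mulFst_mulFst, ← e5, ← e4, LinearMap.lTensor_tmul]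

omit hc in
theorem leftMul_one : leftMul act (Φ : (B ⊗[k] B) ⊗[k] L) 1 = 1 := by
  refine LinearMap.ext fun t => ?_
  rw [leftMul_apply, twistOp, tri_congr_left (a' := epsPoint (Module.End k (A ⊗[k] (A ⊗[k] L))) ε),
    hΦ.eps_left (E := Module.End k (A ⊗[k] (A ⊗[k] L))) (on2 A (on1 L act.toLinearMap))
      (on2 A (on2 A (ptMul k L)))]
  · induction t with
    | zero => simp
    | add r r' hr hr' =>
      simp only [TensorProduct.tmul_add, map_add, Module.End.one_apply] at hr hr' ⊢
      rw [hr, hr']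
    | tmul a l => simp
  · intro x
    simp [hA.act_one, Algebra.algebraMap_eq_smul_one, TensorProduct.smul_tmul']

omit hc in
theorem one_twistedMul (t : A ⊗[k] L) : twistedMul 𝔏 D act Φ (1 ⊗ₜ 1) t = t := by
  rw [twistedMul_tmul_apply, leftMul_one hΦ hA, IsPoint.map_one (f := lact 𝔏 D act)]
  rfl

end

end TwistedProduct

theorem pair_dyn_pt {k H L A E : Type*} [Field k] [Ring H] [Bialgebra k H] [Ring L] [Algebra k L]
    [Ring A] [Algebra k A] [Ring E] [Algebra k E] (𝔏 : BaseAlgebra k H L) (D : H →ₐ[k] A)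
    (a : A →ₗ[k] E) (l : L →ₗ[k] E) [IsPoint a] [IsPoint l] [Commuting a l] (ν : L) :
    pair a l (𝔏.dyn D (ptL k A L) (ptR k A L) ν) = 𝔏.dyn D a l ν := by
  have := LinearMap.congr_fun
    (algHom_comp_dyn 𝔏 (IsPoint.toAlgHom (pair a l)) D (ptL k A L) (ptR k A L)) ν
  rwa [toAlgHom_comp_ptL, toAlgHom_comp_ptR] at this

/-! ## Operators on maps from `B ⊗ L` to an algebra over `L` -/

section Ops

variable {k H L B M T : Type*} [Field k] [Ring H] [Bialgebra k H] [Ring L] [Algebra k L]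
  [Ring B] [Algebra k B] [AddCommGroup M] [Module k M] [Ring T] [Algebra k T]
  (𝔏 : BaseAlgebra k H L) (D : H →ₐ[k] B) (Δ : B →ₐ[k] B ⊗[k] B)
  (actM : B →ₐ[k] Module.End k M) (κ : M →ₗ[k] T) (ι : L →ₗ[k] T)

variable (L) in
/-- `β ↦ β ⊗ 1`, as a left multiplication operator. -/
abbrev ptB : B →ₗ[k] Module.End k (B ⊗[k] L) := lp (ptL k B L)

variable (L B) in
/-- `λ ↦ 1 ⊗ λ`, as a left multiplication operator. -/
abbrev ptLmul (k L B : Type*) [Field k] [Ring L] [Algebra k L] [Ring B] [Algebra k B] :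
    L →ₗ[k] Module.End k (B ⊗[k] L) := lp (ptR k B L)

/-- The maps `Ψ : B ⊗ L → T` with `Ψ(j(λ⁽¹⁾) β ⊗ λ⁽∞⁾ μ) = ι(λ) Ψ(β ⊗ μ)`. -/
def equivariantMaps : Submodule k (B ⊗[k] L →ₗ[k] T) where
  carrier := {Ψ | ∀ (l : L) (t : B ⊗[k] L),
    Ψ (𝔏.dyn D (ptL k B L) (ptR k B L) l * t) = ι l * Ψ t}
  add_mem' h h' l t := by simp [h l t, h' l t, mul_add]
  zero_mem' l t := by simp
  smul_mem' c Ψ h l t := by simp [h l t]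

instance : AddCommGroup (equivariantMaps 𝔏 D ι) := Submodule.addCommGroup _

/-- `t ↦ t · (m ⊗ 1)`, where `B` acts on `M ⊗ (B ⊗ L)` by the coproduct. -/
def spread : M →ₗ[k] B ⊗[k] L →ₗ[k] M ⊗[k] (B ⊗[k] L) :=
  LinearMap.flip (pair (E := Module.End k (M ⊗[k] (B ⊗[k] L)))
    (conv Δ (on1 (B ⊗[k] L) actM.toLinearMap) (on2 M (ptB L))) (on2 M (ptLmul k L B))) ∘ₗ
    (TensorProduct.mk k M (B ⊗[k] L)).flip 1

theorem spread_apply (m : M) (t : B ⊗[k] L) : spread Δ actM m t =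
    pair (E := Module.End k (M ⊗[k] (B ⊗[k] L)))
    (conv Δ (on1 (B ⊗[k] L) actM.toLinearMap) (on2 M (ptB L))) (on2 M (ptLmul k L B)) t
      (m ⊗ₜ 1) := rfl

/-- The operator by which `B ⊗ B ⊗ L` acts on `M ⊗ (B ⊗ L)`. -/
def regOp : (B ⊗[k] B) ⊗[k] L →ₗ[k] Module.End k (M ⊗[k] (B ⊗[k] L)) :=
  tri (on1 (B ⊗[k] L) actM.toLinearMap) (on2 M (ptB L)) (on2 M (ptLmul k L B))

variable (Φ : ((B ⊗[k] B) ⊗[k] L)ˣ)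

/-- The operator `Ψ ↦ (t ↦ (κ · Ψ)(Φ⁻¹ t · (m ⊗ 1)))`. -/
def genOp : M →ₗ[k] Module.End k (B ⊗[k] L →ₗ[k] T) :=
  LinearMap.mk₂ k (fun m Ψ => pair κ Ψ ∘ₗ regOp (L := L) actM (↑Φ⁻¹) ∘ₗ spread Δ actM m)
    (fun m m' Ψ => by rw [map_add, LinearMap.comp_add, LinearMap.comp_add])
    (fun c m Ψ => by rw [map_smul, LinearMap.comp_smul, LinearMap.comp_smul])
    (fun m Ψ Ψ' => by
      have : pair κ (Ψ + Ψ') = pair κ Ψ + pair κ Ψ' := by ext; simp [mul_add]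
      rw [this, LinearMap.add_comp])
    (fun c m Ψ => by
      have : pair κ (c • Ψ) = c • pair κ Ψ := by ext; simp
      rw [this, LinearMap.smul_comp])

theorem genOp_apply (m : M) (Ψ : B ⊗[k] L →ₗ[k] T) (t : B ⊗[k] L) :
    genOp Δ actM κ Φ m Ψ t = pair κ Ψ (regOp (L := L) actM (↑Φ⁻¹) (spread Δ actM m t)) := rfl

theorem spread_mul (m : M) (s t : B ⊗[k] L) : spread Δ actM m (s * t) =
    pair (E := Module.End k (M ⊗[k] (B ⊗[k] L)))
    (conv Δ (on1 (B ⊗[k] L) actM.toLinearMap) (on2 M (ptB L))) (on2 M (ptLmul k L B)) s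
      (spread Δ actM m t) := by
  rw [spread_apply, pair_mul]
  rfl

theorem spread_one (m : M) : spread Δ actM m (1 : B ⊗[k] L) = m ⊗ₜ 1 := by
  rw [spread_apply, pair_one]
  rfl

theorem spread_one_tmul (m : M) (l : L) :
    spread Δ actM m ((1 : B) ⊗ₜ[k] l) = m ⊗ₜ (1 ⊗ₜ l) := by
  rw [spread_apply, pair_tmul, IsPoint.map_one (E := Module.End k (M ⊗[k] (B ⊗[k] L)))
    (f := conv Δ (on1 (B ⊗[k] L) actM.toLinearMap) (on2 M (ptB L)))]
  simp

variable {𝔏 D Δ actM κ ι Φ} {ε : B →ₐ[k] k} (hc : IsCompatible Δ ε D) (hΦ : IsWeakTwist 𝔏 Δ ε D Φ)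
  (hκ : ∀ l m, ι l * κ m = pair (κ ∘ₗ (actM.comp D).toLinearMap.flip m) ι (𝔏.coact l))

-- The cross relation brings `ι(l)` past `κ(m)` with the coaction leg acting on `m`, and
-- equivariance of `Ψ` brings it past the second factor.
include hκ in
theorem pair_dyn_cross {N : Type*} [AddCommGroup N] [Module k N] {Ψ : N →ₗ[k] T}
    {G : L →ₗ[k] Module.End k N} (hΨ : ∀ l t, Ψ (G l t) = ι l * Ψ t) (l : L) (n : M ⊗[k] N) :
    pair κ Ψ (𝔏.dyn (E := Module.End k (M ⊗[k] N)) D (on1 N actM.toLinearMap) (on2 M G) l n) =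
      ι l * pair κ Ψ n := by
  induction n with
  | zero => simp
  | add s t hs ht => simp only [map_add, hs, ht, mul_add]
  | tmul m t =>
    rw [pair_tmul, ← mul_assoc, hκ, BaseAlgebra.dyn, LinearMap.comp_apply,
      AlgHom.toLinearMap_apply]
    generalize 𝔏.coact l = u
    induction u with
    | zero => simp
    | add s t hs ht => simp only [map_add, LinearMap.add_apply, hs, ht, add_mul]
    | tmul h l' => simp [hΨ, mul_assoc]

include hκ in
theorem pair_dyn_of_mem {Ψ : B ⊗[k] L →ₗ[k] T} (hΨ : Ψ ∈ equivariantMaps 𝔏 D ι) (l : L)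
    (n : M ⊗[k] (B ⊗[k] L)) :
    pair κ Ψ (𝔏.dyn (E := Module.End k (M ⊗[k] (B ⊗[k] L))) D (on1 (B ⊗[k] L) actM.toLinearMap)
      (on2 M (𝔏.dyn D (ptB L) (ptLmul k L B))) l n) = ι l * pair κ Ψ n :=
  pair_dyn_cross hκ (fun l t => by rw [dyn_lp, lp_apply]; exact hΨ l t) l n

-- Since `spread` is multiplicative in `t`, the shift appears as an operator that commutes with
-- `Φ⁻¹` by weak invariance and is then turned into `ι(l)` by the cross relation.
include hc hΦ hκ in
theorem genOp_mem (m : M) {Ψ : B ⊗[k] L →ₗ[k] T} (hΨ : Ψ ∈ equivariantMaps 𝔏 D ι) :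
    genOp Δ actM κ Φ m Ψ ∈ equivariantMaps 𝔏 D ι := by
  intro l t
  have h1 := hΦ.commuting_inv (E := Module.End k (M ⊗[k] (B ⊗[k] L)))
    (on1 (B ⊗[k] L) actM.toLinearMap) (on2 M (ptB L)) (on2 M (ptLmul k L B))
  have h2 := (commute_cst (E := Module.End k (M ⊗[k] (B ⊗[k] L)))
    (tri (on1 (B ⊗[k] L) actM.toLinearMap) (on2 M (ptB L)) (on2 M (ptLmul k L B)) (↑Φ⁻¹))
    (𝔏.dyn D (conv Δ (on1 (B ⊗[k] L) actM.toLinearMap) (on2 M (ptB L)))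
      (on2 M (ptLmul k L B))) l).eq
  rw [genOp_apply, genOp_apply, spread_mul, ← pair_dyn_of_mem hκ hΨ, ← dyn_on2,
    𝔏.dyn_assoc hc.comulHom]
  refine congrArg (pair κ Ψ) (Eq.trans ?_ (LinearMap.congr_fun h2 (spread Δ actM m t)))
  rw [Module.End.mul_apply]
  refine congrArg (regOp (L := L) actM (↑Φ⁻¹)) ?_
  rw [pair_dyn_pt]

/-- `genOp`, restricted to equivariant maps. -/
def genEnd : M →ₗ[k] Module.End k (equivariantMaps 𝔏 D ι) where
  toFun m := (genOp Δ actM κ Φ m).restrict fun _ hΨ => genOp_mem hc hΦ hκ m hΨ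
  map_add' m m' := by ext; simp
  map_smul' c m := by ext; simp

theorem genEnd_apply (m : M) (Ψ : equivariantMaps 𝔏 D ι) (t : B ⊗[k] L) :
    (genEnd hc hΦ hκ m Ψ : B ⊗[k] L →ₗ[k] T) t =
      pair κ (Ψ : B ⊗[k] L →ₗ[k] T) (regOp (L := L) actM (↑Φ⁻¹) (spread Δ actM m t)) := rfl

/-! ### Quadratic relations -/

-- Composing the definitions gives `Φ_{23}⁻¹ Φ_{1(23)}⁻¹`. The inverted cocycle equation rewrites
-- this as `Φ_{12|3}⁻¹ Φ_{(12)3}⁻¹`, where the inner factor sees the first two legs only through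
-- their coproduct and hence respects the relations.
include hc hΦ in
theorem pair_genOp (m m' : M) (Ψ : B ⊗[k] L →ₗ[k] T) (t : B ⊗[k] L) :
    genOp Δ actM κ Φ m (genOp Δ actM κ Φ m' Ψ) t =
    pair κ (pair κ Ψ) (tri (E := Module.End k (M ⊗[k] (M ⊗[k] (B ⊗[k] L))))
      (on1 (M ⊗[k] (B ⊗[k] L)) actM.toLinearMap) (on2 M (on1 (B ⊗[k] L) actM.toLinearMap))
      (𝔏.dyn D (on2 M (on2 M (ptB L))) (on2 M (on2 M (ptLmul k L B)))) (↑Φ⁻¹)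
      (tri (E := Module.End k (M ⊗[k] (M ⊗[k] (B ⊗[k] L)))) (conv Δ
        (on1 (M ⊗[k] (B ⊗[k] L)) actM.toLinearMap) (on2 M (on1 (B ⊗[k] L) actM.toLinearMap)))
        (on2 M (on2 M (ptB L))) (on2 M (on2 M (ptLmul k L B))) (↑Φ⁻¹)
        (pair (E := Module.End k (M ⊗[k] (M ⊗[k] (B ⊗[k] L)))) (conv Δ (conv Δ
          (on1 (M ⊗[k] (B ⊗[k] L)) actM.toLinearMap) (on2 M (on1 (B ⊗[k] L) actM.toLinearMap)))
        (on2 M (on2 M (ptB L)))) (on2 M (on2 M (ptLmul k L B))) t (m ⊗ₜ (m' ⊗ₜ 1))))) := by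
  set a1 := on1 (M ⊗[k] (B ⊗[k] L)) actM.toLinearMap
  set a2 := on2 M (on1 (B ⊗[k] L) actM.toLinearMap)
  set a3 := on2 (k := k) M (on2 (k := k) M (ptB (k := k) (B := B) L))
  set l := on2 M (on2 M (ptLmul k L B))
  have e1 : ∀ n, pair κ (genOp Δ actM κ Φ m' Ψ) n = pair κ (pair κ Ψ)
      (tri (E := Module.End k (M ⊗[k] (M ⊗[k] (B ⊗[k] L)))) a2 a3 l (↑Φ⁻¹)
        ((spread Δ actM m').lTensor M n)) := by
    intro n
    simp only [a2, a3, l, tri_on2]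
    have : pair κ (genOp Δ actM κ Φ m' Ψ) = pair κ (pair κ Ψ) ∘ₗ
      (regOp (L := L) actM (↑Φ⁻¹)).lTensor M ∘ₗ (spread Δ actM m').lTensor M := by
      refine TensorProduct.ext' fun a b => ?_
      simp [genOp_apply]
    exact LinearMap.congr_fun this n
  have s1 : ∀ x n, (spread Δ actM m').lTensor M (on1 (B ⊗[k] L) actM.toLinearMap x n) =
      a1 x ((spread Δ actM m').lTensor M n) := by
    intro x
    refine intertwine_of_comp ?_
    refine TensorProduct.ext' fun a b => ?_
    simp [a1]
  have s2 : ∀ x n, (spread Δ actM m').lTensor M (on2 M (ptB L) x n) =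
      conv (E := Module.End k (M ⊗[k] (M ⊗[k] (B ⊗[k] L)))) Δ a2 a3 x
        ((spread Δ actM m').lTensor M n) := by
    intro x
    refine intertwine_of_comp ?_
    refine TensorProduct.ext' fun a b => ?_
    simp only [a2, a3, conv_on2]
    simp only [LinearMap.comp_apply, on2_apply, lp_apply, LinearMap.lTensor_tmul, spread_mul]
    rw [ptL_apply, pair_tmul, on2_map_one, mul_one]
  have s3 : ∀ x n, (spread Δ actM m').lTensor M (on2 M (ptLmul k L B) x n) =
      l x ((spread Δ actM m').lTensor M n) := by
    intro x
    refine intertwine_of_comp ?_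
    refine TensorProduct.ext' fun a b => ?_
    simp only [l]
    simp only [LinearMap.comp_apply, on2_apply, lp_apply, LinearMap.lTensor_tmul, spread_mul]
    rw [ptR_apply, pair_tmul, IsPoint.map_one (E := Module.End k (M ⊗[k] (B ⊗[k] L)))
      (f := conv Δ (on1 (B ⊗[k] L) actM.toLinearMap) (on2 M (ptB L)))]
    simp
  have s4 : (spread Δ actM m').lTensor M (spread Δ actM m t) =
      pair (E := Module.End k (M ⊗[k] (M ⊗[k] (B ⊗[k] L)))) (conv Δ a1 (conv Δ a2 a3)) l t
        (m ⊗ₜ (m' ⊗ₜ 1)) := by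
    rw [spread_apply]
    refine (pair_intertwine (conv_intertwine s1 s2) s3 t _).trans ?_
    rw [LinearMap.lTensor_tmul, spread_one]
  have s5 : (spread Δ actM m').lTensor M (regOp (L := L) actM (↑Φ⁻¹) (spread Δ actM m t)) =
      tri (E := Module.End k (M ⊗[k] (M ⊗[k] (B ⊗[k] L)))) a1 (conv Δ a2 a3) l (↑Φ⁻¹)
        ((spread Δ actM m').lTensor M (spread Δ actM m t)) :=
    tri_intertwine s1 s2 s3 _ _
  rw [genOp_apply, e1, s5, s4, conv_assoc hc.coassoc]
  have h := hΦ.cocycle_inv (E := Module.End k (M ⊗[k] (M ⊗[k] (B ⊗[k] L)))) a1 a2 a3 l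
  exact congrArg (pair κ (pair κ Ψ)) (LinearMap.congr_fun h.symm _)

theorem assoc_on1 {V N : Type*} [AddCommGroup V] [Module k V] [AddCommGroup N] [Module k N]
    {f : V →ₗ[k] Module.End k M} (x : V) (n : (M ⊗[k] M) ⊗[k] N) :
    TensorProduct.assoc k M M N (on1 N (on1 M f) x n) =
      on1 (M ⊗[k] N) f x (TensorProduct.assoc k M M N n) := by
  refine intertwine_of_comp (μ := (TensorProduct.assoc k M M N).toLinearMap) ?_ n
  ext; simp

theorem assoc_on2 {V N : Type*} [AddCommGroup V] [Module k V] [AddCommGroup N] [Module k N]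
    {f : V →ₗ[k] Module.End k M} (x : V) (n : (M ⊗[k] M) ⊗[k] N) :
    TensorProduct.assoc k M M N (on1 N (on2 M f) x n) =
      on2 M (on1 N f) x (TensorProduct.assoc k M M N n) := by
  refine intertwine_of_comp (μ := (TensorProduct.assoc k M M N).toLinearMap) ?_ n
  ext; simp

variable {w : M ⊗[k] M →ₗ[k] M ⊗[k] M} {ρ' : B →ₗ[k] Module.End k (M ⊗[k] M)}
  (hw : ∀ x n, conv (E := Module.End k (M ⊗[k] M)) Δ (on1 M actM.toLinearMap)
    (on2 M actM.toLinearMap) x (w n) = w (ρ' x n))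
  (hrel : ∀ n, pair κ (pair κ ι) (twistOp actM actM (↑Φ⁻¹)
    (TensorProduct.assoc k M M L (w n ⊗ₜ 1))) = 0)

include hw in
theorem conv_assoc_rTensor {N : Type*} [AddCommGroup N] [Module k N] (x : B)
    (n : (M ⊗[k] M) ⊗[k] N) :
    conv (E := Module.End k (M ⊗[k] (M ⊗[k] N))) Δ
      (on1 (M ⊗[k] N) actM.toLinearMap) (on2 M (on1 N actM.toLinearMap)) x
      (TensorProduct.assoc k M M N (w.rTensor N n)) =
    TensorProduct.assoc k M M N (w.rTensor N (on1 N ρ' x n)) := by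
  refine (conv_intertwine (μ := (TensorProduct.assoc k M M N).toLinearMap) assoc_on1 assoc_on2
    x _).symm.trans ?_
  rw [conv_on1]
  refine congrArg (TensorProduct.assoc k M M N) ?_
  symm
  refine intertwine_of_comp (μ := w.rTensor N) ?_ n
  refine TensorProduct.ext' fun a b => ?_
  simp [hw]

-- An equivariant map is determined along the orbit of `s` by `Ψ(s)`: substituting the orbit map `L
-- → B ⊗ L` turns the expression into the relation in `T` multiplied on the right by `Ψ(s)`.
include hrel in
theorem pair_tri_eq_zero {Ψ : B ⊗[k] L →ₗ[k] T} (hΨ : Ψ ∈ equivariantMaps 𝔏 D ι)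
    (n : (M ⊗[k] M) ⊗[k] (B ⊗[k] L)) :
    pair κ (pair κ Ψ) (tri (E := Module.End k (M ⊗[k] (M ⊗[k] (B ⊗[k] L))))
      (on1 (M ⊗[k] (B ⊗[k] L)) actM.toLinearMap) (on2 M (on1 (B ⊗[k] L) actM.toLinearMap))
      (𝔏.dyn D (on2 M (on2 M (ptB L))) (on2 M (on2 M (ptLmul k L B)))) (↑Φ⁻¹)
      (TensorProduct.assoc k M M _ (w.rTensor _ n))) = 0 := by
  induction n with
  | zero => simp
  | add s t hs ht => simp only [map_add, hs, ht, add_zero]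
  | tmul n s =>
    set θ : L →ₗ[k] B ⊗[k] L := LinearMap.flip (𝔏.dyn D (ptB L) (ptLmul k L B)) s with hθ
    have h1 : ∀ x, θ x = 𝔏.dyn D (ptL k B L) (ptR k B L) x * s := fun x => by
      rw [hθ, LinearMap.flip_apply, dyn_lp, lp_apply]
    have h2 : TensorProduct.assoc k M M (B ⊗[k] L) (w.rTensor (B ⊗[k] L) (n ⊗ₜ s)) =
        (θ.lTensor M).lTensor M (TensorProduct.assoc k M M L (w n ⊗ₜ 1)) := by
      rw [LinearMap.rTensor_tmul]
      generalize w n = n'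
      induction n' with
      | zero => simp
      | add s t hs ht => simp only [map_add, TensorProduct.add_tmul, hs, ht]
      | tmul a b => simp [h1, IsPoint.map_one (f := 𝔏.dyn D (ptL k B L) (ptR k B L))]
    have h3 : ∀ n, pair κ (pair κ Ψ) ((θ.lTensor M).lTensor M n) =
        pair κ (pair κ ι) n * Ψ s := by
      have : pair κ (pair κ Ψ) ∘ₗ (θ.lTensor M).lTensor M =
          LinearMap.mulRight k (Ψ s) ∘ₗ pair κ (pair κ ι) := by
        ext a b l
        have := hΨ l s
        simp [h1, this, mul_assoc]
      exact LinearMap.congr_fun this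
    rw [h2]
    have h4 := tri_intertwine (μ := (θ.lTensor M).lTensor M)
      (f := on1 (M ⊗[k] L) actM.toLinearMap)
      (f' := on1 (M ⊗[k] (B ⊗[k] L)) actM.toLinearMap)
      (g := on2 M (on1 L actM.toLinearMap))
      (g' := on2 M (on1 (B ⊗[k] L) actM.toLinearMap))
      (h := on2 M (on2 M (ptMul k L)))
      (h' := 𝔏.dyn (E := Module.End k (M ⊗[k] (M ⊗[k] (B ⊗[k] L)))) D (on2 M (on2 M (ptB L)))
        (on2 M (on2 M (ptLmul k L B))))
      (fun x => intertwine_of_comp (by ext; simp)) (fun x => intertwine_of_comp (by ext; simp))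
      (fun x => intertwine_of_comp (by
        rw [dyn_on2, dyn_on2, dyn_lp]
        ext a b l
        simp [h1, IsPoint.map_mul (f := 𝔏.dyn D (ptL k B L) (ptR k B L)), mul_assoc]))
      (↑Φ⁻¹) (TensorProduct.assoc k M M L (w n ⊗ₜ 1))
    rw [← h4, h3]
    have := hrel n
    rw [twistOp] at this
    rw [this, zero_mul]

-- By `hw` the relation operator `w` can be pulled out past the iterated coproduct of `t` and past
-- `Φ_{(12)3}⁻¹`. It then stands directly behind `Φ_{12|3}⁻¹`, where the hypothesis on `T` applies.
include hw hrel in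
theorem pair_genEnd_eq_zero (n : M ⊗[k] M) :
    pair (E := Module.End k (equivariantMaps 𝔏 D ι)) (genEnd hc hΦ hκ) (genEnd hc hΦ hκ)
      (w n) = 0 := by
  have key : ∀ (n : M ⊗[k] M) (Ψ : equivariantMaps 𝔏 D ι) (t : B ⊗[k] L),
      (pair (E := Module.End k (equivariantMaps 𝔏 D ι)) (genEnd hc hΦ hκ) (genEnd hc hΦ hκ) n Ψ : B ⊗[k] L →ₗ[k] T) t =
      pair κ (pair κ (Ψ : B ⊗[k] L →ₗ[k] T)) (tri (E := Module.End k (M ⊗[k] (M ⊗[k] (B ⊗[k] L))))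
      (on1 (M ⊗[k] (B ⊗[k] L)) actM.toLinearMap) (on2 M (on1 (B ⊗[k] L) actM.toLinearMap))
      (𝔏.dyn D (on2 M (on2 M (ptB L))) (on2 M (on2 M (ptLmul k L B)))) (↑Φ⁻¹)
      (tri (E := Module.End k (M ⊗[k] (M ⊗[k] (B ⊗[k] L)))) (conv Δ
        (on1 (M ⊗[k] (B ⊗[k] L)) actM.toLinearMap) (on2 M (on1 (B ⊗[k] L) actM.toLinearMap)))
        (on2 M (on2 M (ptB L))) (on2 M (on2 M (ptLmul k L B))) (↑Φ⁻¹)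
        (pair (E := Module.End k (M ⊗[k] (M ⊗[k] (B ⊗[k] L)))) (conv Δ (conv Δ
          (on1 (M ⊗[k] (B ⊗[k] L)) actM.toLinearMap) (on2 M (on1 (B ⊗[k] L) actM.toLinearMap)))
        (on2 M (on2 M (ptB L)))) (on2 M (on2 M (ptLmul k L B))) t
          (TensorProduct.assoc k M M (B ⊗[k] L) (n ⊗ₜ 1))))) := by
    intro n Ψ t
    induction n with
    | zero => simp
    | add s s' hs hs' =>
      simp only [map_add, LinearMap.add_apply, TensorProduct.add_tmul, ← hs, ← hs']
      rfl
    | tmul m m' =>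
      rw [TensorProduct.assoc_tmul, ← pair_genOp hc hΦ, pair_tmul]
      rfl
  have c1 := fun x n => (conv_assoc_rTensor (N := B ⊗[k] L) hw x n).symm
  have c2 : ∀ x n, TensorProduct.assoc k M M (B ⊗[k] L) (w.rTensor (B ⊗[k] L)
      (on2 (M ⊗[k] M) (ptB (k := k) (B := B) L) x n)) = on2 M (on2 M (ptB (k := k) (B := B) L)) x
      (TensorProduct.assoc k M M (B ⊗[k] L) (w.rTensor (B ⊗[k] L) n)) := by
    intro x n
    refine intertwine_of_comp (μ := (TensorProduct.assoc k M M (B ⊗[k] L)).toLinearMap ∘ₗ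
      w.rTensor (B ⊗[k] L)) ?_ n
    refine TensorProduct.ext' fun a b => ?_
    simp only [LinearMap.comp_apply, on2_apply, LinearMap.rTensor_tmul]
    generalize w a = a'
    induction a' with
    | zero => simp
    | add s t hs ht => simp only [map_add, TensorProduct.add_tmul, hs, ht]
    | tmul a b => simp
  have c3 : ∀ x n, TensorProduct.assoc k M M (B ⊗[k] L) (w.rTensor (B ⊗[k] L)
      (on2 (M ⊗[k] M) (ptLmul k L B) x n)) = on2 M (on2 M (ptLmul k L B)) x
      (TensorProduct.assoc k M M (B ⊗[k] L) (w.rTensor (B ⊗[k] L) n)) := by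
    intro x n
    refine intertwine_of_comp (μ := (TensorProduct.assoc k M M (B ⊗[k] L)).toLinearMap ∘ₗ
      w.rTensor (B ⊗[k] L)) ?_ n
    refine TensorProduct.ext' fun a b => ?_
    simp only [LinearMap.comp_apply, on2_apply, LinearMap.rTensor_tmul]
    generalize w a = a'
    induction a' with
    | zero => simp
    | add s t hs ht => simp only [map_add, TensorProduct.add_tmul, hs, ht]
    | tmul a b => simp
  refine LinearMap.ext fun Ψ => Subtype.ext (LinearMap.ext fun t => ?_)
  rw [key, ← LinearMap.rTensor_tmul]
  have d1 := pair_intertwine (μ := (TensorProduct.assoc k M M (B ⊗[k] L)).toLinearMap ∘ₗ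
      w.rTensor (B ⊗[k] L)) (conv_intertwine (Δ := Δ) c1 c2) c3 t (n ⊗ₜ 1)
  have d2 := fun n => tri_intertwine (μ := (TensorProduct.assoc k M M (B ⊗[k] L)).toLinearMap ∘ₗ
      w.rTensor (B ⊗[k] L)) c1 c2 c3 (↑Φ⁻¹) n
  simp only [LinearMap.comp_apply, LinearEquiv.coe_coe] at d1 d2
  rw [← d1, ← d2, pair_tri_eq_zero hrel Ψ.2]
  rfl

end Ops

/-! ## A linear map from the twisted product to an algebra over `L` -/

section Section

variable {k H L B M T K : Type*} [Field k] [Ring H] [Bialgebra k H] [Ring L] [Algebra k L]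
  [Ring B] [Algebra k B] [AddCommGroup M] [Module k M] [Ring T] [Algebra k T] [Ring K] [Algebra k K]
  {𝔏 : BaseAlgebra k H L} {D : H →ₐ[k] B} {Δ : B →ₐ[k] B ⊗[k] B} {ε : B →ₐ[k] k}
  {actM : B →ₐ[k] Module.End k M} {κ : M →ₗ[k] T} {ι : L →ₗ[k] T} {Φ : ((B ⊗[k] B) ⊗[k] L)ˣ}

variable (𝔏 D ι) in
/-- `Ψ ↦ Ψ(· (β ⊗ 1))` on equivariant maps. -/
def rightShift : B →ₗ[k] Module.End k (equivariantMaps 𝔏 D ι) where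
  toFun β := (LinearMap.lcomp k T (LinearMap.mulRight k (ptL k B L β))).restrict
    fun Ψ hΨ l t => by
      simp only [LinearMap.lcomp_apply, LinearMap.mulRight_apply, mul_assoc]
      exact hΨ l _
  map_add' β β' := by
    refine LinearMap.ext fun Ψ => Subtype.ext (LinearMap.ext fun t => ?_)
    simp [mul_add, TensorProduct.add_tmul]
  map_smul' c β := by
    refine LinearMap.ext fun Ψ => Subtype.ext (LinearMap.ext fun t => ?_)
    simp

theorem rightShift_apply (β : B) (Ψ : equivariantMaps 𝔏 D ι) (t : B ⊗[k] L) :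
    (rightShift 𝔏 D ι β Ψ : B ⊗[k] L →ₗ[k] T) t =
      (Ψ : B ⊗[k] L →ₗ[k] T) (t * ptL k B L β) := rfl

theorem regOp_mulRight (s : B ⊗[k] L) (u : (B ⊗[k] B) ⊗[k] L) (n : M ⊗[k] (B ⊗[k] L)) :
    (LinearMap.mulRight k s).lTensor M (regOp actM u n) =
      regOp actM u ((LinearMap.mulRight k s).lTensor M n) :=
  tri_intertwine (fun x => intertwine_of_comp (by ext; simp))
    (fun x => intertwine_of_comp (by ext; simp [← mul_assoc]))
    (fun x => intertwine_of_comp (by ext; simp [← mul_assoc])) u n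

theorem pair_rightShift (β : B) (Ψ : equivariantMaps 𝔏 D ι) (n : M ⊗[k] (B ⊗[k] L)) :
    pair κ (rightShift 𝔏 D ι β Ψ : B ⊗[k] L →ₗ[k] T) n =
      pair κ (Ψ : B ⊗[k] L →ₗ[k] T) ((LinearMap.mulRight k (ptL k B L β)).lTensor M n) := by
  induction n with
  | zero => simp
  | add s t hs ht => simp only [map_add, hs, ht]
  | tmul m t => simp [rightShift_apply]

variable (hc : IsCompatible Δ ε D) (hΦ : IsWeakTwist 𝔏 Δ ε D Φ)
  (hκ : ∀ l m, ι l * κ m = pair (κ ∘ₗ (actM.comp D).toLinearMap.flip m) ι (𝔏.coact l))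

/-- Shifting the argument on the right inserts `β` next to `m ⊗ 1`, so its coproduct acts on `m` and
on the argument of `Ψ`. This is the commutation rule of a module algebra with its symmetry. -/
theorem rightShift_mul_genEnd (β : B) (m : M) :
    rightShift 𝔏 D ι β * genEnd hc hΦ hκ m =
      conv (E := Module.End k (equivariantMaps 𝔏 D ι)) Δ
        (genEnd hc hΦ hκ ∘ₗ actM.toLinearMap.flip m) (rightShift 𝔏 D ι) β := by
  refine LinearMap.ext fun Ψ => Subtype.ext (LinearMap.ext fun t => ?_)
  rw [Module.End.mul_apply, rightShift_apply, genEnd_apply, spread_mul, ptL_apply, spread_apply,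
    pair_tmul, on2_map_one, mul_one, conv_apply, conv_apply]
  generalize Δ β = u
  induction u with
  | zero => simp
  | add s s' hs hs' =>
    simp only [map_add, LinearMap.add_apply, hs, hs']
    rfl
  | tmul x y =>
    rw [pair_tmul, pair_tmul, Module.End.mul_apply, Module.End.mul_apply, LinearMap.comp_apply,
      genEnd_apply,
      pair_rightShift, regOp_mulRight, spread_apply]
    refine congrArg (fun n => pair κ _ (regOp actM _ n)) ?_
    refine Eq.symm ((pair_intertwine (μ := (LinearMap.mulRight k (ptL k B L y)).lTensor M)
      (conv_intertwine (Δ := Δ)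
        (f' := on1 (B ⊗[k] L) actM.toLinearMap) (g' := on2 M (ptB L))
        (fun x => intertwine_of_comp (by ext; simp))
        (fun x => intertwine_of_comp (by ext; simp [mul_assoc])))
      (g' := on2 M (ptLmul k L B))
      (fun x => intertwine_of_comp (by ext; simp)) t _).trans ?_)
    simp

variable {act : B →ₐ[k] Module.End k K} (hA : IsModuleAlgebra Δ ε act) {g : M →ₗ[k] K}
  (hg : ∀ β m, act β (g m) = g (actM β m)) (hgen : Algebra.adjoin k (Set.range g) = ⊤)

include hA in
theorem act_mul_conv {E : Type*} [Ring E] [Algebra k E] (f : K →ₐ[k] E) (x y : K) (β : B) :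
    f (act β (x * y)) = conv Δ (f.toLinearMap ∘ₗ act.toLinearMap.flip x)
      (f.toLinearMap ∘ₗ act.toLinearMap.flip y) β := by
  rw [hA.act_mul, conv_apply]
  generalize Δ β = u
  induction u with
  | zero => simp
  | add s s' hs hs' => simp only [map_add, LinearMap.add_apply, hs, hs']
  | tmul x y => simp [tensorAct]

include hA hgen hc in
/-- A compatibility of an algebra homomorphism with a representation, checked on generators. -/
theorem mul_eq_conv_of_generators {E : Type*} [Ring E] [Algebra k E] (f : K →ₐ[k] E)
    (r : B →ₗ[k] E)
    (h : ∀ m β, r β * f (g m) = conv Δ (f.toLinearMap ∘ₗ act.toLinearMap.flip (g m)) r β)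
    (x : K) (β : B) :
    r β * f x = conv Δ (f.toLinearMap ∘ₗ act.toLinearMap.flip x) r β := by
  have hx : x ∈ Algebra.adjoin k (Set.range g) := hgen ▸ trivial
  induction hx using Algebra.adjoin_induction generalizing β with
  | mem x hx =>
    obtain ⟨m, rfl⟩ := hx
    exact h m β
  | algebraMap c =>
    have : f.toLinearMap ∘ₗ act.toLinearMap.flip (algebraMap k K c) = c • epsPoint E ε := by
      ext x
      simp [Algebra.algebraMap_eq_smul_one, hA.act_one]
    rw [this]
    have h2 : conv Δ (c • epsPoint E ε) r = c • conv Δ (epsPoint E ε) r := by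
      ext x
      rw [LinearMap.smul_apply, conv_apply, conv_apply]
      generalize Δ x = u
      induction u with
      | zero => simp
      | add s s' hs hs' => simp only [map_add, smul_add, hs, hs']
      | tmul x y => simp
    rw [h2, conv_eps_left hc.counitLeft]
    simp [Algebra.algebraMap_eq_smul_one]
  | add x y _ _ hx hy =>
    have h2 : f.toLinearMap ∘ₗ act.toLinearMap.flip (x + y) =
      f.toLinearMap ∘ₗ act.toLinearMap.flip x + f.toLinearMap ∘ₗ act.toLinearMap.flip y := by
      ext; simp
    rw [map_add, mul_add, hx, hy, h2, conv_apply, conv_apply, conv_apply]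
    generalize Δ β = u
    induction u with
    | zero => simp
    | add s s' hs hs' => simp only [map_add] at hs hs' ⊢; rw [← hs, ← hs']; abel
    | tmul x y => simp [add_mul]
  | mul x y _ _ hx hy =>
    have h1 : f.toLinearMap ∘ₗ act.toLinearMap.flip (x * y) =
        conv Δ (f.toLinearMap ∘ₗ act.toLinearMap.flip x)
          (f.toLinearMap ∘ₗ act.toLinearMap.flip y) := by
      ext β
      exact act_mul_conv hA f x y β
    have h2 : LinearMap.mulRight k (f y) ∘ₗ r =
        conv Δ (f.toLinearMap ∘ₗ act.toLinearMap.flip y) r := by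
      ext β
      exact hy β
    rw [h1, conv_assoc hc.coassoc, ← h2, map_mul, ← mul_assoc, hx, conv_apply, conv_apply]
    generalize Δ β = u
    induction u with
    | zero => simp
    | add s s' hs hs' => simp only [map_add, add_mul, hs, hs']
    | tmul x y => simp [mul_assoc]

variable [IsPoint ι]

variable (𝔏 D ι) in
include hc in
theorem eps_mem_equivariantMaps : pair (epsPoint T ε) ι ∈ equivariantMaps 𝔏 D ι := by
  intro l t
  rw [pair_mul, pair_dyn_pt, 𝔏.dyn_eps hc.counitHom]

include hc in
theorem rightShift_eps (β : B) :
    rightShift 𝔏 D ι β ⟨_, eps_mem_equivariantMaps 𝔏 D ι hc⟩ =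
      ε β • ⟨_, eps_mem_equivariantMaps 𝔏 D ι hc⟩ := by
  refine Subtype.ext (LinearMap.ext fun t => ?_)
  rw [rightShift_apply]
  simp only [pair_mul, ptL_apply, pair_tmul, epsPoint_apply, IsPoint.map_one (f := ι), mul_one]
  rw [← Algebra.commutes, ← Algebra.smul_def]
  rfl

-- The linear map is `b ⊗ l ↦ (o(b) Ψ₁)(1 ⊗ l)` with `Ψ₁ = ε ⊗ ι`. Covariance under right shifts
-- shows that the values at `β ⊗ l` are those for `(β ▸ b) ⊗ l`. Therefore the `Φ⁻¹` in the
-- generator operators meets and cancels the `Φ` in the twisted product.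
include hA hg hgen in
theorem exists_linear_of_genEnd (o : K →ₐ[k] Module.End k (equivariantMaps 𝔏 D ι))
    (ho : ∀ m, o (g m) = genEnd hc hΦ hκ m) :
    ∃ ψ : K ⊗[k] L →ₗ[k] T, (∀ l v, ψ (lact 𝔏 D act l v) = ι l * ψ v) ∧
      (∀ m v, ψ (leftMul act (Φ : (B ⊗[k] B) ⊗[k] L) (g m) v) = κ m * ψ v) ∧
      ∀ l, ψ (1 ⊗ₜ l) = ι l := by
  set Ψ₁ : equivariantMaps 𝔏 D ι := ⟨_, eps_mem_equivariantMaps 𝔏 D ι hc⟩ with hΨ₁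
  -- The commutation rule of generators extends to all of `K`, and on `Ψ₁` the remaining right shift
  -- is the counit.
  have h1 : ∀ β b, rightShift 𝔏 D ι β (o b Ψ₁) = o (act β b) Ψ₁ := by
    intro β b
    have e := mul_eq_conv_of_generators (E := Module.End k (equivariantMaps 𝔏 D ι)) hc hA hgen o
      (rightShift 𝔏 D ι) (fun m β => by
        rw [ho, rightShift_mul_genEnd]
        congr 2
        ext1 x
        simp [hg, ho]) b β
    have e' := conv_eps_right (E := Module.End k (equivariantMaps 𝔏 D ι)) hc.counitRight
      (o.toLinearMap ∘ₗ act.toLinearMap.flip b)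
    have e2 := LinearMap.congr_fun e Ψ₁
    have e3 := LinearMap.congr_fun (LinearMap.congr_fun e' β) Ψ₁
    rw [Module.End.mul_apply] at e2
    rw [e2]
    refine Eq.trans ?_ e3
    rw [conv_apply, conv_apply]
    generalize Δ β = u
    induction u with
    | zero => simp
    | add s s' hs hs' => simp only [map_add, LinearMap.add_apply, hs, hs']
    | tmul x y =>
      rw [pair_tmul, pair_tmul, Module.End.mul_apply, Module.End.mul_apply, rightShift_eps hc,
        epsPoint_apply]
      rfl
  let ψ : K ⊗[k] L →ₗ[k] T := TensorProduct.lift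
    (LinearMap.mk₂ k (fun b l => (o b Ψ₁ : B ⊗[k] L →ₗ[k] T) (1 ⊗ₜ l))
      (fun b b' l => by simp) (fun c b l => by simp)
      (fun b l l' => by simp [TensorProduct.tmul_add]) (fun c b l => by simp))
  have hψ : ∀ b l, ψ (b ⊗ₜ l) = (o b Ψ₁ : B ⊗[k] L →ₗ[k] T) (1 ⊗ₜ l) := fun b l => by simp [ψ]
  let q : K → B ⊗[k] L →ₗ[k] K ⊗[k] L := fun b => (act.toLinearMap.flip b).rTensor L
  have hq : ∀ b t, ψ (q b t) = (o b Ψ₁ : B ⊗[k] L →ₗ[k] T) t := by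
    intro b t
    induction t with
    | zero => simp
    | add s s' hs hs' => simp only [map_add, hs, hs']
    | tmul β l =>
      have := congrArg (fun Ψ : equivariantMaps 𝔏 D ι => (Ψ : B ⊗[k] L →ₗ[k] T) (1 ⊗ₜ l)) (h1 β b)
      simp only [rightShift_apply, ptL_apply, Algebra.TensorProduct.tmul_mul_tmul, one_mul,
        mul_one] at this
      simp [q, hψ, this]
  have hq1 : ∀ b l, q b (1 ⊗ₜ l) = b ⊗ₜ l := fun b l => by simp [q]
  refine ⟨ψ, fun l v => ?_, fun m v => ?_, fun l => ?_⟩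
  · induction v with
    | zero => simp
    | add s s' hs hs' => simp only [map_add, mul_add, hs, hs']
    | tmul b μ =>
      have e : q b (𝔏.dyn D (ptB L) (ptLmul k L B) l (1 ⊗ₜ μ)) = lact 𝔏 D act l (b ⊗ₜ μ) := by
        refine (dyn_intertwine (μ := q b) (fun x => intertwine_of_comp ?_)
          (fun x => intertwine_of_comp ?_) l _).trans (by rw [hq1]; rfl)
        · ext; simp [q]
        · ext; simp [q]
      rw [← e, hq, dyn_lp, lp_apply, (o b Ψ₁).2, hψ]
  · induction v with
    | zero => simp
    | add s s' hs hs' => simp only [map_add, mul_add, hs, hs']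
    | tmul b μ =>
      have e1 : ∀ n, ψ (mulFst k K L (TensorProduct.map g (q b) n)) =
          pair κ (o b Ψ₁ : B ⊗[k] L →ₗ[k] T) (regOp actM (↑Φ⁻¹) n) := by
        intro n
        induction n with
        | zero => simp
        | add s s' hs hs' => simp only [map_add, hs, hs']
        | tmul m t =>
          induction t with
          | zero => simp
          | add s s' hs hs' => simp only [TensorProduct.tmul_add, map_add, hs, hs']
          | tmul β l =>
            have e2 : TensorProduct.map g (q b) (m ⊗ₜ (β ⊗ₜ l)) = g m ⊗ₜ (act β b ⊗ₜ l) := by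
              simp [q]
            have e3 : m ⊗ₜ[k] (β ⊗ₜ[k] l) =
                (LinearMap.mulRight k (ptL k B L β)).lTensor M (m ⊗ₜ (1 ⊗ₜ l)) := by simp
            rw [e2, mulFst_tmul, hψ, map_mul, Module.End.mul_apply, ← h1, ho, genEnd_apply,
              pair_rightShift, spread_one_tmul, regOp_mulRight, e3]
      -- The map `q b` intertwines left multiplication on `B` with the action on `K`, so `Φ` may be
      -- applied before passing to `K`; there it is the inverse of the operator in `e1`.
      have e4 : TensorProduct.map g (q b) (regOp actM (Φ : (B ⊗[k] B) ⊗[k] L)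
          (m ⊗ₜ (1 ⊗ₜ μ))) = twistOp act act (Φ : (B ⊗[k] B) ⊗[k] L) (g m ⊗ₜ (b ⊗ₜ μ)) := by
        refine (tri_intertwine (μ := TensorProduct.map g (q b)) (fun x => intertwine_of_comp ?_)
          (fun x => intertwine_of_comp ?_) (fun x => intertwine_of_comp ?_) _ _).trans
          (by rw [TensorProduct.map_tmul, hq1]; rfl)
        · ext; simp [hg]
        · ext; simp [q]
        · ext; simp [q]
      have e5 := LinearMap.congr_fun (IsPoint.map_inv_mul
        (tri (E := Module.End k (M ⊗[k] (B ⊗[k] L))) (on1 (B ⊗[k] L) actM.toLinearMap)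
          (on2 M (ptB L)) (on2 M (ptLmul k L B))) Φ) (m ⊗ₜ (1 ⊗ₜ μ))
      rw [Module.End.mul_apply] at e5
      rw [leftMul_apply, ← e4, e1, hψ]
      refine (congrArg (pair κ _) e5).trans ?_
      simp
  · rw [hψ, map_one]
    simp [hΨ₁]

end Section

/-! ## Module algebras with quadratic relations -/

section ModuleAlgebra

universe u v

variable {k : Type*} {B : Type u} {K : Type v} {M : Type*} [Field k] [Ring B] [Algebra k B]
  [AddCommGroup M] [Module k M] [Ring K] [Algebra k K]
  {Δ : B →ₐ[k] B ⊗[k] B} {ε : B →ₐ[k] k} {actM : B →ₐ[k] Module.End k M}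
  {g : M →ₗ[k] K}

theorem IsModuleAlgebra.ext_of_generators {act act' : B →ₐ[k] Module.End k K}
    (hA : IsModuleAlgebra Δ ε act) (hA' : IsModuleAlgebra Δ ε act')
    (hgen : Algebra.adjoin k (Set.range g) = ⊤) (h : ∀ β m, act β (g m) = act' β (g m)) :
    act = act' := by
  refine AlgHom.ext fun β => LinearMap.ext fun x => ?_
  have hx : x ∈ Algebra.adjoin k (Set.range g) := hgen ▸ trivial
  induction hx using Algebra.adjoin_induction generalizing β with
  | mem x hx =>
    obtain ⟨m, rfl⟩ := hx
    exact h β m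
  | algebraMap c => simp [Algebra.algebraMap_eq_smul_one, hA.act_one, hA'.act_one]
  | add x y _ _ hx hy => rw [map_add, map_add, hx, hy]
  | mul x y _ _ hx hy =>
    rw [hA.act_mul, hA'.act_mul]
    generalize Δ β = u
    induction u with
    | zero => simp
    | add s s' hs hs' => simp only [map_add, LinearMap.add_apply, hs, hs']
    | tmul a b => simp [tensorAct, hx, hy]

/-- The multiplication axiom of a module algebra says that `x ↦ (β ↦ β ▸ x)` is an algebra map into
the convolution algebra of linear maps `B → K`. It exists by the universal property of `K`: the
hypothesis on `w` makes the relations act trivially. That it is an action is checked on generators.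
-/
theorem exists_isModuleAlgebra {w : M ⊗[k] M →ₗ[k] M ⊗[k] M} {ρ' : B →ₗ[k] Module.End k (M ⊗[k] M)}
    (hΔ : IsCoassoc Δ) (hl : IsCounitLeft Δ ε) (hr : IsCounitRight Δ ε)
    (hgen : Algebra.adjoin k (Set.range g) = ⊤)
    (hw : ∀ x n, conv (E := Module.End k (M ⊗[k] M)) Δ (on1 M actM.toLinearMap)
      (on2 M actM.toLinearMap) x (w n) = w (ρ' x n))
    (hg : ∀ n, pair g g (w n) = 0)
    (hlift : ∀ (E : Type (max u v)) [Ring E] [Algebra k E] (f : M →ₗ[k] E), (∀ n, pair f f (w n) = 0) →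
      ∃ F : K →ₐ[k] E, ∀ m, F (g m) = f m) :
    ∃ act : B →ₐ[k] Module.End k K, IsModuleAlgebra Δ ε act ∧
      ∀ β m, act β (g m) = g (actM β m) := by
  -- The convolution product has to be formed with the given `Δ` and `ε`, so they are installed as
  -- the coalgebra structure of `B`.
  let _ : Coalgebra k B :=
    { comul := Δ.toLinearMap
      counit := ε.toLinearMap
      coassoc := LinearMap.ext hΔ
      rTensor_counit_comp_comul := LinearMap.ext fun x => by
        apply (TensorProduct.lid k B).injective
        simpa using hl x
      lTensor_counit_comp_comul := LinearMap.ext fun x => by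
        apply (TensorProduct.rid k B).injective
        simpa using hr x }
  let f : M →ₗ[k] WithConv (B →ₗ[k] K) :=
    { toFun := fun m => WithConv.toConv (g ∘ₗ actM.toLinearMap.flip m)
      map_add' := fun m m' => by ext; simp
      map_smul' := fun c m => by ext; simp }
  have hf : ∀ n β, (pair f f n) β = pair g g (conv (E := Module.End k (M ⊗[k] M)) Δ
      (on1 M actM.toLinearMap) (on2 M actM.toLinearMap) β n) := by
    intro n β
    induction n with
    | zero => simp
    | add s s' hs hs' => simp [map_add, hs, hs']
    | tmul m m' =>
      rw [pair_tmul, LinearMap.convMul_apply, conv_apply]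
      change LinearMap.mul' k K (TensorProduct.map _ _ (Δ β)) = _
      generalize Δ β = u
      induction u with
      | zero => simp
      | add s s' hs hs' => simp only [map_add, LinearMap.add_apply, hs, hs']
      | tmul a b => simp [f]
  obtain ⟨F, hF⟩ := hlift (WithConv (B →ₗ[k] K)) f fun n => by
    ext β
    rw [hf, hw, hg]
    rfl
  let A : B →ₗ[k] Module.End k K := LinearMap.flip
    { toFun := fun x => (F x).ofConv
      map_add' := fun x y => by simp
      map_smul' := fun c x => by simp }
  have hA : ∀ β x, A β x = (F x) β := fun β x => rfl
  have hAg : ∀ β m, A β (g m) = g (actM β m) := fun β m => by rw [hA, hF]; rfl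
  have hA1 : ∀ β, A β 1 = ε β • 1 := fun β => by
    rw [hA, map_one, LinearMap.convOne_apply, Algebra.algebraMap_eq_smul_one]; rfl
  have hAc : ∀ β c, A β (algebraMap k K c) = (ε β * c) • 1 := fun β c => by
    rw [Algebra.algebraMap_eq_smul_one, map_smul, hA1, smul_smul, mul_comm]
  have hAm : ∀ β x y, A β (x * y) = LinearMap.mul' k K (TensorProduct.map
      (A.flip x) (A.flip y) (Δ β)) := fun β x y => by
    rw [hA, map_mul, LinearMap.convMul_apply]; rfl
  have hone : A 1 = 1 := by
    refine LinearMap.ext fun x => ?_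
    have hx : x ∈ Algebra.adjoin k (Set.range g) := hgen ▸ trivial
    induction hx using Algebra.adjoin_induction with
    | mem x hx =>
      obtain ⟨m, rfl⟩ := hx
      simp [hAg]
    | algebraMap c => simp [hA1, Algebra.algebraMap_eq_smul_one]
    | add x y _ _ hx hy => rw [map_add, map_add, hx, hy]
    | mul x y _ _ hx hy =>
      rw [hAm, map_one, Algebra.TensorProduct.one_def, TensorProduct.map_tmul]
      simp [hx, hy]
  have hmul : ∀ β β', A (β * β') = A β * A β' := by
    intro β β'
    refine LinearMap.ext fun x => ?_
    have hx : x ∈ Algebra.adjoin k (Set.range g) := hgen ▸ trivial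
    induction hx using Algebra.adjoin_induction generalizing β β' with
    | mem x hx =>
      obtain ⟨m, rfl⟩ := hx
      simp [hAg]
    | algebraMap c => simp [hAc, hA1, smul_smul, mul_left_comm, mul_comm]
    | add x y _ _ hx hy => rw [map_add, map_add, hx, hy]
    | mul x y _ _ hx hy =>
      rw [Module.End.mul_apply, hAm, hAm, map_mul]
      generalize Δ β' = v
      induction v with
      | zero => simp
      | add s s' hs hs' => simp only [mul_add, map_add, hs, hs']
      | tmul c d =>
        rw [TensorProduct.map_tmul, LinearMap.mul'_apply, hAm]
        generalize Δ β = u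
        induction u with
        | zero => simp
        | add s s' hs hs' => simp only [add_mul, map_add, hs, hs']
        | tmul a b => simp [hx, hy]
  refine ⟨AlgHom.ofLinearMap A hone hmul, ⟨hA1, fun β x y => ?_⟩, hAg⟩
  refine (hAm β x y).trans ?_
  generalize Δ β = u
  induction u with
  | zero => simp
  | add s s' hs hs' => simp only [map_add, LinearMap.add_apply, hs, hs']
  | tmul a b => simp [tensorAct]

end ModuleAlgebra

/-! ## Reflection relations in coordinates -/

section Reflection

variable {ι : Type*} [Fintype ι] [DecidableEq ι] {A A' : Type*} [Ring A] [Ring A']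

theorem mul_sndCopy_apply (X : Matrix (ι × ι) (ι × ι) A) (K : Matrix ι ι A) (p : ι × ι) (j m : ι) :
    (X * sndCopy K) p (j, m) = ∑ z, X p (j, z) * K z m := by
  simp [Matrix.mul_apply, sndCopy, Fintype.sum_prod_type, Matrix.one_apply]

theorem sndCopy_mul_apply (X : Matrix (ι × ι) (ι × ι) A) (K : Matrix ι ι A) (i l : ι) (q : ι × ι) :
    (sndCopy K * X) (i, l) q = ∑ z, K l z * X (i, z) q := by
  simp [Matrix.mul_apply, sndCopy, Fintype.sum_prod_type, Matrix.one_apply]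

/-- The flip in `S = P R` acts on row indices only, hence the exchanged pair `(l, i)`. The inner
double sum is isolated because it is the contribution of the factor called `dynSideX` in the
dynamical case. -/
theorem reflection_left_apply (r : Matrix (ι × ι) (ι × ι) A) (K : Matrix ι ι A) (i l j m : ι) :
    (flipMul r * sndCopy K * flipMul r * sndCopy K) (i, l) (j, m) =
      ∑ c, ∑ a, r (l, i) (c, a) * ∑ f, ∑ g, K a f * r (f, c) (j, g) * K g m := by
  rw [mul_assoc (flipMul r * sndCopy K), Matrix.mul_apply, Fintype.sum_prod_type]
  refine Finset.sum_congr rfl fun c _ => ?_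
  simp only [mul_sndCopy_apply, flipMul, Matrix.submatrix_apply, Prod.swap_prod_mk, id,
    Finset.sum_mul_sum]
  rw [Finset.sum_comm]
  simp only [mul_assoc, Finset.mul_sum]

theorem reflection_right_apply (r : Matrix (ι × ι) (ι × ι) A) (K : Matrix ι ι A) (i l j m : ι) :
    (sndCopy K * flipMul r * sndCopy K * flipMul r) (i, l) (j, m) =
      ∑ b, ∑ d, (∑ f, ∑ g, K l f * r (f, i) (d, g) * K g b) * r (b, d) (j, m) := by
  rw [mul_assoc (sndCopy K * flipMul r), Matrix.mul_apply, Fintype.sum_prod_type]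
  simp only [sndCopy_mul_apply, flipMul, Matrix.submatrix_apply, Prod.swap_prod_mk, id,
    Finset.sum_mul_sum]
  simp only [Finset.sum_mul]
  have : ∀ F : ι → ι → ι → ι → A, ∑ d, ∑ g, ∑ f, ∑ b, F b d f g = ∑ b, ∑ d, ∑ f, ∑ g, F b d f g := by
    intro F
    calc _ = ∑ d, ∑ g, ∑ b, ∑ f, F b d f g :=
          Finset.sum_congr rfl fun d _ => Finset.sum_congr rfl fun g _ => Finset.sum_comm
      _ = ∑ d, ∑ b, ∑ g, ∑ f, F b d f g := Finset.sum_congr rfl fun d _ => Finset.sum_comm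
      _ = ∑ b, ∑ d, ∑ g, ∑ f, F b d f g := Finset.sum_comm
      _ = _ := Finset.sum_congr rfl fun d _ => Finset.sum_congr rfl fun g _ => Finset.sum_comm
  refine Eq.trans ?_ (this fun b d f g => K l f * r (f, i) (d, g) * K g b * r (b, d) (j, m))
  simp only [mul_assoc]

variable {k : Type*} [Field k] [Algebra k A] [Algebra k A'] (f : A →ₐ[k] A')
  (S : Matrix (ι × ι) (ι × ι) A) (K : Matrix ι ι A) (p q : ι × ι)

omit [Fintype ι] in
theorem sndCopy_map : (sndCopy K).map f = sndCopy (K.map f) := by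
  ext p q
  simp [sndCopy, Matrix.one_apply, apply_ite f]

theorem map_reflection_left : f ((S * sndCopy K * S * sndCopy K) p q) =
    (S.map f * sndCopy (K.map f) * S.map f * sndCopy (K.map f)) p q := by
  rw [← sndCopy_map, ← Matrix.map_mul, ← Matrix.map_mul, ← Matrix.map_mul, Matrix.map_apply]

theorem map_reflection_right : f ((sndCopy K * S * sndCopy K * S) p q) =
    (sndCopy (K.map f) * S.map f * sndCopy (K.map f) * S.map f) p q := by
  rw [← sndCopy_map, ← Matrix.map_mul, ← Matrix.map_mul, ← Matrix.map_mul, Matrix.map_apply]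

end Reflection

/-! ### Matrix units and the transposed actions of the representation -/

section MatrixRep

variable {k ι : Type*} [Field k] [Fintype ι] [DecidableEq ι]

/-- The linear map sending the matrix unit `e i j` to `X i j`. -/
def matLin {S : Type*} [AddCommGroup S] [Module k S] (X : Matrix ι ι S) :
    Matrix ι ι k →ₗ[k] S where
  toFun m := ∑ i, ∑ j, m i j • X i j
  map_add' m m' := by simp [add_smul, Finset.sum_add_distrib]
  map_smul' c m := by simp [mul_smul, Finset.smul_sum]

@[simp] theorem matLin_single {S : Type*} [AddCommGroup S] [Module k S] (X : Matrix ι ι S)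
    (i j : ι) : matLin X (Matrix.single i j (1 : k)) = X i j := by
  simp [matLin, Matrix.single_apply, ite_and]

theorem ext_single {S : Type*} [AddCommGroup S] [Module k S] {f g : Matrix ι ι k →ₗ[k] S}
    (h : ∀ i j, f (Matrix.single i j 1) = g (Matrix.single i j 1)) : f = g :=
  Matrix.ext_linearMap k fun i j => LinearMap.ext_ring (h i j)

theorem linearMap_eq_matLin {S : Type*} [AddCommGroup S] [Module k S] (f : Matrix ι ι k →ₗ[k] S) :
    f = matLin (Matrix.of fun i j => f (Matrix.single i j 1)) :=
  ext_single fun i j => by simp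

theorem ext_single₂ {S : Type*} [AddCommGroup S] [Module k S]
    {f g : Matrix ι ι k ⊗[k] Matrix ι ι k →ₗ[k] S}
    (h : ∀ i j l m, f (Matrix.single i j 1 ⊗ₜ Matrix.single l m 1) =
      g (Matrix.single i j 1 ⊗ₜ Matrix.single l m 1)) : f = g :=
  TensorProduct.ext (ext_single fun i j => ext_single fun l m => h i j l m)

variable {U : Type*} [Ring U]

section Alg

variable [Algebra k U] (ρ : U →ₐ[k] Matrix ι ι k)

/-- `x ↦ (m ↦ ρ(x)ᵀ m)`. -/
def transLeft : U →ₗ[k] Module.End k (Matrix ι ι k) :=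
  (Algebra.lmul k (Matrix ι ι k)).toLinearMap ∘ₗ
    (Matrix.transposeLinearEquiv ι ι k k).toLinearMap ∘ₗ ρ.toLinearMap

/-- `x ↦ (m ↦ m ρ(x)ᵀ)`. -/
def transRight : U →ₗ[k] Module.End k (Matrix ι ι k) :=
  (LinearMap.mul k (Matrix ι ι k)).flip ∘ₗ
    (Matrix.transposeLinearEquiv ι ι k k).toLinearMap ∘ₗ ρ.toLinearMap

theorem transLeft_apply (x : U) (m : Matrix ι ι k) :
    transLeft ρ x m = (ρ x).transpose * m := rfl

theorem transRight_apply (x : U) (m : Matrix ι ι k) :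
    transRight ρ x m = m * (ρ x).transpose := rfl

instance : IsPoint (transRight ρ) where
  map_one := by ext1 m; simp [transRight_apply]
  map_mul x y := by
    refine LinearMap.ext fun m => ?_
    simp [transRight_apply, Matrix.transpose_mul, mul_assoc]

/-- Matrix units stand for generators, so operators on them are the transposes of operations on the
matrix `K`: the result, read through `matLin K`, is the `(i, j)` entry of `ρ(x) K`. -/
theorem transLeft_single (x : U) (i j : ι) : transLeft ρ x (Matrix.single i j 1) =
    ∑ a, ρ x i a • Matrix.single a j (1 : k) := by
  ext p q
  rw [transLeft_apply, Matrix.sum_apply]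
  simp [Matrix.mul_apply, Matrix.single_apply, ite_and]

theorem transRight_single (x : U) (i j : ι) : transRight ρ x (Matrix.single i j 1) =
    ∑ f, ρ x f j • Matrix.single i f (1 : k) := by
  ext p q
  rw [transRight_apply, Matrix.sum_apply]
  simp [Matrix.mul_apply, Matrix.single_apply, ite_and]

/-- Entries of `u₁ ⊗ u₂ ↦ ρ(u₁) ⊗ ρ(u₂)`. -/
def entry₂ (p q : ι × ι) : U ⊗[k] U →ₗ[k] k :=
  LinearMap.mul' k k ∘ₗ TensorProduct.map (entry ρ p.1 q.1) (entry ρ p.2 q.2)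

theorem entry₂_tmul (p q : ι × ι) (x y : U) :
    entry₂ ρ p q (x ⊗ₜ y) = ρ x p.1 q.1 * ρ y p.2 q.2 := rfl

theorem repMatrix_tmul {L : Type*} [Ring L] [Algebra k L] (u : U ⊗[k] U) (l : L) (p q : ι × ι) :
    repMatrix ρ (u ⊗ₜ l) p q = entry₂ ρ p q u • l := rfl

theorem repMatrix_add {L : Type*} [Ring L] [Algebra k L] (u v : (U ⊗[k] U) ⊗[k] L) (p q : ι × ι) :
    repMatrix ρ (u + v) p q = repMatrix ρ u p q + repMatrix ρ v p q := by
  simp [repMatrix]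

theorem repMatrix_zero {L : Type*} [Ring L] [Algebra k L] (p q : ι × ι) :
    repMatrix ρ (0 : (U ⊗[k] U) ⊗[k] L) p q = 0 := by
  simp [repMatrix]

theorem pair_transRight_transLeft (u : U ⊗[k] U) (i j l m : ι) :
    pair (E := Module.End k (Matrix ι ι k ⊗[k] Matrix ι ι k))
      (on1 _ (transRight ρ)) (on2 _ (transLeft ρ)) u
      (Matrix.single i j 1 ⊗ₜ Matrix.single l m 1) =
    ∑ f, ∑ g, entry₂ ρ (f, l) (j, g) u •
      (Matrix.single i f (1 : k) ⊗ₜ[k] Matrix.single g m (1 : k)) := by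
  induction u with
  | zero => simp
  | add s t hs ht =>
    simp only [map_add, LinearMap.add_apply, hs, ht, add_smul, Finset.sum_add_distrib]
  | tmul x y =>
    simp only [pair_tmul, Module.End.mul_apply, on1_apply, on2_apply, transRight_single, transLeft_single,
      TensorProduct.sum_tmul, TensorProduct.tmul_sum, ← TensorProduct.smul_tmul',
      TensorProduct.tmul_smul, map_sum, map_smul, Finset.smul_sum, smul_smul, entry₂_tmul]
    rw [Finset.sum_comm]
    simp only [mul_comm]

theorem pair_transLeft_transLeft (u : U ⊗[k] U) (i j l m : ι) :
    pair (E := Module.End k (Matrix ι ι k ⊗[k] Matrix ι ι k))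
      (on2 _ (transLeft ρ)) (on1 _ (transLeft ρ)) u
      (Matrix.single i j 1 ⊗ₜ Matrix.single l m 1) =
    ∑ c, ∑ a, entry₂ ρ (l, i) (c, a) u •
      (Matrix.single a j (1 : k) ⊗ₜ[k] Matrix.single c m (1 : k)) := by
  induction u with
  | zero => simp
  | add s t hs ht =>
    simp only [map_add, LinearMap.add_apply, hs, ht, add_smul, Finset.sum_add_distrib]
  | tmul x y =>
    simp only [pair_tmul, Module.End.mul_apply, on1_apply, on2_apply, transLeft_single,
      TensorProduct.sum_tmul, TensorProduct.tmul_sum, ← TensorProduct.smul_tmul',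
      TensorProduct.tmul_smul, map_sum, map_smul, Finset.smul_sum, smul_smul, entry₂_tmul]
    rw [Finset.sum_comm]
    simp only [mul_comm]

theorem pair_transRight_transRight (u : U ⊗[k] U) (i j l m : ι) :
    pair (E := Module.End k (Matrix ι ι k ⊗[k] Matrix ι ι k))
      (on1 _ (transRight ρ)) (on2 _ (transRight ρ)) u
      (Matrix.single i j 1 ⊗ₜ Matrix.single l m 1) =
    ∑ b, ∑ d, entry₂ ρ (b, d) (j, m) u •
      (Matrix.single i b (1 : k) ⊗ₜ[k] Matrix.single l d (1 : k)) := by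
  induction u with
  | zero => simp
  | add s t hs ht =>
    simp only [map_add, LinearMap.add_apply, hs, ht, add_smul, Finset.sum_add_distrib]
  | tmul x y =>
    simp only [pair_tmul, Module.End.mul_apply, on1_apply, on2_apply, transRight_single,
      TensorProduct.sum_tmul, TensorProduct.tmul_sum, ← TensorProduct.smul_tmul',
      TensorProduct.tmul_smul, map_sum, map_smul, Finset.smul_sum, smul_smul, entry₂_tmul]
    rw [Finset.sum_comm]
    simp only [mul_comm]

end Alg

end MatrixRep

/-! ## The RE algebra as a module algebra -/

section RE

variable {k ι U : Type*} [Field k] [Fintype ι] [DecidableEq ι] [Ring U] [HopfAlgebra k U]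
  (ρ : U →ₐ[k] Matrix ι ι k) {R : (U ⊗[k] U)ˣ}
  (hγ : Function.Bijective (HopfAlgebra.antipode k (A := U))) (hR : IsUniversalRMatrix R)

/-- `x ↦ (m ↦ ρ(γ(x))ᵀ m)`. -/
def antiLeft : U →ₗ[k] Module.End k (Matrix ι ι k) := transLeft ρ ∘ₗ HopfAlgebra.antipode k

theorem antiLeft_apply (x : U) (m : Matrix ι ι k) :
    antiLeft ρ x m = (ρ (HopfAlgebra.antipode k x)).transpose * m := rfl

instance : IsPoint (antiLeft ρ) where
  map_one := by
    refine LinearMap.ext fun m => ?_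
    simp [antiLeft_apply, HopfAlgebra.antipode_one]
  map_mul x y := by
    refine LinearMap.ext fun m => ?_
    simp [antiLeft_apply, HopfAlgebra.antipode_mul_antidistrib, Matrix.transpose_mul, mul_assoc]

instance : Commuting (antiLeft ρ) (transRight ρ) :=
  ⟨fun x y => LinearMap.ext fun m => by simp [antiLeft_apply, transRight_apply, mul_assoc]⟩

theorem antiLeft_comp_antiInv : antiLeft ρ ∘ₗ antiInv hγ = transLeft ρ := by
  refine LinearMap.ext fun x => ?_
  simp [antiLeft]

/-- The representation of `U ⊗ U` on matrices corresponding to `(x ⊗ y) ▸ K = ρ(γ(x)) K ρ(y)`. -/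
def matrixRep : U ⊗[k] U →ₐ[k] Module.End k (Matrix ι ι k) :=
  IsPoint.toAlgHom (pair (antiLeft ρ) (transRight ρ))

theorem toLinearMap_matrixRep :
    (matrixRep ρ).toLinearMap = pair (antiLeft ρ) (transRight ρ) := rfl

variable {N : Type*} [AddCommGroup N] [Module k N]

theorem pair_on1 {V W N' : Type*} [AddCommGroup V] [Module k V] [AddCommGroup W] [Module k W]
    [AddCommGroup N'] [Module k N'] (f : V →ₗ[k] Module.End k N) (g : W →ₗ[k] Module.End k N) :
    pair (on1 N' f) (on1 N' g) = on1 N' (pair f g) :=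
  (algHom_comp_pair (Module.End.rTensorAlgHom k N N') f g).symm

theorem on1_matrixRep : on1 N (matrixRep ρ).toLinearMap =
    pair (E := Module.End k (Matrix ι ι k ⊗[k] N)) (on1 N (antiLeft ρ)) (on1 N (transRight ρ)) :=
  (pair_on1 _ _).symm

theorem on2_matrixRep : on2 N (matrixRep ρ).toLinearMap =
    pair (E := Module.End k (N ⊗[k] Matrix ι ι k)) (on2 N (antiLeft ρ)) (on2 N (transRight ρ)) :=
  (pair_on2 _ _).symm

variable (k ι) in
/-- The flip of the tensor square of the space of matrices. -/
def matFlip : Module.End k (Matrix ι ι k ⊗[k] Matrix ι ι k) :=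
  (TensorProduct.comm k (Matrix ι ι k) (Matrix ι ι k)).toLinearMap

omit [Fintype ι] [DecidableEq ι] in
theorem matFlip_mul_on1 {V : Type*} [AddCommGroup V] [Module k V]
    (f : V →ₗ[k] Module.End k (Matrix ι ι k)) (x : V) :
    matFlip k ι * on1 _ f x = on2 _ f x * matFlip k ι :=
  TensorProduct.ext' fun a b => by simp [matFlip]

omit [Fintype ι] [DecidableEq ι] in
theorem matFlip_mul_on2 {V : Type*} [AddCommGroup V] [Module k V]
    (f : V →ₗ[k] Module.End k (Matrix ι ι k)) (x : V) :
    matFlip k ι * on2 _ f x = on1 _ f x * matFlip k ι :=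
  TensorProduct.ext' fun a b => by simp [matFlip]

variable (R) in
/-- The operator of the left hand side of the reflection equation. -/
def reflLeft : Module.End k (Matrix ι ι k ⊗[k] Matrix ι ι k) :=
  pair (E := Module.End k (Matrix ι ι k ⊗[k] Matrix ι ι k))
      (on1 _ (transRight ρ)) (on2 _ (antiLeft ρ)) (↑R⁻¹ : U ⊗[k] U) *
    pair (E := Module.End k (Matrix ι ι k ⊗[k] Matrix ι ι k))
      (on2 _ (antiLeft ρ)) (on1 _ (antiLeft ρ)) (R : U ⊗[k] U)

variable (R) in
/-- The operator of the right hand side of the reflection equation. -/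
def reflRight : Module.End k (Matrix ι ι k ⊗[k] Matrix ι ι k) :=
  pair (E := Module.End k (Matrix ι ι k ⊗[k] Matrix ι ι k))
      (on1 _ (transRight ρ)) (on2 _ (antiLeft ρ)) (↑R⁻¹ : U ⊗[k] U) * matFlip k ι *
    pair (E := Module.End k (Matrix ι ι k ⊗[k] Matrix ι ι k))
      (on1 _ (transRight ρ)) (on2 _ (transRight ρ)) (R : U ⊗[k] U)

section Equivariance

variable {E : Type*} [Ring E] [Algebra k E] (a b c d : U →ₗ[k] E)
  [IsPoint a] [IsPoint b] [IsPoint c] [IsPoint d]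
  [Commuting a b] [Commuting a c] [Commuting a d] [Commuting b c] [Commuting b d] [Commuting c d]

include hR

/-- The factor `R_{bc}⁻¹` passes from the twisted to the componentwise coproduct, and `R_{ca}`
reverses the convolution of `a` and `c`. The resulting representation on the right is the same as
for the other side of the reflection equation, so the difference of the two sides is equivariant. -/
theorem conv_mul_reflection_left (x : U ⊗[k] U) :
    conv (twistedComul R) (pair a b) (pair c d) x *
      (pair b c (↑R⁻¹ : U ⊗[k] U) * pair c a (R : U ⊗[k] U)) =
    pair b c (↑R⁻¹ : U ⊗[k] U) * pair c a (R : U ⊗[k] U) *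
      pair (conv (cop k U) c a) (conv (cop k U) b d) x := by
  have h1 := conv_twistedComul (R := R) a b c d x
  have h2 := pair_semiconj (hR.conv_swap c a)
    (fun y => commute_cst (pair c a (R : U ⊗[k] U)) (conv (cop k U) b d) y) x
  have h3 := congrArg (fun e => pair b c (↑R⁻¹ : U ⊗[k] U) * e * pair b c (↑R⁻¹ : U ⊗[k] U)) h1
  simp only [mul_assoc, IsPoint.inv_mul_cancel, IsPoint.map_mul_inv, mul_one] at h3
  rw [← mul_assoc, h3, mul_assoc, mul_assoc, h2]

theorem conv_mul_reflection_right (τ : E) (ha : ∀ x, τ * c x = a x * τ)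
    (hc' : ∀ x, τ * a x = c x * τ) (hb : ∀ x, τ * b x = d x * τ) (hd : ∀ x, τ * d x = b x * τ)
    (x : U ⊗[k] U) :
    conv (twistedComul R) (pair a b) (pair c d) x *
      (pair b c (↑R⁻¹ : U ⊗[k] U) * τ * pair b d (R : U ⊗[k] U)) =
    pair b c (↑R⁻¹ : U ⊗[k] U) * τ * pair b d (R : U ⊗[k] U) *
      pair (conv (cop k U) c a) (conv (cop k U) b d) x := by
  have h1 := conv_twistedComul (R := R) a b c d x
  have h2 := pair_semiconj
    (fun y => commute_cst (pair b d (R : U ⊗[k] U)) (conv (cop k U) c a) y) (hR.conv_swap b d) x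
  have h4 := pair_semiconj (e := τ) (fun y => conv_semiconj (Δ := cop k U) ha hc' y)
    (fun y => conv_semiconj (Δ := cop k U) hd hb y) x
  have h3 := congrArg (fun e => pair b c (↑R⁻¹ : U ⊗[k] U) * e * pair b c (↑R⁻¹ : U ⊗[k] U)) h1
  simp only [mul_assoc, IsPoint.inv_mul_cancel, IsPoint.map_mul_inv, mul_one] at h3
  rw [← mul_assoc, ← mul_assoc, h3, mul_assoc, mul_assoc, mul_assoc, ← mul_assoc _ τ, ← h4]
  simp only [mul_assoc]
  rw [h2]

end Equivariance

include hR in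
theorem conv_reflection (x : U ⊗[k] U) (n : Matrix ι ι k ⊗[k] Matrix ι ι k) :
    conv (E := Module.End k (Matrix ι ι k ⊗[k] Matrix ι ι k)) (twistedComul R)
      (on1 _ (matrixRep ρ).toLinearMap) (on2 _ (matrixRep ρ).toLinearMap) x
      ((reflLeft ρ R - reflRight ρ R) n) =
    (reflLeft ρ R - reflRight ρ R) (pair (E := Module.End k (Matrix ι ι k ⊗[k] Matrix ι ι k))
      (conv (cop k U) (on2 _ (antiLeft ρ)) (on1 _ (antiLeft ρ)))
      (conv (cop k U) (on1 _ (transRight ρ)) (on2 _ (transRight ρ))) x n) := by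
  have h1 := LinearMap.congr_fun (conv_mul_reflection_left
    (E := Module.End k (Matrix ι ι k ⊗[k] Matrix ι ι k)) hR (on1 _ (antiLeft ρ))
    (on1 _ (transRight ρ)) (on2 _ (antiLeft ρ)) (on2 _ (transRight ρ)) x) n
  have h2 := LinearMap.congr_fun (conv_mul_reflection_right
    (E := Module.End k (Matrix ι ι k ⊗[k] Matrix ι ι k)) hR (on1 _ (antiLeft ρ))
    (on1 _ (transRight ρ)) (on2 _ (antiLeft ρ)) (on2 _ (transRight ρ)) (matFlip k ι)
    (matFlip_mul_on2 _) (matFlip_mul_on1 _) (matFlip_mul_on1 _) (matFlip_mul_on2 _) x) n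
  rw [← reflLeft, Module.End.mul_apply, Module.End.mul_apply] at h1
  rw [← reflRight, Module.End.mul_apply, Module.End.mul_apply] at h2
  rw [on1_matrixRep, on2_matrixRep, LinearMap.sub_apply, LinearMap.sub_apply, map_sub, h1, h2]

/-! ### Coordinates -/

section Coordinates

include hγ hR

/-- The second leg acts through `γ`. Replacing `R⁻¹` by `(id ⊗ γ⁻¹)(R)` removes both the inverse and
the antipode; the operator form of the relations thus contains only `R`. -/
theorem pair_transRight_antiLeft :
    pair (E := Module.End k (Matrix ι ι k ⊗[k] Matrix ι ι k))
      (on1 _ (transRight ρ)) (on2 _ (antiLeft ρ)) (↑R⁻¹ : U ⊗[k] U) =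
    pair (E := Module.End k (Matrix ι ι k ⊗[k] Matrix ι ι k))
      (on1 _ (transRight ρ)) (on2 _ (transLeft ρ)) (R : U ⊗[k] U) := by
  rw [← hR.antiInv_right (E := Module.End k _) _ _ hγ, ← antiLeft_comp_antiInv ρ hγ]
  rfl

theorem pair_antiLeft_antiLeft :
    pair (E := Module.End k (Matrix ι ι k ⊗[k] Matrix ι ι k))
      (on2 _ (antiLeft ρ)) (on1 _ (antiLeft ρ)) (R : U ⊗[k] U) =
    pair (E := Module.End k (Matrix ι ι k ⊗[k] Matrix ι ι k))
      (on2 _ (transLeft ρ)) (on1 _ (transLeft ρ)) (R : U ⊗[k] U) := by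
  rw [← hR.antiInv_antiInv (E := Module.End k _) _ _ hγ, ← antiLeft_comp_antiInv ρ hγ]
  rfl

variable {S : Type*} [Ring S] [Algebra k S] (K : Matrix ι ι S)

/-- Links the coordinate-free operator `reflLeft`, for which equivariance is easy, to the matrix
entries by which the RE algebra is defined. -/
theorem pair_reflLeft_single (i j l m : ι) :
    pair (matLin K) (matLin K)
      (reflLeft ρ R (Matrix.single i j 1 ⊗ₜ Matrix.single l m 1)) =
    (flipMul ((repMatrix ρ ((R : U ⊗[k] U) ⊗ₜ[k] (1 : k))).map (algebraMap k S)) * sndCopy K *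
      flipMul ((repMatrix ρ ((R : U ⊗[k] U) ⊗ₜ[k] (1 : k))).map (algebraMap k S)) * sndCopy K)
      (i, l) (j, m) := by
  rw [reflection_left_apply, reflLeft, Module.End.mul_apply, pair_antiLeft_antiLeft ρ hγ hR,
    pair_transLeft_transLeft, pair_transRight_antiLeft ρ hγ hR]
  simp only [map_sum, map_smul, pair_transRight_transLeft, pair_tmul, matLin_single,
    Matrix.map_apply, repMatrix_tmul, smul_eq_mul, mul_one, ← Algebra.smul_def]
  simp only [← Algebra.commutes, ← Algebra.smul_def, smul_mul_assoc]

theorem pair_reflRight_single (i j l m : ι) :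
    pair (matLin K) (matLin K)
      (reflRight ρ R (Matrix.single i j 1 ⊗ₜ Matrix.single l m 1)) =
    (sndCopy K * flipMul ((repMatrix ρ ((R : U ⊗[k] U) ⊗ₜ[k] (1 : k))).map (algebraMap k S)) *
      sndCopy K * flipMul ((repMatrix ρ ((R : U ⊗[k] U) ⊗ₜ[k] (1 : k))).map (algebraMap k S)))
      (i, l) (j, m) := by
  rw [reflection_right_apply, reflRight, mul_assoc, Module.End.mul_apply, Module.End.mul_apply,
    pair_transRight_transRight, pair_transRight_antiLeft ρ hγ hR]
  simp only [map_sum, map_smul, matFlip, LinearEquiv.coe_coe, TensorProduct.comm_tmul,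
    pair_transRight_transLeft, pair_tmul, matLin_single,
    Matrix.map_apply, repMatrix_tmul, smul_eq_mul, mul_one]
  simp only [← Algebra.commutes, ← Algebra.smul_def, smul_mul_assoc]

end Coordinates

/-! ### The universal property of the RE algebra -/

section Universal

variable {S : Type*} [Ring S] [Algebra k S]

theorem matS_map : (matS ρ R).map (algebraMap k S) =
    flipMul ((repMatrix ρ ((R : U ⊗[k] U) ⊗ₜ[k] (1 : k))).map (algebraMap k S)) := rfl

omit [Fintype ι] [DecidableEq ι] in
theorem map_algebraMap_map {A : Type*} [Ring A] [Algebra k A] (f : A →ₐ[k] S)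
    (X : Matrix (ι × ι) (ι × ι) k) : (X.map (algebraMap k A)).map f = X.map (algebraMap k S) := by
  ext; simp

theorem pair_reflection_eq_zero_iff {f : Matrix ι ι k →ₗ[k] S} :
    (∀ n, pair f f ((reflLeft ρ R - reflRight ρ R) n) = 0) ↔
    ∀ i j l m, pair f f (reflLeft ρ R (Matrix.single i j 1 ⊗ₜ Matrix.single l m 1)) =
      pair f f (reflRight ρ R (Matrix.single i j 1 ⊗ₜ Matrix.single l m 1)) := by
  refine ⟨fun h i j l m => ?_, fun h n => ?_⟩
  · rw [← sub_eq_zero, ← map_sub, ← LinearMap.sub_apply, h]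
  · have : pair f f ∘ₗ (reflLeft ρ R - reflRight ρ R) = 0 := ext_single₂ fun i j l m => by
      rw [LinearMap.comp_apply, LinearMap.sub_apply, map_sub, h, sub_self, LinearMap.zero_apply]
    exact LinearMap.congr_fun this n

include hγ hR in
theorem REAlgebra.pair_gen (n : Matrix ι ι k ⊗[k] Matrix ι ι k) :
    pair (matLin (REAlgebra.gen (matS ρ R))) (matLin (REAlgebra.gen (matS ρ R)))
      ((reflLeft ρ R - reflRight ρ R) n) = 0 := by
  revert n
  rw [pair_reflection_eq_zero_iff]
  intro i j l m
  rw [pair_reflLeft_single ρ hγ hR, pair_reflRight_single ρ hγ hR, ← matS_map]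
  have h := RingQuot.mkAlgHom_rel k (show ReflectionRel
    ((matS ρ R).map (algebraMap k (FreeAlgebra k (ι × ι))))
    (Matrix.of fun i j => FreeAlgebra.ι k (i, j)) _ _ from ⟨(i, l), (j, m), rfl, rfl⟩)
  rw [map_reflection_left, map_reflection_right, map_algebraMap_map] at h
  exact h

include hγ hR in
theorem REAlgebra.exists_lift (f : Matrix ι ι k →ₗ[k] S)
    (hf : ∀ n, pair f f ((reflLeft ρ R - reflRight ρ R) n) = 0) :
    ∃ F : REAlgebra (matS ρ R) →ₐ[k] S, ∀ m, F (matLin (REAlgebra.gen (matS ρ R)) m) = f m := by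
  rw [pair_reflection_eq_zero_iff] at hf
  set K : Matrix ι ι S := Matrix.of fun i j => f (Matrix.single i j 1) with hK
  let F₀ : FreeAlgebra k (ι × ι) →ₐ[k] S := FreeAlgebra.lift k fun p => K p.1 p.2
  have hF₀ : (Matrix.of fun i j => FreeAlgebra.ι k (i, j)).map F₀ = K := by
    ext; simp [F₀]
  have hrel : ∀ ⦃x y⦄, ReflectionRel ((matS ρ R).map (algebraMap k (FreeAlgebra k (ι × ι))))
      (Matrix.of fun i j => FreeAlgebra.ι k (i, j)) x y → F₀ x = F₀ y := by
    rintro x y ⟨⟨i, l⟩, ⟨j, m⟩, rfl, rfl⟩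
    rw [map_reflection_left, map_reflection_right, map_algebraMap_map, hF₀, matS_map,
      ← pair_reflLeft_single ρ hγ hR, ← pair_reflRight_single ρ hγ hR, hK, ← linearMap_eq_matLin]
    exact hf i j l m
  have : (RingQuot.liftAlgHom k ⟨F₀, hrel⟩).toLinearMap ∘ₗ matLin (REAlgebra.gen (matS ρ R)) = f :=
    ext_single fun i j => by simp [REAlgebra.gen, F₀, K]
  exact ⟨RingQuot.liftAlgHom k ⟨F₀, hrel⟩, fun m => LinearMap.congr_fun this m⟩

theorem REAlgebra.adjoin_gen :
    Algebra.adjoin k (Set.range (matLin (k := k) (REAlgebra.gen (matS ρ R)))) = ⊤ := by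
  set q := RingQuot.mkAlgHom k (ReflectionRel
    ((matS ρ R).map (algebraMap k (FreeAlgebra k (ι × ι))))
    (Matrix.of fun i j => FreeAlgebra.ι k (i, j)))
  have h1 : (Algebra.adjoin k (Set.range (FreeAlgebra.ι k (X := ι × ι)))).map q = ⊤ := by
    rw [FreeAlgebra.adjoin_range_ι, Algebra.map_top, AlgHom.range_eq_top]
    exact RingQuot.mkAlgHom_surjective k _
  rw [AlgHom.map_adjoin] at h1
  rw [eq_top_iff, ← h1]
  refine Algebra.adjoin_mono ?_
  rintro _ ⟨_, ⟨p, rfl⟩, rfl⟩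
  exact ⟨Matrix.single p.1 p.2 1, by simp [REAlgebra.gen, q]⟩

end Universal

/-! ### The action -/

theorem isREAction_iff {act : U ⊗[k] U →ₐ[k] Module.End k (REAlgebra (matS ρ R))} :
    IsREAction ρ R act ↔
      IsModuleAlgebra (twistedComul R) (Bialgebra.counitAlgHom k (U ⊗[k] U)) act ∧
      ∀ β m, act β (matLin (REAlgebra.gen (matS ρ R)) m) =
        matLin (REAlgebra.gen (matS ρ R)) (matrixRep ρ β m) := by
  have h : ∀ x y i j, matLin (REAlgebra.gen (matS ρ R))
      (matrixRep ρ (x ⊗ₜ y) (Matrix.single i j 1)) =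
      ∑ a : ι, ∑ b : ι, (ρ (HopfAlgebra.antipode k x) i a * ρ y b j) •
        REAlgebra.gen (matS ρ R) a b := by
    intro x y i j
    have e : matrixRep ρ (x ⊗ₜ y) (Matrix.single i j 1) =
        transLeft ρ (HopfAlgebra.antipode k x) (transRight ρ y (Matrix.single i j 1)) := by
      rw [← AlgHom.toLinearMap_apply, toLinearMap_matrixRep, pair_tmul]
      rfl
    rw [e, transRight_single]
    simp only [map_sum, map_smul, transLeft_single, matLin_single, Finset.smul_sum, smul_smul]
    rw [Finset.sum_comm]
    simp only [mul_comm]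
  refine ⟨fun hA => ⟨hA.1, fun β m => ?_⟩, fun hA => ⟨hA.1, fun x y i j => ?_⟩⟩
  · induction β with
    | zero => simp
    | add s t hs ht => simp only [map_add, LinearMap.add_apply, hs, ht]
    | tmul x y =>
      have e : act (x ⊗ₜ y) ∘ₗ matLin (k := k) (REAlgebra.gen (matS ρ R)) =
          matLin (k := k) (REAlgebra.gen (matS ρ R)) ∘ₗ matrixRep ρ (x ⊗ₜ y) :=
        ext_single fun i j => by
          rw [LinearMap.comp_apply, LinearMap.comp_apply, matLin_single, h, hA.2]
      exact LinearMap.congr_fun e m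
  · have := hA.2 (x ⊗ₜ y) (Matrix.single i j 1)
    rw [matLin_single, h] at this
    exact this

end RE

/-! ### Existence and uniqueness of the action on the RE algebra -/

section Existence

universe u v w

variable {k : Type u} {ι : Type v} {U : Type w} [Field k] [Fintype ι] [DecidableEq ι] [Ring U]
  [HopfAlgebra k U] (ρ : U →ₐ[k] Matrix ι ι k) {R : (U ⊗[k] U)ˣ}
  (hγ : Function.Bijective (HopfAlgebra.antipode k (A := U))) (hR : IsUniversalRMatrix R)

include hγ hR in
theorem existsUnique_isREAction :
    ∃! act : U ⊗[k] U →ₐ[k] Module.End k (REAlgebra (matS ρ R)), IsREAction ρ R act := by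
  have hc := isCompatible_twistedComul hR (BialgHom.id k U)
  obtain ⟨act, h1, h2⟩ := exists_isModuleAlgebra (K := REAlgebra (matS ρ R))
    hc.coassoc hc.counitLeft hc.counitRight
    (REAlgebra.adjoin_gen ρ) (conv_reflection ρ hR) (REAlgebra.pair_gen ρ hγ hR)
    (fun E _ _ f hf => REAlgebra.exists_lift ρ hγ hR f hf)
  refine ⟨act, (isREAction_iff ρ).2 ⟨h1, h2⟩, fun act' h' => ?_⟩
  replace h' := (isREAction_iff ρ).1 h'
  exact h'.1.ext_of_generators h1 (REAlgebra.adjoin_gen ρ) fun β m => by rw [h'.2, h2]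

end Existence

/-! ## The dynamical reflection equation -/

section DynamicalSides

variable {k H L U E : Type*} [Field k] [Ring H] [Bialgebra k H] [Ring L] [Algebra k L]
  [Ring U] [HopfAlgebra k U] [Ring E] [Algebra k E] (𝔏 : BaseAlgebra k H L)
  (j : H →ₐc[k] U) (R : (U ⊗[k] U)ˣ) (F : ((U ⊗[k] U) ⊗[k] L)ˣ)
  (hγ : Function.Bijective (HopfAlgebra.antipode k (A := U)))
  (a b c d : U →ₗ[k] E) (l : L →ₗ[k] E)

/-- The left hand side of the dynamical reflection equation, at points. -/
def dynReflLeft : E :=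
  tri (rp hγ c) (rp hγ a) (lp (𝔏.dyn (j : H →ₐ[k] U) (conv (cop k U) (conv (cop k U) a b)
    (conv (cop k U) c d)) l)) (dynR R F) (dynSideX 𝔏 j R F hγ b c d l)

/-- The right hand side of the dynamical reflection equation, at points. -/
def dynReflRight (τ : E) : E := dynSideX 𝔏 j R F hγ b c d l * τ * tri b d l (dynR R F)

/-- The left hand side of the reflection equation, at points. -/
def ptReflLeft : E := pair b c (↑R⁻¹ : U ⊗[k] U) * pair c a (R : U ⊗[k] U)

/-- The right hand side of the reflection equation, at points. -/
def ptReflRight (τ : E) : E := pair b c (↑R⁻¹ : U ⊗[k] U) * τ * pair b d (R : U ⊗[k] U)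

variable {R F} {z : (U ⊗[k] L)ˣ} (hR : IsUniversalRMatrix R)
  (hF : IsDynamicalTwist (j : H →ₐ[k] U) 𝔏 F) (hz : (z : U ⊗[k] L) = zeta hγ F)
  [IsPoint a] [IsPoint b] [IsPoint c] [IsPoint d] [IsPoint l]
  [Commuting a b] [Commuting a c] [Commuting a d] [Commuting b c] [Commuting b d] [Commuting c d]
  [Commuting a l] [Commuting b l] [Commuting c l] [Commuting d l]

-- The common factor `Z` is `F` gauged by `ζ` at `c, a`, with the `L`-point shifted by `b` and `d`,
-- times `F` at `b, d`. That it is invertible and the same for both sides makes the two kinds of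
-- relations equivalent.
include hR hF hz in
theorem exists_compositeUnit_mul_dynRefl (τ : E) (ha : ∀ x, τ * c x = a x * τ)
    (hc : ∀ x, τ * a x = c x * τ) (hb : ∀ x, τ * b x = d x * τ) (hd : ∀ x, τ * d x = b x * τ)
    (hl : ∀ x, τ * l x = l x * τ) :
    ∃ Z : Eˣ,
      tri (pair a b) (pair c d) l (compositeUnit 𝔏 j R F z : _) * dynReflLeft 𝔏 j R F hγ a b c d l =
        ptReflLeft R a b c * Z ∧
      tri (pair a b) (pair c d) l (compositeUnit 𝔏 j R F z : _) *
          dynReflRight 𝔏 j R F hγ b c d l τ = ptReflRight R b c d τ * Z := by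
  let t₁ := IsPoint.toAlgHom (tri c a (𝔏.dyn (j : H →ₐ[k] U) (conv (cop k U) b d) l))
  let t₂ := IsPoint.toAlgHom (tri b d l)
  exact ⟨Units.map t₁.toMonoidHom (gaugeUnit 𝔏 (cop k U) (j : H →ₐ[k] U) z F) *
    Units.map t₂.toMonoidHom F, compositeUnit_mul_left hR hF hγ hz a b c d l,
    compositeUnit_mul_right hR hF hγ hz a b c d l τ ha hc hb hd hl⟩

include hR hF hz in
/-- The composite twist turns the dynamical reflection equation into the reflection equation. -/
theorem map_compositeUnit_dynRefl {τ : E} (ha : ∀ x, τ * c x = a x * τ)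
    (hc : ∀ x, τ * a x = c x * τ) (hb : ∀ x, τ * b x = d x * τ) (hd : ∀ x, τ * d x = b x * τ)
    (hl : ∀ x, τ * l x = l x * τ) {V : Type*} [AddCommGroup V] [Module k V] (Q : E →ₗ[k] V)
    (hQ : ∀ e, Q (ptReflLeft R a b c * e) = Q (ptReflRight R b c d τ * e)) (e : E) :
    Q (tri (pair a b) (pair c d) l (compositeUnit 𝔏 j R F z : _) *
        (dynReflLeft 𝔏 j R F hγ a b c d l * e)) =
      Q (tri (pair a b) (pair c d) l (compositeUnit 𝔏 j R F z : _) *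
        (dynReflRight 𝔏 j R F hγ b c d l τ * e)) := by
  obtain ⟨Z, h1, h2⟩ := exists_compositeUnit_mul_dynRefl 𝔏 j hγ a b c d l hR hF hz τ ha hc hb hd hl
  rw [← mul_assoc, h1, ← mul_assoc, h2, mul_assoc, mul_assoc, hQ]

include hR hF hz in
/-- The inverse of the composite twist turns the reflection equation into the dynamical reflection
equation. -/
theorem map_compositeUnit_inv_refl {τ : E} (ha : ∀ x, τ * c x = a x * τ)
    (hc : ∀ x, τ * a x = c x * τ) (hb : ∀ x, τ * b x = d x * τ) (hd : ∀ x, τ * d x = b x * τ)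
    (hl : ∀ x, τ * l x = l x * τ) {V : Type*} [AddCommGroup V] [Module k V] (Q : E →ₗ[k] V)
    (hQ : ∀ e, Q (dynReflLeft 𝔏 j R F hγ a b c d l * e) =
      Q (dynReflRight 𝔏 j R F hγ b c d l τ * e)) (e : E) :
    Q (tri (pair a b) (pair c d) l (↑(compositeUnit 𝔏 j R F z)⁻¹ : _) *
        (ptReflLeft R a b c * e)) =
      Q (tri (pair a b) (pair c d) l (↑(compositeUnit 𝔏 j R F z)⁻¹ : _) *
        (ptReflRight R b c d τ * e)) := by
  obtain ⟨Z, h1, h2⟩ := exists_compositeUnit_mul_dynRefl 𝔏 j hγ a b c d l hR hF hz τ ha hc hb hd hl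
  have key : ∀ x y : E, tri (pair a b) (pair c d) l (compositeUnit 𝔏 j R F z : _) * x = y * Z →
      tri (pair a b) (pair c d) l (↑(compositeUnit 𝔏 j R F z)⁻¹ : _) * (y * e) =
        x * (↑Z⁻¹ * e) := by
    intro x y h
    have h3 := congrArg (fun e' => tri (pair a b) (pair c d) l
      (↑(compositeUnit 𝔏 j R F z)⁻¹ : _) * (e' * (↑Z⁻¹ * e))) h
    simp only [mul_assoc, Units.mul_inv_cancel_left] at h3
    have h4 := IsPoint.map_inv_mul (k := k) (E := E)
      (A := ((U ⊗[k] U) ⊗[k] (U ⊗[k] U)) ⊗[k] L)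
      (tri (pair a b) (pair c d) l) (compositeUnit 𝔏 j R F z)
    rw [← mul_assoc, h4, one_mul] at h3
    exact h3.symm
  rw [key _ _ h1, key _ _ h2, hQ]

end DynamicalSides

/-! ### Operators on `M ⊗ M ⊗ L` and the flip -/

section TwoRep

variable {k H L U M : Type*} [Field k] [Ring H] [Bialgebra k H] [Ring L] [Algebra k L]
  [Ring U] [HopfAlgebra k U] [AddCommGroup M] [Module k M] (𝔏 : BaseAlgebra k H L)
  (j : H →ₐc[k] U) {R : (U ⊗[k] U)ˣ} {F : ((U ⊗[k] U) ⊗[k] L)ˣ}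
  (hγ : Function.Bijective (HopfAlgebra.antipode k (A := U)))
  (p q : U →ₗ[k] Module.End k M) [IsPoint p] [IsPoint q] [Commuting p q]

/-- The representation of `U ⊗ U` defined by two commuting representations of `U`. -/
abbrev twoRep : U ⊗[k] U →ₐ[k] Module.End k M := IsPoint.toAlgHom (pair p q)

variable (k L M) in
/-- The algebra of operators on `M ⊗ M ⊗ L`. -/
abbrev DynEnd := Module.End k (M ⊗[k] (M ⊗[k] L))

variable (k L M) in
/-- `m ⊗ m' ⊗ λ ↦ m' ⊗ m ⊗ λ`. -/
def dynFlip : DynEnd k L M := (TensorProduct.leftComm k M M L).toLinearMap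

theorem on1_twoRep {N : Type*} [AddCommGroup N] [Module k N] :
    on1 N (twoRep p q).toLinearMap = pair (E := Module.End k (M ⊗[k] N)) (on1 N p) (on1 N q) :=
  (pair_on1 p q).symm

theorem twistOp_twoRep (u : ((U ⊗[k] U) ⊗[k] (U ⊗[k] U)) ⊗[k] L) :
    twistOp (twoRep p q) (twoRep p q) u =
      tri (E := DynEnd k L M) (pair (E := DynEnd k L M) (on1 _ p) (on1 _ q))
        (pair (E := DynEnd k L M) (on2 _ (on1 L p)) (on2 _ (on1 L q)))
        (on2 _ (on2 _ (ptMul k L))) u := by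
  rw [twistOp, on1_twoRep, on1_twoRep, ← pair_on2]

theorem on2_lact_twoRep : on2 M (lact 𝔏 (diagIncl (j : H →ₐ[k] U)) (twoRep p q)) =
    𝔏.dyn (E := DynEnd k L M) (j : H →ₐ[k] U) (conv (E := DynEnd k L M) (cop k U)
      (on2 _ (on1 L p)) (on2 _ (on1 L q))) (on2 _ (on2 _ (ptMul k L))) := by
  rw [lact, on1_twoRep, ← dyn_on2, ← pair_on2]
  rfl

theorem dyn_twoRep : 𝔏.dyn (E := DynEnd k L M) (diagIncl (j : H →ₐ[k] U))
      (on1 _ (twoRep p q).toLinearMap)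
      (on2 M (lact 𝔏 (diagIncl (j : H →ₐ[k] U)) (twoRep p q))) =
    𝔏.dyn (E := DynEnd k L M) (j : H →ₐ[k] U) (conv (E := DynEnd k L M) (cop k U)
      (conv (E := DynEnd k L M) (cop k U) (on1 _ p) (on1 _ q))
      (conv (E := DynEnd k L M) (cop k U) (on2 _ (on1 L p)) (on2 _ (on1 L q))))
      (on2 _ (on2 _ (ptMul k L))) := by
  rw [on2_lact_twoRep, on1_twoRep, dyn_diagIncl_pair,
    𝔏.dyn_assoc (E := DynEnd k L M) (isCompatible_cop j).comulHom]

theorem dynFlip_mul_on1 {V : Type*} [AddCommGroup V] [Module k V]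
    (f : V →ₗ[k] Module.End k M) (x : V) :
    dynFlip k L M * on1 _ f x = on2 _ (on1 L f) x * dynFlip k L M := by
  ext a b l
  simp [dynFlip]

theorem dynFlip_mul_on2 {V : Type*} [AddCommGroup V] [Module k V]
    (f : V →ₗ[k] Module.End k M) (x : V) :
    dynFlip k L M * on2 _ (on1 L f) x = on1 _ f x * dynFlip k L M := by
  ext a b l
  simp [dynFlip]

theorem dynFlip_mul_on2_on2 {V : Type*} [AddCommGroup V] [Module k V]
    (f : V →ₗ[k] Module.End k L) (x : V) :
    dynFlip k L M * on2 _ (on2 _ f) x = on2 _ (on2 _ f) x * dynFlip k L M := by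
  ext a b l
  simp [dynFlip]

theorem dynFlip_assoc (t : (M ⊗[k] M) ⊗[k] L) : dynFlip k L M (TensorProduct.assoc k M M L t) =
    TensorProduct.assoc k M M L ((TensorProduct.comm k M M).toLinearMap.rTensor L t) := by
  have : dynFlip k L M ∘ₗ (TensorProduct.assoc k M M L).toLinearMap =
      (TensorProduct.assoc k M M L).toLinearMap ∘ₗ
        (TensorProduct.comm k M M).toLinearMap.rTensor L := by
    ext a b l
    simp [dynFlip]
  exact LinearMap.congr_fun this t

theorem assoc_rTensor_pair {V W : Type*} [AddCommGroup V] [Module k V] [AddCommGroup W] [Module k W]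
    {f : V →ₗ[k] Module.End k (M ⊗[k] M)} {g : W →ₗ[k] Module.End k (M ⊗[k] M)}
    {f' : V →ₗ[k] DynEnd k L M} {g' : W →ₗ[k] DynEnd k L M}
    (hf : ∀ x n, TensorProduct.assoc k M M L (on1 L f x n) = f' x (TensorProduct.assoc k M M L n))
    (hg : ∀ x n, TensorProduct.assoc k M M L (on1 L g x n) = g' x (TensorProduct.assoc k M M L n))
    (u : V ⊗[k] W) (t : (M ⊗[k] M) ⊗[k] L) :
    TensorProduct.assoc k M M L
        ((pair (E := Module.End k (M ⊗[k] M)) f g u).rTensor L t) =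
      pair (E := DynEnd k L M) f' g' u (TensorProduct.assoc k M M L t) := by
  refine Eq.trans ?_ (pair_intertwine (μ := (TensorProduct.assoc k M M L).toLinearMap) hf hg u t)
  rw [pair_on1]
  rfl

variable (R)

omit [IsPoint p] [IsPoint q] [Commuting p q] in
theorem ptReflLeft_assoc (t : (M ⊗[k] M) ⊗[k] L) :
    ptReflLeft (E := DynEnd k L M) R (on1 _ p) (on1 _ q) (on2 _ (on1 L p))
      (TensorProduct.assoc k M M L t) =
    TensorProduct.assoc k M M L
      ((ptReflLeft (E := Module.End k (M ⊗[k] M)) R (on1 _ p) (on1 _ q) (on2 _ p)).rTensor L t) := by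
  have h1 := assoc_rTensor_pair (f := on1 M q) (g := on2 M p) (f' := on1 (M ⊗[k] L) q)
    (g' := on2 M (on1 L p)) (fun x n => assoc_on1 x n) (fun x n => assoc_on2 x n)
    (↑R⁻¹ : U ⊗[k] U)
  have h2 := assoc_rTensor_pair (f := on2 M p) (g := on1 M p) (f' := on2 M (on1 L p))
    (g' := on1 (M ⊗[k] L) p) (fun x n => assoc_on2 x n) (fun x n => assoc_on1 x n)
    (R : U ⊗[k] U)
  have h3 := congrArg (fun s => pair (E := DynEnd k L M) (on1 (M ⊗[k] L) q) (on2 M (on1 L p))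
    (↑R⁻¹ : U ⊗[k] U) s) (h2 t)
  refine (h3.symm.trans (h1 _).symm).trans ?_
  refine congrArg (TensorProduct.assoc k M M L) ?_
  exact (LinearMap.congr_fun (LinearMap.rTensor_comp L _ _) t).symm

omit [IsPoint q] [IsPoint p] [Commuting p q] in
theorem ptReflRight_assoc (t : (M ⊗[k] M) ⊗[k] L) :
    ptReflRight (E := DynEnd k L M) R (on1 _ q) (on2 _ (on1 L p)) (on2 _ (on1 L q))
      (dynFlip k L M) (TensorProduct.assoc k M M L t) =
    TensorProduct.assoc k M M L
      ((ptReflRight (E := Module.End k (M ⊗[k] M)) R (on1 _ q) (on2 _ p) (on2 _ q)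
        (TensorProduct.comm k M M).toLinearMap).rTensor L t) := by
  have h1 := assoc_rTensor_pair (f := on1 M q) (g := on2 M p) (f' := on1 (M ⊗[k] L) q)
    (g' := on2 M (on1 L p)) (fun x n => assoc_on1 x n) (fun x n => assoc_on2 x n)
    (↑R⁻¹ : U ⊗[k] U)
  have h2 := assoc_rTensor_pair (f := on1 M q) (g := on2 M q) (f' := on1 (M ⊗[k] L) q)
    (g' := on2 M (on1 L q)) (fun x n => assoc_on1 x n) (fun x n => assoc_on2 x n)
    (R : U ⊗[k] U)
  have h3 := congrArg (fun s => pair (E := DynEnd k L M) (on1 (M ⊗[k] L) q) (on2 M (on1 L p))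
    (↑R⁻¹ : U ⊗[k] U) (dynFlip k L M s)) (h2 t)
  have h4 := congrArg (fun s => pair (E := DynEnd k L M) (on1 (M ⊗[k] L) q) (on2 M (on1 L p))
    (↑R⁻¹ : U ⊗[k] U) s) (dynFlip_assoc
      ((pair (E := Module.End k (M ⊗[k] M)) (on1 M q) (on2 M q) (R : U ⊗[k] U)).rTensor L t))
  refine ((h3.symm.trans h4).trans (h1 _).symm).trans ?_
  refine congrArg (TensorProduct.assoc k M M L) ?_
  exact ((LinearMap.congr_fun (LinearMap.rTensor_comp L _ _) t).trans
    (LinearMap.congr_fun (LinearMap.rTensor_comp L _ _) _)).symm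

end TwoRep

/-! ## The dynamical reflection equation in coordinates -/

section Sides

variable {k L U E : Type*} [Field k] [Ring L] [Algebra k L] [Ring U] [HopfAlgebra k U]
  [Ring E] [Algebra k E] (hγ : Function.Bijective (HopfAlgebra.antipode k (A := U)))
  (a b c : U →ₗ[k] E) (h : L →ₗ[k] E)

/-- `x ⊗ y ⊗ λ ↦ b(x) h(λ) c(γ⁻¹(y))`. -/
def innerSide : (U ⊗[k] U) ⊗[k] L →ₗ[k] E := (tri (lp b) (rp hγ c) (lp h)).flip 1

theorem innerSide_tmul (x y : U) (l : L) :
    innerSide hγ b c h ((x ⊗ₜ y) ⊗ₜ l) = b x * (h l * c (antiInv hγ y)) := by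
  simp [innerSide, rp]

/-- `x ⊗ y ⊗ λ ↦ h(λ) X a(γ⁻¹(y)) c(γ⁻¹(x))`. -/
def outerSide (X : E) : (U ⊗[k] U) ⊗[k] L →ₗ[k] E := (tri (rp hγ c) (rp hγ a) (lp h)).flip X

theorem outerSide_tmul (X : E) (x y : U) (l : L) :
    outerSide hγ a c h X ((x ⊗ₜ y) ⊗ₜ l) =
      h l * (X * (a (antiInv hγ y) * c (antiInv hγ x))) := by
  simp [outerSide, rp, mul_assoc]

end Sides

section Normal

variable {k H L U M S : Type*} [Field k] [Ring H] [Bialgebra k H] [Ring L] [Algebra k L]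
  [Ring U] [HopfAlgebra k U] [AddCommGroup M] [Module k M] [Ring S] [Algebra k S]
  (𝔏 : BaseAlgebra k H L) (j : H →ₐc[k] U) (p q : U →ₗ[k] Module.End k M) [IsPoint p] [IsPoint q]
  [Commuting p q] {κ : M →ₗ[k] S} {σ : L →ₗ[k] S} [IsPoint σ]

/-- `m ⊗ m' ⊗ λ ↦ κ(m) κ(m') σ(λ)`. -/
def normal (κ : M →ₗ[k] S) (σ : L →ₗ[k] S) : M ⊗[k] (M ⊗[k] L) →ₗ[k] S := pair κ (pair κ σ)

@[simp] theorem normal_tmul (κ : M →ₗ[k] S) (σ : L →ₗ[k] S) (m m' : M) (l : L) :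
    normal κ σ (m ⊗ₜ (m' ⊗ₜ l)) = κ m * (κ m' * σ l) := by simp [normal]

variable (hκ : ∀ l m, σ l * κ m =
  pair (κ ∘ₗ ((twoRep p q).comp (diagIncl (j : H →ₐ[k] U))).toLinearMap.flip m) σ (𝔏.coact l))

include hκ in
theorem pair_lact (l : L) (t : M ⊗[k] L) :
    pair κ σ (lact 𝔏 (diagIncl (j : H →ₐ[k] U)) (twoRep p q) l t) = σ l * pair κ σ t :=
  pair_dyn_cross (𝔏 := 𝔏) (D := diagIncl (j : H →ₐ[k] U)) (actM := twoRep p q) hκ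
    (fun l t => by simp [IsPoint.map_mul]) l t

include hκ in
theorem normal_dyn (l : L) (n : M ⊗[k] (M ⊗[k] L)) :
    normal κ σ (𝔏.dyn (E := DynEnd k L M) (j : H →ₐ[k] U) (conv (E := DynEnd k L M) (cop k U)
      (conv (E := DynEnd k L M) (cop k U) (on1 _ p) (on1 _ q))
      (conv (E := DynEnd k L M) (cop k U) (on2 _ (on1 L p)) (on2 _ (on1 L q))))
      (on2 _ (on2 _ (ptMul k L))) l n) = σ l * normal κ σ n := by
  rw [← dyn_twoRep]
  exact pair_dyn_cross (𝔏 := 𝔏) (D := diagIncl (j : H →ₐ[k] U)) (actM := twoRep p q) hκ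
    (pair_lact 𝔏 j p q hκ) l n

end Normal

section Coordinates

variable {k ι H L U S : Type*} [Field k] [Fintype ι] [DecidableEq ι] [Ring H] [Bialgebra k H]
  [Ring L] [Algebra k L] [Ring U] [HopfAlgebra k U] [Ring S] [Algebra k S]
  (𝔏 : BaseAlgebra k H L) (j : H →ₐc[k] U) (ρ : U →ₐ[k] Matrix ι ι k)
  (hγ : Function.Bijective (HopfAlgebra.antipode k (A := U)))
  {K : Matrix ι ι S} {σ : L →ₗ[k] S} [IsPoint σ]

/-- `e i j ⊗ e l m ⊗ ν`. -/
def unit₂ (i j l m : ι) (ν : L) : Matrix ι ι k ⊗[k] (Matrix ι ι k ⊗[k] L) :=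
  Matrix.single i j (1 : k) ⊗ₜ (Matrix.single l m (1 : k) ⊗ₜ ν)

omit [Fintype ι] in
theorem unit₂_add (i j l m : ι) (ν ν' : L) :
    unit₂ (k := k) i j l m (ν + ν') = unit₂ i j l m ν + unit₂ i j l m ν' := by
  simp [unit₂, TensorProduct.tmul_add]

theorem antiLeft_antiInv (x : U) : antiLeft ρ (antiInv hγ x) = transLeft ρ x :=
  LinearMap.congr_fun (antiLeft_comp_antiInv ρ hγ) x

variable (hκ : ∀ l m, σ l * matLin (k := k) K m =
  pair (matLin (k := k) K ∘ₗ ((twoRep (antiLeft ρ) (transRight ρ)).comp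
    (diagIncl (j : H →ₐ[k] U))).toLinearMap.flip m) σ (𝔏.coact l))

-- Normal ordering: the `L`-leg of `u` acts at the left of the second matrix with its coaction
-- spread over it, and the cross relation turns this into an honest left factor `σ`. In this way
-- `R̃` appears between the two copies of `K`.
include hκ in
theorem normal_innerSide (u : (U ⊗[k] U) ⊗[k] L) (i j' l m : ι) (ν : L) :
    normal (matLin K) σ (innerSide (E := DynEnd k L (Matrix ι ι k)) hγ (on1 _ (transRight ρ))
      (on2 _ (on1 L (antiLeft ρ)))
      (𝔏.dyn (E := DynEnd k L (Matrix ι ι k)) (j : H →ₐ[k] U)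
        (conv (E := DynEnd k L (Matrix ι ι k)) (cop k U)
        (on2 _ (on1 L (antiLeft ρ))) (on2 _ (on1 L (transRight ρ))))
        (on2 _ (on2 _ (ptMul k L)))) u (unit₂ (k := k) i j' l m ν)) =
    (∑ f, ∑ g, K i f * σ (repMatrix ρ u (f, l) (j', g)) * K g m) * σ ν := by
  induction u with
  | zero => simp [repMatrix_zero]
  | add s t hs ht =>
    simp only [map_add, LinearMap.add_apply, hs, ht, repMatrix_add, mul_add, add_mul,
      Finset.sum_add_distrib]
  | tmul w μ =>
    induction w with
    | zero => simp [repMatrix_zero]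
    | add s t hs ht =>
      simp only [map_add, TensorProduct.add_tmul, LinearMap.add_apply, hs, ht, repMatrix_add, mul_add,
        add_mul, Finset.sum_add_distrib]
    | tmul x y =>
      rw [innerSide_tmul, Module.End.mul_apply, Module.End.mul_apply, unit₂, on2_apply, on1_apply,
        antiLeft_antiInv, ← on2_lact_twoRep, on2_apply, on1_apply, normal, pair_tmul,
        pair_lact 𝔏 j _ _ hκ, pair_tmul, transRight_single, transLeft_single]
      simp only [map_sum, map_smul, matLin_single, repMatrix_tmul, entry₂_tmul, Finset.sum_mul,
        Finset.mul_sum, smul_mul_assoc, mul_smul_comm, Finset.smul_sum,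
        smul_smul, mul_assoc]
      rw [Finset.sum_comm]
      exact Finset.sum_congr rfl fun a _ => Finset.sum_congr rfl fun b _ => by
        rw [mul_comm (ρ _ _ _)]

-- Here the `L`-leg is spread over both matrices, so the cross relation brings it in front of the
-- whole word. The two antipode legs act first, directly on the matrix units, and give the row
-- indices.
include hκ in
theorem normal_outerSide (X : DynEnd k L (Matrix ι ι k)) (u : (U ⊗[k] U) ⊗[k] L) (i j' l m : ι)
    (ν : L) :
    normal (matLin K) σ (outerSide (E := DynEnd k L (Matrix ι ι k)) hγ (on1 _ (antiLeft ρ))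
      (on2 _ (on1 L (antiLeft ρ)))
      (𝔏.dyn (E := DynEnd k L (Matrix ι ι k)) (j : H →ₐ[k] U)
        (conv (E := DynEnd k L (Matrix ι ι k)) (cop k U)
        (conv (E := DynEnd k L (Matrix ι ι k)) (cop k U) (on1 _ (antiLeft ρ)) (on1 _ (transRight ρ)))
        (conv (E := DynEnd k L (Matrix ι ι k)) (cop k U)
        (on2 _ (on1 L (antiLeft ρ))) (on2 _ (on1 L (transRight ρ)))))
        (on2 _ (on2 _ (ptMul k L)))) X u (unit₂ (k := k) i j' l m ν)) =
    ∑ c, ∑ a, σ (repMatrix ρ u (l, i) (c, a)) *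
      normal (matLin K) σ (X (unit₂ (k := k) a j' c m ν)) := by
  induction u with
  | zero => simp [repMatrix_zero]
  | add s t hs ht =>
    simp only [map_add, LinearMap.add_apply, hs, ht, repMatrix_add, add_mul,
      Finset.sum_add_distrib]
  | tmul w μ =>
    induction w with
    | zero => simp [repMatrix_zero]
    | add s t hs ht =>
      simp only [map_add, TensorProduct.add_tmul, LinearMap.add_apply, hs, ht, repMatrix_add,
        add_mul, Finset.sum_add_distrib]
    | tmul x y =>
      rw [outerSide_tmul, Module.End.mul_apply, Module.End.mul_apply, Module.End.mul_apply, unit₂,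
        on2_apply, on1_apply, on1_apply,
        antiLeft_antiInv, antiLeft_antiInv, normal_dyn 𝔏 j _ _ hκ, transLeft_single,
        transLeft_single]
      simp only [TensorProduct.sum_tmul, TensorProduct.tmul_sum, ← TensorProduct.smul_tmul',
        TensorProduct.tmul_smul, map_sum, map_smul, repMatrix_tmul, entry₂_tmul, unit₂,
        Finset.mul_sum, smul_mul_assoc, mul_smul_comm, Finset.smul_sum,
        smul_smul]

theorem tri_transRight_transRight (u : (U ⊗[k] U) ⊗[k] L) (i j' l m : ι) (ν : L) :
    tri (E := DynEnd k L (Matrix ι ι k)) (on1 _ (transRight ρ)) (on2 _ (on1 L (transRight ρ)))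
      (on2 _ (on2 _ (ptMul k L))) u (unit₂ (k := k) i j' l m ν) =
    ∑ b, ∑ d, unit₂ (k := k) i b l d (repMatrix ρ u (b, d) (j', m) * ν) := by
  induction u with
  | zero => simp [repMatrix_zero, unit₂]
  | add s t hs ht =>
    simp only [map_add, LinearMap.add_apply, hs, ht, repMatrix_add, add_mul, unit₂_add,
      Finset.sum_add_distrib]
  | tmul w μ =>
    induction w with
    | zero => simp [repMatrix_zero, unit₂]
    | add s t hs ht =>
      simp only [map_add, TensorProduct.add_tmul, LinearMap.add_apply, hs, ht, repMatrix_add,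
        add_mul, unit₂_add, Finset.sum_add_distrib]
    | tmul x y =>
      rw [tri, pair_tmul, pair_tmul, Module.End.mul_apply, Module.End.mul_apply, unit₂, on2_apply, on2_apply,
        on2_apply, on1_apply, on1_apply, transRight_single, transRight_single]
      simp only [TensorProduct.sum_tmul, TensorProduct.tmul_sum, ← TensorProduct.smul_tmul',
        TensorProduct.tmul_smul, repMatrix_tmul, entry₂_tmul, unit₂, lp_apply, LinearMap.id_apply,
        smul_mul_assoc, smul_smul, Finset.smul_sum]
      rw [Finset.sum_comm]
      exact Finset.sum_congr rfl fun a _ => Finset.sum_congr rfl fun b _ => by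
        rw [mul_comm (ρ _ _ _)]

omit [Fintype ι] in
theorem dynFlip_unit₂ (i j' l m : ι) (ν : L) : dynFlip k L (Matrix ι ι k)
    (unit₂ (k := k) i j' l m ν) = unit₂ (k := k) l m i j' ν := rfl

theorem ext_unit₂ {V : Type*} [AddCommGroup V] [Module k V]
    {f g : Matrix ι ι k ⊗[k] (Matrix ι ι k ⊗[k] L) →ₗ[k] V}
    (h : ∀ i j l m ν, f (unit₂ i j l m ν) = g (unit₂ i j l m ν)) : f = g :=
  TensorProduct.ext (ext_single fun i j => TensorProduct.ext (ext_single fun l m =>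
    LinearMap.ext fun ν => h i j l m ν))

variable {R : (U ⊗[k] U)ˣ} {F : ((U ⊗[k] U) ⊗[k] L)ˣ}

variable (R F) in
/-- The left hand side of the dynamical reflection equation, as an operator. -/
abbrev dynReflLeftOp : DynEnd k L (Matrix ι ι k) :=
  dynReflLeft (E := DynEnd k L (Matrix ι ι k)) 𝔏 j R F hγ (on1 _ (antiLeft ρ))
    (on1 _ (transRight ρ)) (on2 _ (on1 L (antiLeft ρ))) (on2 _ (on1 L (transRight ρ)))
    (on2 _ (on2 _ (ptMul k L)))

variable (R F) in
/-- The right hand side of the dynamical reflection equation, as an operator. -/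
abbrev dynReflRightOp : DynEnd k L (Matrix ι ι k) :=
  dynReflRight (E := DynEnd k L (Matrix ι ι k)) 𝔏 j R F hγ
    (on1 _ (transRight ρ)) (on2 _ (on1 L (antiLeft ρ))) (on2 _ (on1 L (transRight ρ)))
    (on2 _ (on2 _ (ptMul k L))) (dynFlip k L (Matrix ι ι k))

include hκ in
theorem normal_dynReflLeftOp (i j' l m : ι) (ν : L) :
    normal (matLin K) σ (dynReflLeftOp 𝔏 j ρ hγ R F (unit₂ (k := k) i j' l m ν)) =
    (flipMul ((repMatrix ρ (dynR R F)).map σ) * sndCopy K *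
      flipMul ((repMatrix ρ (dynR R F)).map σ) * sndCopy K) (i, l) (j', m) * σ ν := by
  have h1 := normal_outerSide 𝔏 j ρ hγ hκ (dynSideX (E := DynEnd k L (Matrix ι ι k)) 𝔏 j R F hγ
    (on1 _ (transRight ρ)) (on2 _ (on1 L (antiLeft ρ))) (on2 _ (on1 L (transRight ρ)))
    (on2 _ (on2 _ (ptMul k L)))) (dynR R F) i j' l m ν
  refine h1.trans ?_
  rw [reflection_left_apply, Finset.sum_mul]
  refine Finset.sum_congr rfl fun c _ => ?_
  rw [Finset.sum_mul]
  refine Finset.sum_congr rfl fun a _ => ?_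
  rw [mul_assoc]
  exact congrArg _ (normal_innerSide 𝔏 j ρ hγ hκ (dynR R F) a j' c m ν)

include hκ in
theorem normal_dynReflRightOp (i j' l m : ι) (ν : L) :
    normal (matLin K) σ (dynReflRightOp 𝔏 j ρ hγ R F (unit₂ (k := k) i j' l m ν)) =
    (sndCopy K * flipMul ((repMatrix ρ (dynR R F)).map σ) * sndCopy K *
      flipMul ((repMatrix ρ (dynR R F)).map σ)) (i, l) (j', m) * σ ν := by
  rw [dynReflRightOp, dynReflRight, Module.End.mul_apply, Module.End.mul_apply,
    tri_transRight_transRight]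
  simp only [map_sum, dynFlip_unit₂]
  rw [reflection_right_apply, Finset.sum_mul]
  refine Finset.sum_congr rfl fun b _ => ?_
  rw [Finset.sum_mul]
  refine Finset.sum_congr rfl fun d _ => ?_
  refine (normal_innerSide 𝔏 j ρ hγ hκ (dynR R F) l d i b _).trans ?_
  rw [IsPoint.map_mul, ← mul_assoc]
  rfl

include hκ in
theorem normal_dynRefl_of_reflection
    (h : flipMul ((repMatrix ρ (dynR R F)).map σ) * sndCopy K *
      flipMul ((repMatrix ρ (dynR R F)).map σ) * sndCopy K = sndCopy K *
      flipMul ((repMatrix ρ (dynR R F)).map σ) * sndCopy K *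
      flipMul ((repMatrix ρ (dynR R F)).map σ)) (n : Matrix ι ι k ⊗[k] (Matrix ι ι k ⊗[k] L)) :
    normal (matLin K) σ (dynReflLeftOp 𝔏 j ρ hγ R F n) =
      normal (matLin K) σ (dynReflRightOp 𝔏 j ρ hγ R F n) := by
  have : normal (matLin K) σ ∘ₗ dynReflLeftOp 𝔏 j ρ hγ R F =
      normal (matLin K) σ ∘ₗ dynReflRightOp 𝔏 j ρ hγ R F := ext_unit₂ fun i j' l m ν => by
    rw [LinearMap.comp_apply, LinearMap.comp_apply, normal_dynReflLeftOp 𝔏 j ρ hγ hκ,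
      normal_dynReflRightOp 𝔏 j ρ hγ hκ, h]
  exact LinearMap.congr_fun this n

include hκ in
theorem reflection_of_normal_dynRefl
    (h : ∀ n, normal (matLin K) σ (dynReflLeftOp 𝔏 j ρ hγ R F n) =
      normal (matLin K) σ (dynReflRightOp 𝔏 j ρ hγ R F n)) :
    flipMul ((repMatrix ρ (dynR R F)).map σ) * sndCopy K *
      flipMul ((repMatrix ρ (dynR R F)).map σ) * sndCopy K = sndCopy K *
      flipMul ((repMatrix ρ (dynR R F)).map σ) * sndCopy K *
      flipMul ((repMatrix ρ (dynR R F)).map σ) := by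
  ext ⟨i, l⟩ ⟨j', m⟩
  have := h (unit₂ i j' l m 1)
  rwa [normal_dynReflLeftOp 𝔏 j ρ hγ hκ, normal_dynReflRightOp 𝔏 j ρ hγ hκ, IsPoint.map_one,
    mul_one, mul_one] at this

end Coordinates

/-! ## The dRE algebra -/

section Antipode

variable {k H U : Type*} [Field k] [Ring H] [HopfAlgebra k H] [Ring U] [HopfAlgebra k U]

-- Both composites are convolution inverses of `j`, one from each side.
open WithConv in
theorem antipode_map (j : H →ₐc[k] U) (x : H) :
    HopfAlgebra.antipode k (j x) = j (HopfAlgebra.antipode k x) := by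
  have h : toConv (HopfAlgebra.antipode k ∘ₗ (j : H →ₐ[k] U).toLinearMap) =
      toConv ((j : H →ₐ[k] U).toLinearMap ∘ₗ HopfAlgebra.antipode k) := by
    refine left_inv_eq_right_inv (a := toConv (j : H →ₐ[k] U).toLinearMap) ?_ ?_
    · have := LinearMap.convMul_comp_coalgHom_distrib
        (toConv (HopfAlgebra.antipode k (A := U))) (toConv LinearMap.id) (j : H →ₗc[k] U)
      rw [LinearMap.antipode_mul_id] at this
      refine (WithConv.ofConv_injective this).symm.trans ?_
      ext y
      simp
    · have := LinearMap.algHom_comp_convMul_distrib (j : H →ₐ[k] U)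
        (toConv LinearMap.id) (toConv (HopfAlgebra.antipode k (A := H)))
      rw [LinearMap.id_mul_antipode] at this
      refine (WithConv.ofConv_injective this).symm.trans ?_
      ext y
      simp
  exact LinearMap.congr_fun (WithConv.toConv_injective h) x

end Antipode

/-! ### The cross relation in coordinates -/

section Cross

variable {k ι H L U T : Type*} [Field k] [Fintype ι] [DecidableEq ι] [Ring H] [HopfAlgebra k H]
  [Ring L] [Algebra k L] [Ring U] [HopfAlgebra k U] [Ring T] [Algebra k T]
  (𝔏 : BaseAlgebra k H L) (j : H →ₐc[k] U) (ρ : U →ₐ[k] Matrix ι ι k)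
  (K : Matrix ι ι T) (σ : L →ₗ[k] T)

theorem matLin_twoRep_comul (h : H) (i j' : ι) :
    matLin (k := k) K ((twoRep (antiLeft ρ) (transRight ρ)).comp (diagIncl (j : H →ₐ[k] U)) h
      (Matrix.single i j' 1)) =
    ∑ a, ∑ b, (LinearMap.mul' k k ∘ₗ TensorProduct.map
      (entry (ρ.comp (j : H →ₐ[k] U)) i a ∘ₗ HopfAlgebra.antipode k)
      (entry (ρ.comp (j : H →ₐ[k] U)) b j') ∘ₗ Coalgebra.comul) h • K a b := by
  have h1 : (twoRep (antiLeft ρ) (transRight ρ)).comp (diagIncl (j : H →ₐ[k] U)) h =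
      pair (antiLeft ρ) (transRight ρ) (TensorProduct.map (j : H →ₐ[k] U).toLinearMap
        (j : H →ₐ[k] U).toLinearMap (Coalgebra.comul (R := k) h)) :=
    congrArg (pair (antiLeft ρ) (transRight ρ)) (CoalgHomClass.map_comp_comul_apply j h).symm
  rw [h1]
  change _ = ∑ a, ∑ b, LinearMap.mul' k k (TensorProduct.map
      (entry (ρ.comp (j : H →ₐ[k] U)) i a ∘ₗ HopfAlgebra.antipode k)
      (entry (ρ.comp (j : H →ₐ[k] U)) b j') (Coalgebra.comul (R := k) h)) • K a b
  generalize Coalgebra.comul (R := k) h = t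
  induction t with
  | zero => simp
  | add s t hs ht =>
    simp only [map_add, LinearMap.add_apply, hs, ht, add_smul, Finset.sum_add_distrib]
  | tmul x y =>
    have e : ∀ m : Matrix ι ι k, antiLeft ρ ((j : H →ₐ[k] U) x) m =
        transLeft ρ (j (HopfAlgebra.antipode k x)) m := fun m => by
      rw [← antipode_map]; rfl
    rw [TensorProduct.map_tmul, pair_tmul, Module.End.mul_apply, AlgHom.toLinearMap_apply, e,
      AlgHom.toLinearMap_apply, transRight_single]
    simp only [map_sum, map_smul, transLeft_single, matLin_single, Finset.smul_sum, smul_smul,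
      TensorProduct.map_tmul, LinearMap.mul'_apply, LinearMap.comp_apply]
    rw [Finset.sum_comm]
    refine Finset.sum_congr rfl fun a _ => Finset.sum_congr rfl fun b _ => ?_
    rw [mul_comm]
    rfl

theorem pair_coact_single (l : L) (i j' : ι) :
    pair (matLin (k := k) K ∘ₗ ((twoRep (antiLeft ρ) (transRight ρ)).comp
      (diagIncl (j : H →ₐ[k] U))).toLinearMap.flip (Matrix.single i j' 1)) σ (𝔏.coact l) =
    ∑ a, ∑ b, K a b * σ (crossCoeff 𝔏 (ρ.comp (j : H →ₐ[k] U)) i j' a b l) := by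
  have h1 : ∀ a b, crossCoeff 𝔏 (ρ.comp (j : H →ₐ[k] U)) i j' a b l = TensorProduct.lid k L
      (LinearMap.rTensor L (LinearMap.mul' k k ∘ₗ
        TensorProduct.map (entry (ρ.comp (j : H →ₐ[k] U)) i a ∘ₗ HopfAlgebra.antipode k)
          (entry (ρ.comp (j : H →ₐ[k] U)) b j') ∘ₗ Coalgebra.comul) (𝔏.coact l)) :=
    fun a b => rfl
  simp only [h1]
  generalize 𝔏.coact l = w
  induction w with
  | zero => simp
  | add s t hs ht =>
    simp only [map_add, hs, ht, mul_add, Finset.sum_add_distrib]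
  | tmul h μ =>
    rw [pair_tmul, LinearMap.comp_apply, LinearMap.flip_apply, AlgHom.toLinearMap_apply,
      matLin_twoRep_comul]
    simp only [LinearMap.rTensor_tmul, TensorProduct.lid_tmul, map_smul, Finset.sum_mul,
      mul_smul_comm, smul_mul_assoc]

/-- The cross relation of the smash product, in coordinates. -/
theorem cross_iff : (∀ l m, σ l * matLin (k := k) K m =
      pair (matLin (k := k) K ∘ₗ ((twoRep (antiLeft ρ) (transRight ρ)).comp
        (diagIncl (j : H →ₐ[k] U))).toLinearMap.flip m) σ (𝔏.coact l)) ↔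
    ∀ l i j', σ l * K i j' =
      ∑ a, ∑ b, K a b * σ (crossCoeff 𝔏 (ρ.comp (j : H →ₐ[k] U)) i j' a b l) := by
  refine ⟨fun h l i j' => ?_, fun h l m => ?_⟩
  · rw [← pair_coact_single, ← h, matLin_single]
  · induction m using Matrix.induction_on' with
    | h_zero => simp [pair]
    | h_add m m' hm hm' =>
      have : ∀ f g : H →ₗ[k] T, pair (f + g) σ = pair f σ + pair g σ := fun f g => by
        ext; simp [add_mul]
      rw [map_add, mul_add, hm, hm', map_add, LinearMap.comp_add, this, LinearMap.add_apply]
    | h_std_basis i j' c =>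
      have : ∀ f : H →ₗ[k] T, pair (c • f) σ = c • pair f σ := fun f => by ext; simp
      have e : Matrix.single i j' c = c • Matrix.single i j' (1 : k) := by simp
      rw [e, map_smul, mul_smul_comm, matLin_single, h, map_smul, LinearMap.comp_smul, this,
        LinearMap.smul_apply, pair_coact_single]

end Cross

/-! ### Relations, universal property and generators of the dRE algebra -/

section Lift

variable {k ι H L : Type*} [Field k] [Fintype ι] [DecidableEq ι] [Ring H] [HopfAlgebra k H]
  [Ring L] [Algebra k L] (𝔏 : BaseAlgebra k H L) (ρ : H →ₐ[k] Matrix ι ι k)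
  (S : Matrix (ι × ι) (ι × ι) L)

theorem DREAlgebra.incl_mul_gen (l : L) (i j : ι) :
    DREAlgebra.incl 𝔏 ρ S l * DREAlgebra.gen 𝔏 ρ S i j =
      ∑ a, ∑ b, DREAlgebra.gen 𝔏 ρ S a b * DREAlgebra.incl 𝔏 ρ S (crossCoeff 𝔏 ρ i j a b l) := by
  have h := congrArg (RingQuot.mkAlgHom k
      (ReflectionRel (S.map (SmashAlgebra.incl 𝔏 ρ)) (SmashAlgebra.gen 𝔏 ρ)))
    (RingQuot.mkAlgHom_rel k (SmashRel.cross (𝔏 := 𝔏) (ρ := ρ) l i j))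
  simp only [map_mul, map_sum] at h
  exact h

theorem DREAlgebra.reflection : S.map (DREAlgebra.incl 𝔏 ρ S) * sndCopy (DREAlgebra.gen 𝔏 ρ S) *
      S.map (DREAlgebra.incl 𝔏 ρ S) * sndCopy (DREAlgebra.gen 𝔏 ρ S) =
    sndCopy (DREAlgebra.gen 𝔏 ρ S) * S.map (DREAlgebra.incl 𝔏 ρ S) *
      sndCopy (DREAlgebra.gen 𝔏 ρ S) * S.map (DREAlgebra.incl 𝔏 ρ S) := by
  ext p q
  have h := RingQuot.mkAlgHom_rel k (show ReflectionRel (S.map (SmashAlgebra.incl 𝔏 ρ))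
    (SmashAlgebra.gen 𝔏 ρ) _ _ from ⟨p, q, rfl, rfl⟩)
  exact (map_reflection_left (A := SmashAlgebra 𝔏 ρ) (RingQuot.mkAlgHom k _) _ _ p q).symm.trans
    (h.trans (map_reflection_right (A := SmashAlgebra 𝔏 ρ) (RingQuot.mkAlgHom k _) _ _ p q))

variable {𝔏 ρ S} in
theorem DREAlgebra.exists_lift {T : Type*} [Ring T] [Algebra k T] (K : Matrix ι ι T)
    (σ : L →ₗ[k] T) [IsPoint σ]
    (hcross : ∀ l i j, σ l * K i j = ∑ a, ∑ b, K a b * σ (crossCoeff 𝔏 ρ i j a b l))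
    (hrel : S.map σ * sndCopy K * S.map σ * sndCopy K =
      sndCopy K * S.map σ * sndCopy K * S.map σ) :
    ∃ Θ : DREAlgebra 𝔏 ρ S →ₐ[k] T, (∀ i j, Θ (DREAlgebra.gen 𝔏 ρ S i j) = K i j) ∧
      ∀ l, Θ (DREAlgebra.incl 𝔏 ρ S l) = σ l := by
  let Θ₀ : FreeAlgebra k ((ι × ι) ⊕ L) →ₐ[k] T :=
    FreeAlgebra.lift k (Sum.elim (fun p => K p.1 p.2) σ)
  have h₀ : ∀ p, Θ₀ (FreeAlgebra.ι k (Sum.inl p)) = K p.1 p.2 := fun p => by simp [Θ₀]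
  have h₀' : ∀ l, Θ₀ (FreeAlgebra.ι k (Sum.inr l)) = σ l := fun l => by simp [Θ₀]
  have hr₀ : ∀ ⦃x y⦄, SmashRel 𝔏 ρ x y → Θ₀ x = Θ₀ y := by
    rintro x y (⟨l, m⟩ | ⟨l, m⟩ | c | ⟨l, i, j⟩)
    · simp [h₀']
    · simp [h₀', IsPoint.map_mul]
    · simp [h₀', Algebra.algebraMap_eq_smul_one, IsPoint.map_one]
    · simp [h₀, h₀', hcross]
  let Θ₁ : SmashAlgebra 𝔏 ρ →ₐ[k] T := RingQuot.liftAlgHom k ⟨Θ₀, hr₀⟩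
  have h₁ : (SmashAlgebra.gen 𝔏 ρ).map Θ₁ = K := by
    ext i j; simp [SmashAlgebra.gen, Θ₁, h₀]
  have h₁' : (S.map (SmashAlgebra.incl 𝔏 ρ)).map Θ₁ = S.map σ := by
    ext p q; simp [SmashAlgebra.incl, Θ₁, h₀']
  have hr₁ : ∀ ⦃x y⦄, ReflectionRel (S.map (SmashAlgebra.incl 𝔏 ρ)) (SmashAlgebra.gen 𝔏 ρ) x y →
      Θ₁ x = Θ₁ y := by
    rintro x y ⟨p, q, rfl, rfl⟩
    rw [map_reflection_left, map_reflection_right, h₁, h₁', hrel]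
  refine ⟨RingQuot.liftAlgHom k ⟨Θ₁, hr₁⟩, fun i j => ?_, fun l => ?_⟩
  · exact (RingQuot.liftAlgHom_mkAlgHom_apply k Θ₁ hr₁ _).trans (congrFun (congrFun h₁ i) j)
  · refine (RingQuot.liftAlgHom_mkAlgHom_apply k Θ₁ hr₁ (SmashAlgebra.incl 𝔏 ρ l)).trans ?_
    exact (RingQuot.liftAlgHom_mkAlgHom_apply k Θ₀ hr₀ _).trans (h₀' l)

theorem DREAlgebra.adjoin_eq_top :
    Algebra.adjoin k (Set.range (fun p : ι × ι => DREAlgebra.gen 𝔏 ρ S p.1 p.2) ∪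
      Set.range (DREAlgebra.incl 𝔏 ρ S)) = ⊤ := by
  set q := (RingQuot.mkAlgHom k (ReflectionRel (S.map (SmashAlgebra.incl 𝔏 ρ))
    (SmashAlgebra.gen 𝔏 ρ))).comp (RingQuot.mkAlgHom k (SmashRel 𝔏 ρ)) with hq
  have h1 : (Algebra.adjoin k (Set.range (FreeAlgebra.ι k (X := (ι × ι) ⊕ L)))).map q = ⊤ := by
    rw [FreeAlgebra.adjoin_range_ι, Algebra.map_top, AlgHom.range_eq_top]
    exact (RingQuot.mkAlgHom_surjective k _).comp (RingQuot.mkAlgHom_surjective k _)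
  rw [AlgHom.map_adjoin] at h1
  rw [eq_top_iff, ← h1]
  refine Algebra.adjoin_mono ?_
  rintro _ ⟨_, ⟨p | l, rfl⟩, rfl⟩
  · exact Or.inl ⟨p, rfl⟩
  · exact Or.inr ⟨l, rfl⟩

end Lift

/-! ## The composite twist and the reflection relations -/

section Relations

variable {k ι H L U S : Type*} [Field k] [Fintype ι] [DecidableEq ι] [Ring H] [Bialgebra k H]
  [Ring L] [Algebra k L] [Ring U] [HopfAlgebra k U] [Ring S] [Algebra k S]
  {𝔏 : BaseAlgebra k H L} {j : H →ₐc[k] U} (ρ : U →ₐ[k] Matrix ι ι k)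
  (hγ : Function.Bijective (HopfAlgebra.antipode k (A := U)))
  {R : (U ⊗[k] U)ˣ} {F : ((U ⊗[k] U) ⊗[k] L)ˣ} {z : (U ⊗[k] L)ˣ}
  (hR : IsUniversalRMatrix R) (hF : IsDynamicalTwist (j : H →ₐ[k] U) 𝔏 F)
  (hz : (z : U ⊗[k] L) = zeta hγ F)

variable (R) in
theorem ptReflLeft_matrix (t : (Matrix ι ι k ⊗[k] Matrix ι ι k) ⊗[k] L) :
    ptReflLeft (E := DynEnd k L (Matrix ι ι k)) R (on1 _ (antiLeft ρ)) (on1 _ (transRight ρ))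
      (on2 _ (on1 L (antiLeft ρ))) (TensorProduct.assoc k _ _ L t) =
    TensorProduct.assoc k _ _ L ((reflLeft ρ R).rTensor L t) :=
  ptReflLeft_assoc R (antiLeft ρ) (transRight ρ) t

variable (R) in
theorem ptReflRight_matrix (t : (Matrix ι ι k ⊗[k] Matrix ι ι k) ⊗[k] L) :
    ptReflRight (E := DynEnd k L (Matrix ι ι k)) R (on1 _ (transRight ρ))
      (on2 _ (on1 L (antiLeft ρ))) (on2 _ (on1 L (transRight ρ)))
      (dynFlip k L (Matrix ι ι k)) (TensorProduct.assoc k _ _ L t) =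
    TensorProduct.assoc k _ _ L ((reflRight ρ R).rTensor L t) :=
  ptReflRight_assoc R (antiLeft ρ) (transRight ρ) t

section Inverse

variable {K : Matrix ι ι S} {σ : L →ₗ[k] S} [IsPoint σ]
  (hκ : ∀ l m, σ l * matLin (k := k) K m =
    pair (matLin (k := k) K ∘ₗ ((twoRep (antiLeft ρ) (transRight ρ)).comp
      (diagIncl (j : H →ₐ[k] U))).toLinearMap.flip m) σ (𝔏.coact l))
  (hK : flipMul ((repMatrix ρ (dynR R F)).map σ) * sndCopy K *
      flipMul ((repMatrix ρ (dynR R F)).map σ) * sndCopy K = sndCopy K *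
      flipMul ((repMatrix ρ (dynR R F)).map σ) * sndCopy K *
      flipMul ((repMatrix ρ (dynR R F)).map σ))

-- The inverse composite twist carries the relation of the RE algebra to the dynamical relation
-- times `Z⁻¹`, and the latter vanishes after normal ordering. This is the relation hypothesis
-- needed for the action on equivariant maps.
include hR hF hz hκ hK in
theorem normal_twistOp_inv (n : Matrix ι ι k ⊗[k] Matrix ι ι k) :
    pair (matLin K) (pair (matLin K) σ) (twistOp (matrixRep ρ) (matrixRep ρ)
      (↑(compositeUnit 𝔏 j R F z)⁻¹) (TensorProduct.assoc k _ _ L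
        ((reflLeft ρ R - reflRight ρ R) n ⊗ₜ 1))) = 0 := by
  have h := map_compositeUnit_inv_refl (E := DynEnd k L (Matrix ι ι k)) 𝔏 j hγ
    (on1 _ (antiLeft ρ)) (on1 _ (transRight ρ))
    (on2 _ (on1 L (antiLeft ρ))) (on2 _ (on1 L (transRight ρ))) (on2 _ (on2 _ (ptMul k L)))
    hR hF hz (τ := dynFlip k L (Matrix ι ι k)) (dynFlip_mul_on2 _) (dynFlip_mul_on1 _)
    (dynFlip_mul_on1 _) (dynFlip_mul_on2 _) (dynFlip_mul_on2_on2 _)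
    (normal (matLin K) σ ∘ₗ LinearMap.applyₗ (TensorProduct.assoc k _ _ L (n ⊗ₜ[k] (1 : L))))
    (fun e => normal_dynRefl_of_reflection 𝔏 j ρ hγ hκ hK
      (e (TensorProduct.assoc k _ _ L (n ⊗ₜ[k] (1 : L))))) 1
  have h1 := ptReflLeft_matrix ρ R (n ⊗ₜ[k] (1 : L))
  have h2 := ptReflRight_matrix ρ R (n ⊗ₜ[k] (1 : L))
  rw [LinearMap.rTensor_tmul] at h1 h2
  rw [mul_one, mul_one, ← twistOp_twoRep] at h
  replace h : normal (matLin K) σ (twistOp (matrixRep ρ) (matrixRep ρ) _ (ptReflLeft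
    (E := DynEnd k L (Matrix ι ι k)) R _ _ _ _)) = normal (matLin K) σ (twistOp (matrixRep ρ)
    (matrixRep ρ) _ (ptReflRight (E := DynEnd k L (Matrix ι ι k)) R _ _ _ _ _)) := h
  rw [h1, h2] at h
  rw [LinearMap.sub_apply, TensorProduct.sub_tmul, map_sub, map_sub, map_sub, sub_eq_zero]
  exact h

end Inverse

section Direct

variable {A : Type*} [Ring A] [Algebra k A] {X : Matrix ι ι A}

theorem matLin_leftMul {B : Type*} [Ring B] [Algebra k B] (act : B →ₐ[k] Module.End k A)
    (Φ : (B ⊗[k] B) ⊗[k] L) :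
    matLin (k := k) (X.map (leftMul act Φ)) = leftMul act Φ ∘ₗ matLin (k := k) X :=
  ext_single fun i j => by simp

variable (L X) in
/-- `m ⊗ m' ⊗ λ ↦ X(m) X(m') ⊗ λ`. -/
def genProd : Matrix ι ι k ⊗[k] (Matrix ι ι k ⊗[k] L) →ₗ[k] A ⊗[k] L :=
  mulFst k A L ∘ₗ TensorProduct.map (matLin (k := k) X) ((matLin (k := k) X).rTensor L)

omit [DecidableEq ι] in
theorem genProd_assoc (t : (Matrix ι ι k ⊗[k] Matrix ι ι k) ⊗[k] L) :
    genProd L X (TensorProduct.assoc k _ _ L t) =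
      (pair (matLin (k := k) X) (matLin (k := k) X)).rTensor L t := by
  have : genProd L X ∘ₗ (TensorProduct.assoc k _ _ L).toLinearMap =
      (pair (matLin (k := k) X) (matLin (k := k) X)).rTensor L :=
    TensorProduct.ext_threefold fun a b c => by simp [genProd]
  exact LinearMap.congr_fun this t

theorem genProd_ptRefl (hX : ∀ n, pair (matLin (k := k) X) (matLin (k := k) X)
      ((reflLeft ρ R - reflRight ρ R) n) = 0) (n : Matrix ι ι k ⊗[k] (Matrix ι ι k ⊗[k] L)) :
    genProd L X (ptReflLeft (E := DynEnd k L (Matrix ι ι k)) R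
      (on1 _ (antiLeft ρ)) (on1 _ (transRight ρ)) (on2 _ (on1 L (antiLeft ρ))) n) =
    genProd L X (ptReflRight (E := DynEnd k L (Matrix ι ι k)) R
      (on1 _ (transRight ρ)) (on2 _ (on1 L (antiLeft ρ))) (on2 _ (on1 L (transRight ρ)))
      (dynFlip k L (Matrix ι ι k)) n) := by
  obtain ⟨t, rfl⟩ := (TensorProduct.assoc k _ _ L).surjective n
  rw [ptReflLeft_matrix, ptReflRight_matrix, genProd_assoc, genProd_assoc,
    ← LinearMap.rTensor_comp_apply, ← LinearMap.rTensor_comp_apply]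
  refine congrArg (fun f => LinearMap.rTensor L f t) (LinearMap.ext fun n => ?_)
  rw [← sub_eq_zero, LinearMap.comp_apply, LinearMap.comp_apply, ← map_sub]
  exact hX n

variable {act : U ⊗[k] U →ₐ[k] Module.End k A}
  (hA : IsModuleAlgebra (twistedComul R) (cou k (U ⊗[k] U)) act)
  (hg : ∀ β m, act β (matLin X m) = matLin X (matrixRep ρ β m))

include hg in
theorem genProd_twistOp (u : ((U ⊗[k] U) ⊗[k] (U ⊗[k] U)) ⊗[k] L) (m : Matrix ι ι k)
    (t : Matrix ι ι k ⊗[k] L) :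
    genProd L X (twistOp (matrixRep ρ) (matrixRep ρ) u (m ⊗ₜ t)) =
    leftMul act u (matLin (k := k) X m) ((matLin (k := k) X).rTensor L t) := by
  rw [leftMul_apply, genProd, LinearMap.comp_apply]
  refine congrArg _ ?_
  refine (tri_intertwine (μ := TensorProduct.map (matLin (k := k) X)
    ((matLin (k := k) X).rTensor L)) (fun x => intertwine_of_comp ?_)
    (fun x => intertwine_of_comp ?_) (fun x => intertwine_of_comp ?_) u (m ⊗ₜ t)).trans rfl
  · exact TensorProduct.ext' fun a b => by simp [hg]
  · refine TensorProduct.ext' fun a b => ?_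
    induction b with
    | zero => simp
    | add b b' hb hb' => simp only [TensorProduct.tmul_add, map_add, hb, hb']
    | tmul b c => simp [hg]
  · refine TensorProduct.ext' fun a b => ?_
    induction b with
    | zero => simp
    | add b b' hb hb' => simp only [TensorProduct.tmul_add, map_add, hb, hb']
    | tmul b c => simp

include hR hF hz hA hg

theorem lact_mul_leftMul_gen (l : L) (m : Matrix ι ι k) :
    lact 𝔏 (diagIncl (j : H →ₐ[k] U)) act l *
      matLin (k := k) (X.map (leftMul act (compositeUnit 𝔏 j R F z : _))) m =
    pair (matLin (k := k) (X.map (leftMul act (compositeUnit 𝔏 j R F z : _))) ∘ₗ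
      ((twoRep (antiLeft ρ) (transRight ρ)).comp (diagIncl (j : H →ₐ[k] U))).toLinearMap.flip m)
      (lact 𝔏 (diagIncl (j : H →ₐ[k] U)) act) (𝔏.coact l) := by
  have h := lact_mul_leftMul (isCompatible_twistedComul hR j)
    (isWeakTwist_compositeUnit hR hF hγ hz) hA l (matLin X m)
  have e : (act.comp (diagIncl (j : H →ₐ[k] U))).toLinearMap.flip (matLin X m) =
      matLin X ∘ₗ ((matrixRep ρ).comp (diagIncl (j : H →ₐ[k] U))).toLinearMap.flip m :=
    LinearMap.ext fun x => hg _ m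
  rw [e, ← LinearMap.comp_assoc, ← matLin_leftMul] at h
  rw [matLin_leftMul] at h ⊢
  exact h

/-- A word of two generators and an element of `L`, as an operator, is left multiplication by the
twisted product of its letters, and this product is the ordinary one after `Υ` has acted. It brings
`Υ` into contact with the relations. -/
theorem normal_leftMul (n : Matrix ι ι k ⊗[k] (Matrix ι ι k ⊗[k] L)) (t : A ⊗[k] L) :
    normal (matLin (k := k) (X.map (leftMul act (compositeUnit 𝔏 j R F z : _))))
      (lact 𝔏 (diagIncl (j : H →ₐ[k] U)) act) n t =
    twistedMul 𝔏 (diagIncl (j : H →ₐ[k] U)) act (compositeUnit 𝔏 j R F z : _)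
      (genProd L X (twistOp (matrixRep ρ) (matrixRep ρ) (compositeUnit 𝔏 j R F z : _) n)) t := by
  induction n with
  | zero => simp
  | add s s' hs hs' => simp only [map_add, LinearMap.add_apply, hs, hs']
  | tmul m s =>
    induction s with
    | zero => simp
    | add s s' hs hs' =>
      simp only [TensorProduct.tmul_add, map_add, LinearMap.add_apply, hs, hs']
    | tmul m' l =>
      rw [genProd_twistOp ρ hg, twistedMul_leftMul (isWeakTwist_compositeUnit hR hF hγ hz) hA,
        LinearMap.rTensor_tmul, twistedMul_tmul_apply, normal_tmul, matLin_leftMul]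
      rfl

/-- The difference of the two dynamical sides, acted upon by `Υ`, is the difference of the two
ordinary sides applied to a common vector, which multiplication in `A` annihilates. -/
theorem reflection_leftMul (hX : ∀ n, pair (matLin (k := k) X) (matLin (k := k) X)
      ((reflLeft ρ R - reflRight ρ R) n) = 0) :
    flipMul ((repMatrix ρ (dynR R F)).map (lact 𝔏 (diagIncl (j : H →ₐ[k] U)) act)) *
        sndCopy (X.map (leftMul act (compositeUnit 𝔏 j R F z : _))) *
        flipMul ((repMatrix ρ (dynR R F)).map (lact 𝔏 (diagIncl (j : H →ₐ[k] U)) act)) *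
        sndCopy (X.map (leftMul act (compositeUnit 𝔏 j R F z : _))) =
      sndCopy (X.map (leftMul act (compositeUnit 𝔏 j R F z : _))) *
        flipMul ((repMatrix ρ (dynR R F)).map (lact 𝔏 (diagIncl (j : H →ₐ[k] U)) act)) *
        sndCopy (X.map (leftMul act (compositeUnit 𝔏 j R F z : _))) *
        flipMul ((repMatrix ρ (dynR R F)).map (lact 𝔏 (diagIncl (j : H →ₐ[k] U)) act)) := by
  have hκ := lact_mul_leftMul_gen ρ hγ hR hF hz hA hg
  have hn := normal_leftMul ρ hγ hR hF hz hA hg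
  set K' : Matrix ι ι (Module.End k (A ⊗[k] L)) :=
    X.map (leftMul act (compositeUnit 𝔏 j R F z : _)) with hK'
  clear_value K'
  refine reflection_of_normal_dynRefl (S := Module.End k (A ⊗[k] L)) 𝔏 j ρ hγ (σ := lact 𝔏 (diagIncl (j : H →ₐ[k] U)) act)
    (K := K') hκ fun n => LinearMap.ext fun t => ?_
  rw [hn, hn]
  refine congrArg (fun s => twistedMul 𝔏 (diagIncl (j : H →ₐ[k] U)) act
    (compositeUnit 𝔏 j R F z : _) s t) ?_
  have h := map_compositeUnit_dynRefl (E := DynEnd k L (Matrix ι ι k)) 𝔏 j hγ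
    (on1 _ (antiLeft ρ)) (on1 _ (transRight ρ))
    (on2 _ (on1 L (antiLeft ρ))) (on2 _ (on1 L (transRight ρ))) (on2 _ (on2 _ (ptMul k L)))
    hR hF hz (τ := dynFlip k L (Matrix ι ι k)) (dynFlip_mul_on2 _) (dynFlip_mul_on1 _)
    (dynFlip_mul_on1 _) (dynFlip_mul_on2 _) (dynFlip_mul_on2_on2 _)
    (genProd L X ∘ₗ LinearMap.applyₗ n) (fun e => genProd_ptRefl ρ hX (e n)) 1
  rw [mul_one, mul_one, ← twistOp_twoRep] at h
  exact h

end Direct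

end Relations

/-! ## Presentations of the twisted algebra -/

section Presentation

variable {k H L B A M T : Type*} [Field k] [Ring H] [Bialgebra k H] [Ring L] [Algebra k L]
  [Ring B] [Algebra k B] [Ring A] [Algebra k A] [AddCommGroup M] [Module k M]
  [Ring T] [Algebra k T] {𝔏 : BaseAlgebra k H L} {D : H →ₐ[k] B} {Δ : B →ₐ[k] B ⊗[k] B}
  {ε : B →ₐ[k] k} {act : B →ₐ[k] Module.End k A} {Φ : ((B ⊗[k] B) ⊗[k] L)ˣ}
  {actM : B →ₐ[k] Module.End k M} {g : M →ₗ[k] A}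
  (hc : IsCompatible Δ ε D) (hΦ : IsWeakTwist 𝔏 Δ ε D Φ) (hA : IsModuleAlgebra Δ ε act)
  (hg : ∀ β m, act β (g m) = g (actM β m)) (hgen : Algebra.adjoin k (Set.range g) = ⊤)

include hc hA in
theorem lact_one (l : L) : lact 𝔏 D act l (1 ⊗ₜ[k] 1) = 1 ⊗ₜ l := by
  have h : ∀ w : H ⊗[k] L, pair (on1 L act.toLinearMap ∘ₗ D.toLinearMap) (on2 A (ptMul k L)) w
      ((1 : A) ⊗ₜ[k] (1 : L)) = 1 ⊗ₜ TensorProduct.lid k L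
        ((Coalgebra.counit (R := k) (A := H)).rTensor L w) := by
    intro w
    induction w with
    | zero => simp
    | add s t hs ht => simp only [map_add, LinearMap.add_apply, hs, ht, TensorProduct.tmul_add]
    | tmul h l =>
      have := hc.counitHom h
      simp [hA.act_one, TensorProduct.smul_tmul, this]
  rw [lact, BaseAlgebra.dyn, LinearMap.comp_apply, h, AlgHom.toLinearMap_apply, 𝔏.counit_coact]

include hΦ hA in
theorem leftMul_one_tmul (a : A) :
    leftMul act (Φ : (B ⊗[k] B) ⊗[k] L) a (1 ⊗ₜ 1) = a ⊗ₜ 1 := by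
  rw [leftMul_apply, twistOp, tri_congr_mid (b' := epsPoint (Module.End k (A ⊗[k] (A ⊗[k] L))) ε),
    hΦ.eps_right (E := Module.End k (A ⊗[k] (A ⊗[k] L))) (on1 (A ⊗[k] L) act.toLinearMap)
      (on2 A (on2 A (ptMul k L)))]
  · simp
  · intro x
    simp [hA.act_one, Algebra.algebraMap_eq_smul_one, ← TensorProduct.smul_tmul',
      TensorProduct.tmul_smul]

variable {Θ : T →ₐ[k] Module.End k (A ⊗[k] L)} {κ : M →ₗ[k] T} {σ : L →ₗ[k] T}
  (hκ : ∀ m, Θ (κ m) = leftMul act (Φ : (B ⊗[k] B) ⊗[k] L) (g m))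
  (hσ : ∀ l, Θ (σ l) = lact 𝔏 D act l)
  (hT : Algebra.adjoin k (Set.range κ ∪ Set.range σ) = ⊤)

-- Associativity when the leftmost factor is a generator propagates to all of `T`. Hence `T` acts by
-- left multiplications, and `x ↦ Θ(x)(1 ⊗ 1)` respects products.
include hc hΦ hA hκ hσ hT in
theorem twistedMul_regular (x : T) (s t : A ⊗[k] L) :
    twistedMul 𝔏 D act Φ (Θ x s) t = Θ x (twistedMul 𝔏 D act Φ s t) := by
  have hx : x ∈ Algebra.adjoin k (Set.range κ ∪ Set.range σ) := hT ▸ Algebra.mem_top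
  induction hx using Algebra.adjoin_induction generalizing s with
  | mem x hx =>
    obtain ⟨m, rfl⟩ | ⟨l, rfl⟩ := hx
    · rw [hκ, twistedMul_leftMul hΦ hA]
    · rw [hσ, twistedMul_lact hc hΦ hA]
  | algebraMap c => simp [Algebra.algebraMap_eq_smul_one]
  | add x y _ _ hx hy => simp only [map_add, LinearMap.add_apply, hx, hy]
  | mul x y _ _ hx hy => simp only [map_mul, Module.End.mul_apply, hx, hy]

include hc hΦ hA hκ hσ hT in
theorem regular_apply (x : T) (t : A ⊗[k] L) :
    Θ x t = twistedMul 𝔏 D act Φ (Θ x (1 ⊗ₜ 1)) t := by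
  rw [twistedMul_regular hc hΦ hA hκ hσ hT, one_twistedMul hΦ hA]

-- The product `g m * b` of `A` is not a twisted product, but inserting `Φ Φ⁻¹` writes it as a sum
-- of twisted products of generators with translates of `b`. The induction on words therefore has to
-- carry all translates of `b` along.
include hc hA hg hκ hσ hgen in
theorem regular_surjective (v : A ⊗[k] L) : ∃ x : T, Θ x (1 ⊗ₜ 1) = v := by
  let φ : T →ₗ[k] A ⊗[k] L := (LinearMap.applyₗ ((1 : A) ⊗ₜ[k] (1 : L))) ∘ₗ Θ.toLinearMap
  have hφ : ∀ x, φ x = Θ x (1 ⊗ₜ 1) := fun x => rfl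
  suffices hv : v ∈ LinearMap.range φ from hv
  have hΘ : ∀ x, ∀ t ∈ LinearMap.range φ, Θ x t ∈ LinearMap.range φ := by
    rintro x _ ⟨y, rfl⟩
    exact ⟨x * y, by rw [hφ, hφ, map_mul, Module.End.mul_apply]⟩
  -- The strengthened induction hypothesis: not only `b ⊗ ν` but every translate is reached. It is
  -- stable under left multiplication by generators because these are stable under the action.
  let P : Set A := {b | ∀ β ν, act β b ⊗ₜ[k] ν ∈ LinearMap.range φ}
  have hP0 : (0 : A) ∈ P := fun β ν => by simp
  have hPadd : ∀ b b', b ∈ P → b' ∈ P → b + b' ∈ P := fun b b' h h' β ν => by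
    rw [map_add, TensorProduct.add_tmul]
    exact add_mem (h β ν) (h' β ν)
  have hPsmul : ∀ (c : k) b, b ∈ P → c • b ∈ P := fun c b h β ν => by
    rw [map_smul, ← TensorProduct.smul_tmul']
    exact Submodule.smul_mem _ c (h β ν)
  have hPact : ∀ β b, b ∈ P → act β b ∈ P := fun β b h β' ν => by
    rw [← Module.End.mul_apply, ← map_mul]
    exact h _ ν
  have hPr : ∀ b ∈ P, ∀ ν : L, b ⊗ₜ[k] ν ∈ LinearMap.range φ := fun b h ν => by
    have := h 1 ν
    rwa [map_one] at this
  have hP1 : (1 : A) ∈ P := fun β ν => by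
    rw [hA.act_one, ← TensorProduct.smul_tmul']
    refine Submodule.smul_mem _ _ ⟨σ ν, ?_⟩
    rw [hφ, hσ, lact_one hc hA]
  have key : ∀ (u : (B ⊗[k] B) ⊗[k] L) (m : M) (b : A) (ν : L), b ∈ P →
      mulFst k A L (twistOp act act (Φ : (B ⊗[k] B) ⊗[k] L)
        (twistOp act act u (g m ⊗ₜ (b ⊗ₜ ν)))) ∈ LinearMap.range φ := by
    intro u m b ν hb
    induction u with
    | zero => simp
    | add s t hs ht => simp only [map_add, LinearMap.add_apply]; exact add_mem hs ht
    | tmul p l =>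
      induction p with
      | zero => simp
      | add s t hs ht =>
        simp only [TensorProduct.add_tmul, map_add, LinearMap.add_apply]; exact add_mem hs ht
      | tmul x y =>
        have e : twistOp act act ((x ⊗ₜ[k] y) ⊗ₜ[k] l) (g m ⊗ₜ (b ⊗ₜ ν)) =
            g (actM x m) ⊗ₜ (act y b ⊗ₜ[k] (l * ν)) := by simp [twistOp, hg]
        rw [e, ← leftMul_apply, ← hκ]
        exact hΘ _ _ (hPr _ (hPact y b hb) _)
  have hgP : ∀ m b, b ∈ P → ∀ ν, (g m * b) ⊗ₜ[k] ν ∈ LinearMap.range φ := by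
    intro m b hb ν
    have h1 := key (↑Φ⁻¹) m b ν hb
    have h2 := LinearMap.congr_fun (IsPoint.map_mul_inv
      (tri (E := Module.End k (A ⊗[k] (A ⊗[k] L))) (on1 (A ⊗[k] L) act.toLinearMap)
        (on2 A (on1 L act.toLinearMap)) (on2 A (on2 A (ptMul k L)))) Φ) (g m ⊗ₜ (b ⊗ₜ ν))
    rw [Module.End.mul_apply, Module.End.one_apply] at h2
    rw [twistOp, h2, mulFst_tmul] at h1
    exact h1
  have hgP' : ∀ m b, b ∈ P → g m * b ∈ P := by
    intro m b hb β ν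
    rw [hA.act_mul]
    generalize Δ β = w
    induction w with
    | zero => simp [tensorAct]
    | add s t hs ht =>
      simp only [map_add, LinearMap.add_apply, TensorProduct.add_tmul]; exact add_mem hs ht
    | tmul x y =>
      have e : LinearMap.mul' k A (tensorAct act (x ⊗ₜ[k] y) (g m ⊗ₜ b)) =
          g (actM x m) * act y b := by simp [tensorAct, hg]
      rw [e]
      exact hgP _ _ (hPact y b hb) ν
  have hall : ∀ a b, b ∈ P → a * b ∈ P := by
    intro a
    have ha : a ∈ Algebra.adjoin k (Set.range g) := hgen ▸ Algebra.mem_top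
    induction ha using Algebra.adjoin_induction with
    | mem a ha => obtain ⟨m, rfl⟩ := ha; exact hgP' m
    | algebraMap c => intro b hb; rw [← Algebra.smul_def]; exact hPsmul c b hb
    | add a a' _ _ h h' => intro b hb; rw [add_mul]; exact hPadd _ _ (h b hb) (h' b hb)
    | mul a a' _ _ h h' => intro b hb; rw [mul_assoc]; exact h _ (h' b hb)
  induction v with
  | zero => exact zero_mem _
  | add s t hs ht => exact add_mem hs ht
  | tmul a l =>
    have := hPr _ (hall a 1 hP1) l
    rwa [mul_one] at this

variable {ψ : A ⊗[k] L →ₗ[k] T} (hψσ : ∀ l v, ψ (lact 𝔏 D act l v) = σ l * ψ v)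
  (hψκ : ∀ m v, ψ (leftMul act (Φ : (B ⊗[k] B) ⊗[k] L) (g m) v) = κ m * ψ v)
  (hψ1 : ψ (1 ⊗ₜ 1) = 1)

-- It suffices to compare on generators of `T`. At `1 ⊗ 1` the statement says that `ψ` is a left
-- inverse of `x ↦ Θ(x)(1 ⊗ 1)`.
include hκ hσ hT hψσ hψκ in
theorem map_regular (x : T) (v : A ⊗[k] L) : ψ (Θ x v) = x * ψ v := by
  have hx : x ∈ Algebra.adjoin k (Set.range κ ∪ Set.range σ) := hT ▸ Algebra.mem_top
  induction hx using Algebra.adjoin_induction generalizing v with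
  | mem x hx =>
    obtain ⟨m, rfl⟩ | ⟨l, rfl⟩ := hx
    · rw [hκ, hψκ]
    · rw [hσ, hψσ]
  | algebraMap c => simp [Algebra.algebraMap_eq_smul_one]
  | add x y _ _ hx hy => simp only [map_add, LinearMap.add_apply, hx, hy, add_mul]
  | mul x y _ _ hx hy => simp only [map_mul, Module.End.mul_apply, hx, hy, mul_assoc]

include hc hΦ hA hg hκ hσ hT hgen hψσ hψκ hψ1 in
/-- An algebra `T` acting on `A ⊗ L` by left multiplications, with a compatible map back, is
isomorphic to `A ⊗ L` with the twisted product. -/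
theorem exists_linearEquiv_twisted : ∃ φ : T ≃ₗ[k] A ⊗[k] L, φ 1 = 1 ⊗ₜ 1 ∧
    (∀ x y, φ (x * y) = twistedMul 𝔏 D act Φ (φ x) (φ y)) ∧
    (∀ l, φ (σ l) = 1 ⊗ₜ l) ∧ ∀ m, φ (κ m) = g m ⊗ₜ 1 := by
  let φ : T →ₗ[k] A ⊗[k] L := (LinearMap.applyₗ ((1 : A) ⊗ₜ[k] (1 : L))) ∘ₗ Θ.toLinearMap
  have hφ : ∀ x, φ x = Θ x (1 ⊗ₜ 1) := fun x => rfl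
  have hinj : Function.Injective φ := Function.LeftInverse.injective (g := ψ) fun x => by
    rw [hφ, map_regular hκ hσ hT hψσ hψκ, hψ1, mul_one]
  have hsurj : Function.Surjective φ := regular_surjective hc hA hg hgen hκ hσ
  have hbij : Function.Bijective φ := ⟨hinj, hsurj⟩
  refine ⟨LinearEquiv.ofBijective φ hbij, ?_, fun x y => ?_, fun l => ?_, fun m => ?_⟩
  · rw [LinearEquiv.ofBijective_apply, hφ, map_one, Module.End.one_apply]
  · rw [LinearEquiv.ofBijective_apply, LinearEquiv.ofBijective_apply,
      LinearEquiv.ofBijective_apply, hφ, map_mul, Module.End.mul_apply,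
      regular_apply hc hΦ hA hκ hσ hT, hφ, hφ]
  · rw [LinearEquiv.ofBijective_apply, hφ, hσ, lact_one hc hA]
  · rw [LinearEquiv.ofBijective_apply, hφ, hκ, leftMul_one_tmul hΦ hA]

end Presentation

/-! ### The isomorphism from the two universal properties -/

section Isomorphism

variable {k ι H L U : Type*} [Field k] [Fintype ι] [DecidableEq ι] [Ring H] [HopfAlgebra k H]
  [Ring L] [Algebra k L] [Ring U] [HopfAlgebra k U]
  {𝔏 : BaseAlgebra k H L} {j : H →ₐc[k] U} (ρ : U →ₐ[k] Matrix ι ι k)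
  (hγ : Function.Bijective (HopfAlgebra.antipode k (A := U)))
  {R : (U ⊗[k] U)ˣ} {F : ((U ⊗[k] U) ⊗[k] L)ˣ} {z : (U ⊗[k] L)ˣ}
  (hR : IsUniversalRMatrix R) (hF : IsDynamicalTwist (j : H →ₐ[k] U) 𝔏 F)
  (hz : (z : U ⊗[k] L) = zeta hγ F)

theorem DREAlgebra.adjoin_matLin (ρ' : H →ₐ[k] Matrix ι ι k) (S : Matrix (ι × ι) (ι × ι) L) :
    Algebra.adjoin k (Set.range (matLin (k := k) (DREAlgebra.gen 𝔏 ρ' S)) ∪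
      Set.range (DREAlgebra.incl 𝔏 ρ' S).toLinearMap) = ⊤ := by
  rw [eq_top_iff, ← DREAlgebra.adjoin_eq_top 𝔏 ρ' S]
  refine Algebra.adjoin_mono (Set.union_subset_union ?_ subset_rfl)
  rintro _ ⟨p, rfl⟩
  exact ⟨Matrix.single p.1 p.2 1, by simp⟩

theorem matLin_map {A A' : Type*} [AddCommGroup A] [Module k A] [AddCommGroup A'] [Module k A']
    {f : A →ₗ[k] A'} {X : Matrix ι ι A} {X' : Matrix ι ι A'} (h : ∀ i j, f (X i j) = X' i j)
    (m : Matrix ι ι k) : f (matLin (k := k) X m) = matLin (k := k) X' m :=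
  LinearMap.congr_fun (f := f ∘ₗ matLin (k := k) X) (ext_single fun i j => by simp [h]) m

include hR hF hz in
/-- An algebra `A` with the universal property of the RE algebra and an algebra `T` with the
universal property of the dRE algebra are related by the composite twist. -/
theorem exists_linearEquiv_of_lift {A T : Type*} [Ring A] [Algebra k A] [Ring T] [Algebra k T]
    {X : Matrix ι ι A} {K : Matrix ι ι T} {σ : L →ₗ[k] T} [IsPoint σ]
    {act : U ⊗[k] U →ₐ[k] Module.End k A}
    (hA : IsModuleAlgebra (twistedComul R) (cou k (U ⊗[k] U)) act)
    (hg : ∀ β m, act β (matLin X m) = matLin X (matrixRep ρ β m))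
    (hgen : Algebra.adjoin k (Set.range (matLin (k := k) X)) = ⊤)
    (hX : ∀ n, pair (matLin (k := k) X) (matLin (k := k) X)
      ((reflLeft ρ R - reflRight ρ R) n) = 0)
    (hAlift : ∀ f : Matrix ι ι k →ₗ[k]
        Module.End k (equivariantMaps 𝔏 (diagIncl (j : H →ₐ[k] U)) σ),
      (∀ n, pair f f ((reflLeft ρ R - reflRight ρ R) n) = 0) →
      ∃ o : A →ₐ[k] Module.End k (equivariantMaps 𝔏 (diagIncl (j : H →ₐ[k] U)) σ),
        ∀ m, o (matLin X m) = f m)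
    (hcross : ∀ l i j', σ l * K i j' =
      ∑ a, ∑ b, K a b * σ (crossCoeff 𝔏 (ρ.comp (j : H →ₐ[k] U)) i j' a b l))
    (hK : flipMul ((repMatrix ρ (dynR R F)).map σ) * sndCopy K *
        flipMul ((repMatrix ρ (dynR R F)).map σ) * sndCopy K = sndCopy K *
        flipMul ((repMatrix ρ (dynR R F)).map σ) * sndCopy K *
        flipMul ((repMatrix ρ (dynR R F)).map σ))
    (hTgen : Algebra.adjoin k (Set.range (matLin (k := k) K) ∪ Set.range σ) = ⊤)
    (hTlift : ∀ (K' : Matrix ι ι (Module.End k (A ⊗[k] L))) (σ' : L →ₗ[k] Module.End k (A ⊗[k] L))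
      [IsPoint σ'], (∀ l i j', σ' l * K' i j' =
        ∑ a, ∑ b, K' a b * σ' (crossCoeff 𝔏 (ρ.comp (j : H →ₐ[k] U)) i j' a b l)) →
      flipMul ((repMatrix ρ (dynR R F)).map σ') * sndCopy K' *
        flipMul ((repMatrix ρ (dynR R F)).map σ') * sndCopy K' = sndCopy K' *
        flipMul ((repMatrix ρ (dynR R F)).map σ') * sndCopy K' *
        flipMul ((repMatrix ρ (dynR R F)).map σ') →
      ∃ Θ : T →ₐ[k] Module.End k (A ⊗[k] L), (∀ a b, Θ (K a b) = K' a b) ∧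
        ∀ l, Θ (σ l) = σ' l) :
    ∃ φ : T ≃ₗ[k] A ⊗[k] L, φ 1 = 1 ⊗ₜ[k] 1 ∧
      (∀ x y, φ (x * y) = twistedMul 𝔏 (diagIncl (j : H →ₐ[k] U)) act
        (compositeUnit 𝔏 j R F z : _) (φ x) (φ y)) ∧
      (∀ l : L, φ (σ l) = 1 ⊗ₜ[k] l) ∧
      ∀ m, φ (matLin (k := k) K m) = matLin (k := k) X m ⊗ₜ[k] 1 := by
  have hc := isCompatible_twistedComul hR j
  have hΦ := isWeakTwist_compositeUnit hR hF hγ hz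
  have hκ := (cross_iff 𝔏 j ρ K σ).2 hcross
  have hrel := normal_twistOp_inv ρ hγ hR hF hz hκ hK
  -- The operators on equivariant maps satisfy the ordinary reflection equation, so `A` acts on
  -- these maps by its universal property; this yields the backward map `ψ`.
  have hpair := pair_genEnd_eq_zero hc hΦ (actM := matrixRep ρ) hκ (conv_reflection ρ hR) hrel
  obtain ⟨o, ho⟩ := hAlift _ hpair
  obtain ⟨ψ, hψσ, hψκ, hψ1⟩ := exists_linear_of_genEnd hc hΦ (actM := matrixRep ρ) hκ hA hg
    hgen o ho
  -- The left multiplications on `A ⊗ L` satisfy the cross relation and the dynamical reflection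
  -- equation, so `T` acts there; this yields the forward map.
  obtain ⟨Θ, hΘ, hΘσ⟩ := hTlift _ _
    ((cross_iff 𝔏 j ρ _ _).1 (lact_mul_leftMul_gen ρ hγ hR hF hz hA hg))
    (reflection_leftMul ρ hγ hR hF hz hA hg hX)
  have hΘκ : ∀ m, Θ (matLin (k := k) K m) = leftMul act (compositeUnit 𝔏 j R F z : _)
      (matLin (k := k) X m) := fun m => by
    rw [← AlgHom.toLinearMap_apply, matLin_map (f := Θ.toLinearMap) hΘ, matLin_leftMul]
    rfl
  exact exists_linearEquiv_twisted hc hΦ hA hg hgen hΘκ hΘσ hTgen hψσ hψκ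
    ((hψ1 1).trans IsPoint.map_one)

end Isomorphism

section Isomorphism

variable {k ι H L U : Type*} [Field k] [Fintype ι] [DecidableEq ι] [Ring H] [HopfAlgebra k H]
  [Ring L] [Algebra k L] [Ring U] [HopfAlgebra k U]
  {𝔏 : BaseAlgebra k H L} {j : H →ₐc[k] U} (ρ : U →ₐ[k] Matrix ι ι k)
  (hγ : Function.Bijective (HopfAlgebra.antipode k (A := U)))
  {R : (U ⊗[k] U)ˣ} {F : ((U ⊗[k] U) ⊗[k] L)ˣ} {z : (U ⊗[k] L)ˣ}
  (hR : IsUniversalRMatrix R) (hF : IsDynamicalTwist (j : H →ₐ[k] U) 𝔏 F)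
  (hz : (z : U ⊗[k] L) = zeta hγ F)

include hγ hR hF hz in
theorem exists_linearEquiv_dre {act : U ⊗[k] U →ₐ[k] Module.End k (REAlgebra (matS ρ R))}
    (hact : IsREAction ρ R act) :
    ∃ φ : DREAlgebra 𝔏 (ρ.comp (j : H →ₐ[k] U)) (flipMul (repMatrix ρ (dynR R F))) ≃ₗ[k]
        REAlgebra (matS ρ R) ⊗[k] L,
      φ 1 = 1 ⊗ₜ[k] 1 ∧
      (∀ x y, φ (x * y) = twistedMul 𝔏 (diagIncl (j : H →ₐ[k] U)) act
        (compositeUnit 𝔏 j R F z : _) (φ x) (φ y)) ∧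
      (∀ l : L, φ ((DREAlgebra.incl 𝔏 _ _).toLinearMap l) = 1 ⊗ₜ[k] l) ∧
      ∀ m, φ (matLin (k := k) (DREAlgebra.gen 𝔏 _ _) m) =
        matLin (k := k) (REAlgebra.gen (matS ρ R)) m ⊗ₜ[k] 1 := by
  have h1 := isREAction_iff ρ |>.1 hact
  refine exists_linearEquiv_of_lift (𝔏 := 𝔏) (j := j) ρ hγ hR hF hz
    (A := REAlgebra (matS ρ R))
    (T := DREAlgebra 𝔏 (ρ.comp (j : H →ₐ[k] U)) (flipMul (repMatrix ρ (dynR R F))))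
    (X := REAlgebra.gen (matS ρ R)) (K := DREAlgebra.gen 𝔏 _ _)
    (σ := (DREAlgebra.incl 𝔏 _ _).toLinearMap) ?_ ?_ ?_ ?_ ?_ ?_ ?_ ?_ ?_
  · exact h1.1
  · exact h1.2
  · exact REAlgebra.adjoin_gen ρ
  · exact REAlgebra.pair_gen ρ hγ hR
  · exact fun f hf => REAlgebra.exists_lift ρ hγ hR f hf
  · exact DREAlgebra.incl_mul_gen 𝔏 _ _
  · exact DREAlgebra.reflection 𝔏 _ _
  · exact DREAlgebra.adjoin_matLin _ _
  · intro K' σ' _ h h'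
    obtain ⟨Θ, h1, h2⟩ := DREAlgebra.exists_lift K' σ' h h'
    exact ⟨Θ, h1, h2⟩

end Isomorphism

end DynRE

end

open DynRE
theorem mainTheorem1 {k H U L ι : Type*} [Field k] [CharZero k]
    [Ring H] [HopfAlgebra k H] [Ring U] [HopfAlgebra k U] [Ring L] [Algebra k L]
    [Fintype ι] [DecidableEq ι]
    (hγH : Function.Bijective (HopfAlgebra.antipode k (A := H)))
    (hγU : Function.Bijective (HopfAlgebra.antipode k (A := U)))
    (j : H →ₐc[k] U) (hj : Function.Injective j)
    (𝔏 : BaseAlgebra k H L)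
    (R : (U ⊗[k] U)ˣ) (hR : IsUniversalRMatrix R)
    (F : ((U ⊗[k] U) ⊗[k] L)ˣ) (hF : IsDynamicalTwist (j : H →ₐ[k] U) 𝔏 F)
    (ρ : U →ₐ[k] Matrix ι ι k) :
    ∃ z : (U ⊗[k] L)ˣ, (z : U ⊗[k] L) = zeta hγU F ∧
      (∃! act : U ⊗[k] U →ₐ[k] Module.End k (REAlgebra (matS ρ R)), IsREAction ρ R act) ∧
      ∀ act : U ⊗[k] U →ₐ[k] Module.End k (REAlgebra (matS ρ R)), IsREAction ρ R act →
        ∃ φ : DREAlgebra 𝔏 (ρ.comp (j : H →ₐ[k] U)) (flipMul (repMatrix ρ (dynR R F))) ≃ₗ[k]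
            REAlgebra (matS ρ R) ⊗[k] L,
          φ 1 = 1 ⊗ₜ[k] 1 ∧
          (∀ x y, φ (x * y) =
            twistedMul 𝔏 (diagIncl (j : H →ₐ[k] U)) act
              (compositeTwist (j : H →ₐ[k] U) 𝔏 R F z) (φ x) (φ y)) ∧
          (∀ l : L, φ (DREAlgebra.incl 𝔏 _ _ l) = 1 ⊗ₜ[k] l) ∧
          (∀ a b : ι, φ (DREAlgebra.gen 𝔏 _ _ a b) = REAlgebra.gen (matS ρ R) a b ⊗ₜ[k] 1) := by
  obtain ⟨z, hz⟩ := isUnit_zeta hγU hF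
  refine ⟨z, hz, existsUnique_isREAction ρ hγU hR, fun act hact => ?_⟩
  obtain ⟨φ, h1, h2, h3, h4⟩ := exists_linearEquiv_dre ρ hγU hR hF hz hact
  -- The product formula `h2` is about the unit `compositeUnit`, whose underlying element is
  -- `compositeTwist` by definition.
  refine ⟨φ, h1, h2, h3, fun a b => ?_⟩
  have := h4 (Matrix.single a b 1)
  rwa [matLin_single, matLin_single] at this
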